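/- Let $k$ be a complete non-Archimedean valued field. All Banach spaces are non-Archimedean Banach spaces over $k$, morphisms are bounded linear maps, and $\hat\otimes$ is the completed tensor product for the norm $\|z\|=\inf\max_i\|x_i\|\|y_i\|$ over finite expressions $z=\sum_i x_i\otimes y_i$. A pre-braiding on a Banach space $W$ is a bounded map $c:W\hat\otimes W\to W\hat\otimes W$ with $(c\otimes\mathrm{Id})(\mathrm{Id}\otimes c)(c\otimes\mathrm{Id})=(\mathrm{Id}\otimes c)(c\otimes\mathrm{Id})(\mathrm{Id}\otimes c)$; it is a braiding if it is an isomorphism. Pre-braided bialgebras are algebras and coalgebras with a pre-braiding that commutes with unit, multiplication, counit and comultiplication, such that $\varepsilon$ is multiplicative and unital, $\Delta\circ\eta=\eta\otimes\eta$ and $\Delta\circ\mu=(\mu\otimes\mu)(\mathrm{Id}\otimes c\otimes\mathrm{Id})(\Delta\otimes\Delta)$; they are Hopf algebras if $\mathrm{Id}$ has a convolution inverse, the antipode. Let $k\{t\}$ be the bialgebra of power series with coefficients tending to $0$, with $\Delta(t^n)=t^n\otimes t^n$. An analytically graded pre-braided Hopf algebra $R$ is one with a coaction $R\to k\{t\}\hat\otimes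 R$ for which unit, multiplication, counit, comultiplication and antipode are comodule maps and the pre-braiding is a map of $k\{t\}\hat\otimes k\{t\}$-comodules, where the two factors of $k\{t\}\hat\otimes k\{t\}$ are exchanged along with those of $R\hat\otimes R$. Write $R(n)$ for the closed subspace of elements with coaction $x\mapsto t^n\otimes x$, and $P(R)=\{x:\Delta x=1\otimes x+x\otimes 1\}$. An analytic Nichols algebra of a pre-braided Banach space $(V,c)$ is an analytically graded pre-braided Banach Hopf algebra $R$ which is flat ($R\hat\otimes-$ preserves finite limits), with $R(0)\cong k$, with $P(R)=R(1)\cong V$ as pre-braided Banach spaces, and generated by $R(1)$: every morphism of Banach algebras $A\to R$ through which $R(1)\hookrightarrow R$ factors is an epimorphism of Banach spaces. Let $V$ be a Banach space with a pre-braiding $c$ of norm at most $1$. For $r>0$ let $V_r$ be $V$ with its norm multiplied by $r$, and let $T_r^c(V)$ be the space of families $(x_n)_{n\ge 0}$, $x_n\in V_r^{\hat\otimes n}$, with $\|x_n\|\to 0$, under the supremum norm. It is given the concatenation product, the pre-braiding $\tilde c$ induced by $c$, the comultiplication determined by $\Delta v=1\otimes v+v\otimes 1$ for $v\in V$, the counit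 that projects to degree $0$, and the coaction $x\mapsto t^n\otimes x$ on $V_r^{\hat\otimes n}$. Let $\langle-,-\rangle:V\hat\otimes V\to k$ be a bounded bilinear form of norm $C$ which is * symmetric; * non-degenerate, i.e. both induced maps $V\to V^*$ are injective; * compatible with $c$, i.e. $\langle c\,u,w\rangle=\langle u,c\,w\rangle$ for all $u,w\in V\hat\otimes V$, where $\langle a\otimes a',b\otimes b'\rangle=\langle a,b\rangle\langle a',b'\rangle$. A dual pairing of Hopf algebras $A\hat\otimes B\to k$ is a bounded bilinear pairing with $\langle aa',b\rangle=\langle a\otimes a',\Delta b\rangle$, $\langle a,bb'\rangle=\langle\Delta a,b\otimes b'\rangle$, $\langle a,1\rangle=\varepsilon(a)$, $\langle 1,b\rangle=\varepsilon(b)$ and $\langle Sa,b\rangle=\langle a,Sb\rangle$; its radical in $A$ is $\{a:\langle a,b\rangle=0\text{ for all }b\in B\}$. **Proposition 3.10.** For every $r>0$ there is a closed subspace $I_r\subset T_r^c(V)$ with the following properties. 1. For every $s>0$ with $C\le rs$, the form on $V$ extends to a unique dual pairing of Hopf algebras $T_r^c(V)\hat\otimes T_s^c(V)\to k$, and $I_r$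 is the radical in $T_r^c(V)$ of this pairing. In particular the radical is independent of $s$. 2. $I_r$ is a two-sided ideal and a coideal: $\varepsilon(I_r)=0$, and $\Delta(I_r)$ lies in the closure of $I_r\otimes T_r^c(V)+T_r^c(V)\otimes I_r$. 3. There are unique structure maps (unit, multiplication, counit, comultiplication, pre-braiding, $k\{t\}$-coaction) on $T_r^c(V)/I_r$ with which the projection $T_r^c(V)\to T_r^c(V)/I_r$ is compatible. With them, $P(T_r^c(V)/I_r)=V$: the primitive elements are exactly the image of $V$, and the map $V\to T_r^c(V)/I_r$ multiplies norms by $r$. 4. With these structure maps $T_r^c(V)/I_r$ is an analytic Nichols algebra of $(V,c)$. If moreover $c$ is an isometric isomorphism, then the pre-braiding of $T_r^c(V)/I_r$ is a braiding. -/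

import Mathlib

open CategoryTheory MonoidalCategory Filter Topology
open scoped ENNReal

universe u

noncomputable section

/-- A Banach space over the valued field `k`, with norm satisfying the strong triangle
inequality. -/
structure NABan (k : Type u) [NormedField k] where
  /-- the underlying vector space -/
  carrier : Type u
  [grp : NormedAddCommGroup carrier]
  [mod : NormedSpace k carrier]
  [ultra : IsUltrametricDist carrier]
  [complete : CompleteSpace carrier]

namespace NABan

variable {k : Type u} [NormedField k]

instance : CoeSort (NABan k) (Type u) := ⟨carrier⟩

instance (X : NABan k) : NormedAddCommGroup X := X.grp
instance (X : NABan k) : NormedSpace k X := X.mod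
instance (X : NABan k) : IsUltrametricDist X := X.ultra
instance (X : NABan k) : CompleteSpace X := X.complete

/-- Bounded linear maps. -/
@[ext]
structure Hom (X Y : NABan k) where
  /-- the underlying linear map -/
  lin : X →ₗ[k] Y
  bound : ∃ C : ℝ, ∀ x, ‖lin x‖ ≤ C * ‖x‖

instance : Category (NABan k) where
  Hom := Hom
  id X := ⟨LinearMap.id, 1, fun x => by simp⟩
  comp f g := ⟨g.lin ∘ₗ f.lin, by
    obtain ⟨C, hC⟩ := f.bound
    obtain ⟨D, hD⟩ := g.bound
    refine ⟨|D| * C, fun x => ?_⟩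
    calc ‖g.lin (f.lin x)‖ ≤ D * ‖f.lin x‖ := hD _
      _ ≤ |D| * ‖f.lin x‖ := by gcongr; exact le_abs_self D
      _ ≤ |D| * (C * ‖x‖) := by gcongr; exact hC x
      _ = |D| * C * ‖x‖ := by ring⟩

instance (X Y : NABan k) : CoeFun (X ⟶ Y) (fun _ => X → Y) := ⟨fun f => Hom.lin f⟩

/-- Build a morphism from a bounded linear map. -/
def mk' {X Y : NABan k} (f : X →ₗ[k] Y) (C : ℝ) (h : ∀ x, ‖f x‖ ≤ C * ‖x‖) : X ⟶ Y :=
  Hom.mk f ⟨C, h⟩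

section basics

variable {X Y Z : NABan k}

@[simp] lemma mk'_apply (f : X →ₗ[k] Y) (C : ℝ) (h) (x : X) : (mk' f C h : X ⟶ Y) x = f x := rfl
@[simp] lemma id_apply (x : X) : (𝟙 X : X ⟶ X) x = x := rfl
@[simp] lemma comp_apply (f : X ⟶ Y) (g : Y ⟶ Z) (x : X) : (f ≫ g) x = g (f x) := rfl
@[simp] lemma lin_id (x : X) : Hom.lin (𝟙 X) x = x := rfl
@[simp] lemma lin_comp (f : X ⟶ Y) (g : Y ⟶ Z) (x : X) :
    Hom.lin (f ≫ g) x = Hom.lin g (Hom.lin f x) := rfl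

lemma hom_ext {f g : X ⟶ Y} (h : ∀ x, f x = g x) : f = g :=
  Hom.ext (LinearMap.ext h)

lemma continuous (f : X ⟶ Y) : Continuous f := by
  obtain ⟨C, hC⟩ := Hom.bound f
  exact AddMonoidHomClass.continuous_of_bound (Hom.lin f) C hC

instance : Add (X ⟶ Y) := ⟨fun f g => Hom.mk (Hom.lin f + Hom.lin g) (by
  obtain ⟨C, hC⟩ := Hom.bound f
  obtain ⟨D, hD⟩ := Hom.bound g
  refine ⟨C + D, fun x => (norm_add_le _ _).trans ?_⟩
  rw [add_mul]
  exact add_le_add (hC x) (hD x))⟩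

@[simp] lemma add_apply (f g : X ⟶ Y) (x : X) : (f + g) x = f x + g x := rfl

instance : Zero (X ⟶ Y) := ⟨Hom.mk 0 ⟨0, fun x => by simp⟩⟩

@[simp] lemma zero_apply (x : X) : (0 : X ⟶ Y) x = 0 := rfl

/-- The operator norm of a bounded linear map. -/
def opNorm (f : X ⟶ Y) : ℝ := sInf {C : ℝ | 0 ≤ C ∧ ∀ x, ‖f x‖ ≤ C * ‖x‖}

lemma opNorm_nonneg (f : X ⟶ Y) : 0 ≤ opNorm f := Real.sInf_nonneg fun _ h => h.1

lemma le_opNorm (f : X ⟶ Y) (x : X) : ‖f x‖ ≤ opNorm f * ‖x‖ := by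
  obtain ⟨C, hC⟩ := Hom.bound f
  have hne : {C : ℝ | 0 ≤ C ∧ ∀ x, ‖f x‖ ≤ C * ‖x‖}.Nonempty :=
    ⟨|C|, abs_nonneg C, fun x => (hC x).trans (by gcongr; exact le_abs_self C)⟩
  rcases (norm_nonneg x).eq_or_lt with h | h
  · have : x = 0 := norm_eq_zero.mp h.symm
    subst this; simp
  · rw [← div_le_iff₀ h]
    exact le_csInf hne fun D hD => by rw [div_le_iff₀ h]; exact hD.2 x

/-- Maps of operator norm at most one. -/
def IsContr (f : X ⟶ Y) : Prop := ∀ x, ‖f x‖ ≤ ‖x‖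

lemma isContr_of_opNorm_le {f : X ⟶ Y} (h : opNorm f ≤ 1) : IsContr f := fun x =>
  (le_opNorm f x).trans (by nlinarith [norm_nonneg x])

lemma isContr_iff_opNorm_le {f : X ⟶ Y} : IsContr f ↔ opNorm f ≤ 1 :=
  ⟨fun h => csInf_le ⟨0, fun _ h => h.1⟩ ⟨zero_le_one, fun x => by rw [one_mul]; exact h x⟩,
    isContr_of_opNorm_le⟩

lemma isContr_id : IsContr (𝟙 X) := fun _ => le_rfl

lemma IsContr.comp {f : X ⟶ Y} {g : Y ⟶ Z} (hf : IsContr f) (hg : IsContr g) :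
    IsContr (f ≫ g) := fun x => (hg (f x)).trans (hf x)

lemma IsContr.add {f g : X ⟶ Y} (hf : IsContr f) (hg : IsContr g) : IsContr (f + g) := fun x =>
  (IsUltrametricDist.norm_add_le_max _ _).trans (max_le (hf x) (hg x))

lemma isContr_conj {W : NABan k} {f : X ⟶ Y} {g : Y ⟶ Z} {h : Z ⟶ W} {K L : ℝ}
    (hL : 0 ≤ L) (hKL : L * K = 1) (hf : ∀ x, ‖f x‖ ≤ K * ‖x‖) (hg : IsContr g)
    (hh : ∀ x, ‖h x‖ ≤ L * ‖x‖) : IsContr (f ≫ g ≫ h) := fun x =>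
  calc ‖h (g (f x))‖ ≤ L * ‖g (f x)‖ := hh _
    _ ≤ L * (K * ‖x‖) := mul_le_mul_of_nonneg_left ((hg _).trans (hf x)) hL
    _ = ‖x‖ := by rw [← mul_assoc, hKL, one_mul]

end basics

/-! ### The completed tensor product -/

section tensor

/-- The algebraic tensor product, which will carry the non-Archimedean tensor norm. -/
def AlgTensor (X Y : NABan k) : Type u := TensorProduct k X Y

variable (X Y : NABan k)

instance : AddCommGroup (AlgTensor X Y) := inferInstanceAs (AddCommGroup (TensorProduct k X Y))
instance : Module k (AlgTensor X Y) := inferInstanceAs (Module k (TensorProduct k X Y))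

variable {X Y} in
/-- Elementary tensors in the algebraic tensor product. -/
def AlgTensor.tmul (x : X) (y : Y) : AlgTensor X Y := TensorProduct.tmul k x y

/-- The finite sums of elementary tensors `x ⊗ y` with `‖x‖ * ‖y‖ ≤ C`. -/
def AlgTensor.ball (C : ℝ) : AddSubgroup (AlgTensor X Y) :=
  AddSubgroup.closure {z | ∃ (x : X) (y : Y), ‖x‖ * ‖y‖ ≤ C ∧ z = AlgTensor.tmul x y}

/-- The tensor norm: `‖z‖` is the infimum over all finite expressions `z = ∑ xᵢ ⊗ yᵢ` of
`max ‖xᵢ‖ * ‖yᵢ‖`. -/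
instance : Norm (AlgTensor X Y) := ⟨fun z => sInf {C : ℝ | 0 ≤ C ∧ z ∈ AlgTensor.ball X Y C}⟩

variable {X Y}

namespace AlgTensor

lemma norm_def (z : AlgTensor X Y) : ‖z‖ = sInf {C : ℝ | 0 ≤ C ∧ z ∈ ball X Y C} := rfl

lemma ball_mono {C D : ℝ} (h : C ≤ D) : ball X Y C ≤ ball X Y D :=
  AddSubgroup.closure_mono fun _ ⟨x, y, hxy, hz⟩ => ⟨x, y, hxy.trans h, hz⟩

lemma tmul_mem_ball (x : X) (y : Y) : tmul x y ∈ ball X Y (‖x‖ * ‖y‖) :=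
  AddSubgroup.subset_closure ⟨x, y, le_rfl, rfl⟩

lemma exists_mem_ball (z : AlgTensor X Y) : ∃ C : ℝ, 0 ≤ C ∧ z ∈ ball X Y C := by
  induction z using TensorProduct.induction_on with
  | zero => exact ⟨0, le_rfl, zero_mem _⟩
  | tmul x y => exact ⟨_, by positivity, tmul_mem_ball x y⟩
  | add a b ha hb =>
    obtain ⟨C, hC, ha⟩ := ha
    obtain ⟨D, hD, hb⟩ := hb
    exact ⟨max C D, hC.trans (le_max_left _ _), add_mem (ball_mono (le_max_left C D) ha)
      (ball_mono (le_max_right C D) hb)⟩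

lemma norm_nonneg' (z : AlgTensor X Y) : 0 ≤ ‖z‖ := Real.sInf_nonneg fun _ h => h.1

lemma norm_le_of_mem {z : AlgTensor X Y} {C : ℝ} (hC : 0 ≤ C) (h : z ∈ ball X Y C) : ‖z‖ ≤ C :=
  csInf_le ⟨0, fun _ h => h.1⟩ ⟨hC, h⟩

lemma mem_ball_of_norm_lt {z : AlgTensor X Y} {C : ℝ} (h : ‖z‖ < C) : z ∈ ball X Y C := by
  obtain ⟨D, hD, hDC⟩ := exists_lt_of_csInf_lt (exists_mem_ball z) h
  exact ball_mono hDC.le hD.2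

lemma norm_add_le_max' (z w : AlgTensor X Y) : ‖z + w‖ ≤ max ‖z‖ ‖w‖ := by
  refine le_of_forall_gt_imp_ge_of_dense fun C hC => ?_
  have h := max_lt_iff.mp hC
  exact norm_le_of_mem ((norm_nonneg' z).trans h.1.le)
    (add_mem (mem_ball_of_norm_lt h.1) (mem_ball_of_norm_lt h.2))

lemma smul_mem_ball {z : AlgTensor X Y} {C : ℝ} (a : k) (h : z ∈ ball X Y C) :
    a • z ∈ ball X Y (‖a‖ * C) := by
  induction h using AddSubgroup.closure_induction with
  | mem z hz =>
    obtain ⟨x, y, hxy, rfl⟩ := hz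
    refine AddSubgroup.subset_closure ⟨a • x, y, ?_, (TensorProduct.smul_tmul' a x y)⟩
    rw [norm_smul, mul_assoc]
    gcongr
  | zero => rw [smul_zero]; exact zero_mem _
  | add z w _ _ hz hw => rw [smul_add]; exact add_mem hz hw
  | neg z _ hz => rw [smul_neg]; exact neg_mem hz

lemma norm_smul_le' (a : k) (z : AlgTensor X Y) : ‖a • z‖ ≤ ‖a‖ * ‖z‖ := by
  rcases eq_or_ne a 0 with rfl | ha
  · rw [zero_smul, norm_zero, zero_mul]
    exact norm_le_of_mem le_rfl (zero_mem _)
  have ha' : 0 < ‖a‖ := norm_pos_iff.mpr ha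
  refine le_of_forall_gt_imp_ge_of_dense fun C hC => ?_
  have h : ‖z‖ < C / ‖a‖ := by rw [lt_div_iff₀ ha', mul_comm]; exact hC
  have h2 := smul_mem_ball a (mem_ball_of_norm_lt h)
  rw [mul_div_cancel₀ _ ha'.ne'] at h2
  exact norm_le_of_mem ((mul_nonneg ha'.le (norm_nonneg' z)).trans hC.le) h2

lemma core : SeminormedSpace.Core k (AlgTensor X Y) where
  norm_nonneg := norm_nonneg'
  norm_smul a z := by
    refine le_antisymm (norm_smul_le' a z) ?_
    rcases eq_or_ne a 0 with rfl | ha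
    · rw [norm_zero, zero_mul]; exact norm_nonneg' _
    have ha' : 0 < ‖a‖ := norm_pos_iff.mpr ha
    have h := norm_smul_le' a⁻¹ (a • z)
    rw [inv_smul_smul₀ ha, norm_inv] at h
    calc ‖a‖ * ‖z‖ ≤ ‖a‖ * (‖a‖⁻¹ * ‖a • z‖) := by gcongr
      _ = ‖a • z‖ := by field_simp
  norm_triangle z w := (norm_add_le_max' z w).trans
    (max_le (le_add_of_nonneg_right (norm_nonneg' w)) (le_add_of_nonneg_left (norm_nonneg' z)))

instance : SeminormedAddCommGroup (AlgTensor X Y) := SeminormedAddCommGroup.ofCore core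

instance : NormedSpace k (AlgTensor X Y) where
  norm_smul_le := norm_smul_le'

lemma norm_tmul_le (x : X) (y : Y) : ‖tmul x y‖ ≤ ‖x‖ * ‖y‖ :=
  norm_le_of_mem (by positivity) (tmul_mem_ball x y)

/-- The linear map out of the algebraic tensor product given by a bilinear map. -/
def liftLin {Z : NABan k} (f : X →ₗ[k] Y →ₗ[k] Z) : AlgTensor X Y →ₗ[k] Z := TensorProduct.lift f

lemma liftLin_tmul {Z : NABan k} (f : X →ₗ[k] Y →ₗ[k] Z) (x : X) (y : Y) :
    liftLin f (tmul x y) = f x y := TensorProduct.lift.tmul x y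

lemma norm_liftLin_le {Z : NABan k} (f : X →ₗ[k] Y →ₗ[k] Z) (K : ℝ) (hK : 0 ≤ K)
    (h : ∀ x y, ‖f x y‖ ≤ K * (‖x‖ * ‖y‖)) (z : AlgTensor X Y) : ‖liftLin f z‖ ≤ K * ‖z‖ := by
  have key : ∀ C : ℝ, 0 ≤ C → ∀ z ∈ ball X Y C, ‖liftLin f z‖ ≤ K * C := by
    intro C hC z hz
    induction hz using AddSubgroup.closure_induction with
    | mem z hz =>
      obtain ⟨x, y, hxy, rfl⟩ := hz
      rw [liftLin_tmul]
      exact (h x y).trans (by gcongr)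
    | zero => rw [map_zero, norm_zero]; positivity
    | add z w _ _ hz hw =>
      rw [map_add]
      exact (IsUltrametricDist.norm_add_le_max _ _).trans (max_le hz hw)
    | neg z _ hz => rwa [map_neg, norm_neg]
  refine le_of_forall_pos_le_add fun ε hε => ?_
  have hlt : ‖z‖ < ‖z‖ + ε / (K + 1) := lt_add_of_pos_right _ (by positivity)
  refine (key _ (by positivity) z (mem_ball_of_norm_lt hlt)).trans ?_
  rw [mul_add]
  gcongr
  rw [← mul_div_assoc, div_le_iff₀ (by positivity)]
  nlinarith

end AlgTensor

variable (X Y) in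
/-- The completed tensor product: the completion of the algebraic tensor product for the
non-Archimedean tensor norm. -/
def tensor : NABan k where
  carrier := UniformSpace.Completion (AlgTensor X Y)
  ultra := by
    refine IsUltrametricDist.isUltrametricDist_of_forall_norm_add_le_max_norm fun a b => ?_
    induction a, b using UniformSpace.Completion.induction_on₂ with
    | hp => exact isClosed_le (by fun_prop) (by fun_prop)
    | ih a b =>
      rw [← UniformSpace.Completion.coe_add]
      simp only [UniformSpace.Completion.norm_coe]
      exact AlgTensor.norm_add_le_max' a b

/-- The elementary tensor `x ⊗ y` in the completed tensor product. -/
def tmk (x : X) (y : Y) : tensor X Y :=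
  ((AlgTensor.tmul x y : AlgTensor X Y) : UniformSpace.Completion (AlgTensor X Y))

lemma norm_tmk_le (x : X) (y : Y) : ‖tmk x y‖ ≤ ‖x‖ * ‖y‖ :=
  (UniformSpace.Completion.norm_coe _).trans_le (AlgTensor.norm_tmul_le x y)

/-- Elementary tensors, as a bilinear map. -/
def tmkLin : X →ₗ[k] Y →ₗ[k] tensor X Y :=
  LinearMap.compr₂ (TensorProduct.mk k X Y)
    (UniformSpace.Completion.toComplₗᵢ (𝕜 := k) (E := AlgTensor X Y)).toLinearMap

@[simp] lemma tmkLin_apply (x : X) (y : Y) : tmkLin x y = tmk x y := rfl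

/-- A closed set containing all finite sums of elementary tensors is everything. -/
lemma tensor_induction {p : tensor X Y → Prop} (hp : IsClosed {z | p z})
    (h0 : p 0) (ht : ∀ x y, p (tmk x y)) (ha : ∀ a b, p a → p b → p (a + b)) (z : tensor X Y) :
    p z := by
  induction z using UniformSpace.Completion.induction_on with
  | hp => exact hp
  | ih z =>
    induction z using TensorProduct.induction_on with
    | zero => exact h0
    | tmul x y => exact ht x y
    | add a b ha' hb' =>
      have := ha _ _ ha' hb'
      exact (UniformSpace.Completion.coe_add (α := AlgTensor X Y) a b) ▸ this

lemma tensor_ext {Z : NABan k} {f g : tensor X Y ⟶ Z} (h : ∀ x y, f (tmk x y) = g (tmk x y)) :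
    f = g := by
  refine hom_ext fun z => ?_
  induction z using tensor_induction with
  | hp => exact isClosed_eq (continuous f) (continuous g)
  | h0 => rw [map_zero, map_zero]
  | ht x y => exact h x y
  | ha a b ha hb => rw [map_add, map_add, ha, hb]

/-- The universal property of the completed tensor product. -/
def lift {Z : NABan k} (f : X →ₗ[k] Y →ₗ[k] Z) (K : ℝ) (hK : 0 ≤ K)
    (h : ∀ x y, ‖f x y‖ ≤ K * (‖x‖ * ‖y‖)) : tensor X Y ⟶ Z :=
  let g : AlgTensor X Y →L[k] Z := LinearMap.mkContinuous (AlgTensor.liftLin f) K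
    (AlgTensor.norm_liftLin_le f K hK h)
  let e := UniformSpace.Completion.toComplL (𝕜 := k) (E := AlgTensor X Y)
  let f' := ContinuousLinearMap.extend g e
  mk' (Y := Z) (X := tensor X Y) f'.toLinearMap K (by
      intro z
      have hd : DenseRange e := UniformSpace.Completion.denseRange_coe
      have hi : IsUniformInducing e := UniformSpace.Completion.isUniformInducing_coe _
      induction z using UniformSpace.Completion.induction_on with
      | hp => exact isClosed_le f'.continuous.norm (by fun_prop)
      | ih z =>
        have h1 : ContinuousLinearMap.extend g e (e z) = g z :=
          ContinuousLinearMap.extend_eq _ hd hi z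
        have h2 : ‖e z‖ = ‖z‖ := UniformSpace.Completion.norm_coe z
        change ‖ContinuousLinearMap.extend g e (e z)‖ ≤ K * ‖e z‖
        rw [h1, h2]
        exact AlgTensor.norm_liftLin_le f K hK h z)

lemma lift_tmk {Z : NABan k} (f : X →ₗ[k] Y →ₗ[k] Z) (K : ℝ) (hK : 0 ≤ K)
    (h : ∀ x y, ‖f x y‖ ≤ K * (‖x‖ * ‖y‖)) (x : X) (y : Y) :
    lift f K hK h (tmk x y) = f x y := by
  have hd : DenseRange (UniformSpace.Completion.toComplL (𝕜 := k) (E := AlgTensor X Y)) :=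
    UniformSpace.Completion.denseRange_coe
  have hi : IsUniformInducing (UniformSpace.Completion.toComplL (𝕜 := k) (E := AlgTensor X Y)) :=
    UniformSpace.Completion.isUniformInducing_coe _
  exact (ContinuousLinearMap.extend_eq _ hd hi (AlgTensor.tmul x y)).trans
    (AlgTensor.liftLin_tmul f x y)

lemma lift_bound {Z : NABan k} (f : X →ₗ[k] Y →ₗ[k] Z) (K : ℝ) (hK : 0 ≤ K)
    (h : ∀ x y, ‖f x y‖ ≤ K * (‖x‖ * ‖y‖)) (z : tensor X Y) :
    ‖lift f K hK h z‖ ≤ K * ‖z‖ := by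
  have hbd : ∀ x y, ‖f x y‖ ≤ K * (‖x‖ * ‖y‖) := h
  induction z using UniformSpace.Completion.induction_on with
  | hp => exact isClosed_le (continuous _).norm (by fun_prop)
  | ih z =>
    have hd : DenseRange (UniformSpace.Completion.toComplL (𝕜 := k) (E := AlgTensor X Y)) :=
      UniformSpace.Completion.denseRange_coe
    have hi : IsUniformInducing (UniformSpace.Completion.toComplL (𝕜 := k) (E := AlgTensor X Y)) :=
      UniformSpace.Completion.isUniformInducing_coe _
    have h1 : lift f K hK h (z : UniformSpace.Completion (AlgTensor X Y)) = AlgTensor.liftLin f z :=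
      ContinuousLinearMap.extend_eq _ hd hi z
    have h2 : ‖(z : UniformSpace.Completion (AlgTensor X Y))‖ = ‖z‖ :=
      UniformSpace.Completion.norm_coe z
    rw [h1]
    exact (AlgTensor.norm_liftLin_le f K hK h z).trans_eq (by rw [← h2]; rfl)

end tensor

/-! ### The symmetric monoidal category of Banach spaces -/

section monoidal

set_option linter.unusedSectionVars false

variable {X Y Z W : NABan k}

lemma bound_of_tmk {f : tensor X Y ⟶ Z} (K : ℝ) (hK : 0 ≤ K)
    (h : ∀ x y, ‖f (tmk x y)‖ ≤ K * (‖x‖ * ‖y‖)) (w : tensor X Y) : ‖f w‖ ≤ K * ‖w‖ := by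
  have : f = lift (tmkLin.compr₂ (Hom.lin f)) K hK h :=
    tensor_ext fun x y => (lift_tmk (tmkLin.compr₂ (Hom.lin f)) K hK h x y).symm
  rw [this]
  exact lift_bound _ K hK h w

lemma isContr_of_tmk {f : tensor X Y ⟶ Z} (h : ∀ x y, ‖f (tmk x y)‖ ≤ ‖x‖ * ‖y‖) :
    IsContr f := fun w => by
  simpa using bound_of_tmk 1 zero_le_one (by simpa using h) w

lemma tmk_add (x : X) (y y' : Y) : tmk x (y + y') = tmk x y + tmk x y' :=
  map_add (tmkLin x) y y'
lemma add_tmk (x x' : X) (y : Y) : tmk (x + x') y = tmk x y + tmk x' y :=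
  LinearMap.map_add₂ tmkLin x x' y
lemma tmk_smul (a : k) (x : X) (y : Y) : tmk x (a • y) = a • tmk x y :=
  map_smul (tmkLin x) a y
lemma smul_tmk (a : k) (x : X) (y : Y) : tmk (a • x) y = a • tmk x y :=
  LinearMap.map_smul₂ tmkLin a x y

/-- The tensor product of two morphisms. -/
def tensorMap (f : X ⟶ Y) (g : Z ⟶ W) : tensor X Z ⟶ tensor Y W :=
  lift (tmkLin.compl₁₂ (Hom.lin f) (Hom.lin g)) (opNorm f * opNorm g)
    (mul_nonneg (opNorm_nonneg f) (opNorm_nonneg g)) fun x y => by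
      refine (norm_tmk_le _ _).trans ?_
      calc ‖f x‖ * ‖g y‖ ≤ (opNorm f * ‖x‖) * (opNorm g * ‖y‖) :=
            mul_le_mul (le_opNorm f x) (le_opNorm g y) (norm_nonneg _)
              (mul_nonneg (opNorm_nonneg f) (norm_nonneg x))
        _ = _ := by ring

@[simp] lemma tensorMap_tmk (f : X ⟶ Y) (g : Z ⟶ W) (x : X) (z : Z) :
    tensorMap f g (tmk x z) = tmk (f x) (g z) := lift_tmk _ _ _ _ x z

lemma IsContr.tensorMap {f : X ⟶ Y} {g : Z ⟶ W} (hf : IsContr f) (hg : IsContr g) :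
    IsContr (tensorMap f g) := isContr_of_tmk fun x z => by
  rw [tensorMap_tmk]
  exact (norm_tmk_le _ _).trans
    (mul_le_mul (hf x) (hg z) (norm_nonneg _) (norm_nonneg _))

variable (X) in
/-- The map `x ↦ x ⊗ y`. -/
def tmkRight (y : Y) : X ⟶ tensor X Y :=
  mk' (tmkLin.flip y) ‖y‖ fun x => (norm_tmk_le x y).trans_eq (mul_comm _ _)

variable (Y) in
/-- The map `y ↦ x ⊗ y`. -/
def tmkLeft (x : X) : Y ⟶ tensor X Y := mk' (tmkLin x) ‖x‖ fun y => norm_tmk_le x y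

@[simp] lemma tmkRight_apply (x : X) (y : Y) : tmkRight X y x = tmk x y := rfl
@[simp] lemma tmkLeft_apply (x : X) (y : Y) : tmkLeft Y x y = tmk x y := rfl

lemma tensor_ext₃ {f g : tensor (tensor X Y) Z ⟶ W}
    (h : ∀ x y z, f (tmk (tmk x y) z) = g (tmk (tmk x y) z)) : f = g := by
  refine tensor_ext fun w z => ?_
  have : tmkRight _ z ≫ f = tmkRight _ z ≫ g := tensor_ext fun x y => h x y z
  exact congrArg (fun F : tensor X Y ⟶ W => F w) this

lemma tensor_ext₃' {f g : tensor X (tensor Y Z) ⟶ W}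
    (h : ∀ x y z, f (tmk x (tmk y z)) = g (tmk x (tmk y z))) : f = g := by
  refine tensor_ext fun x w => ?_
  have : tmkLeft _ x ≫ f = tmkLeft _ x ≫ g := tensor_ext fun y z => h x y z
  exact congrArg (fun F : tensor Y Z ⟶ W => F w) this

lemma tensor_ext₄ {V : NABan k} {f g : tensor (tensor (tensor X Y) Z) W ⟶ V}
    (h : ∀ x y z w, f (tmk (tmk (tmk x y) z) w) = g (tmk (tmk (tmk x y) z) w)) :
    f = g := by
  refine tensor_ext fun t w => ?_
  have : tmkRight _ w ≫ f = tmkRight _ w ≫ g := tensor_ext₃ fun x y z => h x y z w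
  exact congrArg (fun F : tensor (tensor X Y) Z ⟶ V => F t) this

variable (X Y Z)

/-- The associativity isomorphism, forwards. -/
def assocHom : tensor (tensor X Y) Z ⟶ tensor X (tensor Y Z) :=
  lift (LinearMap.mk₂ k (fun w z => tensorMap (𝟙 X) (tmkRight Y z) w)
    (fun w w' z => map_add _ _ _) (fun a w z => map_smul _ _ _)
    (fun w z z' => congrArg (fun F : tensor X Y ⟶ tensor X (tensor Y Z) => F w)
      (show tensorMap (𝟙 X) (tmkRight Y (z + z')) =
        tensorMap (𝟙 X) (tmkRight Y z) + tensorMap (𝟙 X) (tmkRight Y z') from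
        tensor_ext fun x y => by simp [tmk_add]))
    (fun a w z => by
      have : tensorMap (𝟙 X) (tmkRight Y (a • z)) =
          tensorMap (𝟙 X) (tmkRight Y z) ≫ mk' (a • LinearMap.id) ‖a‖ (fun x => by
            simp [norm_smul]) :=
        tensor_ext fun x y => by simp [tmk_smul]
      exact congrArg (fun F : tensor X Y ⟶ tensor X (tensor Y Z) => F w) this))
    1 zero_le_one fun w z => by
      rw [one_mul, mul_comm]
      refine bound_of_tmk ‖z‖ (norm_nonneg z) (fun x y => ?_) w
      rw [tensorMap_tmk]
      refine (norm_tmk_le _ _).trans ?_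
      calc ‖x‖ * ‖tmk y z‖ ≤ ‖x‖ * (‖y‖ * ‖z‖) := by gcongr; exact norm_tmk_le y z
        _ = _ := by ring

/-- The associativity isomorphism, backwards. -/
def assocInv : tensor X (tensor Y Z) ⟶ tensor (tensor X Y) Z :=
  lift (LinearMap.mk₂ k (fun x w => tensorMap (tmkLeft Y x) (𝟙 Z) w)
    (fun x x' w => congrArg (fun F : tensor Y Z ⟶ tensor (tensor X Y) Z => F w)
      (show tensorMap (tmkLeft Y (x + x')) (𝟙 Z) =
        tensorMap (tmkLeft Y x) (𝟙 Z) + tensorMap (tmkLeft Y x') (𝟙 Z) from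
        tensor_ext fun y z => by simp [add_tmk]))
    (fun a x w => by
      have : tensorMap (tmkLeft Y (a • x)) (𝟙 Z) =
          tensorMap (tmkLeft Y x) (𝟙 Z) ≫ mk' (a • LinearMap.id) ‖a‖ (fun x => by
            simp [norm_smul]) :=
        tensor_ext fun y z => by simp [smul_tmk]
      exact congrArg (fun F : tensor Y Z ⟶ tensor (tensor X Y) Z => F w) this)
    (fun x w w' => map_add _ _ _) (fun a x w => map_smul _ _ _))
    1 zero_le_one fun x w => by
      rw [one_mul]
      refine bound_of_tmk ‖x‖ (norm_nonneg x) (fun y z => ?_) w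
      rw [tensorMap_tmk]
      refine (norm_tmk_le _ _).trans ?_
      calc ‖tmk x y‖ * ‖z‖ ≤ (‖x‖ * ‖y‖) * ‖z‖ := by gcongr; exact norm_tmk_le x y
        _ = _ := by ring

variable {X Y Z}

@[simp] lemma assocHom_tmk (x : X) (y : Y) (z : Z) :
    assocHom X Y Z (tmk (tmk x y) z) = tmk x (tmk y z) :=
  (lift_tmk _ _ _ _ _ _).trans (tensorMap_tmk _ _ x y)

@[simp] lemma assocInv_tmk (x : X) (y : Y) (z : Z) :
    assocInv X Y Z (tmk x (tmk y z)) = tmk (tmk x y) z :=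
  (lift_tmk _ _ _ _ _ _).trans (tensorMap_tmk _ _ y z)

lemma isContr_assocHom : IsContr (assocHom X Y Z) := fun w =>
  (lift_bound _ 1 zero_le_one _ w).trans_eq (one_mul _)

lemma isContr_assocInv : IsContr (assocInv X Y Z) := fun w =>
  (lift_bound _ 1 zero_le_one _ w).trans_eq (one_mul _)

variable (X Y Z)

/-- The associativity isomorphism. -/
def assocIso : tensor (tensor X Y) Z ≅ tensor X (tensor Y Z) where
  hom := assocHom X Y Z
  inv := assocInv X Y Z
  hom_inv_id := tensor_ext₃ fun x y z => by simp
  inv_hom_id := tensor_ext₃' fun x y z => by simp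

/-- The flip `x ⊗ y ↦ y ⊗ x`, as a morphism. -/
def swapHom : tensor X Y ⟶ tensor Y X :=
  lift tmkLin.flip 1 zero_le_one fun x y => by
    rw [one_mul, mul_comm]; exact norm_tmk_le y x

variable {X Y} in
@[simp] lemma swapHom_tmk (x : X) (y : Y) : swapHom X Y (tmk x y) = tmk y x :=
  lift_tmk _ _ _ _ _ _

variable {X Y} in
lemma isContr_swapHom : IsContr (swapHom X Y) := fun w =>
  (lift_bound _ 1 zero_le_one _ w).trans_eq (one_mul _)

/-- The flip `x ⊗ y ↦ y ⊗ x`, as an isomorphism. -/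
def swapIso : tensor X Y ≅ tensor Y X where
  hom := swapHom X Y
  inv := swapHom Y X
  hom_inv_id := tensor_ext fun x y => by simp
  inv_hom_id := tensor_ext fun x y => by simp

variable [IsUltrametricDist k] [CompleteSpace k]

variable (k) in
/-- The base field as a Banach space. -/
def unit : NABan k where
  carrier := k

/-- An element of the base field, as an element of the Banach space `unit k`. -/
def scalar (a : k) : unit k := a

/-- The element of the base field underlying an element of `unit k`. -/
def toScalar : unit k →ₗ[k] k := LinearMap.id

@[simp] lemma toScalar_scalar (a : k) : toScalar (scalar a) = a := rfl
@[simp] lemma scalar_toScalar (a : unit k) : scalar (toScalar a) = a := rfl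
lemma norm_toScalar (a : unit k) : ‖toScalar a‖ = ‖a‖ := rfl
lemma toScalar_smul_one (a : unit k) : toScalar a • scalar (1 : k) = a :=
  mul_one (M := k) a

/-- The isomorphism `k ⊗ X ≅ X`, forwards. -/
def lunitHom : tensor (unit k) X ⟶ X :=
  lift (LinearMap.lsmul k X ∘ₗ toScalar) 1 zero_le_one fun a x => by
    rw [one_mul]; exact (norm_smul (toScalar a) x).le

variable {X} in
@[simp] lemma lunitHom_tmk (a : unit k) (x : X) : lunitHom X (tmk a x) = toScalar a • x :=
  lift_tmk _ _ _ _ _ _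

variable {X} in
lemma isContr_lunitHom : IsContr (lunitHom X) := fun w =>
  (lift_bound _ 1 zero_le_one _ w).trans_eq (one_mul _)

/-- The isomorphism `k ⊗ X ≅ X`. -/
def lunitIso : tensor (unit k) X ≅ X where
  hom := lunitHom X
  inv := tmkLeft X (scalar 1)
  hom_inv_id := tensor_ext fun a x => by
    rw [comp_apply, lunitHom_tmk, tmkLeft_apply, tmk_smul, ← smul_tmk, toScalar_smul_one]
    rfl
  inv_hom_id := hom_ext fun x => by
    rw [comp_apply, tmkLeft_apply, lunitHom_tmk, toScalar_scalar, one_smul]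
    rfl

/-- The isomorphism `X ⊗ k ≅ X`. -/
def runitIso : tensor X (unit k) ≅ X where
  hom := swapHom X (unit k) ≫ lunitHom X
  inv := tmkRight X (scalar 1)
  hom_inv_id := tensor_ext fun x a => by
    rw [comp_apply, comp_apply, swapHom_tmk, lunitHom_tmk, tmkRight_apply, smul_tmk,
      ← tmk_smul, toScalar_smul_one]
    rfl
  inv_hom_id := hom_ext fun x => by
    rw [comp_apply, comp_apply, tmkRight_apply, swapHom_tmk, lunitHom_tmk, toScalar_scalar,
      one_smul]
    rfl

lemma tensorMap_comp {A B C A' B' C' : NABan k} (f : A ⟶ B) (f' : A' ⟶ B') (g : B ⟶ C)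
    (g' : B' ⟶ C') : tensorMap f f' ≫ tensorMap g g' = tensorMap (f ≫ g) (f' ≫ g') :=
  tensor_ext fun x y => by simp

lemma tensorMap_id : tensorMap (𝟙 X) (𝟙 Y) = 𝟙 (tensor X Y) := tensor_ext fun x y => by simp

lemma assocHom_naturality {A B C A' B' C' : NABan k} (f : A ⟶ A') (g : B ⟶ B') (h : C ⟶ C') :
    tensorMap (tensorMap f g) h ≫ assocHom A' B' C' =
      assocHom A B C ≫ tensorMap f (tensorMap g h) :=
  tensor_ext₃ fun x y z => by simp

lemma assocHom_pentagon {A B C D : NABan k} :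
    tensorMap (assocHom A B C) (𝟙 D) ≫ assocHom A (tensor B C) D ≫
      tensorMap (𝟙 A) (assocHom B C D) =
      assocHom (tensor A B) C D ≫ assocHom A B (tensor C D) :=
  tensor_ext₄ fun x y z w => by simp

lemma lunitHom_naturality {A B : NABan k} (f : A ⟶ B) :
    tensorMap (𝟙 (unit k)) f ≫ lunitHom B = lunitHom A ≫ f :=
  tensor_ext fun a x => by simp

lemma runitHom_naturality {A B : NABan k} (f : A ⟶ B) :
    tensorMap f (𝟙 (unit k)) ≫ (swapHom B (unit k) ≫ lunitHom B) =
      (swapHom A (unit k) ≫ lunitHom A) ≫ f :=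
  tensor_ext fun x a => by simp

lemma unit_triangle {A B : NABan k} :
    assocHom A (unit k) B ≫ tensorMap (𝟙 A) (lunitHom B) =
      tensorMap (swapHom A (unit k) ≫ lunitHom A) (𝟙 B) :=
  tensor_ext₃ fun x a y => by simp [tmk_smul, smul_tmk]

lemma swapHom_naturality {A B A' B' : NABan k} (f : A ⟶ A') (g : B ⟶ B') :
    tensorMap f g ≫ swapHom A' B' = swapHom A B ≫ tensorMap g f :=
  tensor_ext fun x y => by simp

lemma swapHom_hexagon {A B C : NABan k} :
    assocHom A B C ≫ swapHom A (tensor B C) ≫ assocHom B C A =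
      tensorMap (swapHom A B) (𝟙 C) ≫ assocHom B A C ≫ tensorMap (𝟙 B) (swapHom A C) :=
  tensor_ext₃ fun x y z => by simp

lemma swapHom_hexagon' {A B C : NABan k} :
    assocInv A B C ≫ swapHom (tensor A B) C ≫ assocInv C A B =
      tensorMap (𝟙 A) (swapHom B C) ≫ assocInv A C B ≫ tensorMap (swapHom A C) (𝟙 B) :=
  tensor_ext₃' fun x y z => by simp

lemma swapHom_swapHom {A B : NABan k} : swapHom A B ≫ swapHom B A = 𝟙 (tensor A B) :=
  tensor_ext fun x y => by simp

instance : MonoidalCategoryStruct (NABan k) where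
  tensorObj := tensor
  whiskerLeft X _ _ f := tensorMap (𝟙 X) f
  whiskerRight f Y := tensorMap f (𝟙 Y)
  tensorHom := tensorMap
  tensorUnit := unit k
  associator X Y Z := assocIso X Y Z
  leftUnitor X := lunitIso X
  rightUnitor X := runitIso X

instance : MonoidalCategory (NABan k) := MonoidalCategory.ofTensorHom
  (id_tensorHom_id := fun _ _ => tensorMap_id _ _)
  (id_tensorHom := fun _ _ _ _ => rfl)
  (tensorHom_id := fun _ _ => rfl)
  (tensorHom_comp_tensorHom := fun f f' g g' => tensorMap_comp f f' g g')
  (associator_naturality := fun f g h => assocHom_naturality f g h)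
  (leftUnitor_naturality := fun f => lunitHom_naturality f)
  (rightUnitor_naturality := fun f => runitHom_naturality f)
  (pentagon := fun _ _ _ _ => assocHom_pentagon)
  (triangle := fun _ _ => unit_triangle)

instance : SymmetricCategory (NABan k) where
  braiding X Y := swapIso X Y
  braiding_naturality_right _ _ _ f := swapHom_naturality (𝟙 _) f
  braiding_naturality_left f _ := swapHom_naturality f (𝟙 _)
  hexagon_forward _ _ _ := swapHom_hexagon
  hexagon_reverse _ _ _ := swapHom_hexagon'
  symmetry _ _ := swapHom_swapHom

end monoidal

section tmul

variable [IsUltrametricDist k] [CompleteSpace k] {X Y Z W X' Y' : NABan k}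

/-- An element of the base field, as an element of the unit object. -/
def scal (a : k) : (𝟙_ (NABan k) : NABan k) := scalar a

/-- The element of the base field underlying an element of the unit object. -/
def unscal (a : (𝟙_ (NABan k) : NABan k)) : k := toScalar a

/-- The elementary tensor `x ⊗ y` in `X ⊗ Y`. -/
def tmul (x : X) (y : Y) : (X ⊗ Y : NABan k) := tmk x y

lemma norm_tmul_le (x : X) (y : Y) : ‖tmul x y‖ ≤ ‖x‖ * ‖y‖ := norm_tmk_le x y

lemma tmul_ext {f g : X ⊗ Y ⟶ Z} (h : ∀ x y, f (tmul x y) = g (tmul x y)) : f = g :=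
  tensor_ext h

@[simp] lemma tensorHom_tmul (f : X ⟶ Y) (g : X' ⟶ Y') (x : X) (x' : X') :
    (f ⊗ₘ g) (tmul x x') = tmul (f x) (g x') := tensorMap_tmk f g x x'
@[simp] lemma whiskerLeft_tmul (f : X ⟶ Y) (z : Z) (x : X) :
    (Z ◁ f) (tmul z x) = tmul z (f x) := tensorMap_tmk _ f z x
@[simp] lemma whiskerRight_tmul (f : X ⟶ Y) (x : X) (z : Z) :
    (f ▷ Z) (tmul x z) = tmul (f x) z := tensorMap_tmk f _ x z
@[simp] lemma associator_hom_tmul (x : X) (y : Y) (z : Z) :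
    (α_ X Y Z).hom (tmul (tmul x y) z) = tmul x (tmul y z) := assocHom_tmk x y z
@[simp] lemma associator_inv_tmul (x : X) (y : Y) (z : Z) :
    (α_ X Y Z).inv (tmul x (tmul y z)) = tmul (tmul x y) z := assocInv_tmk x y z
@[simp] lemma leftUnitor_tmul (a : (𝟙_ (NABan k) : NABan k)) (x : X) :
    (λ_ X).hom (tmul a x) = unscal a • x := lunitHom_tmk a x
@[simp] lemma leftUnitor_inv_apply (x : X) : (λ_ X).inv x = tmul (scal (1 : k)) x := rfl
@[simp] lemma rightUnitor_tmul (x : X) (a : (𝟙_ (NABan k) : NABan k)) :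
    (ρ_ X).hom (tmul x a) = unscal a • x :=
  (congrArg (lunitHom X) (swapHom_tmk x a)).trans (lunitHom_tmk a x)
@[simp] lemma rightUnitor_inv_apply (x : X) : (ρ_ X).inv x = tmul x (scal (1 : k)) := rfl
@[simp] lemma braiding_tmul (x : X) (y : Y) : (β_ X Y).hom (tmul x y) = tmul y x :=
  swapHom_tmk x y

lemma IsContr.tensorHom {f : X ⟶ Y} {g : X' ⟶ Y'} (hf : IsContr f) (hg : IsContr g) :
    IsContr (f ⊗ₘ g) := hf.tensorMap hg
lemma IsContr.whiskerLeft {f : X ⟶ Y} (hf : IsContr f) : IsContr (Z ◁ f) :=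
  isContr_id.tensorMap hf
lemma IsContr.whiskerRight {f : X ⟶ Y} (hf : IsContr f) : IsContr (f ▷ Z) :=
  hf.tensorMap isContr_id
lemma isContr_assoc : IsContr (α_ X Y Z).hom := isContr_assocHom
lemma isContr_assoc_inv : IsContr (α_ X Y Z).inv := isContr_assocInv
lemma isContr_leftUnitor : IsContr (λ_ X).hom := isContr_lunitHom
lemma isContr_rightUnitor : IsContr (ρ_ X).hom := isContr_swapHom.comp isContr_lunitHom
lemma isContr_leftUnitor_inv : IsContr (λ_ X).inv := fun x =>
  (norm_tmul_le (scal (1 : k)) x).trans_eq (by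
    have : ‖scal (1 : k)‖ = 1 := norm_one (α := k)
    rw [this, one_mul])
lemma isContr_rightUnitor_inv : IsContr (ρ_ X).inv := fun x =>
  (norm_tmul_le x (scal (1 : k))).trans_eq (by
    have : ‖scal (1 : k)‖ = 1 := norm_one (α := k)
    rw [this, mul_one])
lemma isContr_braiding : IsContr (β_ X Y).hom := isContr_swapHom

end tmul

/-! ### Contracting coproducts, rescaling, equalisers, quotients -/

section coprod

variable (E F : ℕ → NABan k)

/-- The null sequences inside the bounded sequences. -/
def nullSeq : Submodule k (lp (fun n => (E n : Type u)) ∞) where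
  carrier := {x | Tendsto (fun n => ‖x n‖) atTop (𝓝 0)}
  zero_mem' := by simp
  add_mem' {x y} hx hy := by
    have h := (Tendsto.add hx hy)
    rw [add_zero] at h
    exact squeeze_zero (fun n => norm_nonneg _) (fun n => norm_add_le (x n) (y n)) h
  smul_mem' a x hx := by
    have h := Tendsto.const_mul ‖a‖ hx
    rw [mul_zero] at h
    refine h.congr fun n => ?_
    exact (norm_smul a (x n)).symm

lemma isClosed_nullSeq : IsClosed (nullSeq E : Set (lp (fun n => (E n : Type u)) ∞)) := by
  refine isClosed_of_closure_subset fun x hx => ?_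
  change Tendsto (fun n => ‖x n‖) atTop (𝓝 0)
  rw [Metric.tendsto_atTop]
  intro ε hε
  obtain ⟨y, hy, hxy⟩ := Metric.mem_closure_iff.mp hx (ε / 2) (half_pos hε)
  obtain ⟨N, hN⟩ := Metric.tendsto_atTop.mp (show Tendsto (fun n => ‖y n‖) atTop (𝓝 0) from hy)
    (ε / 2) (half_pos hε)
  refine ⟨N, fun n hn => ?_⟩
  have h1 := hN n hn
  rw [dist_zero_right, norm_norm] at h1 ⊢
  have h2 : ‖(x - y) n‖ ≤ ‖x - y‖ := lp.norm_apply_le_norm ENNReal.top_ne_zero (x - y) n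
  rw [dist_eq_norm] at hxy
  have h3 : x n = (x - y) n + y n := by simp
  rw [h3]
  linarith [norm_add_le ((x - y) n) (y n)]

/-- The contracting coproduct of a sequence of Banach spaces: families `(xₙ)` with `‖xₙ‖ → 0`,
with the supremum norm. -/
def coprod : NABan k where
  carrier := nullSeq E
  ultra := IsUltrametricDist.isUltrametricDist_of_forall_norm_add_le_max_norm fun x y =>
    lp.norm_le_of_forall_le (le_max_of_le_left (norm_nonneg _)) fun n =>
      (IsUltrametricDist.norm_add_le_max _ _).trans
        (max_le_max (lp.norm_apply_le_norm ENNReal.top_ne_zero x.1 n)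
          (lp.norm_apply_le_norm ENNReal.top_ne_zero y.1 n))
  complete := (isClosed_nullSeq E).completeSpace_coe

variable {E F}

/-- The `n`-th component of an element of the contracting coproduct. -/
def comp (x : coprod E) (n : ℕ) : E n := (x : nullSeq E).1 n

lemma comp_tendsto (x : coprod E) : Tendsto (fun n => ‖comp x n‖) atTop (𝓝 0) :=
  (x : nullSeq E).2

lemma norm_comp_le (x : coprod E) (n : ℕ) : ‖comp x n‖ ≤ ‖x‖ :=
  lp.norm_apply_le_norm ENNReal.top_ne_zero (x : nullSeq E).1 n

lemma comp_add (x y : coprod E) (n : ℕ) : comp (x + y) n = comp x n + comp y n := rfl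
lemma comp_smul (a : k) (x : coprod E) (n : ℕ) : comp (a • x) n = a • comp x n := rfl

variable (E) in
/-- The inclusion of the `n`-th component. -/
def incl (n : ℕ) : E n ⟶ coprod E :=
  mk' (Y := coprod E)
    { toFun := fun x => (⟨lp.single ∞ n x, by
        refine tendsto_const_nhds.congr' ?_
        filter_upwards [eventually_gt_atTop n] with m hm
        exact ((congrArg norm (lp.single_apply_ne (E := fun n => (E n : Type u))
          ∞ n x hm.ne')).trans norm_zero).symm⟩ : nullSeq E)
      map_add' := fun x y => Subtype.ext (lp.single_add (E := fun n => (E n : Type u)) ∞ n x y)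
      map_smul' := fun a x => Subtype.ext
        (lp.single_smul (E := fun n => (E n : Type u)) ∞ n a (x : E n)) } 1
    fun x => by
      rw [one_mul]
      exact (lp.norm_single (p := ∞) (E := fun n => (E n : Type u)) (by simp) n x).le

lemma isContr_incl (n : ℕ) : IsContr (incl E n) := fun x =>
  (lp.norm_single (p := ∞) (E := fun n => (E n : Type u)) (by simp) n x).le

lemma summable_desc {Z : NABan k} (f : ∀ n, E n ⟶ Z) (hf : ∀ n, IsContr (f n)) (x : coprod E) :
    Summable fun n => f n (comp x n) := by
  refine NonarchimedeanAddGroup.summable_of_tendsto_cofinite_zero ?_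
  rw [Nat.cofinite_eq_atTop]
  exact squeeze_zero_norm (fun n => hf n _) (comp_tendsto x)

/-- The morphism `(xₙ) ↦ ∑ fₙ(xₙ)` induced by a family of contracting maps. -/
def desc {Z : NABan k} (f : ∀ n, E n ⟶ Z) (hf : ∀ n, IsContr (f n)) : coprod E ⟶ Z :=
  mk' { toFun := fun x => ∑' n, f n (comp x n)
        map_add' := fun x y => by
          rw [← (summable_desc f hf x).tsum_add (summable_desc f hf y)]
          exact tsum_congr fun n => by rw [comp_add, map_add]
        map_smul' := fun a x => by
          rw [RingHom.id_apply, ← (summable_desc f hf x).tsum_const_smul a]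
          exact tsum_congr fun n => by rw [comp_smul, map_smul] } 1
    fun x => by
      rw [one_mul]
      exact IsUltrametricDist.norm_tsum_le_of_forall_le_of_nonneg (norm_nonneg x) fun n =>
        (hf n _).trans (norm_comp_le x n)

lemma desc_apply {Z : NABan k} (f : ∀ n, E n ⟶ Z) (hf : ∀ n, IsContr (f n)) (x : coprod E) :
    desc f hf x = ∑' n, f n (comp x n) := rfl

lemma isContr_desc {Z : NABan k} (f : ∀ n, E n ⟶ Z) (hf : ∀ n, IsContr (f n)) :
    IsContr (desc f hf) := fun x =>
  IsUltrametricDist.norm_tsum_le_of_forall_le_of_nonneg (norm_nonneg x) fun n =>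
    (hf n _).trans (norm_comp_le x n)

lemma comp_incl_self (n : ℕ) (x : E n) : comp (incl E n x) n = x :=
  lp.single_apply_self (E := fun n => (E n : Type u)) ∞ n x

lemma comp_incl_ne {n m : ℕ} (x : E n) (h : m ≠ n) : comp (incl E n x) m = 0 :=
  lp.single_apply_ne (E := fun n => (E n : Type u)) ∞ n x h

lemma desc_incl {Z : NABan k} (f : ∀ n, E n ⟶ Z) (hf : ∀ n, IsContr (f n)) (n : ℕ) (x : E n) :
    desc f hf (incl E n x) = f n x := by
  rw [desc_apply, tsum_eq_single n, comp_incl_self]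
  intro m hm
  rw [comp_incl_ne x hm, map_zero]

variable [IsUltrametricDist k] [CompleteSpace k]

lemma isContr_tmul_of_norm {X Y Z : NABan k} {f : X ⊗ Y ⟶ Z}
    (h : ∀ x y, ‖f (tmul x y)‖ ≤ ‖x‖ * ‖y‖) : IsContr f := isContr_of_tmk h

lemma tmul_hasSum {Z : NABan k} {X : NABan k} (f : ∀ n, X ⊗ E n ⟶ Z)
    (hf : ∀ n, IsContr (f n)) (x : X) (y : coprod E) :
    Summable fun n => f n (tmul x (comp y n)) := by
  refine NonarchimedeanAddGroup.summable_of_tendsto_cofinite_zero ?_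
  rw [Nat.cofinite_eq_atTop]
  refine squeeze_zero_norm (fun n => (hf n _).trans (norm_tmul_le _ _)) ?_
  simpa using (comp_tendsto y).const_mul ‖x‖

/-- The morphism `x ⊗ (yₙ) ↦ ∑ fₙ(x ⊗ yₙ)` induced by a family of contracting maps. -/
def descRight {X Z : NABan k} (f : ∀ n, X ⊗ E n ⟶ Z) (hf : ∀ n, IsContr (f n)) :
    X ⊗ coprod E ⟶ Z :=
  lift (LinearMap.mk₂ k (fun x y => ∑' n, f n (tmul x (comp y n)))
    (fun x x' y => by
      rw [← (tmul_hasSum f hf x y).tsum_add (tmul_hasSum f hf x' y)]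
      exact tsum_congr fun n => by
        rw [← map_add]; exact congrArg (f n) (add_tmk x x' _))
    (fun a x y => by
      rw [← (tmul_hasSum f hf x y).tsum_const_smul a]
      exact tsum_congr fun n => by
        rw [← map_smul]; exact congrArg (f n) (smul_tmk a x _))
    (fun x y y' => by
      rw [← (tmul_hasSum f hf x y).tsum_add (tmul_hasSum f hf x y')]
      exact tsum_congr fun n => by
        rw [← map_add, comp_add]; exact congrArg (f n) (tmk_add x _ _))
    (fun a x y => by
      rw [← (tmul_hasSum f hf x y).tsum_const_smul a]
      exact tsum_congr fun n => by
        rw [← map_smul, comp_smul]; exact congrArg (f n) (tmk_smul a x _)))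
    1 zero_le_one fun x y => by
      rw [one_mul]
      exact IsUltrametricDist.norm_tsum_le_of_forall_le_of_nonneg (by positivity) fun n =>
        (hf n _).trans ((norm_tmul_le _ _).trans (by gcongr; exact norm_comp_le y n))

lemma descRight_tmul {X Z : NABan k} (f : ∀ n, X ⊗ E n ⟶ Z) (hf : ∀ n, IsContr (f n))
    (x : X) (y : coprod E) : descRight f hf (tmul x y) = ∑' n, f n (tmul x (comp y n)) :=
  lift_tmk _ _ _ _ _ _

lemma isContr_descRight {X Z : NABan k} (f : ∀ n, X ⊗ E n ⟶ Z) (hf : ∀ n, IsContr (f n)) :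
    IsContr (descRight f hf) := fun w =>
  (lift_bound _ 1 zero_le_one _ w).trans_eq (one_mul _)

lemma descRight_incl {X Z : NABan k} (f : ∀ n, X ⊗ E n ⟶ Z) (hf : ∀ n, IsContr (f n))
    (n : ℕ) (x : X) (y : E n) : descRight f hf (tmul x (incl E n y)) = f n (tmul x y) := by
  rw [descRight_tmul, tsum_eq_single n, comp_incl_self]
  intro m hm
  rw [comp_incl_ne y hm, ← map_zero (Hom.lin (f m))]
  exact congrArg (f m) (map_zero (tmkLin x))

/-- The morphism `(xₙ) ⊗ y ↦ ∑ fₙ(xₙ ⊗ y)` induced by a family of contracting maps. -/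
def descLeft {Y Z : NABan k} (f : ∀ n, E n ⊗ Y ⟶ Z) (hf : ∀ n, IsContr (f n)) :
    coprod E ⊗ Y ⟶ Z :=
  (β_ (coprod E) Y).hom ≫ descRight (fun n => (β_ Y (E n)).hom ≫ f n)
    (fun n => isContr_braiding.comp (hf n))

lemma isContr_descLeft {Y Z : NABan k} (f : ∀ n, E n ⊗ Y ⟶ Z) (hf : ∀ n, IsContr (f n)) :
    IsContr (descLeft f hf) := isContr_braiding.comp (isContr_descRight _ _)

/-- The morphism `(xₙ) ⊗ (yₘ) ↦ ∑ fₙₘ(xₙ ⊗ yₘ)` induced by a family of contracting maps. -/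
def desc₂ {Z : NABan k} (f : ∀ n m, E n ⊗ F m ⟶ Z) (hf : ∀ n m, IsContr (f n m)) :
    coprod E ⊗ coprod F ⟶ Z :=
  descLeft (fun n => descRight (f n) (hf n)) (fun _ => isContr_descRight _ _)

lemma isContr_desc₂ {Z : NABan k} (f : ∀ n m, E n ⊗ F m ⟶ Z) (hf : ∀ n m, IsContr (f n m)) :
    IsContr (desc₂ f hf) := isContr_descLeft _ _

lemma desc₂_incl {Z : NABan k} (f : ∀ n m, E n ⊗ F m ⟶ Z) (hf : ∀ n m, IsContr (f n m))
    (n m : ℕ) (x : E n) (y : F m) :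
    desc₂ f hf (tmul (incl E n x) (incl F m y)) = f n m (tmul x y) := by
  rw [desc₂, descLeft, comp_apply, braiding_tmul, descRight_incl, comp_apply, braiding_tmul,
    descRight_incl]

end coprod

section rescale

/-- The vector space underlying a rescaled Banach space. -/
def RescaleCarrier (_r : ℝ) (V : NABan k) : Type u := V

variable {r : ℝ} {V : NABan k}

instance : AddCommGroup (RescaleCarrier r V) := inferInstanceAs (AddCommGroup V)
instance : Module k (RescaleCarrier r V) := inferInstanceAs (Module k V)

/-- The identity map from a rescaled Banach space to the original one. -/
def unrescale : RescaleCarrier r V →ₗ[k] V := LinearMap.id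

instance : Norm (RescaleCarrier r V) := ⟨fun x => r * ‖unrescale x‖⟩

lemma rescale_norm (x : RescaleCarrier r V) : ‖x‖ = r * ‖unrescale x‖ := rfl

lemma rescale_core (hr : 0 < r) : NormedSpace.Core k (RescaleCarrier r V) where
  norm_nonneg x := mul_nonneg hr.le (norm_nonneg (unrescale x))
  norm_smul a x := by rw [rescale_norm, rescale_norm, map_smul, norm_smul]; ring
  norm_triangle x y := by
    rw [rescale_norm, rescale_norm, rescale_norm, map_add, ← mul_add]
    exact mul_le_mul_of_nonneg_left (norm_add_le _ _) hr.le
  norm_eq_zero_iff x := by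
    rw [rescale_norm, mul_eq_zero, or_iff_right hr.ne', norm_eq_zero]
    rfl

/-- The Banach space `V` with its norm multiplied by `r > 0`. -/
def rescale (r : ℝ) (hr : 0 < r) (V : NABan k) : NABan k :=
  letI : NormedAddCommGroup (RescaleCarrier r V) := NormedAddCommGroup.ofCore (rescale_core hr)
  letI : NormedSpace k (RescaleCarrier r V) :=
    { norm_smul_le := fun a x => ((rescale_core hr).norm_smul a x).le }
  { carrier := RescaleCarrier r V
    ultra := IsUltrametricDist.isUltrametricDist_of_forall_norm_add_le_max_norm fun x y => by
      rw [rescale_norm, rescale_norm, rescale_norm, map_add, ← mul_max_of_nonneg _ _ hr.le]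
      exact mul_le_mul_of_nonneg_left (IsUltrametricDist.norm_add_le_max _ _) hr.le
    complete := by
      have h1 : AntilipschitzWith ⟨r, hr.le⟩ (unrescale : RescaleCarrier r V →ₗ[k] V) :=
        AddMonoidHomClass.antilipschitz_of_bound _ fun x => (rescale_norm x).le
      have h2 : UniformContinuous (unrescale : RescaleCarrier r V →ₗ[k] V) :=
        AddMonoidHomClass.uniformContinuous_of_bound _ r⁻¹ fun x => by
          rw [rescale_norm, inv_mul_cancel_left₀ hr.ne']
      exact ((h1.isUniformInducing h2).completeSpace_congr fun x => ⟨x, rfl⟩).mpr V.complete }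

variable (r V)

/-- The identity, as a bounded map from `V` to the rescaled space. -/
def toRescale (hr : 0 < r) : V ⟶ rescale r hr V :=
  mk' (X := V) (Y := rescale r hr V) (LinearMap.id (M := V)) r fun _ => le_rfl

/-- The identity, as a bounded map from the rescaled space to `V`. -/
def ofRescale (hr : 0 < r) : rescale r hr V ⟶ V :=
  mk' (X := rescale r hr V) (Y := V) (LinearMap.id (M := V)) r⁻¹ fun x =>
    (inv_mul_cancel_left₀ hr.ne' ‖(show V from x)‖).ge

lemma norm_toRescale (hr : 0 < r) (x : V) : ‖toRescale r V hr x‖ = r * ‖x‖ := rfl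

lemma norm_ofRescale (hr : 0 < r) (x : rescale r hr V) :
    ‖ofRescale r V hr x‖ = r⁻¹ * ‖x‖ :=
  (inv_mul_cancel_left₀ hr.ne' ‖(show V from x)‖).symm

end rescale

section subquot

variable {X Y : NABan k}

/-- The subspace on which two morphisms agree. -/
def eqSub (f g : X ⟶ Y) : Submodule k X := LinearMap.eqLocus (Hom.lin f) (Hom.lin g)

/-- The equaliser of two morphisms. -/
def eqObj (f g : X ⟶ Y) : NABan k where
  carrier := eqSub f g
  complete :=
    (show IsClosed (eqSub f g : Set X) from
      isClosed_eq (continuous f) (continuous g)).completeSpace_coe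

/-- The inclusion of the equaliser of two morphisms. -/
def eqIncl (f g : X ⟶ Y) : eqObj f g ⟶ X :=
  mk' (X := eqObj f g) (eqSub f g).subtype 1 fun x => (one_mul ‖(x : eqSub f g)‖).ge

/-- The quotient of a Banach space by a closed subspace, with the quotient norm. -/
def quot (I : Submodule k X) (hI : IsClosed (I : Set X)) : NABan k :=
  haveI := hI
  { carrier := X ⧸ I
    ultra := IsUltrametricDist.isUltrametricDist_of_forall_norm_add_le_max_norm fun x y => by
      refine le_of_forall_pos_le_add fun ε hε => ?_
      obtain ⟨a, rfl, ha⟩ := Submodule.Quotient.norm_mk_lt x hε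
      obtain ⟨b, rfl, hb⟩ := Submodule.Quotient.norm_mk_lt y hε
      rw [← Submodule.Quotient.mk_add, ← max_add_add_right]
      exact (Submodule.Quotient.norm_mk_le I (a + b)).trans
        ((IsUltrametricDist.norm_add_le_max a b).trans (max_le_max ha.le hb.le)) }

/-- The projection to the quotient by a closed subspace. -/
def proj (I : Submodule k X) (hI : IsClosed (I : Set X)) : X ⟶ quot I hI :=
  mk' (Y := quot I hI) I.mkQ 1 fun x =>
    (Submodule.Quotient.norm_mk_le I x).trans_eq (one_mul _).symm

end subquot

/-! ### Graded pre-braided Hopf algebras -/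

variable [IsUltrametricDist k] [CompleteSpace k]

section hopf

/-- The hexagon axiom for a morphism `c : V ⊗ V ⟶ V ⊗ V`. -/
def IsPreBraiding {V : NABan k} (c : V ⊗ V ⟶ V ⊗ V) : Prop :=
  (c ▷ V) ≫ (α_ V V V).hom ≫ (V ◁ c) ≫ (α_ V V V).inv ≫ (c ▷ V) ≫ (α_ V V V).hom =
    (α_ V V V).hom ≫ (V ◁ c) ≫ (α_ V V V).inv ≫ (c ▷ V) ≫ (α_ V V V).hom ≫ (V ◁ c)

variable (k) in
/-- The Banach space `k{t}` of power series in `t` with coefficients tending to zero; the `n`-th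
component is the coefficient of `tⁿ`. -/
def kt : NABan k := coprod fun _ => 𝟙_ (NABan k)

variable (k) in
/-- The generalised element `1 ↦ tⁿ` of `k{t}`. -/
def tpower (n : ℕ) : 𝟙_ (NABan k) ⟶ kt k := incl (fun _ => 𝟙_ (NABan k)) n

lemma isContr_tpower (n : ℕ) : IsContr (tpower k n) := isContr_incl n

variable (k) in
/-- The multiplication `tⁿ ⊗ tᵐ ↦ tⁿ⁺ᵐ` of `k{t}`. -/
def ktMul : kt k ⊗ kt k ⟶ kt k :=
  desc₂ (fun n m => (λ_ (𝟙_ (NABan k))).hom ≫ tpower k (n + m))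
    fun _ _ => isContr_leftUnitor.comp (isContr_tpower _)

variable (k) in
/-- The comultiplication `tⁿ ↦ tⁿ ⊗ tⁿ` of `k{t}`. -/
def ktComul : kt k ⟶ kt k ⊗ kt k :=
  desc (fun n => (λ_ (𝟙_ (NABan k))).inv ≫ (tpower k n ⊗ₘ tpower k n))
    fun n => isContr_leftUnitor_inv.comp ((isContr_tpower n).tensorHom (isContr_tpower n))

variable (k) in
/-- The counit `tⁿ ↦ 1` of `k{t}`. -/
def ktCounit : kt k ⟶ 𝟙_ (NABan k) := desc (fun _ => 𝟙 _) fun _ => isContr_id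

/-- The structure maps of a pre-braided Hopf algebra graded over `k{t}`: unit, multiplication,
counit, comultiplication, pre-braiding and coaction of `k{t}`. The axioms are imposed
separately. -/
@[ext]
structure HopfData (A : NABan k) where
  /-- unit -/
  one : 𝟙_ (NABan k) ⟶ A
  /-- multiplication -/
  mul : A ⊗ A ⟶ A
  /-- counit -/
  counit : A ⟶ 𝟙_ (NABan k)
  /-- comultiplication -/
  comul : A ⟶ A ⊗ A
  /-- pre-braiding -/
  braid : A ⊗ A ⟶ A ⊗ A
  /-- coaction of `k{t}` -/
  coact : A ⟶ kt k ⊗ A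

/-- `Id ⊗ c ⊗ Id` on `(A ⊗ A) ⊗ (A ⊗ A)`. -/
def midBraid {A : NABan k} (c : A ⊗ A ⟶ A ⊗ A) : (A ⊗ A) ⊗ (A ⊗ A) ⟶ (A ⊗ A) ⊗ (A ⊗ A) :=
  (α_ A A (A ⊗ A)).hom ≫ (A ◁ (α_ A A A).inv) ≫ (A ◁ (c ▷ A)) ≫ (A ◁ (α_ A A A).hom) ≫
    (α_ A A (A ⊗ A)).inv

/-- Flatness: the functor `A ⊗ -` preserves kernels (and finite products). -/
def IsFlat (A : NABan k) : Prop := Limits.PreservesFiniteLimits (tensorLeft A)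

namespace HopfData

variable {A B : NABan k}

/-- The axioms of a pre-braided bialgebra: algebra, coalgebra, pre-braiding, compatibility of the
pre-braiding with the four structure maps, and multiplicativity of comultiplication and counit. -/
structure IsPreBraidedBialgebra (D : HopfData A) : Prop where
  one_mul : (D.one ▷ A) ≫ D.mul = (λ_ A).hom
  mul_one : (A ◁ D.one) ≫ D.mul = (ρ_ A).hom
  mul_assoc : (D.mul ▷ A) ≫ D.mul = (α_ A A A).hom ≫ (A ◁ D.mul) ≫ D.mul
  counit_comul : D.comul ≫ (D.counit ▷ A) = (λ_ A).inv
  comul_counit : D.comul ≫ (A ◁ D.counit) = (ρ_ A).inv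
  comul_assoc : D.comul ≫ (D.comul ▷ A) ≫ (α_ A A A).hom = D.comul ≫ (A ◁ D.comul)
  hexagon : IsPreBraiding D.braid
  one_braid : (D.one ▷ A) ≫ D.braid = (λ_ A).hom ≫ (ρ_ A).inv ≫ (A ◁ D.one)
  braid_one : (A ◁ D.one) ≫ D.braid = (ρ_ A).hom ≫ (λ_ A).inv ≫ (D.one ▷ A)
  mul_braid : (D.mul ▷ A) ≫ D.braid =
    (α_ A A A).hom ≫ (A ◁ D.braid) ≫ (α_ A A A).inv ≫ (D.braid ▷ A) ≫ (α_ A A A).hom ≫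
      (A ◁ D.mul)
  braid_mul : (A ◁ D.mul) ≫ D.braid =
    (α_ A A A).inv ≫ (D.braid ▷ A) ≫ (α_ A A A).hom ≫ (A ◁ D.braid) ≫ (α_ A A A).inv ≫
      (D.mul ▷ A)
  braid_counit_left : D.braid ≫ (D.counit ▷ A) ≫ (λ_ A).hom = (A ◁ D.counit) ≫ (ρ_ A).hom
  braid_counit_right : D.braid ≫ (A ◁ D.counit) ≫ (ρ_ A).hom = (D.counit ▷ A) ≫ (λ_ A).hom
  comul_braid : (D.comul ▷ A) ≫ (α_ A A A).hom ≫ (A ◁ D.braid) ≫ (α_ A A A).inv ≫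
    (D.braid ▷ A) ≫ (α_ A A A).hom = D.braid ≫ (A ◁ D.comul)
  braid_comul : (A ◁ D.comul) ≫ (α_ A A A).inv ≫ (D.braid ▷ A) ≫ (α_ A A A).hom ≫
    (A ◁ D.braid) ≫ (α_ A A A).inv = D.braid ≫ (D.comul ▷ A)
  mul_comul : D.mul ≫ D.comul =
    (D.comul ⊗ₘ D.comul) ≫ midBraid D.braid ≫ (D.mul ⊗ₘ D.mul)
  one_comul : D.one ≫ D.comul = (λ_ (𝟙_ (NABan k))).inv ≫ (D.one ⊗ₘ D.one)
  one_counit : D.one ≫ D.counit = 𝟙 _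
  mul_counit : D.mul ≫ D.counit = (D.counit ⊗ₘ D.counit) ≫ (λ_ (𝟙_ (NABan k))).hom

/-- The coaction of `k{t} ⊗ k{t}` on `A ⊗ A`. -/
def coact₂ (D : HopfData A) : A ⊗ A ⟶ (kt k ⊗ kt k) ⊗ (A ⊗ A) :=
  (D.coact ⊗ₘ D.coact) ≫ tensorμ (kt k) A (kt k) A

/-- `A` is graded over `k{t}`: the coaction makes `A` a `k{t}`-comodule, unit, multiplication,
counit and comultiplication are comodule maps (`k{t}` coacting on `A ⊗ A` through its
multiplication), and the pre-braiding is a map of `k{t} ⊗ k{t}`-comodules, where the factors of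
`k{t} ⊗ k{t}` are exchanged along with those of `A ⊗ A`. -/
structure IsGraded (D : HopfData A) : Prop where
  counit_coact : D.coact ≫ (ktCounit k ▷ A) = (λ_ A).inv
  coassoc : D.coact ≫ (ktComul k ▷ A) ≫ (α_ (kt k) (kt k) A).hom = D.coact ≫ (kt k ◁ D.coact)
  one : D.one ≫ D.coact = (λ_ (𝟙_ (NABan k))).inv ≫ (tpower k 0 ⊗ₘ D.one)
  mul : D.mul ≫ D.coact = D.coact₂ ≫ (ktMul k ⊗ₘ D.mul)
  counit : D.coact ≫ (kt k ◁ D.counit) =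
    D.counit ≫ (λ_ (𝟙_ (NABan k))).inv ≫ (tpower k 0 ▷ 𝟙_ (NABan k))
  comul : D.comul ≫ D.coact₂ ≫ (ktMul k ▷ (A ⊗ A)) = D.coact ≫ (kt k ◁ D.comul)
  braid : D.braid ≫ D.coact₂ = D.coact₂ ≫ ((β_ (kt k) (kt k)).hom ⊗ₘ D.braid)

/-- `S` is an antipode: a convolution inverse of the identity. -/
def IsAntipode (D : HopfData A) (S : A ⟶ A) : Prop :=
  D.comul ≫ (S ▷ A) ≫ D.mul = D.counit ≫ D.one ∧ D.comul ≫ (A ◁ S) ≫ D.mul = D.counit ≫ D.one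

/-- Analytically graded pre-braided Banach Hopf algebras. -/
structure IsGradedHopf (D : HopfData A) : Prop where
  bialgebra : D.IsPreBraidedBialgebra
  graded : D.IsGraded
  antipode : ∃ S : A ⟶ A, D.IsAntipode S ∧ S ≫ D.coact = D.coact ≫ (kt k ◁ S)

/-- Morphisms respecting all the structure maps. -/
structure IsHom (D : HopfData A) (D' : HopfData B) (f : A ⟶ B) : Prop where
  one : D.one ≫ f = D'.one
  mul : (f ⊗ₘ f) ≫ D'.mul = D.mul ≫ f
  counit : f ≫ D'.counit = D.counit
  comul : f ≫ D'.comul = D.comul ≫ (f ⊗ₘ f)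
  braid : (f ⊗ₘ f) ≫ D'.braid = D.braid ≫ (f ⊗ₘ f)
  coact : f ≫ D'.coact = D.coact ≫ (kt k ◁ f)

/-- The homogeneous elements of degree `n`, i.e. those with coaction `x ↦ tⁿ ⊗ x`. -/
def pieceSub (D : HopfData A) (n : ℕ) : Submodule k A :=
  eqSub D.coact ((λ_ A).inv ≫ (tpower k n ▷ A))

/-- The graded piece of degree `n`, as a Banach space. -/
def piece (D : HopfData A) (n : ℕ) : NABan k := eqObj D.coact ((λ_ A).inv ≫ (tpower k n ▷ A))

/-- The inclusion of the graded piece of degree `n`. -/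
def pieceIncl (D : HopfData A) (n : ℕ) : D.piece n ⟶ A := eqIncl _ _

/-- The primitive elements, `Δ x = 1 ⊗ x + x ⊗ 1`. -/
def prim (D : HopfData A) : Submodule k A :=
  eqSub D.comul ((λ_ A).inv ≫ (D.one ▷ A) + (ρ_ A).inv ≫ (A ◁ D.one))

/-- `A` is generated as a Banach algebra by `i : W ⟶ A`: every morphism of Banach algebras
`A' ⟶ A` through which `i` factors is an epimorphism. -/
def IsGeneratedBy (D : HopfData A) {W : NABan k} (i : W ⟶ A) : Prop :=
  ∀ (A' : NABan k) [MonObj A'] (f : A' ⟶ A) (j : W ⟶ A'),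
    MonObj.one ≫ f = D.one → MonObj.mul ≫ f = (f ⊗ₘ f) ≫ D.mul → j ≫ f = i → Epi f

/-- `A` is an analytic Nichols algebra of the pre-braided Banach space `(V, c)`. -/
structure IsAnalyticNichols (D : HopfData A) (V : NABan k) (c : V ⊗ V ⟶ V ⊗ V) : Prop where
  hopf : D.IsGradedHopf
  flat : IsFlat A
  piece_zero : Nonempty (D.piece 0 ≅ 𝟙_ (NABan k))
  prim_eq : D.prim = D.pieceSub 1
  piece_one : ∃ e : V ≅ D.piece 1,
    c ≫ ((e.hom ≫ D.pieceIncl 1) ⊗ₘ (e.hom ≫ D.pieceIncl 1)) =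
      ((e.hom ≫ D.pieceIncl 1) ⊗ₘ (e.hom ≫ D.pieceIncl 1)) ≫ D.braid
  generated : D.IsGeneratedBy (D.pieceIncl 1)

/-- Two-sided ideals. -/
def IsIdeal (D : HopfData A) (I : Submodule k A) : Prop :=
  ∀ x ∈ I, ∀ y : A, D.mul (tmul x y) ∈ I ∧ D.mul (tmul y x) ∈ I

/-- The closure of `I ⊗ A + A ⊗ I` in `A ⊗ A`. -/
def closedSum (I : Submodule k A) : Submodule k (A ⊗ A : NABan k) :=
  (Submodule.span k {z | ∃ x ∈ I, ∃ y : A, z = tmul x y ∨ z = tmul y x}).topologicalClosure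

/-- Coideals. -/
def IsCoideal (D : HopfData A) (I : Submodule k A) : Prop :=
  (∀ x ∈ I, D.comul x ∈ closedSum I) ∧ ∀ x ∈ I, D.counit x = 0

end HopfData

end hopf

/-! ### Bilinear forms and dual pairings -/

section pairing

variable {A B V : NABan k}

/-- The pairing of `A ⊗ A` with `B ⊗ B` given by `⟨a ⊗ a', b ⊗ b'⟩ = ⟨a, b⟩ ⟨a', b'⟩`. -/
def pair₂ (p : A ⊗ B ⟶ 𝟙_ (NABan k)) : (A ⊗ A) ⊗ (B ⊗ B) ⟶ 𝟙_ (NABan k) :=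
  tensorμ A A B B ≫ (p ⊗ₘ p) ≫ (λ_ (𝟙_ (NABan k))).hom

/-- Compatibility of a form with `c`: `⟨c u, w⟩ = ⟨u, c w⟩` for `u` and `w` in `V ⊗ V`, i.e. the
map `V ⊗ V → V* ⊗ V* → (V ⊗ V)*` carries `c` to its transpose. Written for the other of the two
maps `V → V*` this is the same equation with `u` and `w` exchanged. -/
def IsCompatible (c : V ⊗ V ⟶ V ⊗ V) (φ : V ⊗ V ⟶ 𝟙_ (NABan k)) : Prop :=
  (c ▷ (V ⊗ V)) ≫ pair₂ φ = ((V ⊗ V) ◁ c) ≫ pair₂ φ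

/-- Symmetric forms. -/
def IsSymmForm (φ : V ⊗ V ⟶ 𝟙_ (NABan k)) : Prop := (β_ V V).hom ≫ φ = φ

/-- Non-degenerate forms: both induced maps `V → V*` are injective. -/
def IsNondegenerate (φ : V ⊗ V ⟶ 𝟙_ (NABan k)) : Prop :=
  (∀ x : V, (∀ y : V, φ (tmul x y) = 0) → x = 0) ∧ ∀ y : V, (∀ x : V, φ (tmul x y) = 0) → y = 0

/-- Dual pairings of Hopf algebras: `⟨aa', b⟩ = ⟨a ⊗ a', Δ b⟩`, `⟨a, bb'⟩ = ⟨Δ a, b ⊗ b'⟩`,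
`⟨a, 1⟩ = ε a`, `⟨1, b⟩ = ε b`, `⟨S a, b⟩ = ⟨a, S b⟩`. -/
structure IsDualPairing (D : HopfData A) (D' : HopfData B) (p : A ⊗ B ⟶ 𝟙_ (NABan k)) :
    Prop where
  mul_left : (D.mul ▷ B) ≫ p = ((A ⊗ A) ◁ D'.comul) ≫ pair₂ p
  mul_right : (A ◁ D'.mul) ≫ p = (D.comul ▷ (B ⊗ B)) ≫ pair₂ p
  one_right : (ρ_ A).inv ≫ (A ◁ D'.one) ≫ p = D.counit
  one_left : (λ_ B).inv ≫ (D.one ▷ B) ≫ p = D'.counit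
  antipode : ∃ (S : A ⟶ A) (S' : B ⟶ B), D.IsAntipode S ∧ D'.IsAntipode S' ∧
    (S ▷ B) ≫ p = (A ◁ S') ≫ p

/-- The (left) radical of a pairing. -/
def radical (p : A ⊗ B ⟶ 𝟙_ (NABan k)) : Submodule k A where
  carrier := {x | ∀ y : B, p (tmul x y) = 0}
  zero_mem' y := (congrArg p (LinearMap.map_zero₂ tmkLin y)).trans (map_zero _)
  add_mem' {x x'} hx hx' y := (congrArg p (add_tmk x x' y)).trans <| by
    rw [map_add]
    exact (congrArg₂ (· + ·) (hx y) (hx' y)).trans (add_zero _)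
  smul_mem' a x hx y := (congrArg p (smul_tmk a x y)).trans <| by
    rw [map_smul]
    exact (congrArg (a • ·) (hx y)).trans (smul_zero _)

end pairing

/-! ### The Banach tensor algebra -/

section tensorAlgebra

variable (V : NABan k)

/-- The completed tensor powers of `V`. -/
def tpow : ℕ → NABan k
  | 0 => 𝟙_ (NABan k)
  | n + 1 => tpow n ⊗ V

/-- The Banach tensor algebra, the contracting coproduct of the completed tensor powers. -/
def tens : NABan k := coprod (tpow V)

/-- The inclusion of `V^{⊗ n}`. -/
def tensIncl (n : ℕ) : tpow V n ⟶ tens V := incl (tpow V) n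

/-- The unit of the tensor algebra. -/
def tensOne : 𝟙_ (NABan k) ⟶ tens V := incl (tpow V) 0

/-- The inclusion of `V` in degree one. -/
def gen : V ⟶ tens V := (λ_ V).inv ≫ tensIncl V 1

/-- Concatenation of tensors. -/
def powMul (n : ℕ) : ∀ m : ℕ, tpow V n ⊗ tpow V m ⟶ tpow V (n + m)
  | 0 => (ρ_ (tpow V n)).hom
  | m + 1 => (α_ (tpow V n) (tpow V m) V).inv ≫ (powMul n m ▷ V)

lemma isContr_powMul (n : ℕ) : ∀ m : ℕ, IsContr (powMul V n m)
  | 0 => isContr_rightUnitor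
  | m + 1 => isContr_assoc_inv.comp (isContr_powMul n m).whiskerRight

/-- The multiplication of the tensor algebra. -/
def tensMul : tens V ⊗ tens V ⟶ tens V :=
  desc₂ (fun n m => powMul V n m ≫ tensIncl V (n + m))
    fun n m => (isContr_powMul V n m).comp (isContr_incl _)

/-- The projection of the tensor algebra to degree zero, on the components. -/
def counitComp : ∀ n : ℕ, tpow V n ⟶ 𝟙_ (NABan k)
  | 0 => 𝟙 _
  | _ + 1 => 0

lemma isContr_counitComp : ∀ n : ℕ, IsContr (counitComp V n)
  | 0 => isContr_id
  | _ + 1 => fun x => norm_zero.trans_le (norm_nonneg x)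

variable {V}

/-- The map `V^{⊗ n} ⊗ V ⟶ V ⊗ V^{⊗ n}` induced by `c`. -/
def powBraid₁ (c : V ⊗ V ⟶ V ⊗ V) : ∀ n : ℕ, tpow V n ⊗ V ⟶ V ⊗ tpow V n
  | 0 => (λ_ V).hom ≫ (ρ_ V).inv
  | n + 1 => (α_ (tpow V n) V V).hom ≫ (tpow V n ◁ c) ≫ (α_ (tpow V n) V V).inv ≫
      (powBraid₁ c n ▷ V) ≫ (α_ V (tpow V n) V).hom

/-- The map `V^{⊗ n} ⊗ V^{⊗ m} ⟶ V^{⊗ m} ⊗ V^{⊗ n}` induced by `c`. -/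
def powBraid (c : V ⊗ V ⟶ V ⊗ V) (n : ℕ) :
    ∀ m : ℕ, tpow V n ⊗ tpow V m ⟶ tpow V m ⊗ tpow V n
  | 0 => (ρ_ (tpow V n)).hom ≫ (λ_ (tpow V n)).inv
  | m + 1 => (α_ (tpow V n) (tpow V m) V).inv ≫ (powBraid c n m ▷ V) ≫
      (α_ (tpow V m) (tpow V n) V).hom ≫ (tpow V m ◁ powBraid₁ c n) ≫
      (α_ (tpow V m) V (tpow V n)).inv

variable {c : V ⊗ V ⟶ V ⊗ V}

lemma isContr_powBraid₁ (hc : IsContr c) : ∀ n : ℕ, IsContr (powBraid₁ c n)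
  | 0 => isContr_leftUnitor.comp isContr_rightUnitor_inv
  | n + 1 => isContr_assoc.comp (hc.whiskerLeft.comp (isContr_assoc_inv.comp
      ((isContr_powBraid₁ hc n).whiskerRight.comp isContr_assoc)))

lemma isContr_powBraid (hc : IsContr c) (n : ℕ) : ∀ m : ℕ, IsContr (powBraid c n m)
  | 0 => isContr_rightUnitor.comp isContr_leftUnitor_inv
  | m + 1 => isContr_assoc_inv.comp ((isContr_powBraid hc n m).whiskerRight.comp
      (isContr_assoc.comp ((isContr_powBraid₁ hc n).whiskerLeft.comp isContr_assoc_inv)))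

/-- The pre-braiding of the tensor algebra induced by `c`. -/
def tensBraid (hc : IsContr c) : tens V ⊗ tens V ⟶ tens V ⊗ tens V :=
  desc₂ (fun n m => powBraid c n m ≫ (tensIncl V m ⊗ₘ tensIncl V n))
    fun n m => (isContr_powBraid hc n m).comp ((isContr_incl m).tensorHom (isContr_incl n))

lemma isContr_tensBraid (hc : IsContr c) : IsContr (tensBraid hc) := isContr_desc₂ _ _

variable (V) in
/-- The map `v ↦ 1 ⊗ v + v ⊗ 1`. -/
def genComul : V ⟶ tens V ⊗ tens V :=
  (λ_ V).inv ≫ (tensOne V ⊗ₘ gen V) + (ρ_ V).inv ≫ (gen V ⊗ₘ tensOne V)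

lemma isContr_gen : IsContr (gen V) := isContr_leftUnitor_inv.comp (isContr_incl 1)

lemma isContr_genComul : IsContr (genComul V) :=
  (isContr_leftUnitor_inv.comp ((isContr_incl 0).tensorHom isContr_gen)).add
    (isContr_rightUnitor_inv.comp (isContr_gen.tensorHom (isContr_incl 0)))

/-- The multiplication `(μ ⊗ μ)(Id ⊗ c ⊗ Id)` on the tensor square of the tensor algebra. -/
def tensMul₂ (hc : IsContr c) :
    (tens V ⊗ tens V) ⊗ (tens V ⊗ tens V) ⟶ tens V ⊗ tens V :=
  midBraid (tensBraid hc) ≫ (tensMul V ⊗ₘ tensMul V)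

/-- The comultiplication of the tensor algebra on `V^{⊗ n}`, determined by `genComul` and
multiplicativity. -/
def powComul (hc : IsContr c) : ∀ n : ℕ, tpow V n ⟶ tens V ⊗ tens V
  | 0 => (λ_ (𝟙_ (NABan k))).inv ≫ (tensOne V ⊗ₘ tensOne V)
  | n + 1 => (powComul hc n ⊗ₘ genComul V) ≫ tensMul₂ hc

lemma isContr_midBraid {A : NABan k} {b : A ⊗ A ⟶ A ⊗ A} (hb : IsContr b) :
    IsContr (midBraid b) :=
  isContr_assoc.comp (isContr_assoc_inv.whiskerLeft.comp (hb.whiskerRight.whiskerLeft.comp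
    (isContr_assoc.whiskerLeft.comp isContr_assoc_inv)))

lemma isContr_tensMul : IsContr (tensMul V) := isContr_desc₂ _ _

lemma isContr_powComul (hc : IsContr c) : ∀ n : ℕ, IsContr (powComul hc n)
  | 0 => isContr_leftUnitor_inv.comp ((isContr_incl 0).tensorHom (isContr_incl 0))
  | n + 1 => ((isContr_powComul hc n).tensorHom isContr_genComul).comp
      ((isContr_midBraid (isContr_tensBraid hc)).comp (isContr_tensMul.tensorHom isContr_tensMul))

/-- The structure maps of the Banach tensor algebra of `(V, c)`; the coaction of `k{t}` is
`x ↦ tⁿ ⊗ x` on `V^{⊗ n}`. -/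
def tensHopf (hc : IsContr c) : HopfData (tens V) where
  one := tensOne V
  mul := tensMul V
  counit := desc (counitComp V) (isContr_counitComp V)
  comul := desc (powComul hc) (isContr_powComul hc)
  braid := tensBraid hc
  coact := desc (fun n => (λ_ (tpow V n)).inv ≫ (tpower k n ⊗ₘ tensIncl V n))
    fun n => isContr_leftUnitor_inv.comp ((isContr_tpower n).tensorHom (isContr_incl n))

/-- The map `c` on the tensor square of the rescaled space. -/
def rescaleBraid (r : ℝ) (hr : 0 < r) (c : V ⊗ V ⟶ V ⊗ V) :
    rescale r hr V ⊗ rescale r hr V ⟶ rescale r hr V ⊗ rescale r hr V :=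
  (ofRescale r V hr ⊗ₘ ofRescale r V hr) ≫ c ≫ (toRescale r V hr ⊗ₘ toRescale r V hr)

lemma bound_tensorHom {X Y Z W : NABan k} {f : X ⟶ Y} {g : Z ⟶ W} {K : ℝ} (hK : 0 ≤ K)
    (hf : ∀ x, ‖f x‖ ≤ K * ‖x‖) (hg : ∀ x, ‖g x‖ ≤ K * ‖x‖) (z : (X ⊗ Z : NABan k)) :
    ‖(f ⊗ₘ g) z‖ ≤ (K * K) * ‖z‖ :=
  bound_of_tmk (f := f ⊗ₘ g) (K * K) (mul_nonneg hK hK) (fun x y =>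
    calc ‖(f ⊗ₘ g) (tmul x y)‖ = ‖tmul (f x) (g y)‖ := by rw [tensorHom_tmul]
      _ ≤ ‖f x‖ * ‖g y‖ := norm_tmul_le _ _
      _ ≤ (K * ‖x‖) * (K * ‖y‖) :=
        mul_le_mul (hf x) (hg y) (norm_nonneg _) (mul_nonneg hK (norm_nonneg x))
      _ = K * K * (‖x‖ * ‖y‖) := mul_mul_mul_comm _ _ _ _) z

lemma isContr_rescaleBraid (r : ℝ) (hr : 0 < r) (hc : IsContr c) :
    IsContr (rescaleBraid r hr c) := by
  have hto : ∀ x, ‖toRescale r V hr x‖ ≤ r * ‖x‖ := fun x => (norm_toRescale r V hr x).le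
  have hof : ∀ x, ‖ofRescale r V hr x‖ ≤ r⁻¹ * ‖x‖ := fun x => (norm_ofRescale r V hr x).le
  refine isContr_conj (K := r⁻¹ * r⁻¹) (L := r * r) (mul_nonneg hr.le hr.le) ?_
    (bound_tensorHom (inv_nonneg.mpr hr.le) hof hof) hc (bound_tensorHom hr.le hto hto)
  rw [mul_mul_mul_comm, mul_inv_cancel₀ hr.ne', one_mul]

variable (V)

/-- The Banach tensor algebra of radius `r`. -/
def tensR (r : ℝ) (hr : 0 < r) : NABan k := tens (rescale r hr V)

/-- The inclusion of `V` in degree one of the tensor algebra of radius `r`. -/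
def genR (r : ℝ) (hr : 0 < r) : V ⟶ tensR V r hr := toRescale r V hr ≫ gen (rescale r hr V)

variable {V} in
/-- The structure maps of the Banach tensor algebra of `(V, c)` of radius `r`. -/
def tensRHopf (hc : IsContr c) (r : ℝ) (hr : 0 < r) : HopfData (tensR V r hr) :=
  tensHopf (isContr_rescaleBraid r hr hc)

variable {V} in
/-- `p` is a dual pairing of the tensor algebras of radii `r` and `s` extending the form `φ`. -/
def IsExtension (hc : IsContr c) (φ : V ⊗ V ⟶ 𝟙_ (NABan k)) (r : ℝ) (hr : 0 < r) (s : ℝ)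
    (hs : 0 < s) (p : tensR V r hr ⊗ tensR V s hs ⟶ 𝟙_ (NABan k)) : Prop :=
  IsDualPairing (tensRHopf hc r hr) (tensRHopf hc s hs) p ∧ (genR V r hr ⊗ₘ genR V s hs) ≫ p = φ

end tensorAlgebra

end NABan

end

open NABan

/-! Write `T` for the tensor algebra of a space with a contracting pre-braiding `c`. The maps `c_i`,
which apply `c` to the strands `i` and `i + 1`, satisfy the braid relations on `T`, and every
structure map is a braid word combined with concatenation or deconcatenation: the pre-braiding is
the block braiding `bb`, the antipode is the signed half twist `anti`, and in degree `N` the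
comultiplication is the sum over `n + m = N` of `split n m` after the shuffle operator `shuf n m`
(`comul_eq`). The Hopf algebra axioms thereby become identities of braid words, proved in an
abstract ring with a braid sequence.

The centre of the proof is the braided symmetrizer `symz`, in each degree the sum of the positive
lifts of all permutations, with the factorisation `sym (n + m) = (sym n ⊗ sym m) shuf n m`
(`sym_add`). It has two consequences. First, if `form` pairs tensors factor by factor, then `⟨x,
symz y⟩` is a dual pairing: compatibility of the form makes every crossing adjoint to itself, and
`sym` is its own transpose because it can be expanded from either side (`sym_succ'`). A dual pairing
is determined by its values on generators, since these are primitive. As `form` is non-degenerate,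
the radical is the kernel of `symz`, which does not involve `s`; the condition `C ≤ r s` makes the
rescaled form a contraction, so that it extends to the completed algebras. Second, `(symz ⊗ symz) Δ
= deconc symz` (`comul_symz`), and `symz` commutes with pre-braiding, antipode and coaction.

Let `I` be the kernel of `symz`. Then `symz` factors through an injection `F` of `T / I` into `T`.
Once `F ⊗ F` is known to be injective, equations in the tensor square of `T / I` can be checked
after applying it: the structure maps descend, `I` is a coideal, and a primitive element of `T / I`
goes to a primitive element for deconcatenation. Those have degree one (`mem_Homog_of_deconc`),
where `symz` is the identity, so the primitives are the image of `V`. The graded pieces are found by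
the same comparison.

What remains is analysis: completed tensor products preserve injections and kernels over every
complete non-Archimedean field. Norm-preserving extension of functionals may fail when `k` is not
spherically complete, but a functional extends to finitely many further vectors with arbitrarily
small loss (`exists_functional`). This gives each `z` in `A ⊗ X` an expansion into terms `e i ⊗ x i`
with `‖e i‖ * ‖x i‖ ≤ 2 * ‖z‖` (`exists_ortho_expansion`, `norm_le_of_isOrtho_of_hasSum`), along
which kernels are tested coefficient by coefficient. Hence every Banach space is flat (`isFlat`), `F
⊗ F` is injective (`tensorHom_injective`), and tensor powers of a non-degenerate form are
non-degenerate (`powForm_nondegenerate`). -/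

open Finset.HasAntidiagonal (antidiagonal)

noncomputable section

/-! ### Words in generators satisfying the braid relations -/

namespace BraidWord

variable {E : Type*} [Ring E]

/-- A sequence of ring elements satisfying the relations of the infinite braid monoid. -/
structure IsBraidSeq (c : ℕ → E) : Prop where
  comm : ∀ i j, i + 2 ≤ j → c i * c j = c j * c i
  braid : ∀ i, c i * c (i + 1) * c i = c (i + 1) * c i * c (i + 1)

/-- The operators on the strands `a, …, b - 1`. -/
def Loc (c : ℕ → E) (a b : ℕ) : Subring E := Subring.closure {x | ∃ i, a ≤ i ∧ i + 1 < b ∧ x = c i}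

/-- Operators on `n` strands, as functions of the position of the first strand. -/
def Fam (c : ℕ → E) (n : ℕ) : Subring (ℕ → E) :=
  Subring.closure {u | ∃ i, i + 1 < n ∧ u = fun o => c (o + i)}

variable {c : ℕ → E}

lemma gen_mem_Fam {i n : ℕ} (h : i + 1 < n) : (fun o => c (o + i)) ∈ Fam c n :=
  Subring.subset_closure ⟨i, h, rfl⟩

lemma Fam_mono {n m : ℕ} (h : n ≤ m) : Fam c n ≤ Fam c m :=
  Subring.closure_mono fun _ ⟨i, hi, hu⟩ => ⟨i, by omega, hu⟩

lemma Fam_shift {n : ℕ} {u : ℕ → E} (hu : u ∈ Fam c n) (a : ℕ) :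
    (fun o => u (o + a)) ∈ Fam c (a + n) := by
  induction hu using Subring.closure_induction with
  | mem u hu =>
    obtain ⟨i, hi, rfl⟩ := hu
    simpa only [add_assoc] using gen_mem_Fam (c := c) (show a + i + 1 < a + n by omega)
  | zero => exact zero_mem _
  | one => exact one_mem _
  | add u v _ _ hu hv => exact add_mem hu hv
  | neg u _ hu => exact neg_mem hu
  | mul u v _ _ hu hv => exact mul_mem hu hv

lemma Fam_loc {n : ℕ} {u : ℕ → E} (hu : u ∈ Fam c n) (o : ℕ) : u o ∈ Loc c o (o + n) := by
  induction hu using Subring.closure_induction with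
  | mem u hu =>
    obtain ⟨i, hi, rfl⟩ := hu
    exact Subring.subset_closure ⟨o + i, by omega, by omega, rfl⟩
  | zero => exact zero_mem _
  | one => exact one_mem _
  | add u v _ _ hu hv => exact add_mem hu hv
  | neg u _ hu => exact neg_mem hu
  | mul u v _ _ hu hv => exact mul_mem hu hv

/-- An induction principle for operators on `n` strands. -/
lemma Fam_induction {n : ℕ} {P : (ℕ → E) → Prop} {u : ℕ → E}
    (hu : u ∈ Fam c n) (gen : ∀ i, i + 1 < n → P fun o => c (o + i))
    (one : P 1) (add : ∀ u v, P u → P v → P (u + v)) (neg : ∀ u, P u → P (-u))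
    (mul : ∀ u v, P u → P v → P (u * v)) : P u := by
  induction hu using Subring.closure_induction with
  | mem u hu =>
    obtain ⟨i, hi, rfl⟩ := hu
    exact gen i hi
  | zero => simpa using add _ _ one (neg _ one)
  | one => exact one
  | add u v _ _ hu hv => exact add u v hu hv
  | neg u _ hu => exact neg u hu
  | mul u v _ _ hu hv => exact mul u v hu hv

/-- Crossings inside disjoint blocks of strands have indices at least two apart: the left block uses
indices up to `b - 2`, the right one starts at `a' ≥ b`. -/
lemma IsBraidSeq.commute (hc : IsBraidSeq c) {a b a' b' : ℕ} (h : b ≤ a') {x y : E}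
    (hx : x ∈ Loc c a b) (hy : y ∈ Loc c a' b') : x * y = y * x := by
  have key : ∀ i, i + 1 < b → ∀ y ∈ Loc c a' b', Commute (c i) y := by
    intro i hi y hy
    induction hy using Subring.closure_induction with
    | mem y hy =>
      obtain ⟨j, hj, _, rfl⟩ := hy
      exact hc.comm i j (by omega)
    | zero => exact Commute.zero_right _
    | one => exact Commute.one_right _
    | add u v _ _ hu hv => exact hu.add_right hv
    | neg u _ hu => exact hu.neg_right
    | mul u v _ _ hu hv => exact hu.mul_right hv
  change Commute x y
  induction hx using Subring.closure_induction with
  | mem x hx =>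
    obtain ⟨i, _, hi, rfl⟩ := hx
    exact key i hi y hy
  | zero => exact Commute.zero_left _
  | one => exact Commute.one_left _
  | add u v _ _ hu hv => exact hu.add_left hv
  | neg u _ hu => exact hu.neg_left
  | mul u v _ _ hu hv => exact hu.mul_left hv

lemma IsBraidSeq.commute_Fam (hc : IsBraidSeq c) {n m o o' : ℕ} (h : o + n ≤ o') {u v : ℕ → E}
    (hu : u ∈ Fam c n) (hv : v ∈ Fam c m) : u o * v o' = v o' * u o :=
  hc.commute h (Fam_loc hu o) (Fam_loc hv o')

variable (c)

/-- One strand passes to the left of `n` strands. -/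
def up : ℕ → ℕ → E
  | 0, _ => 1
  | n + 1, o => up n o * c (o + n)

/-- One strand passes to the right of `m` strands. -/
def dn : ℕ → ℕ → E
  | 0, _ => 1
  | m + 1, o => c (o + m) * dn m o

/-- The block braiding of `n` strands with `m` strands. -/
def bb (n : ℕ) : ℕ → ℕ → E
  | 0, _ => 1
  | m + 1, o => up c n (o + m) * bb n m o

/-- The sum of the operators of the inverse `(n, m)`-shuffles. -/
def shuf : ℕ → ℕ → ℕ → E
  | 0 => fun _ _ => 1
  | n + 1 => fun m => Nat.rec (fun _ => 1)
      (fun m s o => s o + up c (m + 1) (o + n) * shuf n (m + 1) o) m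

/-- The braided symmetrizer on `n` strands. -/
def sym : ℕ → ℕ → E
  | 0, _ => 1
  | n + 1, o => sym n o * shuf c n 1 o

/-- The operator of the antipode on `n` strands. -/
def anti : ℕ → ℕ → E
  | 0, _ => 1
  | n + 1, o => -(anti n (o + 1) * up c n o)

/-- The transpose of `shuf c n 1`. -/
def coshuf : ℕ → ℕ → E
  | 0, _ => 1
  | n + 1, o => 1 + coshuf n o * c (o + n)

variable {c}

@[simp] lemma up_zero (o : ℕ) : up c 0 o = 1 := rfl
@[simp] lemma dn_zero (o : ℕ) : dn c 0 o = 1 := rfl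
@[simp] lemma bb_zero (n o : ℕ) : bb c n 0 o = 1 := rfl
@[simp] lemma up_one (o : ℕ) : up c 1 o = c o := one_mul _
@[simp] lemma dn_one (o : ℕ) : dn c 1 o = c o := mul_one _
@[simp] lemma bb_one_right (n o : ℕ) : bb c n 1 o = up c n o := mul_one _
@[simp] lemma zero_bb (m o : ℕ) : bb c 0 m o = 1 := by
  induction m with
  | zero => rfl
  | succ m ih => rw [bb, ih, up_zero, mul_one]
@[simp] lemma bb_one_left (m o : ℕ) : bb c 1 m o = dn c m o := by
  induction m with
  | zero => rfl
  | succ m ih => rw [bb, ih, up_one, dn]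

lemma up_add (n m o : ℕ) : up c (n + m) o = up c n o * up c m (o + n) := by
  induction m with
  | zero => simp
  | succ m ih => rw [← add_assoc, up, ih, up, mul_assoc, add_assoc]

lemma up_succ' (n o : ℕ) : up c (n + 1) o = c o * up c n (o + 1) := by
  rw [add_comm, up_add, up_one]

lemma dn_add (n m o : ℕ) : dn c (n + m) o = dn c m (o + n) * dn c n o := by
  induction m with
  | zero => simp
  | succ m ih => rw [← add_assoc, dn, ih, dn, mul_assoc, add_assoc]

lemma up_mem (n : ℕ) : up c n ∈ Fam c (n + 1) := by
  induction n with
  | zero => exact one_mem _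
  | succ n ih =>
    exact mul_mem (Fam_mono (by omega) ih) (gen_mem_Fam (c := c) (show n + 1 < n + 1 + 1 by omega))

lemma dn_mem (n : ℕ) : dn c n ∈ Fam c (n + 1) := by
  induction n with
  | zero => exact one_mem _
  | succ n ih =>
    exact mul_mem (gen_mem_Fam (c := c) (show n + 1 < n + 1 + 1 by omega)) (Fam_mono (by omega) ih)

lemma bb_mem (n m : ℕ) : bb c n m ∈ Fam c (n + m) := by
  induction m with
  | zero => exact one_mem _
  | succ m ih =>
    exact mul_mem (Fam_mono (by omega) (Fam_shift (up_mem n) m)) (Fam_mono (by omega) ih)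

lemma shuf_mem (n m : ℕ) : shuf c n m ∈ Fam c (n + m) := by
  induction n generalizing m with
  | zero => exact one_mem _
  | succ n ihn =>
    induction m with
    | zero => exact one_mem _
    | succ m ihm =>
      exact add_mem (Fam_mono (by omega) ihm) (mul_mem
        (Fam_mono (by omega) (Fam_shift (up_mem (m + 1)) n)) (Fam_mono (by omega) (ihn (m + 1))))

lemma sym_mem (n : ℕ) : sym c n ∈ Fam c n := by
  induction n with
  | zero => exact one_mem _
  | succ n ih => exact mul_mem (Fam_mono (by omega) ih) (shuf_mem n 1)

lemma anti_mem (n : ℕ) : anti c n ∈ Fam c n := by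
  induction n with
  | zero => exact one_mem _
  | succ n ih =>
    exact neg_mem (mul_mem (Fam_mono (by omega) (Fam_shift ih 1)) (up_mem n))

@[simp] lemma shuf_zero_left (m o : ℕ) : shuf c 0 m o = 1 := rfl
@[simp] lemma shuf_zero_right (n o : ℕ) : shuf c n 0 o = 1 := by cases n <;> rfl
lemma shuf_succ_succ (n m o : ℕ) : shuf c (n + 1) (m + 1) o =
    shuf c (n + 1) m o + up c (m + 1) (o + n) * shuf c n (m + 1) o := rfl
lemma shuf_succ_one (n o : ℕ) : shuf c (n + 1) 1 o = 1 + c (o + n) * shuf c n 1 o := by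
  rw [shuf_succ_succ, shuf_zero_right, up_one]

/-- Reindexing of sums of shuffles, by the last strand. -/
lemma sum_shuf {M : Type*} [AddCommGroup M] (G : ℕ → ℕ → E →+ M) (N o : ℕ) :
    ∑ p ∈ antidiagonal (N + 1), G p.1 p.2 (shuf c p.1 p.2 o) =
      ∑ p ∈ antidiagonal N, (G p.1 (p.2 + 1) (shuf c p.1 p.2 o) +
        G (p.1 + 1) p.2 (up c p.2 (o + p.1) * shuf c p.1 p.2 o)) := by
  -- The recursion of `shuf` has both summands only when both indices are positive. At either end of
  -- the antidiagonal one summand is absent, which the `if`s record; after separating the two sums,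
  -- each becomes a sum over `antidiagonal N`.
  have h : ∀ i j, i + j = N + 1 → G i j (shuf c i j o) =
      (if j = 0 then 0 else G i j (shuf c i (j - 1) o)) +
      (if i = 0 then 0 else G i j (up c j (o + (i - 1)) * shuf c (i - 1) j o)) := by
    intro i j hij
    rcases i with _ | i <;> rcases j with _ | j
    · omega
    · simp
    · simp
    · simp [shuf_succ_succ]
  rw [Finset.sum_congr rfl fun p hp => h p.1 p.2 (Finset.HasAntidiagonal.mem_antidiagonal.mp hp),
    Finset.sum_add_distrib, Finset.sum_add_distrib, Finset.Nat.sum_antidiagonal_succ' (n := N),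
    Finset.Nat.sum_antidiagonal_succ (n := N)]
  simp

/-- Adding one strand to the right block, it passes the `n'` strands and then the `n` strands. The
words only have to be reordered, and the two that change places act on disjoint strands. -/
lemma bb_add_left (hc : IsBraidSeq c) (n n' m o : ℕ) :
    bb c (n + n') m o = bb c n m o * bb c n' m (o + n) := by
  induction m with
  | zero => simp
  | succ m ih =>
    have h := hc.commute_Fam (o := o) (o' := o + m + n) (by omega) (bb_mem (c := c) n m)
      (up_mem n')
    simp only [bb]
    rw [ih, up_add, mul_assoc, ← mul_assoc (up c n' _) (bb c n m o), ← h,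
      show o + n + m = o + m + n by omega]
    simp only [mul_assoc]

lemma bb_add_right (n m m' o : ℕ) :
    bb c n (m + m') o = bb c n m' (o + m) * bb c n m o := by
  induction m' with
  | zero => simp
  | succ m' ih => rw [← add_assoc, bb, ih, bb, mul_assoc, add_assoc]

/-- A strand slides past a crossing. The word `up` is cut around the two generators next to the
crossing; everything else commutes with it, and one braid relation carries it across, raising its
index by one. -/
lemma up_gen (hc : IsBraidSeq c) {n i : ℕ} (o : ℕ) (h : i + 1 < n) :
    up c n o * c (o + i) = c (o + 1 + i) * up c n o := by
  obtain ⟨l, rfl⟩ : ∃ l, n = i + (2 + l) := ⟨n - i - 2, by omega⟩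
  have e1 : up c (i + (2 + l)) o =
      up c i o * (c (o + i) * c (o + i + 1)) * up c l (o + i + 2) := by
    rw [up_add, up_add, up, up_one]; simp only [mul_assoc, add_assoc]
  have e2 : c (o + i) * up c l (o + i + 2) = up c l (o + i + 2) * c (o + i) :=
    hc.commute_Fam (o := o + i) (o' := o + i + 2) (n := 2) le_rfl
      (gen_mem_Fam (c := c) (i := 0) (by omega)) (up_mem l)
  have e3 : up c i o * c (o + i + 1) = c (o + i + 1) * up c i o :=
    hc.commute_Fam (o := o) (o' := o + i + 1) (m := 2) (by omega) (up_mem i)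
      (gen_mem_Fam (c := c) (i := 0) (by omega))
  have e4 := hc.braid (o + i)
  rw [e1, show o + 1 + i = o + i + 1 by omega, mul_assoc _ _ (c (o + i)), ← e2]
  simp only [← mul_assoc]
  rw [← e3]
  simp only [mul_assoc] at e4 ⊢
  rw [← mul_assoc (c (o + i + 1)) (c (o + i)), ← mul_assoc (c (o + i)), e4]
  simp only [mul_assoc]

lemma dn_gen (hc : IsBraidSeq c) {n i : ℕ} (o : ℕ) (h : i + 1 < n) :
    dn c n o * c (o + 1 + i) = c (o + i) * dn c n o := by
  obtain ⟨l, rfl⟩ : ∃ l, n = i + (2 + l) := ⟨n - i - 2, by omega⟩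
  have e1 : dn c (i + (2 + l)) o =
      dn c l (o + i + 2) * (c (o + i + 1) * c (o + i)) * dn c i o := by
    rw [dn_add, dn_add, dn, dn_one]
  have e2 : c (o + i) * dn c l (o + i + 2) = dn c l (o + i + 2) * c (o + i) :=
    hc.commute_Fam (o := o + i) (o' := o + i + 2) (n := 2) le_rfl
      (gen_mem_Fam (c := c) (i := 0) (by omega)) (dn_mem l)
  have e3 : dn c i o * c (o + i + 1) = c (o + i + 1) * dn c i o :=
    hc.commute_Fam (o := o) (o' := o + i + 1) (m := 2) (by omega) (dn_mem i)
      (gen_mem_Fam (c := c) (i := 0) (by omega))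
  have e4 := hc.braid (o + i)
  rw [e1, show o + 1 + i = o + i + 1 by omega, mul_assoc _ _ (c (o + i + 1)), e3]
  simp only [← mul_assoc]
  rw [e2]
  simp only [mul_assoc] at e4 ⊢
  rw [← mul_assoc (c (o + i)) (c (o + i + 1)), ← mul_assoc (c (o + i + 1)), ← e4]
  simp only [mul_assoc]

lemma up_nat (hc : IsBraidSeq c) {n : ℕ} {u : ℕ → E} (hu : u ∈ Fam c n) (o : ℕ) :
    up c n o * u o = u (o + 1) * up c n o := by
  refine Fam_induction (P := fun u => up c n o * u o = u (o + 1) * up c n o) hu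
    (fun i hi => up_gen hc o hi) (by simp)
    (fun u v hu hv => by simp only [Pi.add_apply, mul_add, add_mul, hu, hv])
    (fun u hu => by simp [hu]) fun u v hu hv => ?_
  simp only [Pi.mul_apply]
  rw [← mul_assoc, hu, mul_assoc, hv, mul_assoc]

lemma dn_nat (hc : IsBraidSeq c) {n : ℕ} {u : ℕ → E} (hu : u ∈ Fam c n) (o : ℕ) :
    dn c n o * u (o + 1) = u o * dn c n o := by
  refine Fam_induction (P := fun u => dn c n o * u (o + 1) = u o * dn c n o) hu
    (fun i hi => dn_gen hc o hi) (by simp)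
    (fun u v hu hv => by simp only [Pi.add_apply, mul_add, add_mul, hu, hv])
    (fun u hu => by simp [hu]) fun u v hu hv => ?_
  simp only [Pi.mul_apply]
  rw [← mul_assoc, hu, mul_assoc, hv, mul_assoc]

/-- The block braiding is natural in the left block. -/
lemma bb_nat_left (hc : IsBraidSeq c) {n : ℕ} {u : ℕ → E} (hu : u ∈ Fam c n) (m o : ℕ) :
    bb c n m o * u o = u (o + m) * bb c n m o := by
  induction m with
  | zero => simp
  | succ m ih =>
    rw [bb, mul_assoc, ih, ← mul_assoc, up_nat hc hu, mul_assoc, add_assoc]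

/-- The block braiding is natural in the right block. -/
lemma bb_nat_right (hc : IsBraidSeq c) {m : ℕ} {u : ℕ → E} (hu : u ∈ Fam c m) (n o : ℕ) :
    bb c n m o * u (o + n) = u o * bb c n m o := by
  induction n with
  | zero => simp
  | succ n ih =>
    rw [bb_add_left hc, bb_one_left, mul_assoc, ← add_assoc, dn_nat hc hu, ← mul_assoc, ih,
      mul_assoc]

/-- This is coassociativity of the comultiplication in terms of operators: both sides distribute `i
+ j + l` strands over three blocks, and the induction follows the last strand. -/
lemma shuf_coassoc (hc : IsBraidSeq c) (i j l o : ℕ) : shuf c i j o * shuf c (i + j) l o =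
    shuf c j l (o + i) * shuf c i (j + l) o := by
  induction i generalizing j l with
  | zero => simp
  | succ i ihi =>
    induction j generalizing l with
    | zero => simp
    | succ j ihj =>
      induction l with
      | zero => simp
      | succ l ihl =>
        have h1 := ihi (j + 1) (l + 1)
        have h2 := ihj (l + 1)
        have k1 := hc.commute_Fam (o := o) (o' := o + (i + 1 + j)) (by omega)
          (shuf_mem (c := c) (i + 1) j) (up_mem (l + 1))
        have k2 := hc.commute_Fam (o := o) (o' := o + (i + 1 + j)) (by omega)
          (shuf_mem (c := c) i (j + 1)) (up_mem (l + 1))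
        have k3 := up_nat hc (o := o + i)
          (Fam_mono (m := j + 1 + (l + 1)) (by omega) (shuf_mem (c := c) (j + 1) (l + 1)))
        have u1 : up c (j + 1 + (l + 1)) (o + i) =
            up c (j + 1) (o + i) * up c (l + 1) (o + (i + 1 + j)) := by
          rw [up_add]; congr 2; omega
        have r1 : shuf c (i + 1) (j + 1 + (l + 1)) o =
            shuf c (i + 1) (j + 1 + l) o + up c (j + 1 + (l + 1)) (o + i) *
              shuf c i (j + 1 + (l + 1)) o := rfl
        have r2 : shuf c (i + 1 + (j + 1)) (l + 1) o = shuf c (i + 1 + (j + 1)) l o +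
            up c (l + 1) (o + (i + 1 + j)) * shuf c (i + 1 + j) (l + 1) o := rfl
        have r3 : shuf c (j + 1) (l + 1) (o + (i + 1)) = shuf c (j + 1) l (o + (i + 1)) +
            up c (l + 1) (o + (i + 1 + j)) * shuf c j (l + 1) (o + (i + 1)) := by
          rw [shuf_succ_succ]; congr 3; omega
        have r4 : shuf c (i + 1) (j + 1) o = shuf c (i + 1) j o +
            up c (j + 1) (o + i) * shuf c i (j + 1) o := rfl
        -- The three summands are sorted by the block that receives the last strand: the third, the
        -- second, the first. They are treated by `ihl`, `h2` and `h1` respectively.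
        calc shuf c (i + 1) (j + 1) o * shuf c (i + 1 + (j + 1)) (l + 1) o
            = shuf c (i + 1) (j + 1) o * shuf c (i + 1 + (j + 1)) l o +
              (shuf c (i + 1) j o * up c (l + 1) (o + (i + 1 + j))) *
                shuf c (i + 1 + j) (l + 1) o +
              up c (j + 1) (o + i) * (shuf c i (j + 1) o * up c (l + 1) (o + (i + 1 + j))) *
                shuf c (i + 1 + j) (l + 1) o := by
              have r6 : shuf c (i + 1) (j + 1) o * up c (l + 1) (o + (i + 1 + j)) =
                  shuf c (i + 1) j o * up c (l + 1) (o + (i + 1 + j)) +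
                  up c (j + 1) (o + i) * (shuf c i (j + 1) o * up c (l + 1) (o + (i + 1 + j))) := by
                rw [r4, add_mul, mul_assoc]
              rw [r2, mul_add, ← mul_assoc _ (up c _ _), r6, add_mul, ← add_assoc]
          _ = shuf c (j + 1) l (o + (i + 1)) * shuf c (i + 1) (j + 1 + l) o +
              up c (l + 1) (o + (i + 1 + j)) * (shuf c j (l + 1) (o + (i + 1)) *
                shuf c (i + 1) (j + (l + 1)) o) +
              up c (j + 1 + (l + 1)) (o + i) * (shuf c (j + 1) (l + 1) (o + i) *
                shuf c i (j + 1 + (l + 1)) o) := by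
              rw [k1, k2, ihl, ← h2, ← h1, u1, show i + (j + 1) = i + 1 + j by omega]
              simp only [mul_assoc]
          -- The strand that joins the first block slides past the shuffle of the other two blocks
          -- (`k3`), which raises the offset of that shuffle by one. The recursions `r3` and `r1`
          -- then reassemble the right-hand side.
          _ = _ := by
              rw [show j + (l + 1) = j + 1 + l by omega, ← mul_assoc (up c (j + 1 + (l + 1)) _),
                k3, r1, mul_add, add_assoc o i 1]
              have r5 : shuf c (j + 1) (l + 1) (o + (i + 1)) * shuf c (i + 1) (j + 1 + l) o =
                  shuf c (j + 1) l (o + (i + 1)) * shuf c (i + 1) (j + 1 + l) o +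
                  up c (l + 1) (o + (i + 1 + j)) * (shuf c j (l + 1) (o + (i + 1)) *
                    shuf c (i + 1) (j + 1 + l) o) := by
                rw [r3, add_mul, mul_assoc]
              rw [r5, mul_assoc (shuf c (j + 1) (l + 1) (o + (i + 1)))]

/-- The recursion for shuffles by the first strand. -/
lemma shuf_first (hc : IsBraidSeq c) (n m o : ℕ) : shuf c (n + 1) (m + 1) o =
    shuf c n (m + 1) (o + 1) + dn c (n + 1) o * shuf c (n + 1) m (o + 1) := by
  induction n generalizing m with
  | zero =>
    induction m with
    | zero => simp [shuf]
    | succ m ih =>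
      rw [shuf_succ_succ, ih, shuf_zero_left, shuf_zero_left, shuf_zero_left, dn_one,
        shuf_succ_succ, shuf_zero_left, up_succ']
      simp [mul_add, add_assoc]
  | succ n ihn =>
    induction m with
    | zero =>
      simp only [zero_add] at ihn ⊢
      rw [shuf_succ_one, ihn, shuf_succ_one, shuf_zero_right, shuf_zero_right]
      simp only [dn, mul_one, mul_add, add_assoc, add_comm 1 n]
    | succ m ihm =>
      have k := hc.commute_Fam (o := o) (o' := o + (n + 1) + 1) (by omega) (dn_mem (c := c) (n + 1))
        (up_mem (m + 1))
      -- When the last strand goes to the left block and the first strand to the right block, they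
      -- cross each other once, in `c (o + (n + 1))`. This crossing is transferred from the path of
      -- the last strand to the path of the first.
      have e1 : up c (m + 1 + 1) (o + (n + 1)) * dn c (n + 1) o =
          dn c (n + 1 + 1) o * up c (m + 1) (o + (n + 1) + 1) := by
        rw [up_succ', mul_assoc, ← k, ← mul_assoc]; rfl
      have e2 : shuf c (n + 1 + 1) (m + 1) (o + 1) = shuf c (n + 1 + 1) m (o + 1) +
          up c (m + 1) (o + (n + 1) + 1) * shuf c (n + 1) (m + 1) (o + 1) := by
        rw [shuf_succ_succ]; congr 3; omega
      have e3 : shuf c (n + 1) (m + 1 + 1) (o + 1) = shuf c (n + 1) (m + 1) (o + 1) +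
          up c (m + 1 + 1) (o + (n + 1)) * shuf c n (m + 1 + 1) (o + 1) := by
        rw [shuf_succ_succ]; congr 3; omega
      rw [shuf_succ_succ, ihm, ihn, mul_add, ← mul_assoc, e1, e2, e3, mul_add, mul_assoc]
      abel

/-- Reindexing of sums of shuffles, by the first strand. -/
lemma sum_shuf_first (hc : IsBraidSeq c) {M : Type*} [AddCommGroup M]
    (G : ℕ → ℕ → E →+ M) (N o : ℕ) :
    ∑ p ∈ antidiagonal (N + 1), G p.1 p.2 (shuf c p.1 p.2 o) =
      ∑ p ∈ antidiagonal N, (G (p.1 + 1) p.2 (shuf c p.1 p.2 (o + 1)) +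
        G p.1 (p.2 + 1) (dn c p.1 o * shuf c p.1 p.2 (o + 1))) := by
  have h : ∀ i j, i + j = N + 1 → G i j (shuf c i j o) =
      (if i = 0 then 0 else G i j (shuf c (i - 1) j (o + 1))) +
      (if j = 0 then 0 else G i j (dn c i o * shuf c i (j - 1) (o + 1))) := by
    intro i j hij
    rcases i with _ | i <;> rcases j with _ | j
    · omega
    · simp
    · simp
    · simp [shuf_first hc]
  rw [Finset.sum_congr rfl fun p hp => h p.1 p.2 (Finset.HasAntidiagonal.mem_antidiagonal.mp hp),
    Finset.sum_add_distrib, Finset.sum_add_distrib, Finset.Nat.sum_antidiagonal_succ (n := N),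
    Finset.Nat.sum_antidiagonal_succ' (n := N)]
  simp

/-- A permutation factors uniquely into a shuffle and permutations of the two blocks. Strand by
strand, this is `shuf_coassoc` with a last block of one strand. -/
lemma sym_add (hc : IsBraidSeq c) (n m o : ℕ) :
    sym c (n + m) o = sym c n o * sym c m (o + n) * shuf c n m o := by
  induction m with
  | zero => simp [sym]
  | succ m ih =>
    rw [← add_assoc, sym, ih, mul_assoc, shuf_coassoc hc, sym]
    simp only [mul_assoc]

/-- The mirror image of the defining recursion. Transposition reverses words and so exchanges the
two recursions; having both is what makes `sym` its own transpose. -/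
lemma sym_succ' (hc : IsBraidSeq c) (n o : ℕ) : sym c (n + 1) o = coshuf c n o * sym c n o := by
  induction n with
  | zero => simp [sym, coshuf]
  | succ n ih =>
    have k : sym c n o * c (o + n) = c (o + n) * sym c n o := by
      rcases n with _ | n
      · simp [sym]
      · exact hc.commute_Fam (o := o) (o' := o + (n + 1)) (m := 2) (by omega) (sym_mem (n + 1))
          (gen_mem_Fam (c := c) (i := 0) (by omega))
    calc sym c (n + 1 + 1) o = sym c (n + 1) o + sym c (n + 1) o * c (o + n) * shuf c n 1 o := by
          rw [sym, shuf_succ_one, mul_add, mul_one, mul_assoc]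
      _ = sym c (n + 1) o + coshuf c n o * c (o + n) * sym c (n + 1) o := by
          rw [ih, mul_assoc (coshuf c n o) (sym c n o), k, ← ih]
          simp only [mul_assoc, sym]
      _ = _ := by rw [coshuf, add_mul, one_mul]

/-- Up to sign `anti` is the half twist, which can be built by bringing the last strand to the front
or the first strand to the end. -/
lemma anti_succ' (hc : IsBraidSeq c) (n o : ℕ) : anti c (n + 1) o = -(anti c n o * dn c n o) := by
  induction n generalizing o with
  | zero => simp [anti]
  | succ n ih =>
    have h := up_nat hc (dn_mem (c := c) n) o
    rw [anti, ih, anti, neg_mul, neg_mul, mul_assoc, mul_assoc, ← h, up, dn, mul_assoc]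

/-- The half twist reverses the order of the strands, so it exchanges the last crossing with the
first. -/
lemma anti_gen (hc : IsBraidSeq c) (n o : ℕ) :
    anti c (n + 2) o * c (o + n) = c o * anti c (n + 2) o := by
  induction n with
  | zero => simp [anti]
  | succ n ih =>
    have h := dn_gen hc (n := n + 2) (i := n) o (by omega)
    rw [anti_succ' hc, neg_mul, mul_assoc, show o + (n + 1) = o + 1 + n by omega, h, ← mul_assoc,
      ih, mul_neg, mul_assoc]

lemma anti_shuf (hc : IsBraidSeq c) (n o : ℕ) :
    anti c (n + 1) o * shuf c n 1 o = shuf c 1 n o * anti c (n + 1) o := by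
  induction n generalizing o with
  | zero => simp
  | succ n ih =>
    have h1 : shuf c 1 (n + 1) o = 1 + c o * shuf c 1 n (o + 1) := by
      rw [shuf_first hc, shuf_zero_left, dn_one]
    have h2 := up_nat hc (shuf_mem (c := c) n 1) o
    have h3 : anti c (n + 2) o * shuf c n 1 o = shuf c 1 n (o + 1) * anti c (n + 2) o := by
      rw [anti, neg_mul, mul_assoc, h2, ← mul_assoc, ih, mul_neg, mul_assoc]
    rw [h1, shuf_succ_one, mul_add, add_mul, mul_one, one_mul, ← mul_assoc, anti_gen hc,
      mul_assoc, h3, mul_assoc]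

/-- The symmetrizer is invariant under reversal of the strands: it factors as `sym n` times `shuf n
1` and as the shifted `sym n` times `shuf 1 n`, and `anti` carries one factorisation into the other.
-/
lemma anti_sym (hc : IsBraidSeq c) (n o : ℕ) : anti c n o * sym c n o = sym c n o * anti c n o := by
  induction n generalizing o with
  | zero => simp [sym, anti]
  | succ n ih =>
    have h1 : anti c (n + 1) o * sym c n o = sym c n (o + 1) * anti c (n + 1) o := by
      rw [anti, neg_mul, mul_assoc, up_nat hc (sym_mem n), ← mul_assoc, ih, mul_neg, mul_assoc]
    have h2 : sym c (n + 1) o = sym c n (o + 1) * shuf c 1 n o := by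
      rw [add_comm, sym_add hc]; simp [sym]
    rw [sym, ← mul_assoc, h1, mul_assoc, anti_shuf hc, ← mul_assoc, ← h2, sym]

section antipode

/-- The antipode is a right convolution inverse of the identity. -/
lemma sum_anti_right (N o : ℕ) :
    ∑ p ∈ antidiagonal (N + 1), anti c p.2 (o + p.1) * shuf c p.1 p.2 o = 0 := by
  -- After the reindexing each `p` contributes two terms, which cancel by the recursion defining
  -- `anti`. For the other side the reindexing follows the first strand and `anti_succ'` takes its
  -- place.
  refine (sum_shuf (fun i j => AddMonoidHom.mulLeft (anti c j (o + i))) N o).trans ?_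
  refine Finset.sum_eq_zero fun p _ => ?_
  simp only [AddMonoidHom.coe_mulLeft, anti]
  rw [neg_mul, mul_assoc, ← add_assoc, neg_add_cancel]

/-- The antipode is a left convolution inverse of the identity. -/
lemma sum_anti_left (hc : IsBraidSeq c) (N o : ℕ) :
    ∑ p ∈ antidiagonal (N + 1), anti c p.1 o * shuf c p.1 p.2 o = 0 := by
  refine (sum_shuf_first hc (fun i _ => AddMonoidHom.mulLeft (anti c i o)) N o).trans ?_
  refine Finset.sum_eq_zero fun p _ => ?_
  simp only [AddMonoidHom.coe_mulLeft, anti_succ' hc]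
  rw [neg_mul, mul_assoc, neg_add_cancel]

end antipode

/-! ### Transposes of braid words -/

section transpose

variable {E' : Type*} [Ring E'] {c' : ℕ → E'} {P : E → E' → Prop}

lemma transpose_up (one : P 1 1) (gen : ∀ i, P (c i) (c' i))
    (mul : ∀ u v u' v', P u u' → P v v' → P (u * v) (v' * u'))
    (n o : ℕ) : P (up c n o) (dn c' n o) := by
  induction n with
  | zero => exact one
  | succ n ih => exact mul _ _ _ _ ih (gen _)

lemma transpose_shuf (one : P 1 1) (gen : ∀ i, P (c i) (c' i))
    (add : ∀ u v u' v', P u u' → P v v' → P (u + v) (u' + v'))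
    (mul : ∀ u v u' v', P u u' → P v v' → P (u * v) (v' * u'))
    (n o : ℕ) : P (shuf c n 1 o) (coshuf c' n o) := by
  induction n with
  | zero => exact one
  | succ n ih =>
    rw [shuf_succ_one, coshuf]; exact add _ _ _ _ one (mul _ _ _ _ (gen _) ih)

/-- Here `P u u'` stands for `u'` being a transpose of `u`, so that products are reversed. The
reversed recursion of `sym` is `sym_succ'`. -/
lemma transpose_sym (one : P 1 1) (gen : ∀ i, P (c i) (c' i))
    (add : ∀ u v u' v', P u u' → P v v' → P (u + v) (u' + v'))
    (mul : ∀ u v u' v', P u u' → P v v' → P (u * v) (v' * u'))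
    (hc' : IsBraidSeq c') (n o : ℕ) : P (sym c n o) (sym c' n o) := by
  induction n with
  | zero => exact one
  | succ n ih =>
    rw [sym_succ' hc']
    exact mul _ _ _ _ ih (transpose_shuf one gen add mul n o)

/-- Reversal turns `anti n (o + 1) * up n o` into `dn n o * anti n (o + 1)`, which agrees with the
recursion `anti_succ'` after the strand has been slid through. -/
lemma transpose_anti (one : P 1 1) (gen : ∀ i, P (c i) (c' i))
    (neg : ∀ u u', P u u' → P (-u) (-u'))
    (mul : ∀ u v u' v', P u u' → P v v' → P (u * v) (v' * u'))
    (hc' : IsBraidSeq c') (n o : ℕ) : P (anti c n o) (anti c' n o) := by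
  induction n generalizing o with
  | zero => exact one
  | succ n ih =>
    rw [anti_succ' hc', ← dn_nat hc' (anti_mem n)]
    exact neg _ _ (mul _ _ _ _ (ih (o + 1)) (transpose_up one gen mul n o))

end transpose

end BraidWord

namespace NABan

/-! ### Generalities on Banach spaces -/

section generalities

variable {k : Type u} [NormedField k] {X Y Z W : NABan k}

instance : Neg (X ⟶ Y) := ⟨fun f => Hom.mk (-Hom.lin f) (by
  obtain ⟨C, hC⟩ := Hom.bound f
  exact ⟨C, fun x => (norm_neg _).trans_le (hC x)⟩)⟩


instance : AddCommGroup (X ⟶ Y) where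
  add_assoc f g h := hom_ext fun x => add_assoc (f x) (g x) (h x)
  zero_add f := hom_ext fun x => zero_add (f x)
  add_zero f := hom_ext fun x => add_zero (f x)
  neg_add_cancel f := hom_ext fun x => neg_add_cancel (f x)
  add_comm f g := hom_ext fun x => add_comm (f x) (g x)
  nsmul := nsmulRec
  zsmul := zsmulRec

instance : Preadditive (NABan k) where
  add_comp _ _ _ f f' g := hom_ext fun x => map_add (Hom.lin g) (f x) (f' x)
  comp_add _ _ _ _ _ _ := rfl

instance : Module (End X) X where
  smul f x := Hom.lin f x
  one_smul _ := rfl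
  mul_smul _ _ _ := rfl
  smul_zero f := map_zero (Hom.lin f)
  smul_add f := map_add (Hom.lin f)
  add_smul _ _ _ := rfl
  zero_smul _ := rfl

instance : SMulCommClass (End X) k X := ⟨fun f a x => map_smul (Hom.lin f) a x⟩

lemma IsContr.neg {f : X ⟶ Y} (hf : IsContr f) : IsContr (-f) := fun x =>
  (norm_neg _).trans_le (hf x)

lemma isContr_zero : IsContr (0 : X ⟶ Y) := fun x => norm_zero.trans_le (norm_nonneg x)

/-- Isometric isomorphisms: contractions with a contracting inverse. -/
def IsIsom (f : X ⟶ Y) : Prop := IsContr f ∧ ∃ g : Y ⟶ X, IsContr g ∧ f ≫ g = 𝟙 X ∧ g ≫ f = 𝟙 Y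

/-- The inverse of an isometric isomorphism. -/
def IsIsom.inv {f : X ⟶ Y} (h : IsIsom f) : Y ⟶ X := h.2.choose

lemma IsIsom.isContr_inv {f : X ⟶ Y} (h : IsIsom f) : IsContr h.inv := h.2.choose_spec.1
@[simp] lemma IsIsom.inv_apply {f : X ⟶ Y} (h : IsIsom f) (x : X) : h.inv (f x) = x :=
  congrArg (fun F : X ⟶ X => F x) h.2.choose_spec.2.1
@[simp] lemma IsIsom.apply_inv {f : X ⟶ Y} (h : IsIsom f) (y : Y) : f (h.inv y) = y :=
  congrArg (fun F : Y ⟶ Y => F y) h.2.choose_spec.2.2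
lemma IsIsom.hom_inv {f : X ⟶ Y} (h : IsIsom f) : f ≫ h.inv = 𝟙 X := hom_ext h.inv_apply
lemma IsIsom.inv_hom {f : X ⟶ Y} (h : IsIsom f) : h.inv ≫ f = 𝟙 Y := hom_ext h.apply_inv

lemma IsIsom.of_iso (e : X ≅ Y) (h : IsContr e.hom) (h' : IsContr e.inv) : IsIsom e.hom :=
  ⟨h, e.inv, h', e.hom_inv_id, e.inv_hom_id⟩

lemma IsIsom.of_iso_inv (e : X ≅ Y) (h : IsContr e.hom) (h' : IsContr e.inv) : IsIsom e.inv :=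
  ⟨h', e.hom, h, e.inv_hom_id, e.hom_inv_id⟩

lemma isIsom_id : IsIsom (𝟙 X) := ⟨isContr_id, 𝟙 X, isContr_id, rfl, rfl⟩

lemma IsIsom.comp {f : X ⟶ Y} {g : Y ⟶ Z} (hf : IsIsom f) (hg : IsIsom g) : IsIsom (f ≫ g) :=
  ⟨hf.1.comp hg.1, hg.inv ≫ hf.inv, hg.isContr_inv.comp hf.isContr_inv,
    hom_ext fun x => by simp, hom_ext fun x => by simp⟩

lemma IsIsom.norm_eq {f : X ⟶ Y} (hf : IsIsom f) (x : X) : ‖f x‖ = ‖x‖ :=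
  le_antisymm (hf.1 x) (by simpa using hf.isContr_inv (f x))

/-- An isomorphism from a bijective bounded map that scales norms. -/
lemma exists_iso_of_norm (f : X ⟶ Y) (hf : Function.Surjective f) {r : ℝ} (hr : 0 < r)
    (h : ∀ x, ‖f x‖ = r * ‖x‖) : ∃ e : X ≅ Y, e.hom = f := by
  have hi : Function.Injective (Hom.lin f) := by
    rw [injective_iff_map_eq_zero]
    intro x hx
    have := h x
    rw [hx, norm_zero] at this
    exact norm_eq_zero.mp ((mul_eq_zero.mp this.symm).resolve_left hr.ne')
  let e := LinearEquiv.ofBijective (Hom.lin f) ⟨hi, hf⟩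
  have he : ∀ y, f (e.symm y) = y := fun y => e.apply_symm_apply y
  let g : Y ⟶ X := mk' e.symm.toLinearMap r⁻¹ fun y => by
    have h2 := h (e.symm y)
    rw [he] at h2
    rw [h2, inv_mul_cancel_left₀ hr.ne']
    rfl
  exact ⟨⟨f, g, hom_ext fun x => e.symm_apply_apply x, hom_ext he⟩, rfl⟩

lemma sum_apply {ι : Type*} (s : Finset ι) (f : ι → (X ⟶ Y)) (x : X) :
    (∑ i ∈ s, f i) x = ∑ i ∈ s, f i x :=
  map_sum (AddMonoidHom.mk' (fun f : X ⟶ Y => f x) fun _ _ => rfl) f s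

lemma eq_of_dense {f g : X ⟶ Y} {S : Set X} (hS : Dense S) (h : ∀ x ∈ S, f x = g x) : f = g :=
  hom_ext fun x => congrFun (Continuous.ext_on hS (continuous f) (continuous g) h) x

/-- Multiplication by a scalar. -/
def scaleHom (a : k) (X : NABan k) : X ⟶ X := mk' (a • LinearMap.id) ‖a‖ fun x => by
  simp [norm_smul]

end generalities

section coproducts

variable {k : Type u} [NormedField k] {E F : ℕ → NABan k} {Z : NABan k}

variable (E) in
/-- The projection to the `n`-th component. -/
def compHom (n : ℕ) : coprod E ⟶ E n :=
  mk' (X := coprod E) { toFun := fun x => comp x n, map_add' := fun x y => comp_add x y n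
                        map_smul' := fun a x => comp_smul a x n } 1
    fun x => (norm_comp_le x n).trans_eq (one_mul _).symm

lemma isContr_compHom (n : ℕ) : IsContr (compHom E n) := fun x => norm_comp_le x n

lemma coprod_ext_comp {x y : coprod E} (h : ∀ n, comp x n = comp y n) : x = y :=
  Subtype.ext (lp.ext (funext h))

lemma norm_coprod_le {x : coprod E} {C : ℝ} (hC : 0 ≤ C) (h : ∀ n, ‖comp x n‖ ≤ C) : ‖x‖ ≤ C :=
  lp.norm_le_of_forall_le hC h

/-- The components tend to zero, so the series converges in the ultrametric space; morphisms out of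
the coproduct are therefore determined by their restrictions to the summands. -/
lemma hasSum_incl (x : coprod E) : HasSum (fun n => incl E n (comp x n)) x := by
  have hs := summable_desc (incl E) isContr_incl x
  have : ∑' n, incl E n (comp x n) = x := by
    refine coprod_ext_comp fun m => ?_
    have h2 := (hs.hasSum.map (Hom.lin (compHom E m)) (continuous (compHom E m))).tsum_eq
    refine h2.symm.trans ?_
    rw [tsum_eq_single m]
    · exact comp_incl_self m _
    · intro n hn
      exact comp_incl_ne _ hn.symm
  rw [← this]
  convert hs.hasSum using 2
  rw [this]

lemma coprod_ext {f g : coprod E ⟶ Z} (h : ∀ n x, f (incl E n x) = g (incl E n x)) : f = g := by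
  refine hom_ext fun x => ?_
  have h1 := ((hasSum_incl x).map (Hom.lin f) (continuous f)).tsum_eq
  have h2 := ((hasSum_incl x).map (Hom.lin g) (continuous g)).tsum_eq
  rw [← h1, ← h2]
  exact tsum_congr fun n => h n _

lemma norm_incl (n : ℕ) (x : E n) : ‖incl E n x‖ = ‖x‖ :=
  le_antisymm (isContr_incl n x) (by simpa [comp_incl_self] using norm_comp_le (incl E n x) n)

end coproducts

section tensors

variable {k : Type u} [NormedField k] [IsUltrametricDist k] [CompleteSpace k]
  {X Y Z W X' Y' : NABan k}

instance : MonoidalPreadditive (NABan k) where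
  whiskerLeft_zero := tmul_ext fun x y => by rw [whiskerLeft_tmul]; exact map_zero (tmkLin x)
  zero_whiskerRight := tmul_ext fun x y => by
    rw [whiskerRight_tmul]; exact LinearMap.map_zero₂ tmkLin y
  whiskerLeft_add f g := tmul_ext fun x y => by
    rw [add_apply, whiskerLeft_tmul, whiskerLeft_tmul, whiskerLeft_tmul]
    exact tmk_add x (f y) (g y)
  add_whiskerRight f g := tmul_ext fun x y => by
    rw [add_apply, whiskerRight_tmul, whiskerRight_tmul, whiskerRight_tmul]
    exact add_tmk (f x) (g x) y

lemma tmul_add (x : X) (y y' : Y) : tmul x (y + y') = tmul x y + tmul x y' := tmk_add x y y'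
lemma add_tmul (x x' : X) (y : Y) : tmul (x + x') y = tmul x y + tmul x' y := add_tmk x x' y
lemma tmul_smul (a : k) (x : X) (y : Y) : tmul x (a • y) = a • tmul x y := tmk_smul a x y
lemma smul_tmul (a : k) (x : X) (y : Y) : tmul (a • x) y = a • tmul x y := smul_tmk a x y
@[simp] lemma tmul_zero (x : X) : tmul x (0 : Y) = 0 := map_zero (tmkLin x)
@[simp] lemma zero_tmul (y : Y) : tmul (0 : X) y = 0 := LinearMap.map_zero₂ tmkLin y
lemma tmul_sub (x : X) (y y' : Y) : tmul x (y - y') = tmul x y - tmul x y' :=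
  map_sub (tmkLin x) y y'
lemma sub_tmul (x x' : X) (y : Y) : tmul (x - x') y = tmul x y - tmul x' y :=
  LinearMap.map_sub₂ tmkLin x x' y

/-- The map `y ↦ x ⊗ y`. -/
def tmulL (x : X) (Y : NABan k) : Y ⟶ X ⊗ Y := tmkLeft Y x
/-- The map `x ↦ x ⊗ y`. -/
def tmulR (X : NABan k) (y : Y) : X ⟶ X ⊗ Y := tmkRight X y
@[simp] lemma tmulL_apply (x : X) (y : Y) : tmulL x Y y = tmul x y := rfl
@[simp] lemma tmulR_apply (x : X) (y : Y) : tmulR X y x = tmul x y := rfl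

lemma continuous_tmul : Continuous fun p : X × Y => tmul p.1 p.2 := by
  refine continuous_iff_continuousAt.mpr fun p₀ => tendsto_iff_norm_sub_tendsto_zero.mpr ?_
  have hb : ∀ p : X × Y, ‖tmul p.1 p.2 - tmul p₀.1 p₀.2‖ ≤
      ‖p.1 - p₀.1‖ * ‖p.2‖ + ‖p₀.1‖ * ‖p.2 - p₀.2‖ := fun p => by
    have : tmul p.1 p.2 - tmul p₀.1 p₀.2 = tmul (p.1 - p₀.1) p.2 + tmul p₀.1 (p.2 - p₀.2) := by
      rw [sub_tmul, tmul_sub]; abel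
    rw [this]
    exact (norm_add_le _ _).trans (add_le_add (norm_tmul_le _ _) (norm_tmul_le _ _))
  refine squeeze_zero (fun _ => norm_nonneg _) hb ?_
  have : Continuous fun p : X × Y => ‖p.1 - p₀.1‖ * ‖p.2‖ + ‖p₀.1‖ * ‖p.2 - p₀.2‖ := by fun_prop
  simpa using this.tendsto p₀

lemma tmul_induction {p : (X ⊗ Y : NABan k) → Prop} (hp : IsClosed {z | p z})
    (h0 : p 0) (ht : ∀ x y, p (tmul x y)) (ha : ∀ a b, p a → p b → p (a + b))
    (z : (X ⊗ Y : NABan k)) : p z := tensor_induction hp h0 ht ha z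

lemma IsIsom.tensorHom {f : X ⟶ Y} {g : X' ⟶ Y'} (hf : IsIsom f) (hg : IsIsom g) :
    IsIsom (f ⊗ₘ g) :=
  ⟨hf.1.tensorHom hg.1, hf.inv ⊗ₘ hg.inv, hf.isContr_inv.tensorHom hg.isContr_inv,
    tmul_ext fun x y => by simp, tmul_ext fun x y => by simp⟩
lemma IsIsom.whiskerLeft {f : X ⟶ Y} (hf : IsIsom f) : IsIsom (Z ◁ f) := isIsom_id.tensorHom hf
lemma IsIsom.whiskerRight {f : X ⟶ Y} (hf : IsIsom f) : IsIsom (f ▷ Z) := hf.tensorHom isIsom_id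
lemma isIsom_assoc : IsIsom (α_ X Y Z).hom := .of_iso _ isContr_assoc isContr_assoc_inv
lemma isIsom_assoc_inv : IsIsom (α_ X Y Z).inv := .of_iso_inv _ isContr_assoc isContr_assoc_inv
lemma isIsom_leftUnitor : IsIsom (λ_ X).hom := .of_iso _ isContr_leftUnitor isContr_leftUnitor_inv
lemma isIsom_leftUnitor_inv : IsIsom (λ_ X).inv :=
  .of_iso_inv _ isContr_leftUnitor isContr_leftUnitor_inv
lemma isIsom_rightUnitor : IsIsom (ρ_ X).hom :=
  .of_iso _ isContr_rightUnitor isContr_rightUnitor_inv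
lemma isIsom_rightUnitor_inv : IsIsom (ρ_ X).inv :=
  .of_iso_inv _ isContr_rightUnitor isContr_rightUnitor_inv

@[simp] lemma unscal_scal (a : k) : unscal (scal a) = a := rfl
lemma scal_smul (a b : k) : a • scal b = scal (a * b) := rfl
lemma eq_smul_one (a : (𝟙_ (NABan k) : NABan k)) : a = unscal a • scal 1 :=
  (toScalar_smul_one a).symm

lemma unit_ext {f g : 𝟙_ (NABan k) ⟶ X} (h : f (scal 1) = g (scal 1)) : f = g :=
  hom_ext fun a => by rw [eq_smul_one a, map_smul, map_smul, h]

lemma tmul_unit_eq (a b : (𝟙_ (NABan k) : NABan k)) :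
    (λ_ (𝟙_ (NABan k))).hom (tmul a b) = unscal a • b := leftUnitor_tmul a b

lemma tmul_ext₃ {f g : (X ⊗ Y) ⊗ Z ⟶ W}
    (h : ∀ x y z, f (tmul (tmul x y) z) = g (tmul (tmul x y) z)) : f = g := tensor_ext₃ h
end tensors

end NABan

namespace NABan

/-! ### The tensor algebra as a ring with operators -/

section tensorRing

variable {k : Type u} [NormedField k] [IsUltrametricDist k] [CompleteSpace k] {V Z : NABan k}

lemma tens_ext {f g : tens V ⟶ Z} (h : ∀ n x, f (tensIncl V n x) = g (tensIncl V n x)) : f = g :=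
  coprod_ext h

lemma tensMul_incl (n m : ℕ) (x : tpow V n) (y : tpow V m) :
    tensMul V (tmul (tensIncl V n x) (tensIncl V m y)) =
      tensIncl V (n + m) (powMul V n m (tmul x y)) :=
  desc₂_incl _ _ n m x y

/-- The unit in degree zero. -/
def nil (V : NABan k) : tpow V 0 := scal (1 : k)

/-- The elementary tensor `x ⊗ v` in degree `n + 1`. -/
def snoc {n : ℕ} (x : tpow V n) (v : V) : tpow V (n + 1) := tmul x v

/-- The tensor `x ⊗ t` in degree `n + 2`. -/
def snoc₂ {n : ℕ} (x : tpow V n) (t : (V ⊗ V : NABan k)) : tpow V (n + 2) :=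
  (α_ (tpow V n) V V).inv (tmul x t)

lemma snoc₂_tmul {n : ℕ} (x : tpow V n) (v w : V) : snoc₂ x (tmul v w) = snoc (snoc x v) w :=
  associator_inv_tmul x v w

lemma tpow_ext {n : ℕ} {f g : tpow V (n + 1) ⟶ Z} (h : ∀ x v, f (snoc x v) = g (snoc x v)) :
    f = g := tmul_ext (X := tpow V n) h

lemma tpow_ext₂ {n : ℕ} {f g : tpow V (n + 2) ⟶ Z}
    (h : ∀ x v w, f (snoc (snoc x v) w) = g (snoc (snoc x v) w)) : f = g :=
  tmul_ext₃ (X := tpow V n) h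

lemma eq_smul_nil (a : tpow V 0) : ∃ b : k, a = b • nil V := ⟨unscal a, eq_smul_one (k := k) a⟩

lemma gen_apply (v : V) : gen V v = tensIncl V 1 (snoc (nil V) v) := rfl

lemma tensOne_apply : tensOne V (scal 1) = tensIncl V 0 (nil V) := rfl

lemma powMul_nil (n : ℕ) (x : tpow V n) : powMul V n 0 (tmul x (nil V)) = x := by
  refine (rightUnitor_tmul x (scal (1 : k))).trans ?_
  rw [unscal_scal, one_smul]

lemma powMul_snoc (n m : ℕ) (x : tpow V n) (y : tpow V m) (v : V) :
    powMul V n (m + 1) (tmul x (snoc y v)) = snoc (powMul V n m (tmul x y)) v := by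
  change (powMul V n m ▷ V) ((α_ (tpow V n) (tpow V m) V).inv (tmul x (tmul y v))) = _
  rw [associator_inv_tmul, whiskerRight_tmul]
  rfl

lemma tensMul_gen (n : ℕ) (x : tpow V n) (v : V) :
    tensMul V (tmul (tensIncl V n x) (gen V v)) = tensIncl V (n + 1) (snoc x v) := by
  rw [gen_apply, tensMul_incl, powMul_snoc n 0, powMul_nil]

lemma tensMul_succ (n m : ℕ) (x : tpow V n) (y : tpow V m) (v : V) :
    tensMul V (tmul (tensIncl V n x) (tensIncl V (m + 1) (snoc y v))) =
      tensMul V (tmul (tensMul V (tmul (tensIncl V n x) (tensIncl V m y))) (gen V v)) := by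
  rw [tensMul_incl, tensMul_incl, tensMul_gen, powMul_snoc]
  rfl

/-- Left multiplication. -/
def mulL (x : tens V) : tens V ⟶ tens V := tmulL x (tens V) ≫ tensMul V
/-- Right multiplication. -/
def mulR (y : tens V) : tens V ⟶ tens V := tmulR (tens V) y ≫ tensMul V

lemma tensMul_one (a : tens V) : tensMul V (tmul a (tensOne V (scal 1))) = a := by
  have : mulR (tensOne V (scal 1)) = 𝟙 (tens V) := tens_ext fun n x =>
    (tensMul_incl n 0 x (nil V)).trans (congrArg (tensIncl V n) (powMul_nil n x))
  exact congrArg (fun F : tens V ⟶ tens V => F a) this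

lemma one_tensMul (a : tens V) : tensMul V (tmul (tensOne V (scal 1)) a) = a := by
  have : mulL (tensOne V (scal 1)) = 𝟙 (tens V) := tens_ext fun n x => by
    change tensMul V (tmul (tensIncl V 0 (nil V)) (tensIncl V n x)) = tensIncl V n x
    induction n with
    | zero =>
      obtain ⟨b, rfl⟩ := eq_smul_nil x
      rw [map_smul, tmul_smul, map_smul]
      exact congrArg _ (tensMul_one _)
    | succ n ih =>
      have : tensIncl V (n + 1) ≫ mulL (tensIncl V 0 (nil V)) = tensIncl V (n + 1) :=
        tpow_ext fun y v => by
          refine (tensMul_succ 0 n (nil V) y v).trans ?_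
          rw [ih, tensMul_gen]
      exact congrArg (fun F : tpow V (n + 1) ⟶ tens V => F x) this
  exact congrArg (fun F : tens V ⟶ tens V => F a) this

/-- Each stage fixes two of the three arguments and compares morphisms in the remaining one, which
may then be taken homogeneous. Only the last argument needs an induction on the degree. -/
lemma tensMul_assoc (a b c : tens V) : tensMul V (tmul (tensMul V (tmul a b)) c) =
    tensMul V (tmul a (tensMul V (tmul b c))) := by
  have h1 : ∀ n x m y l z, mulL (tensMul V (tmul (tensIncl V n x) (tensIncl V m y)))
      (tensIncl V l z) = (mulL (tensIncl V m y) ≫ mulL (tensIncl V n x)) (tensIncl V l z) := by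
    intro n x m y l z
    induction l with
    | zero =>
      obtain ⟨b, rfl⟩ := eq_smul_nil z
      simp only [mulL, comp_apply, tmulL_apply]
      rw [map_smul, tmul_smul, map_smul, tmul_smul, map_smul, tmul_smul, map_smul,
        ← tensOne_apply, tensMul_one, tensMul_one]
    | succ l ih =>
      have : tensIncl V (l + 1) ≫ mulL (tensMul V (tmul (tensIncl V n x) (tensIncl V m y))) =
          tensIncl V (l + 1) ≫ mulL (tensIncl V m y) ≫ mulL (tensIncl V n x) :=
        tpow_ext fun w v => by
          have ih := ih w
          simp only [mulL, comp_apply, tmulL_apply] at ih ⊢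
          rw [tensMul_succ m l, tensMul_incl m l, tensMul_gen, tensMul_succ, ← tensMul_incl m l,
            ← ih, tensMul_incl n m, tensMul_succ]
      exact congrArg (fun F : tpow V (l + 1) ⟶ tens V => F z) this
  have h2 : ∀ n x m y, mulL (tensMul V (tmul (tensIncl V n x) (tensIncl V m y))) =
      mulL (tensIncl V m y) ≫ mulL (tensIncl V n x) := fun n x m y => tens_ext (h1 n x m y)
  have h3 : ∀ n x, mulL (tensIncl V n x) ≫ mulR c = mulR c ≫ mulL (tensIncl V n x) :=
    fun n x => tens_ext fun m y => congrArg (fun F : tens V ⟶ tens V => F c) (h2 n x m y)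
  have h4 : mulR b ≫ mulR c = mulR (tensMul V (tmul b c)) :=
    tens_ext fun n x => congrArg (fun F : tens V ⟶ tens V => F b) (h3 n x)
  exact congrArg (fun F : tens V ⟶ tens V => F a) h4

instance : Ring (tens V) :=
  { (inferInstance : AddCommGroup (tens V)) with
    mul := fun x y => tensMul V (tmul x y)
    one := tensOne V (scal 1)
    left_distrib := fun x y z => (congrArg (tensMul V) (tmul_add x y z)).trans (map_add _ _ _)
    right_distrib := fun x y z => (congrArg (tensMul V) (add_tmul x y z)).trans (map_add _ _ _)
    zero_mul := fun x => (congrArg (tensMul V) (zero_tmul x)).trans (map_zero _)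
    mul_zero := fun x => (congrArg (tensMul V) (tmul_zero x)).trans (map_zero _)
    mul_assoc := tensMul_assoc
    one_mul := one_tensMul
    mul_one := tensMul_one }

instance : IsScalarTower k (tens V) (tens V) :=
  ⟨fun a x y => (congrArg (tensMul V) (smul_tmul a x y)).trans (map_smul _ _ _)⟩
instance : SMulCommClass k (tens V) (tens V) :=
  ⟨fun a x y => ((congrArg (tensMul V) (tmul_smul a x y)).trans (map_smul _ _ _)).symm⟩

lemma tensMul_eq (x y : tens V) : tensMul V (tmul x y) = x * y := rfl
lemma tensOne_eq : tensOne V (scal 1) = 1 := rfl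
lemma mulL_apply (x y : tens V) : mulL x y = x * y := rfl
lemma mulR_apply (x y : tens V) : mulR y x = x * y := rfl

/-- The homogeneous elements of degree `n`. -/
def Homog (V : NABan k) (n : ℕ) : Submodule k (tens V) := LinearMap.range (Hom.lin (tensIncl V n))

lemma incl_mem_Homog (n : ℕ) (x : tpow V n) : tensIncl V n x ∈ Homog V n := ⟨x, rfl⟩
lemma one_mem_Homog : (1 : tens V) ∈ Homog V 0 := ⟨scal (1 : k), rfl⟩
lemma gen_mem_Homog (v : V) : gen V v ∈ Homog V 1 := ⟨_, rfl⟩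
lemma mul_mem_Homog {n m : ℕ} {x y : tens V} (hx : x ∈ Homog V n) (hy : y ∈ Homog V m) :
    x * y ∈ Homog V (n + m) := by
  obtain ⟨x, rfl⟩ := hx
  obtain ⟨y, rfl⟩ := hy
  exact ⟨_, (tensMul_incl n m x y).symm⟩

lemma eq_smul_of_mem_Homog_zero {x : tens V} (hx : x ∈ Homog V 0) : ∃ a : k, x = a • 1 := by
  obtain ⟨x, rfl⟩ := hx
  obtain ⟨b, rfl⟩ := eq_smul_nil x
  exact ⟨b, map_smul _ _ _⟩

lemma exists_gen_of_mem_Homog_one {x : tens V} (hx : x ∈ Homog V 1) : ∃ v, x = gen V v := by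
  obtain ⟨x, rfl⟩ := hx
  exact ⟨(λ_ V).hom x, congrArg (tensIncl V 1)
    (congrArg (fun F : 𝟙_ (NABan k) ⊗ V ⟶ 𝟙_ (NABan k) ⊗ V => F x) (λ_ V).hom_inv_id).symm⟩

/-- Concatenation in fixed degrees loses nothing. Its inverse defines `split`, and its surjectivity
lets equations in degree `n + m` be checked on products. -/
lemma isIsom_powMul (n m : ℕ) : IsIsom (powMul V n m) := by
  induction m with
  | zero => exact isIsom_rightUnitor
  | succ m ih => exact isIsom_assoc_inv.comp ih.whiskerRight

lemma mul_incl (n m : ℕ) (x : tpow V n) (y : tpow V m) :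
    tensIncl V n x * tensIncl V m y = tensIncl V (n + m) (powMul V n m (tmul x y)) :=
  tensMul_incl n m x y

lemma tensIncl_snoc (n : ℕ) (x : tpow V n) (v : V) :
    tensIncl V (n + 1) (snoc x v) = tensIncl V n x * gen V v :=
  (tensMul_gen n x v).symm

/-- Two morphisms agree in degree `n + m` if they agree on products. -/
lemma eqOn_mul {n m : ℕ} {f g : tens V ⟶ Z}
    (h : ∀ x ∈ Homog V n, ∀ y ∈ Homog V m, f (x * y) = g (x * y)) {z : tens V}
    (hz : z ∈ Homog V (n + m)) : f z = g z := by
  obtain ⟨z, rfl⟩ := hz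
  have : powMul V n m ≫ tensIncl V (n + m) ≫ f = powMul V n m ≫ tensIncl V (n + m) ≫ g :=
    tmul_ext fun x y => by
      have := h _ (incl_mem_Homog n x) _ (incl_mem_Homog m y)
      rwa [mul_incl] at this
  have := congrArg (fun F : tpow V n ⊗ tpow V m ⟶ Z => F ((isIsom_powMul n m).inv z)) this
  simpa using this

/-- Two morphisms agree in degree `n + 1` if they agree on products with generators. -/
lemma eqOn_gen {n : ℕ} {f g : tens V ⟶ Z}
    (h : ∀ x ∈ Homog V n, ∀ v : V, f (x * gen V v) = g (x * gen V v)) {z : tens V}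
    (hz : z ∈ Homog V (n + 1)) : f z = g z :=
  eqOn_mul (fun x hx y hy => by
    obtain ⟨v, rfl⟩ := exists_gen_of_mem_Homog_one hy
    exact h x hx v) hz

lemma tens_ext_Homog {f g : tens V ⟶ Z} (h : ∀ n, ∀ x ∈ Homog V n, f x = g x) : f = g :=
  tens_ext fun n x => h n _ (incl_mem_Homog n x)

variable (V) in
/-- The multiplication on generators. -/
def genMul : V ⊗ V ⟶ tens V := (gen V ⊗ₘ gen V) ≫ tensMul V

@[simp] lemma genMul_tmul (v w : V) : genMul V (tmul v w) = gen V v * gen V w := by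
  rw [genMul, comp_apply, tensorHom_tmul]; rfl

lemma tensIncl_snoc₂ (n : ℕ) (x : tpow V n) (t : (V ⊗ V : NABan k)) :
    tensIncl V (n + 2) (snoc₂ x t) = tensIncl V n x * genMul V t := by
  let S : V ⊗ V ⟶ tpow V (n + 2) := tmulL x (V ⊗ V) ≫ (α_ (tpow V n) V V).inv
  have hS : ∀ t, S t = snoc₂ x t := fun _ => rfl
  have : S ≫ tensIncl V (n + 2) = genMul V ≫ mulL (tensIncl V n x) := tmul_ext fun v w => by
    rw [comp_apply, hS, snoc₂_tmul, tensIncl_snoc, tensIncl_snoc, comp_apply, mulL_apply,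
      genMul_tmul, mul_assoc]
  exact congrArg (fun F : V ⊗ V ⟶ tens V => F t) this

lemma genMul_mem (t : (V ⊗ V : NABan k)) : genMul V t ∈ Homog V 2 := by
  have := tensIncl_snoc₂ 0 (nil V) t
  rw [← tensOne_apply, tensOne_eq, one_mul] at this
  exact this ▸ incl_mem_Homog 2 _

end tensorRing

/-! ### Crossings as operators on the tensor algebra -/

section operators

variable {k : Type u} [NormedField k] [IsUltrametricDist k] [CompleteSpace k] {V Z : NABan k}

/-- The map `c` applied to the strands `i` and `i + 1` of `V^{⊗ n}`. -/
def posBraid (c : V ⊗ V ⟶ V ⊗ V) : ∀ n : ℕ, ℕ → (tpow V n ⟶ tpow V n)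
  | 0, _ => 0
  | 1, _ => 0
  | n + 2, i => if i = n then (α_ (tpow V n) V V).hom ≫ (tpow V n ◁ c) ≫ (α_ (tpow V n) V V).inv
      else posBraid c (n + 1) i ▷ V

variable {c : V ⊗ V ⟶ V ⊗ V}

lemma posBraid_self (n : ℕ) : posBraid c (n + 2) n =
    (α_ (tpow V n) V V).hom ≫ (tpow V n ◁ c) ≫ (α_ (tpow V n) V V).inv := if_pos rfl

lemma posBraid_ne {n i : ℕ} (h : i ≠ n) : posBraid c (n + 2) i = posBraid c (n + 1) i ▷ V :=
  if_neg h

lemma posBraid_snoc {n i : ℕ} (h : i ≠ n) (x : tpow V (n + 1)) (v : V) :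
    posBraid c (n + 2) i (snoc x v) = snoc (posBraid c (n + 1) i x) v :=
  (congrArg (fun F : tpow V (n + 1) ⊗ V ⟶ tpow V (n + 1) ⊗ V => F (tmul x v))
    (posBraid_ne h)).trans (whiskerRight_tmul _ _ _)

lemma posBraid_snoc₂ (n : ℕ) (x : tpow V n) (t : (V ⊗ V : NABan k)) :
    posBraid c (n + 2) n (snoc₂ x t) = snoc₂ x (c t) := by
  have : (α_ (tpow V n) V V).inv ≫ (α_ (tpow V n) V V).hom ≫ (tpow V n ◁ c) ≫
      (α_ (tpow V n) V V).inv = (tpow V n ◁ c) ≫ (α_ (tpow V n) V V).inv := by simp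
  refine (congrArg (fun F : tpow V (n + 2) ⟶ tpow V (n + 2) => F (snoc₂ x t))
    (posBraid_self n)).trans ?_
  refine (congrArg (fun F : tpow V n ⊗ (V ⊗ V) ⟶ _ => F (tmul x t)) this).trans ?_
  rw [comp_apply, whiskerLeft_tmul]
  rfl

lemma isContr_posBraid (hc : IsContr c) : ∀ n i : ℕ, IsContr (posBraid c n i)
  | 0, _ => isContr_zero
  | 1, _ => isContr_zero
  | n + 2, i => by
    by_cases h : i = n
    · subst h
      rw [posBraid_self]
      exact isContr_assoc.comp (hc.whiskerLeft.comp isContr_assoc_inv)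
    · rw [posBraid_ne h]
      exact (isContr_posBraid hc (n + 1) i).whiskerRight

/-- The map `c` applied to the strands `i` and `i + 1`, as an operator on the tensor algebra. -/
def strand (hc : IsContr c) (i : ℕ) : End (tens V) :=
  desc (fun n => posBraid c n i ≫ tensIncl V n)
    fun n => (isContr_posBraid hc n i).comp (isContr_incl n)

variable (hc : IsContr c)

lemma isContr_strand (i : ℕ) : IsContr (X := tens V) (Y := tens V) (strand hc i) :=
  isContr_desc _ _

lemma strand_incl (i n : ℕ) (x : tpow V n) :
    strand hc i • tensIncl V n x = tensIncl V n (posBraid c n i x) :=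
  desc_incl _ _ n x

lemma strand_mem {i n : ℕ} {x : tens V} (hx : x ∈ Homog V n) : strand hc i • x ∈ Homog V n := by
  obtain ⟨x, rfl⟩ := hx
  rw [strand_incl]
  exact incl_mem_Homog n _

lemma strand_smul (i : ℕ) (a : k) (x : tens V) : strand hc i • a • x = a • strand hc i • x :=
  smul_comm _ _ _

lemma strand_mul_gen {i n : ℕ} (h : i ≠ n) {x : tens V} (hx : x ∈ Homog V (n + 1)) (v : V) :
    strand hc i • (x * gen V v) = (strand hc i • x) * gen V v := by
  obtain ⟨x, rfl⟩ := hx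
  rw [← tensIncl_snoc, strand_incl, strand_incl, posBraid_snoc h, tensIncl_snoc]

lemma strand_mul_genMul {n : ℕ} {x : tens V} (hx : x ∈ Homog V n) (t : (V ⊗ V : NABan k)) :
    strand hc n • (x * genMul V t) = x * genMul V (c t) := by
  obtain ⟨x, rfl⟩ := hx
  rw [← tensIncl_snoc₂, strand_incl, posBraid_snoc₂, tensIncl_snoc₂]

/-- A crossing of strands that are not there is zero. With the identity instead, the braid relation
would fail in degree `i + 2`, where only one of its two crossings exists; with zero both sides
vanish there. -/
lemma strand_of_lt {i n : ℕ} (h : n < i + 2) {x : tens V} (hx : x ∈ Homog V n) :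
    strand hc i • x = 0 := by
  obtain ⟨x, rfl⟩ := hx
  rw [strand_incl]
  have : ∀ n, n < i + 2 → posBraid c n i = 0 := by
    intro n
    induction n with
    | zero => intro _; rfl
    | succ n ih =>
      intro h
      rcases n with _ | n
      · rfl
      · exact (posBraid_ne (by omega)).trans (by
          rw [ih (by omega), MonoidalPreadditive.zero_whiskerRight]; rfl)
  rw [this n h, zero_apply, map_zero]

/-- An operator on the first strands commutes with right multiplication. -/
lemma strand_mul_left {i n : ℕ} (h : i + 1 < n) {x : tens V} (hx : x ∈ Homog V n) (y : tens V) :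
    strand hc i • (x * y) = (strand hc i • x) * y := by
  have : mulL x ≫ strand hc i = mulL (strand hc i • x) := tens_ext_Homog fun m y hy => by
    change strand hc i • (x * y) = (strand hc i • x) * y
    induction m generalizing y with
    | zero =>
      obtain ⟨a, rfl⟩ := eq_smul_of_mem_Homog_zero hy
      rw [mul_smul_comm, mul_smul_comm, mul_one, mul_one, strand_smul]
    | succ m ih =>
      refine eqOn_gen (f := mulL x ≫ strand hc i) (g := mulL (strand hc i • x)) (n := m) ?_ hy
      intro y hy v
      change strand hc i • (x * (y * gen V v)) = (strand hc i • x) * (y * gen V v)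
      obtain ⟨l, rfl⟩ : ∃ l, n = l + 1 := ⟨n - 1, by omega⟩
      have hxy := mul_mem_Homog hx hy
      rw [show l + 1 + m = l + m + 1 by omega] at hxy
      rw [← mul_assoc, strand_mul_gen hc (by omega) hxy, ih y hy, mul_assoc]
  exact congrArg (fun F : tens V ⟶ tens V => F y) this

/-- An operator on the last strands commutes with left multiplication. -/
lemma strand_mul_right {n : ℕ} (i : ℕ) {x : tens V} (hx : x ∈ Homog V n) (y : tens V) :
    strand hc (n + i) • (x * y) = x * (strand hc i • y) := by
  have : mulL x ≫ strand hc (n + i) = strand hc i ≫ mulL x := tens_ext_Homog fun m y hy => by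
    change strand hc (n + i) • (x * y) = x * (strand hc i • y)
    induction m generalizing y with
    | zero =>
      rw [strand_of_lt hc (by omega) hy, strand_of_lt hc _ (mul_mem_Homog hx hy), mul_zero]
      omega
    | succ m ih =>
      rcases m with _ | m
      · rw [strand_of_lt hc (by omega) hy, strand_of_lt hc _ (mul_mem_Homog hx hy), mul_zero]
        omega
      by_cases him : i = m
      · subst him
        obtain ⟨y, rfl⟩ := hy
        have : tensIncl V (i + 2) ≫ mulL x ≫ strand hc (n + i) =
            tensIncl V (i + 2) ≫ strand hc i ≫ mulL x :=
          tpow_ext₂ fun y v w => by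
            change strand hc (n + i) • (x * tensIncl V (i + 2) (snoc (snoc y v) w)) =
              x * (strand hc i • tensIncl V (i + 2) (snoc (snoc y v) w))
            rw [tensIncl_snoc, tensIncl_snoc, mul_assoc (tensIncl V i y), ← genMul_tmul,
              ← mul_assoc, strand_mul_genMul hc (mul_mem_Homog hx (incl_mem_Homog _ y)),
              strand_mul_genMul hc (incl_mem_Homog _ y), mul_assoc]
        exact congrArg (fun F : tpow V (i + 2) ⟶ tens V => F y) this
      · refine eqOn_gen (f := mulL x ≫ strand hc (n + i)) (g := strand hc i ≫ mulL x)
          (n := m + 1) ?_ hy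
        intro y hy v
        change strand hc (n + i) • (x * (y * gen V v)) = x * (strand hc i • (y * gen V v))
        have hxy := mul_mem_Homog hx hy
        rw [← mul_assoc, strand_mul_gen hc (n := n + m) (by omega) hxy,
          strand_mul_gen hc him hy, ih y hy, mul_assoc]
  exact congrArg (fun F : tens V ⟶ tens V => F y) this

lemma strand_mul_genMul_mul {n : ℕ} {x : tens V} (hx : x ∈ Homog V n) (t : (V ⊗ V : NABan k))
    (y : tens V) : strand hc n • (x * genMul V t * y) = x * genMul V (c t) * y := by
  rw [strand_mul_left hc (n := n + 2) (by omega) (mul_mem_Homog hx (genMul_mem t)),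
    strand_mul_genMul hc hx]

lemma ext_three {f g : tens V ⟶ Z}
    (h : ∀ u v w : V, f (gen V u * gen V v * gen V w) = g (gen V u * gen V v * gen V w))
    {z : tens V} (hz : z ∈ Homog V 3) : f z = g z := by
  refine eqOn_gen (n := 2) (fun z hz w => ?_) hz
  refine eqOn_gen (n := 1) (f := mulR (gen V w) ≫ f) (g := mulR (gen V w) ≫ g) (fun z hz v => ?_) hz
  obtain ⟨u, rfl⟩ := exists_gen_of_mem_Homog_one hz
  exact h u v w

/-- The multiplication of three generators. -/
lemma strand_three (hb : IsPreBraiding c) {z : tens V} (hz : z ∈ Homog V 3) :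
    strand hc 0 • strand hc 1 • strand hc 0 • z = strand hc 1 • strand hc 0 • strand hc 1 • z := by
  -- The product map `q` of three generators transports the crossings `1` and `0` to `V ◁ c` and, up
  -- to associators, `c ▷ V`. The claim is then the hexagon `hb` followed by `q`.
  obtain ⟨q, hq⟩ : ∃ q : V ⊗ (V ⊗ V) ⟶ tens V, ∀ v t, q (tmul v t) = gen V v * genMul V t :=
    ⟨(gen V ⊗ₘ genMul V) ≫ tensMul V, fun v t => by rw [comp_apply, tensorHom_tmul]; rfl⟩
  have hq' : ∀ t v, q ((α_ V V V).hom (tmul t v)) = genMul V t * gen V v := fun t v => by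
    have : tmulR (V ⊗ V) v ≫ (α_ V V V).hom ≫ q = genMul V ≫ mulR (gen V v) :=
      tmul_ext fun a b => by
        simp only [comp_apply, tmulR_apply, associator_hom_tmul, hq, genMul_tmul, mulR_apply,
          mul_assoc]
    exact congrArg (fun F : V ⊗ V ⟶ tens V => F t) this
  have h1 : q ≫ strand hc 1 = (V ◁ c) ≫ q := tmul_ext fun v t => by
    rw [comp_apply, comp_apply, hq, whiskerLeft_tmul, hq]
    exact strand_mul_genMul hc (gen_mem_Homog v) t
  have h0 : (α_ V V V).hom ≫ q ≫ strand hc 0 = (c ▷ V) ≫ (α_ V V V).hom ≫ q :=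
    tmul_ext fun t v => by
      simp only [comp_apply]
      rw [hq', whiskerRight_tmul, hq']
      have := strand_mul_genMul_mul hc one_mem_Homog t (gen V v)
      rwa [one_mul, one_mul] at this
  have h0' : q ≫ strand hc 0 = (α_ V V V).inv ≫ (c ▷ V) ≫ (α_ V V V).hom ≫ q := by
    rw [← h0, Iso.inv_hom_id_assoc]
  have h01 : (α_ V V V).hom ≫ q ≫ strand hc 0 ≫ strand hc 1 ≫ strand hc 0 =
      (α_ V V V).hom ≫ q ≫ strand hc 1 ≫ strand hc 0 ≫ strand hc 1 := by
    have e1 : (α_ V V V).hom ≫ q ≫ strand hc 0 ≫ strand hc 1 ≫ strand hc 0 =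
        ((c ▷ V) ≫ (α_ V V V).hom ≫ (V ◁ c) ≫ (α_ V V V).inv ≫ (c ▷ V) ≫ (α_ V V V).hom) ≫ q := by
      rw [← Category.assoc q, h0', Category.assoc, Category.assoc, Category.assoc,
        Iso.hom_inv_id_assoc, ← Category.assoc q, h1, Category.assoc, h0']
      simp only [Category.assoc]
    have e2 : (α_ V V V).hom ≫ q ≫ strand hc 1 ≫ strand hc 0 ≫ strand hc 1 =
        ((α_ V V V).hom ≫ (V ◁ c) ≫ (α_ V V V).inv ≫ (c ▷ V) ≫ (α_ V V V).hom ≫ (V ◁ c)) ≫ q := by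
      rw [← Category.assoc q, h1, Category.assoc, ← Category.assoc q, h0', Category.assoc,
        Category.assoc, Category.assoc, h1]
      simp only [Category.assoc]
    rw [e1, e2, hb]
  refine ext_three (f := strand hc 0 ≫ strand hc 1 ≫ strand hc 0)
    (g := strand hc 1 ≫ strand hc 0 ≫ strand hc 1) (fun u v w => ?_) hz
  have := congrArg (fun F : (V ⊗ V) ⊗ V ⟶ tens V => F (tmul (tmul u v) w)) h01
  simp only [comp_apply, associator_hom_tmul, hq, genMul_tmul, ← mul_assoc] at this
  exact this

open BraidWord

/-- Distant crossings act on different factors of a product whose left factor has degree `i + 2`.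
For adjacent crossings, cutting off the strands to the left and to the right leaves the case of
three strands. In degrees too small for the crossings both sides are zero. -/
lemma isBraidSeq_strand (hb : IsPreBraiding c) : IsBraidSeq (strand hc) where
  comm i j hij := tens_ext_Homog fun n x hx => by
    change strand hc i • strand hc j • x = strand hc j • strand hc i • x
    by_cases hn : n < j + 2
    · rw [strand_of_lt hc hn hx, strand_of_lt hc hn (strand_mem hc hx), smul_zero]
    obtain ⟨l, rfl⟩ : ∃ l, n = (i + 2) + l := ⟨n - (i + 2), by omega⟩
    obtain ⟨m, rfl⟩ : ∃ m, j = (i + 2) + m := ⟨j - (i + 2), by omega⟩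
    refine eqOn_mul (f := strand hc (i + 2 + m) ≫ strand hc i)
      (g := strand hc i ≫ strand hc (i + 2 + m)) (fun x hx y hy => ?_) hx
    change strand hc i • strand hc (i + 2 + m) • (x * y) =
      strand hc (i + 2 + m) • strand hc i • (x * y)
    rw [strand_mul_right hc m hx, strand_mul_left hc (by omega) hx,
      strand_mul_left hc (by omega) hx, strand_mul_right hc m (strand_mem hc hx)]
  braid i := tens_ext_Homog fun n x hx => by
    change strand hc i • strand hc (i + 1) • strand hc i • x =
      strand hc (i + 1) • strand hc i • strand hc (i + 1) • x
    by_cases hn : n < i + 3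
    · rw [strand_of_lt hc (i := i + 1) hn hx,
        strand_of_lt hc (i := i + 1) hn (strand_mem hc hx), smul_zero, smul_zero]
    obtain ⟨l, rfl⟩ : ∃ l, n = i + (3 + l) := ⟨n - (i + 3), by omega⟩
    have key : ∀ y ∈ Homog V (3 + l), strand hc 0 • strand hc 1 • strand hc 0 • y =
        strand hc 1 • strand hc 0 • strand hc 1 • y := fun y hy => by
      refine eqOn_mul (f := strand hc 0 ≫ strand hc 1 ≫ strand hc 0)
        (g := strand hc 1 ≫ strand hc 0 ≫ strand hc 1) (fun x hx y hy => ?_) hy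
      change strand hc 0 • strand hc 1 • strand hc 0 • (x * y) =
        strand hc 1 • strand hc 0 • strand hc 1 • (x * y)
      have h0 : ∀ x ∈ Homog V 3, strand hc 0 • (x * y) = (strand hc 0 • x) * y :=
        fun x hx => strand_mul_left hc (by omega) hx y
      have h1 : ∀ x ∈ Homog V 3, strand hc 1 • (x * y) = (strand hc 1 • x) * y :=
        fun x hx => strand_mul_left hc (by omega) hx y
      rw [h0 x hx, h1 _ (strand_mem hc hx), h0 _ (strand_mem hc (strand_mem hc hx)), h1 x hx,
        h0 _ (strand_mem hc hx), h1 _ (strand_mem hc (strand_mem hc hx)), strand_three hc hb hx]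
    refine eqOn_mul (f := strand hc i ≫ strand hc (i + 1) ≫ strand hc i)
        (g := strand hc (i + 1) ≫ strand hc i ≫ strand hc (i + 1)) (fun x hx y hy => ?_) hx
    change strand hc i • strand hc (i + 1) • strand hc i • (x * y) =
      strand hc (i + 1) • strand hc i • strand hc (i + 1) • (x * y)
    have h0 : ∀ y, strand hc i • (x * y) = x * (strand hc 0 • y) :=
      fun y => strand_mul_right hc 0 hx y
    simp only [h0, strand_mul_right hc 1 hx, key y hy]

/-- Operators given by words in the strands preserve the degree. -/
lemma Fam_mem {n N : ℕ} {u : ℕ → End (tens V)} (hu : u ∈ Fam (strand hc) n) (o : ℕ) {x : tens V}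
    (hx : x ∈ Homog V N) : u o • x ∈ Homog V N := by
  refine Fam_induction (P := fun u => ∀ x ∈ Homog V N, u o • x ∈ Homog V N) hu
    (fun i _ x hx => strand_mem hc hx) (fun x hx => (one_smul (End (tens V)) x).symm ▸ hx)
    (fun u v hu hv x hx => by rw [Pi.add_apply, add_smul]; exact add_mem (hu x hx) (hv x hx))
    (fun u hu x hx => by rw [Pi.neg_apply, neg_smul]; exact neg_mem (hu x hx))
    (fun u v hu hv x hx => by rw [Pi.mul_apply, mul_smul]; exact hu _ (hv x hx)) x hx

/-- Together with `Fam_mul_right` this translates between words and products: at offset `0` a word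
on `n` strands acts on a left factor of degree `n`, at offset `n + o` on what follows it.
Preservation of the degree is carried through the induction, as composition requires it. -/
lemma Fam_mul_left {n : ℕ} {u : ℕ → End (tens V)} (hu : u ∈ Fam (strand hc) n) {x : tens V}
    (hx : x ∈ Homog V n) (y : tens V) : u 0 • (x * y) = (u 0 • x) * y := by
  have := Fam_induction (P := fun u => ∀ x ∈ Homog V n, u 0 • x ∈ Homog V n ∧
      u 0 • (x * y) = (u 0 • x) * y) hu
    (fun i hi x hx => ⟨strand_mem hc hx, by
      simp only [zero_add]; exact strand_mul_left hc hi hx y⟩)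
    (fun x hx => ⟨(one_smul (End (tens V)) x).symm ▸ hx, rfl⟩)
    (fun u v hu hv x hx => by
      rw [Pi.add_apply, add_smul, add_smul, add_mul, (hu x hx).2, (hv x hx).2]
      exact ⟨add_mem (hu x hx).1 (hv x hx).1, rfl⟩)
    (fun u hu x hx => by
      rw [Pi.neg_apply, neg_smul, neg_smul, neg_mul, (hu x hx).2]
      exact ⟨neg_mem (hu x hx).1, rfl⟩)
    (fun u v hu hv x hx => by
      rw [Pi.mul_apply, mul_smul, mul_smul, (hv x hx).2, (hu _ (hv x hx).1).2]
      exact ⟨(hu _ (hv x hx).1).1, rfl⟩) x hx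
  exact this.2

lemma Fam_mul_right {n m : ℕ} {u : ℕ → End (tens V)} (hu : u ∈ Fam (strand hc) m) {x : tens V}
    (hx : x ∈ Homog V n) (y : tens V) (o : ℕ) : u (n + o) • (x * y) = x * (u o • y) := by
  refine Fam_induction (P := fun u => ∀ y, u (n + o) • (x * y) = x * (u o • y)) hu
    (fun i _ y => by simp only [add_assoc]; exact strand_mul_right hc (o + i) hx y)
    (fun y => rfl)
    (fun u v hu hv y => by
      rw [Pi.add_apply, Pi.add_apply, add_smul, add_smul, mul_add, hu, hv])
    (fun u hu y => by rw [Pi.neg_apply, Pi.neg_apply, neg_smul, neg_smul, mul_neg, hu])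
    (fun u v hu hv y => by
      rw [Pi.mul_apply, Pi.mul_apply, mul_smul, mul_smul, hv, hu]) y

lemma Fam_isContr {n : ℕ} {u : ℕ → End (tens V)} (hu : u ∈ Fam (strand hc) n) (o : ℕ) :
    IsContr (X := tens V) (Y := tens V) (u o) :=
  Fam_induction (P := fun u : ℕ → End (tens V) => IsContr (X := tens V) (Y := tens V) (u o)) hu
    (fun _ _ => isContr_strand hc _) isContr_id (fun _ _ hu hv => IsContr.add hu hv)
    (fun _ hu => IsContr.neg hu) (fun _ _ hu hv => IsContr.comp hv hu)

end operators

end NABan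

namespace NABan

/-! ### Deconcatenation -/

section splitting

variable {k : Type u} [NormedField k] [IsUltrametricDist k] [CompleteSpace k] {V W Z : NABan k}

lemma tens_ext₂ {f g : tens V ⊗ tens W ⟶ Z}
    (h : ∀ n, ∀ x ∈ Homog V n, ∀ m, ∀ y ∈ Homog W m, f (tmul x y) = g (tmul x y)) : f = g := by
  refine tmul_ext fun x y => ?_
  have h1 : ∀ n, ∀ x ∈ Homog V n, tmulL x (tens W) ≫ f = tmulL x (tens W) ≫ g :=
    fun n x hx => tens_ext_Homog fun m y hy => h n x hx m y hy
  have h2 : tmulR (tens V) y ≫ f = tmulR (tens V) y ≫ g :=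
    tens_ext_Homog fun n x hx => congrArg (fun F : tens W ⟶ Z => F y) (h1 n x hx)
  exact congrArg (fun F : tens V ⟶ Z => F x) h2

/-- The projection to degree `n`. -/
def tensProj (n : ℕ) : tens V ⟶ tpow V n := compHom (tpow V) n

lemma tensProj_self (n : ℕ) (x : tpow V n) : tensProj n (tensIncl V n x) = x := comp_incl_self n x

lemma tensProj_ne {n N : ℕ} (h : N ≠ n) (x : tpow V N) : tensProj n (tensIncl V N x) = 0 :=
  comp_incl_ne x h.symm

lemma isContr_tensProj (n : ℕ) : IsContr (tensProj n : tens V ⟶ _) := isContr_compHom n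

/-- The map `x * y ↦ x ⊗ y` for `x` of degree `n` and `y` of degree `m`; it vanishes in degrees
other than `n + m`. -/
def split (n m : ℕ) : tens V ⟶ tens V ⊗ tens V :=
  tensProj (n + m) ≫ (isIsom_powMul n m).inv ≫ (tensIncl V n ⊗ₘ tensIncl V m)

lemma isContr_split (n m : ℕ) : IsContr (split n m : tens V ⟶ _) :=
  (isContr_tensProj _).comp ((isIsom_powMul n m).isContr_inv.comp
    ((isContr_incl n).tensorHom (isContr_incl m)))

lemma split_mul {n m : ℕ} {x y : tens V} (hx : x ∈ Homog V n) (hy : y ∈ Homog V m) :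
    split n m (x * y) = tmul x y := by
  obtain ⟨x, rfl⟩ := hx
  obtain ⟨y, rfl⟩ := hy
  rw [mul_incl, split, comp_apply, comp_apply, tensProj_self, IsIsom.inv_apply, tensorHom_tmul]

lemma split_of_ne {n m N : ℕ} (h : N ≠ n + m) {x : tens V} (hx : x ∈ Homog V N) :
    split n m x = 0 := by
  obtain ⟨x, rfl⟩ := hx
  rw [split, comp_apply, tensProj_ne h, map_zero]

lemma one_split {n : ℕ} {x : tens V} (hx : x ∈ Homog V n) : split 0 n x = tmul 1 x := by
  conv_lhs => rw [← one_mul x]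
  exact split_mul one_mem_Homog hx

lemma split_one {n : ℕ} {x : tens V} (hx : x ∈ Homog V n) : split n 0 x = tmul x 1 := by
  conv_lhs => rw [← mul_one x]
  exact split_mul hx one_mem_Homog

/-- Two morphisms that agree after deconcatenation are equal. -/
lemma split_ext {f g : tens V ⊗ tens V ⟶ Z}
    (h : ∀ n m, ∀ z ∈ Homog V (n + m), f (split n m z) = g (split n m z)) : f = g :=
  tens_ext₂ fun n x hx m y hy => by
    rw [← split_mul hx hy]; exact h n m _ (mul_mem_Homog hx hy)

/-- Two morphisms agree if they do in degree `n + m` on products and vanish in other degrees. -/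
lemma ext_mul {n m : ℕ} {f g : tens V ⟶ Z}
    (h : ∀ x ∈ Homog V n, ∀ y ∈ Homog V m, f (x * y) = g (x * y))
    (hf : ∀ N, N ≠ n + m → ∀ x ∈ Homog V N, f x = 0)
    (hg : ∀ N, N ≠ n + m → ∀ x ∈ Homog V N, g x = 0) : f = g :=
  tens_ext_Homog fun N x hx => by
    by_cases hN : N = n + m
    · subst hN; exact eqOn_mul h hx
    · rw [hf N hN x hx, hg N hN x hx]

/-- Deconcatenation into three factors, bracketed to the left. -/
def splitL (n m l : ℕ) : tens V ⟶ (tens V ⊗ tens V) ⊗ tens V :=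
  split (n + m) l ≫ (split n m ▷ tens V)

/-- Deconcatenation into three factors, bracketed to the right. -/
def splitR (n m l : ℕ) : tens V ⟶ tens V ⊗ (tens V ⊗ tens V) :=
  split n (m + l) ≫ (tens V ◁ split m l)

lemma splitL_mul {n m l : ℕ} {x y z : tens V} (hx : x ∈ Homog V n) (hy : y ∈ Homog V m)
    (hz : z ∈ Homog V l) : splitL n m l (x * y * z) = tmul (tmul x y) z := by
  rw [splitL, comp_apply, split_mul (mul_mem_Homog hx hy) hz, whiskerRight_tmul, split_mul hx hy]

lemma splitR_mul {n m l : ℕ} {x y z : tens V} (hx : x ∈ Homog V n) (hy : y ∈ Homog V m)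
    (hz : z ∈ Homog V l) : splitR n m l (x * y * z) = tmul x (tmul y z) := by
  rw [splitR, comp_apply, mul_assoc, split_mul hx (mul_mem_Homog hy hz), whiskerLeft_tmul,
    split_mul hy hz]

lemma splitL_assoc (n m l : ℕ) :
    splitL n m l ≫ (α_ (tens V) (tens V) (tens V)).hom = splitR n m l := by
  refine ext_mul (n := n + m) (m := l) (fun w hw z hz => ?_) (fun N hN x hx => ?_)
    (fun N hN x hx => ?_)
  · refine eqOn_mul (f := mulR z ≫ splitL n m l ≫ (α_ (tens V) (tens V) (tens V)).hom)
      (g := mulR z ≫ splitR n m l) (fun x hx y hy => ?_) hw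
    rw [comp_apply, comp_apply, comp_apply, mulR_apply, splitL_mul hx hy hz, splitR_mul hx hy hz,
      associator_hom_tmul]
  · rw [splitL, comp_apply, comp_apply, split_of_ne hN hx, map_zero, map_zero]
  · rw [splitR, comp_apply, split_of_ne (by omega) hx, map_zero]

lemma splitL_assoc_apply (n m l : ℕ) (z : tens V) :
    (α_ (tens V) (tens V) (tens V)).hom (splitL n m l z) = splitR n m l z := by
  rw [← splitL_assoc]; rfl

lemma splitR_assoc_apply (n m l : ℕ) (z : tens V) :
    (α_ (tens V) (tens V) (tens V)).inv (splitR n m l z) = splitL n m l z := by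
  rw [← splitL_assoc_apply, ← comp_apply, Iso.hom_inv_id, id_apply]

/-- Axioms on three tensor factors thereby concern a single homogeneous `z`, on which the structure
maps act by braid words on `n + m + l` strands. -/
lemma splitL_ext {f g : (tens V ⊗ tens V) ⊗ tens V ⟶ Z}
    (h : ∀ n m l, ∀ z ∈ Homog V (n + m + l), f (splitL n m l z) = g (splitL n m l z)) : f = g := by
  refine tmul_ext fun w z => ?_
  have h1 : ∀ l, ∀ z ∈ Homog V l, tmulR (tens V ⊗ tens V) z ≫ f =
      tmulR (tens V ⊗ tens V) z ≫ g := fun l z hz => tens_ext₂ fun n x hx m y hy => by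
    have := h n m l _ (mul_mem_Homog (mul_mem_Homog hx hy) hz)
    rwa [splitL_mul hx hy hz] at this
  have h2 : tmulL w (tens V) ≫ f = tmulL w (tens V) ≫ g := tens_ext_Homog fun l z hz =>
    congrArg (fun F : tens V ⊗ tens V ⟶ Z => F w) (h1 l z hz)
  exact congrArg (fun F : tens V ⟶ Z => F z) h2

lemma splitR_ext {f g : tens V ⊗ (tens V ⊗ tens V) ⟶ Z}
    (h : ∀ n m l, ∀ z ∈ Homog V (n + m + l), f (splitR n m l z) = g (splitR n m l z)) : f = g := by
  rw [← cancel_epi (α_ (tens V) (tens V) (tens V)).hom]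
  refine splitL_ext fun n m l z hz => ?_
  rw [comp_apply, comp_apply, splitL_assoc_apply, h n m l z hz]

lemma mul_split {n m : ℕ} {z : tens V} (hz : z ∈ Homog V (n + m)) :
    tensMul V (split n m z) = z := by
  refine eqOn_mul (f := split n m ≫ tensMul V) (g := 𝟙 _) (fun x hx y hy => ?_) hz
  rw [comp_apply, split_mul hx hy]
  rfl

lemma mulR_split {n m l : ℕ} {z y : tens V} (hz : z ∈ Homog V (n + m)) (hy : y ∈ Homog V l) :
    (tens V ◁ mulR y) (split n m z) = split n (m + l) (z * y) := by
  refine eqOn_mul (f := split n m ≫ (tens V ◁ mulR y)) (g := mulR y ≫ split n (m + l))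
    (fun a ha b hb => ?_) hz
  rw [comp_apply, comp_apply, split_mul ha hb, mulR_apply, whiskerLeft_tmul, mulR_apply,
    mul_assoc, split_mul ha (mul_mem_Homog hb hy)]

lemma mulL_split {n m l : ℕ} {z y : tens V} (hz : z ∈ Homog V (n + m)) (hy : y ∈ Homog V l) :
    (mulL y ▷ tens V) (split n m z) = split (l + n) m (y * z) := by
  refine eqOn_mul (f := split n m ≫ (mulL y ▷ tens V)) (g := mulL y ≫ split (l + n) m)
    (fun a ha b hb => ?_) hz
  rw [comp_apply, comp_apply, split_mul ha hb, mulL_apply, whiskerRight_tmul, mulL_apply,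
    ← mul_assoc, split_mul (mul_mem_Homog hy ha) hb]

lemma mul_splitL {n m l : ℕ} {z : tens V} (hz : z ∈ Homog V (n + m + l)) :
    (tensMul V ▷ tens V) (splitL n m l z) = split (n + m) l z := by
  refine eqOn_mul (f := splitL n m l ≫ (tensMul V ▷ tens V)) (g := split (n + m) l)
    (fun x hx y hy => ?_) hz
  rw [comp_apply, splitL, comp_apply, split_mul hx hy, whiskerRight_tmul, whiskerRight_tmul,
    mul_split hx]

lemma mul_splitR {n m l : ℕ} {z : tens V} (hz : z ∈ Homog V (n + m + l)) :
    (tens V ◁ tensMul V) (splitR n m l z) = split n (m + l) z := by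
  rw [add_assoc] at hz
  refine eqOn_mul (f := splitR n m l ≫ (tens V ◁ tensMul V)) (g := split n (m + l))
    (fun x hx y hy => ?_) hz
  rw [comp_apply, splitR, comp_apply, split_mul hx hy, whiskerLeft_tmul, whiskerLeft_tmul,
    mul_split hy]

open BraidWord

variable {c : V ⊗ V ⟶ V ⊗ V} (hc : IsContr c)

/-- An operator on `tens V`, as a morphism. -/
def op (u : End (tens V)) : tens V ⟶ tens V := u

lemma op_apply (u : End (tens V)) (x : tens V) : op u x = u • x := rfl

lemma split_Fam_left {n m : ℕ} {u : ℕ → End (tens V)} (hu : u ∈ Fam (strand hc) n) :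
    split n m ≫ (op (u 0) ▷ tens V) = op (u 0) ≫ split n m := by
  refine ext_mul (n := n) (m := m) (fun x hx y hy => ?_) (fun N hN x hx => ?_)
    (fun N hN x hx => ?_)
  · rw [comp_apply, comp_apply, split_mul hx hy, whiskerRight_tmul, op_apply, op_apply,
      Fam_mul_left hc hu hx, split_mul (Fam_mem hc hu 0 hx) hy]
  · rw [comp_apply, split_of_ne hN hx, map_zero]
  · rw [comp_apply, op_apply, split_of_ne hN (Fam_mem hc hu 0 hx)]

lemma split_Fam_right {n m : ℕ} {u : ℕ → End (tens V)} (hu : u ∈ Fam (strand hc) m) (o : ℕ) :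
    split n m ≫ (tens V ◁ op (u o)) = op (u (n + o)) ≫ split n m := by
  refine ext_mul (n := n) (m := m) (fun x hx y hy => ?_) (fun N hN x hx => ?_)
    (fun N hN x hx => ?_)
  · rw [comp_apply, comp_apply, split_mul hx hy, whiskerLeft_tmul, op_apply, op_apply,
      Fam_mul_right hc hu hx, split_mul hx (Fam_mem hc hu o hy)]
  · rw [comp_apply, split_of_ne hN hx, map_zero]
  · rw [comp_apply, op_apply, split_of_ne hN (Fam_mem hc hu (n + o) hx)]

lemma up_mem_Homog (n o : ℕ) {N : ℕ} {x : tens V} (hx : x ∈ Homog V N) :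
    up (strand hc) n o • x ∈ Homog V N := Fam_mem hc (up_mem n) o hx
lemma bb_mem_Homog (n m o : ℕ) {N : ℕ} {x : tens V} (hx : x ∈ Homog V N) :
    bb (strand hc) n m o • x ∈ Homog V N := Fam_mem hc (bb_mem n m) o hx
lemma shuf_mem_Homog (n m o : ℕ) {N : ℕ} {x : tens V} (hx : x ∈ Homog V N) :
    shuf (strand hc) n m o • x ∈ Homog V N := Fam_mem hc (shuf_mem n m) o hx

lemma powBraid₁_nil (v : V) : powBraid₁ c 0 (tmul (nil V) v) = tmul v (nil V) := by
  have : powBraid₁ c 0 (tmul (nil V) v) = (ρ_ V).inv ((λ_ V).hom (tmul (scal (1 : k)) v)) := rfl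
  rw [this, leftUnitor_tmul, unscal_scal, one_smul]
  rfl

lemma powBraid₁_snoc₂ (n : ℕ) (x : tpow V n) (t : (V ⊗ V : NABan k)) :
    powBraid₁ c (n + 1) ((α_ (tpow V n) V V).inv (tmul x t)) =
      (α_ V (tpow V n) V).hom ((powBraid₁ c n ▷ V) ((α_ (tpow V n) V V).inv (tmul x (c t)))) := by
  have h : (α_ (tpow V n) V V).inv ≫ powBraid₁ c (n + 1) =
      (tpow V n ◁ c) ≫ (α_ (tpow V n) V V).inv ≫ (powBraid₁ c n ▷ V) ≫
        (α_ V (tpow V n) V).hom := by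
    rw [powBraid₁]; exact Iso.inv_hom_id_assoc _ _
  have := congrArg (fun F : tpow V n ⊗ (V ⊗ V) ⟶ V ⊗ (tpow V n ⊗ V) => F (tmul x t)) h
  refine this.trans ?_
  rw [comp_apply, whiskerLeft_tmul]
  rfl

/-- This replaces composites of whiskered copies of `c` and associators by the word `up`. Both
recursions let the last tensor factor cross `v` first and then proceed with the remaining `n`
strands. -/
lemma powBraid₁_eq (n : ℕ) (x : tpow V n) (v : V) :
    (gen V ⊗ₘ tensIncl V n) (powBraid₁ c n (tmul x v)) =
      split 1 n (up (strand hc) n 0 • (tensIncl V n x * gen V v)) := by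
  induction n generalizing v with
  | zero =>
    have : tmulR (tpow V 0) v ≫ powBraid₁ c 0 ≫ (gen V ⊗ₘ tensIncl V 0) =
        tensIncl V 0 ≫ mulR (gen V v) ≫ split 1 0 := unit_ext <| by
      change (gen V ⊗ₘ tensIncl V 0) (powBraid₁ c 0 (tmul (nil V) v)) = split 1 0 (1 * gen V v)
      rw [powBraid₁_nil, tensorHom_tmul, one_mul, split_one (gen_mem_Homog v)]
      rfl
    exact congrArg (fun F : tpow V 0 ⟶ tens V ⊗ tens V => F x) this
  | succ n ih =>
    have h1 : ∀ (s : (V ⊗ tpow V n : NABan k)) (b : V),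
        (gen V ⊗ₘ tensIncl V (n + 1)) ((α_ V (tpow V n) V).hom (tmul s b)) =
          (tens V ◁ mulR (gen V b)) ((gen V ⊗ₘ tensIncl V n) s) := fun s b => by
      have : tmulR (V ⊗ tpow V n) b ≫ (α_ V (tpow V n) V).hom ≫ (gen V ⊗ₘ tensIncl V (n + 1)) =
          (gen V ⊗ₘ tensIncl V n) ≫ (tens V ◁ mulR (gen V b)) := tmul_ext fun v y => by
        rw [comp_apply, comp_apply, comp_apply, tmulR_apply, associator_hom_tmul, tensorHom_tmul,
          whiskerLeft_tmul, mulR_apply, ← tensIncl_snoc]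
        exact tensorHom_tmul _ _ _ _
      exact congrArg (fun F : V ⊗ tpow V n ⟶ tens V ⊗ tens V => F s) this
    have h2 : ∀ (x : tpow V n) (t : (V ⊗ V : NABan k)),
        (gen V ⊗ₘ tensIncl V (n + 1)) ((α_ V (tpow V n) V).hom ((powBraid₁ c n ▷ V)
          ((α_ (tpow V n) V V).inv (tmul x t)))) =
        split 1 (n + 1) (up (strand hc) n 0 • (tensIncl V n x * genMul V t)) := fun x t => by
      have : tmulL x (V ⊗ V) ≫ (α_ (tpow V n) V V).inv ≫ (powBraid₁ c n ▷ V) ≫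
          (α_ V (tpow V n) V).hom ≫ (gen V ⊗ₘ tensIncl V (n + 1)) =
          genMul V ≫ mulL (tensIncl V n x) ≫ op (up (strand hc) n 0) ≫ split 1 (n + 1) :=
        tmul_ext fun a b => by
          have hxa := mul_mem_Homog (incl_mem_Homog n x) (gen_mem_Homog a)
          simp only [comp_apply]
          rw [tmulL_apply, associator_inv_tmul, whiskerRight_tmul]
          refine (h1 _ b).trans ?_
          rw [ih, genMul_tmul, mulL_apply,
            op_apply, ← mul_assoc, Fam_mul_left hc (up_mem n) hxa,
            mulR_split (by rw [add_comm 1 n]; exact up_mem_Homog hc n 0 hxa) (gen_mem_Homog b)]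
      exact congrArg (fun F : V ⊗ V ⟶ tens V ⊗ tens V => F t) this
    have h3 : tmulR (tpow V (n + 1)) v ≫ powBraid₁ c (n + 1) ≫ (gen V ⊗ₘ tensIncl V (n + 1)) =
        tensIncl V (n + 1) ≫ mulR (gen V v) ≫ op (up (strand hc) (n + 1) 0) ≫ split 1 (n + 1) :=
      tpow_ext fun x w => by
        have e : tmul (snoc x w) v = (α_ (tpow V n) V V).inv (tmul x (tmul w v)) :=
          (associator_inv_tmul x w v).symm
        simp only [comp_apply]
        rw [tmulR_apply, e, powBraid₁_snoc₂, h2, mulR_apply, op_apply, tensIncl_snoc, mul_assoc,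
          ← genMul_tmul, ← strand_mul_genMul hc (incl_mem_Homog n x), up,
          zero_add, mul_smul]
    exact congrArg (fun F : tpow V (n + 1) ⟶ tens V ⊗ tens V => F x) h3

lemma powBraid_nil (n : ℕ) (x : tpow V n) : powBraid c n 0 (tmul x (nil V)) = tmul (nil V) x := by
  have : powBraid c n 0 (tmul x (nil V)) =
    (λ_ (tpow V n)).inv ((ρ_ (tpow V n)).hom (tmul x (scal (1 : k)))) := rfl
  rw [this, rightUnitor_tmul, unscal_scal, one_smul]
  rfl

lemma powBraid_snoc (n m : ℕ) (x : tpow V n) (y : tpow V m) (v : V) :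
    powBraid c n (m + 1) (tmul x (snoc y v)) =
      (α_ (tpow V m) V (tpow V n)).inv ((tpow V m ◁ powBraid₁ c n)
        ((α_ (tpow V m) (tpow V n) V).hom (tmul (powBraid c n m (tmul x y)) v))) := by
  have : (α_ (tpow V n) (tpow V m) V).inv (tmul x (snoc y v)) = tmul (tmul x y) v :=
    associator_inv_tmul x y v
  rw [← whiskerRight_tmul, ← this]
  rfl

lemma powBraid_eq (n m : ℕ) (x : tpow V n) (y : tpow V m) :
    (tensIncl V m ⊗ₘ tensIncl V n) (powBraid c n m (tmul x y)) =
      split m n (bb (strand hc) n m 0 • (tensIncl V n x * tensIncl V m y)) := by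
  induction m with
  | zero =>
    have : tmulL x (tpow V 0) ≫ powBraid c n 0 ≫ (tensIncl V 0 ⊗ₘ tensIncl V n) =
        tensIncl V 0 ≫ mulL (tensIncl V n x) ≫ split 0 n := unit_ext <| by
      change (tensIncl V 0 ⊗ₘ tensIncl V n) (powBraid c n 0 (tmul x (nil V))) =
        split 0 n (tensIncl V n x * 1)
      rw [powBraid_nil, tensorHom_tmul, mul_one, one_split (incl_mem_Homog n x)]
      rfl
    exact congrArg (fun F : tpow V 0 ⟶ tens V ⊗ tens V => F y) this
  | succ m ih =>
    have h1 : ∀ (v : V) (s : (tpow V m ⊗ tpow V n : NABan k)),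
        (tensIncl V (m + 1) ⊗ₘ tensIncl V n) ((α_ (tpow V m) V (tpow V n)).inv
          ((tpow V m ◁ powBraid₁ c n) ((α_ (tpow V m) (tpow V n) V).hom (tmul s v)))) =
        split (m + 1) n (up (strand hc) n m •
          (tensMul V ((tensIncl V m ⊗ₘ tensIncl V n) s) * gen V v)) := fun v s => by
      have : tmulR (tpow V m ⊗ tpow V n) v ≫ (α_ (tpow V m) (tpow V n) V).hom ≫
          (tpow V m ◁ powBraid₁ c n) ≫ (α_ (tpow V m) V (tpow V n)).inv ≫
          (tensIncl V (m + 1) ⊗ₘ tensIncl V n) =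
          (tensIncl V m ⊗ₘ tensIncl V n) ≫ tensMul V ≫ mulR (gen V v) ≫
            op (up (strand hc) n m) ≫ split (m + 1) n := tmul_ext fun y x => by
        have h2 : tmulL y (V ⊗ tpow V n) ≫ (α_ (tpow V m) V (tpow V n)).inv ≫
            (tensIncl V (m + 1) ⊗ₘ tensIncl V n) = (gen V ⊗ₘ tensIncl V n) ≫
              (mulL (tensIncl V m y) ▷ tens V) := tmul_ext fun v x => by
          simp only [comp_apply]
          rw [tmulL_apply, associator_inv_tmul, tensorHom_tmul, whiskerRight_tmul, mulL_apply,
            ← tensIncl_snoc]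
          exact tensorHom_tmul _ _ _ _
        have h3 := congrArg (fun F : V ⊗ tpow V n ⟶ tens V ⊗ tens V =>
          F (powBraid₁ c n (tmul x v))) h2
        simp only [comp_apply, tmulR_apply, associator_hom_tmul, whiskerLeft_tmul]
        refine h3.trans ?_
        have hxv := mul_mem_Homog (incl_mem_Homog n x) (gen_mem_Homog v)
        rw [comp_apply, powBraid₁_eq hc,
          mulL_split (by rw [add_comm 1 n]; exact up_mem_Homog hc n 0 hxv) (incl_mem_Homog m y),
          ← Fam_mul_right hc (up_mem n) (incl_mem_Homog m y), tensorHom_tmul, tensMul_eq,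
          mulR_apply, op_apply, mul_assoc, add_zero]
      exact congrArg (fun F : tpow V m ⊗ tpow V n ⟶ tens V ⊗ tens V => F s) this
    have h4 : tmulL x (tpow V (m + 1)) ≫ powBraid c n (m + 1) ≫
        (tensIncl V (m + 1) ⊗ₘ tensIncl V n) = tensIncl V (m + 1) ≫ mulL (tensIncl V n x) ≫
          op (bb (strand hc) n (m + 1) 0) ≫ split (m + 1) n := tpow_ext fun y v => by
      have hxy := mul_mem_Homog (incl_mem_Homog n x) (incl_mem_Homog m y)
      simp only [comp_apply]
      rw [tmulL_apply, powBraid_snoc, h1, ih, mul_split (by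
          rw [add_comm m n]; exact bb_mem_Homog hc n m 0 hxy),
        mulL_apply, op_apply, tensIncl_snoc, ← mul_assoc, bb, zero_add, mul_smul,
        Fam_mul_left hc (bb_mem n m) hxy]
    exact congrArg (fun F : tpow V (m + 1) ⟶ tens V ⊗ tens V => F y) h4

/-- The braiding is a block braiding on strands. -/
lemma split_braid (n m : ℕ) :
    split n m ≫ tensBraid hc = op (bb (strand hc) n m 0) ≫ split m n := by
  refine ext_mul (n := n) (m := m) (fun x hx y hy => ?_) (fun N hN x hx => ?_)
    (fun N hN x hx => ?_)
  · rw [comp_apply, split_mul hx hy]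
    obtain ⟨x, rfl⟩ := hx
    obtain ⟨y, rfl⟩ := hy
    exact (desc₂_incl _ _ n m x y).trans (powBraid_eq hc n m x y)
  · rw [comp_apply, split_of_ne hN hx, map_zero]
  · rw [comp_apply, op_apply, split_of_ne (by omega) (bb_mem_Homog hc n m 0 hx)]

lemma braid_split (n m : ℕ) (z : tens V) :
    tensBraid hc (split n m z) = split m n (bb (strand hc) n m 0 • z) :=
  congrArg (fun F : tens V ⟶ tens V ⊗ tens V => F z) (split_braid hc n m)

lemma braid_splitL (n m l : ℕ) (z : tens V) :
    (tensBraid hc ▷ tens V) (splitL n m l z) = splitL m n l (bb (strand hc) n m 0 • z) := by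
  have : splitL n m l ≫ (tensBraid hc ▷ tens V) =
      op (bb (strand hc) n m 0) ≫ splitL m n l := by
    rw [splitL, Category.assoc, ← comp_whiskerRight, split_braid, comp_whiskerRight,
      ← Category.assoc, split_Fam_left hc (bb_mem n m), Category.assoc, splitL, add_comm m n]
  exact congrArg (fun F : tens V ⟶ (tens V ⊗ tens V) ⊗ tens V => F z) this

lemma braid_splitR (n m l : ℕ) (z : tens V) :
    (tens V ◁ tensBraid hc) (splitR n m l z) = splitR n l m (bb (strand hc) m l n • z) := by
  have : splitR n m l ≫ (tens V ◁ tensBraid hc) =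
      op (bb (strand hc) m l n) ≫ splitR n l m := by
    rw [splitR, Category.assoc, ← MonoidalCategory.whiskerLeft_comp, split_braid,
      MonoidalCategory.whiskerLeft_comp, ← Category.assoc, split_Fam_right hc (bb_mem m l),
      Category.assoc, splitR, add_comm m l, add_zero]
  exact congrArg (fun F : tens V ⟶ tens V ⊗ (tens V ⊗ tens V) => F z) this

end splitting

end NABan

namespace NABan

/-! ### The comultiplication of the tensor algebra -/

lemma sum_antidiagonal_assoc {M : Type*} [AddCommMonoid M] (f : ℕ → ℕ → ℕ → M) (N : ℕ) :
    ∑ p ∈ antidiagonal N, ∑ q ∈ antidiagonal p.1, f q.1 q.2 p.2 =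
      ∑ p ∈ antidiagonal N, ∑ q ∈ antidiagonal p.2, f p.1 q.1 q.2 := by
  rw [Finset.sum_sigma', Finset.sum_sigma']
  refine Finset.sum_nbij' (fun p => ⟨(p.2.1, p.2.2 + p.1.2), (p.2.2, p.1.2)⟩)
    (fun p => ⟨(p.1.1 + p.2.1, p.2.2), (p.1.1, p.2.1)⟩) ?_ ?_ ?_ ?_ ?_
  · rintro ⟨⟨a, l⟩, ⟨i, j⟩⟩ h
    simp only [Finset.mem_sigma, Finset.HasAntidiagonal.mem_antidiagonal] at h ⊢
    refine ⟨?_, trivial⟩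
    omega
  · rintro ⟨⟨a, l⟩, ⟨i, j⟩⟩ h
    simp only [Finset.mem_sigma, Finset.HasAntidiagonal.mem_antidiagonal] at h ⊢
    refine ⟨?_, trivial⟩
    omega
  · rintro ⟨⟨a, l⟩, ⟨i, j⟩⟩ h
    simp only [Finset.mem_sigma, Finset.HasAntidiagonal.mem_antidiagonal] at h
    obtain ⟨h1, rfl⟩ := h
    rfl
  · rintro ⟨⟨a, l⟩, ⟨i, j⟩⟩ h
    simp only [Finset.mem_sigma, Finset.HasAntidiagonal.mem_antidiagonal] at h
    obtain ⟨h1, rfl⟩ := h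
    rfl
  · rintro ⟨⟨a, l⟩, ⟨i, j⟩⟩ h
    rfl

section comultiplication

variable {k : Type u} [NormedField k] [IsUltrametricDist k] [CompleteSpace k] {V W Z : NABan k}

open BraidWord

variable {c : V ⊗ V ⟶ V ⊗ V} (hc : IsContr c)

/-- The braided product on the tensor square of the tensor algebra. -/
def star (X Y : (tens V ⊗ tens V : NABan k)) : (tens V ⊗ tens V : NABan k) :=
  tensMul₂ hc (tmul X Y)

lemma star_tmul (a b a' b' : tens V) : star hc (tmul a b) (tmul a' b') =
    (mulL a ⊗ₘ mulR b') (tensBraid hc (tmul b a')) := by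
  have h : ∀ s : (tens V ⊗ tens V : NABan k), (tensMul V ⊗ₘ tensMul V)
      ((α_ (tens V) (tens V) (tens V ⊗ tens V)).inv (tmul a
        ((α_ (tens V) (tens V) (tens V)).hom (tmul s b')))) = (mulL a ⊗ₘ mulR b') s := fun s => by
    have : tmulR (tens V ⊗ tens V) b' ≫ (α_ (tens V) (tens V) (tens V)).hom ≫
        tmulL a (tens V ⊗ (tens V ⊗ tens V)) ≫ (α_ (tens V) (tens V) (tens V ⊗ tens V)).inv ≫
        (tensMul V ⊗ₘ tensMul V) = mulL a ⊗ₘ mulR b' := tmul_ext fun x y => by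
      simp only [comp_apply, tmulR_apply, tmulL_apply, associator_hom_tmul, associator_inv_tmul,
        tensorHom_tmul]
      rfl
    exact congrArg (fun F : tens V ⊗ tens V ⟶ tens V ⊗ tens V => F s) this
  rw [← h, star, tensMul₂, midBraid]
  simp only [comp_apply, associator_hom_tmul, associator_inv_tmul, whiskerLeft_tmul,
    whiskerRight_tmul]

lemma mulLR_split {n m i l : ℕ} {z x y : tens V} (hz : z ∈ Homog V (n + m)) (hx : x ∈ Homog V i)
    (hy : y ∈ Homog V l) :
    (mulL x ⊗ₘ mulR y) (split n m z) = split (i + n) (m + l) (x * z * y) := by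
  have : (mulL x ⊗ₘ mulR y : tens V ⊗ tens V ⟶ _) = (mulL x ▷ tens V) ≫ (tens V ◁ mulR y) :=
    MonoidalCategory.tensorHom_def _ _
  rw [this, comp_apply, mulL_split hz hx, mulR_split (by
    rw [add_assoc]; exact mul_mem_Homog hx hz) hy]

/-- In the braided product only the inner blocks, of lengths `j` and `n`, have to cross; the `i`
strands of the outer left block account for the offset of the block braiding. -/
lemma star_split {i j n m : ℕ} {z w : tens V} (hz : z ∈ Homog V (i + j))
    (hw : w ∈ Homog V (n + m)) : star hc (split i j z) (split n m w) =
      split (i + n) (j + m) (bb (strand hc) j n i • (z * w)) := by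
  refine eqOn_mul (f := split i j ≫ tmulR _ (split n m w) ≫ tensMul₂ hc)
    (g := mulR w ≫ op (bb (strand hc) j n i) ≫ split (i + n) (j + m)) (fun a ha b hb => ?_) hz
  refine eqOn_mul (f := split n m ≫ tmulL (split i j (a * b)) _ ≫ tensMul₂ hc)
    (g := mulL (a * b) ≫ op (bb (strand hc) j n i) ≫ split (i + n) (j + m))
    (fun a' ha' b' hb' => ?_) hw
  simp only [comp_apply, tmulL_apply, mulL_apply, op_apply]
  have h1 := mul_mem_Homog hb ha'
  have h2 : bb (strand hc) j n i • (a * b * (a' * b')) =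
      a * (bb (strand hc) j n 0 • (b * a')) * b' := by
    rw [show a * b * (a' * b') = a * (b * a') * b' by simp only [mul_assoc], mul_assoc a,
      ← add_zero i, Fam_mul_right hc (bb_mem j n) ha, Fam_mul_left hc (bb_mem j n) h1, mul_assoc]
  refine (congrArg₂ (star hc) (split_mul ha hb) (split_mul ha' hb')).trans ?_
  rw [star_tmul, ← split_mul hb ha', braid_split, mulLR_split (by
    rw [add_comm n j]; exact bb_mem_Homog hc j n 0 h1) ha hb', h2]

lemma star_ext {f g : tens V ⊗ tens V ⟶ Z}
    (h : ∀ n m, ∀ z ∈ Homog V (n + m), f (split n m z) = g (split n m z)) (x) : f x = g x := by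
  rw [split_ext h]

/-- Both sides are deconcatenations of the same triple product after a word in block braidings. The
words agree because a block crosses two blocks in succession and disjoint block braidings commute.
-/
lemma star_assoc (hb : IsPreBraiding c) (X Y T : (tens V ⊗ tens V : NABan k)) :
    star hc (star hc X Y) T = star hc X (star hc Y T) := by
  let L := fun X : (tens V ⊗ tens V : NABan k) => tmulL X (tens V ⊗ tens V) ≫ tensMul₂ hc
  let R := fun X : (tens V ⊗ tens V : NABan k) => tmulR (tens V ⊗ tens V) X ≫ tensMul₂ hc
  refine star_ext (f := R Y ≫ R T) (g := R (star hc Y T)) (fun i j z hz => ?_) X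
  refine star_ext (f := L (split i j z) ≫ R T) (g := R T ≫ L (split i j z))
    (fun n m w hw => ?_) Y
  refine star_ext (f := L (star hc (split i j z) (split n m w)))
    (g := L (split n m w) ≫ L (split i j z)) (fun p q t ht => ?_) T
  change star hc (star hc (split i j z) (split n m w)) (split p q t) =
    star hc (split i j z) (star hc (split n m w) (split p q t))
  have hzw := bb_mem_Homog hc j n i (mul_mem_Homog hz hw)
  have hwt := bb_mem_Homog hc m p n (mul_mem_Homog hw ht)
  have hs := isBraidSeq_strand hc hb
  rw [star_split hc hz hw, star_split hc hw ht, star_split hc (by convert hzw using 2; ring) ht,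
    star_split hc hz (by convert hwt using 2; ring)]
  have e1 : (bb (strand hc) j n i • (z * w)) * t = bb (strand hc) j n i • (z * w * t) := by
    have := Fam_mul_left hc (Fam_mono (m := i + j + (n + m)) (by omega)
      (Fam_shift (bb_mem (c := strand hc) j n) i)) (mul_mem_Homog hz hw) t
    simpa only [zero_add] using this.symm
  have e2 : z * (bb (strand hc) m p n • (w * t)) =
      bb (strand hc) m p (i + j + n) • (z * w * t) := by
    rw [mul_assoc, Fam_mul_right hc (bb_mem m p) hz]
  rw [e1, e2, smul_smul, smul_smul, bb_add_left hs, bb_add_right, mul_assoc, mul_assoc,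
    show i + n + j = i + j + n by omega,
    ← hs.commute_Fam (o := i) (o' := i + j + n) (by omega) (bb_mem j n) (bb_mem m p)]
  simp only [add_assoc, mul_assoc]

lemma one_tmul_one : tmul 1 1 = split 0 0 (1 : tens V) := (one_split one_mem_Homog).symm

lemma star_one (X : (tens V ⊗ tens V : NABan k)) : star hc X (tmul 1 1) = X := by
  refine star_ext (f := tmulR (tens V ⊗ tens V) (tmul 1 1) ≫ tensMul₂ hc) (g := 𝟙 _)
    (fun i j z hz => ?_) X
  change star hc (split i j z) (tmul 1 1) = split i j z
  rw [one_tmul_one, star_split hc hz one_mem_Homog, bb_zero, one_smul, mul_one]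
  rfl

variable {hc} in
lemma comul_one : (tensHopf hc).comul 1 = tmul 1 1 := by
  refine (desc_incl (powComul hc) (isContr_powComul hc) 0 (scal 1)).trans ?_
  change (tensOne V ⊗ₘ tensOne V) (tmul (scal 1) (scal 1)) = _
  rw [tensorHom_tmul]
  rfl

lemma genComul_apply (v : V) : genComul V v = tmul 1 (gen V v) + tmul (gen V v) 1 := by
  change (tensOne V ⊗ₘ gen V) (tmul (scal 1) v) + (gen V ⊗ₘ tensOne V) (tmul v (scal 1)) = _
  rw [tensorHom_tmul, tensorHom_tmul]
  rfl

lemma comul_incl (n : ℕ) (x : tpow V n) :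
    (tensHopf hc).comul (tensIncl V n x) = powComul hc n x :=
  desc_incl (powComul hc) (isContr_powComul hc) n x

lemma powComul_snoc (n : ℕ) (x : tpow V n) (v : V) :
    powComul hc (n + 1) (snoc x v) = star hc (powComul hc n x) (genComul V v) :=
  congrArg (tensMul₂ hc) (tensorHom_tmul _ _ x v)

lemma comul_mul_gen {n : ℕ} {x : tens V} (hx : x ∈ Homog V n) (v : V) :
    (tensHopf hc).comul (x * gen V v) = star hc ((tensHopf hc).comul x) (genComul V v) := by
  obtain ⟨x, rfl⟩ := hx
  rw [← tensIncl_snoc, comul_incl, comul_incl, powComul_snoc]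

/-- The comultiplication is defined by multiplying with one generator at a time on the right, so the
general product follows by induction on the degree of `y` from `star_assoc`. -/
lemma comul_mul (hb : IsPreBraiding c) (x y : tens V) :
    (tensHopf hc).comul (x * y) = star hc ((tensHopf hc).comul x) ((tensHopf hc).comul y) := by
  let D := tensHopf hc
  have key : tensMul V ≫ D.comul = (D.comul ⊗ₘ D.comul) ≫ tensMul₂ hc := by
    refine tens_ext₂ fun n x hx m y hy => ?_
    rw [comp_apply, comp_apply, tensorHom_tmul]
    change D.comul (x * y) = star hc (D.comul x) (D.comul y)
    induction m generalizing y with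
    | zero =>
      obtain ⟨a, rfl⟩ := eq_smul_of_mem_Homog_zero hy
      rw [mul_smul_comm, mul_one, map_smul, map_smul, comul_one, star, tmul_smul, map_smul]
      exact congrArg (a • ·) (star_one hc _).symm
    | succ m ih =>
      refine eqOn_gen (f := mulL x ≫ D.comul)
        (g := D.comul ≫ tmulL (D.comul x) (tens V ⊗ tens V) ≫ tensMul₂ hc) (fun y hy v => ?_) hy
      change D.comul (x * (y * gen V v)) = star hc (D.comul x) (D.comul (y * gen V v))
      rw [← mul_assoc, comul_mul_gen hc (mul_mem_Homog hx hy), ih y hy, star_assoc hc hb,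
        comul_mul_gen hc hy]
  have := congrArg (fun F : tens V ⊗ tens V ⟶ tens V ⊗ tens V => F (tmul x y)) key
  simp only [comp_apply, tensorHom_tmul] at this
  exact this

/-- The comultiplication is a sum of deconcatenations of shuffles. -/
lemma comul_eq {N : ℕ} {z : tens V} (hz : z ∈ Homog V N) : (tensHopf hc).comul z =
    ∑ p ∈ antidiagonal N, split p.1 p.2 (shuf (strand hc) p.1 p.2 0 • z) := by
  induction N generalizing z with
  | zero =>
    obtain ⟨a, rfl⟩ := eq_smul_of_mem_Homog_zero hz
    rw [Finset.Nat.antidiagonal_zero, Finset.sum_singleton, shuf_zero_left, one_smul, map_smul,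
      comul_one, map_smul, one_tmul_one]
  | succ N ih =>
    have := eqOn_gen (f := (tensHopf hc).comul) (g := ∑ p ∈ antidiagonal (N + 1),
      op (shuf (strand hc) p.1 p.2 0) ≫ split p.1 p.2) (fun x hx v => ?_) hz
    · rw [this, sum_apply]
      rfl
    let G : ℕ → ℕ → End (tens V) →+ (tens V ⊗ tens V : NABan k) := fun i j =>
      AddMonoidHom.mk' (fun e => split i j (e • (x * gen V v))) fun e e' => by
        rw [add_smul, map_add]
    rw [sum_apply, comul_mul_gen hc hx, ih hx, star, ← tmulR_apply, map_sum, map_sum]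
    -- Multiplication by `1 ⊗ v + v ⊗ 1` produces two terms for each `p`: in the first `v` stays at
    -- the end without a crossing, in the second it passes the `p.2` strands of the right factor.
    -- These are the two terms of the shuffle recursion.
    refine Eq.trans ?_ (sum_shuf (c := strand hc) G N 0).symm
    refine Finset.sum_congr rfl fun p hp => ?_
    rw [Finset.HasAntidiagonal.mem_antidiagonal] at hp
    have hs := shuf_mem_Homog hc p.1 p.2 0 hx
    have hm : shuf (strand hc) p.1 p.2 0 • (x * gen V v) =
        (shuf (strand hc) p.1 p.2 0 • x) * gen V v :=
      Fam_mul_left hc (shuf_mem p.1 p.2) (hp.symm ▸ hx) _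
    rw [tmulR_apply, genComul_apply, tmul_add, map_add, ← one_split (gen_mem_Homog v),
      ← split_one (gen_mem_Homog v)]
    refine congrArg₂ (· + ·) ?_ ?_
    · refine (star_split hc (hp.symm ▸ hs) (gen_mem_Homog v)).trans ?_
      rw [bb_zero, one_smul, ← hm]
      rfl
    · refine (star_split hc (hp.symm ▸ hs) (gen_mem_Homog v)).trans ?_
      rw [bb_one_right, ← hm, smul_smul]
      simp only [G, AddMonoidHom.mk'_apply, zero_add]
      rfl

end comultiplication

end NABan

namespace NABan

/-! ### The tensor algebra is a pre-braided bialgebra -/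

section bialgebra

variable {k : Type u} [NormedField k] [IsUltrametricDist k] [CompleteSpace k] {V X Z : NABan k}

lemma unit_tmul_ext {f g : 𝟙_ (NABan k) ⊗ X ⟶ Z}
    (h : ∀ x, f (tmul (scal 1) x) = g (tmul (scal 1) x)) : f = g := by
  rw [← cancel_epi (λ_ X).inv]
  exact hom_ext h

lemma tmul_unit_ext {f g : X ⊗ 𝟙_ (NABan k) ⟶ Z}
    (h : ∀ x, f (tmul x (scal 1)) = g (tmul x (scal 1))) : f = g := by
  rw [← cancel_epi (ρ_ X).inv]
  exact hom_ext h

lemma sum_tmul {Y : NABan k} {ι : Type*} (s : Finset ι) (f : ι → X) (y : Y) :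
    tmul (∑ i ∈ s, f i) y = ∑ i ∈ s, tmul (f i) y := map_sum (Hom.lin (tmulR X y)) f s

lemma tmul_sum {Y : NABan k} {ι : Type*} (s : Finset ι) (x : X) (f : ι → Y) :
    tmul x (∑ i ∈ s, f i) = ∑ i ∈ s, tmul x (f i) := map_sum (Hom.lin (tmulL x Y)) f s

open BraidWord

variable {c : V ⊗ V ⟶ V ⊗ V} (hc : IsContr c)

lemma tensHopf_mul (x y : tens V) : (tensHopf hc).mul (tmul x y) = x * y := rfl
lemma tensHopf_one : (tensHopf hc).one (scal 1) = 1 := rfl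

lemma counit_one : (tensHopf hc).counit 1 = scal (1 : k) :=
  desc_incl (counitComp V) (isContr_counitComp V) 0 (scal 1)

lemma counit_of_mem {n : ℕ} {x : tens V} (hx : x ∈ Homog V (n + 1)) :
    (tensHopf hc).counit x = 0 := by
  obtain ⟨x, rfl⟩ := hx
  exact desc_incl (counitComp V) (isContr_counitComp V) (n + 1) x

lemma counit_split_left {n m : ℕ} {z : tens V} (hz : z ∈ Homog V (n + 1 + m)) :
    ((tensHopf hc).counit ▷ tens V) (split (n + 1) m z) = 0 := by
  refine eqOn_mul (f := split (n + 1) m ≫ ((tensHopf hc).counit ▷ tens V)) (g := 0)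
    (fun x hx y hy => ?_) hz
  rw [comp_apply, split_mul hx hy, whiskerRight_tmul, counit_of_mem hc hx, zero_tmul]
  rfl

lemma counit_split_right {n m : ℕ} {z : tens V} (hz : z ∈ Homog V (n + (m + 1))) :
    (tens V ◁ (tensHopf hc).counit) (split n (m + 1) z) = 0 := by
  refine eqOn_mul (f := split n (m + 1) ≫ (tens V ◁ (tensHopf hc).counit)) (g := 0)
    (fun x hx y hy => ?_) hz
  rw [comp_apply, split_mul hx hy, whiskerLeft_tmul, counit_of_mem hc hy, tmul_zero]
  rfl

lemma counit_one_split {m : ℕ} {z : tens V} (hz : z ∈ Homog V m) :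
    ((tensHopf hc).counit ▷ tens V) (split 0 m z) = tmul (scal (1 : k)) z := by
  rw [one_split hz, whiskerRight_tmul, counit_one]

lemma counit_split_one {m : ℕ} {z : tens V} (hz : z ∈ Homog V m) :
    (tens V ◁ (tensHopf hc).counit) (split m 0 z) = tmul z (scal (1 : k)) := by
  rw [split_one hz, whiskerLeft_tmul, counit_one]

lemma comul_split_left {n l : ℕ} {z : tens V} (hz : z ∈ Homog V (n + l)) :
    ((tensHopf hc).comul ▷ tens V) (split n l z) =
      ∑ q ∈ antidiagonal n, splitL q.1 q.2 l (shuf (strand hc) q.1 q.2 0 • z) := by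
  refine (eqOn_mul (f := split n l ≫ ((tensHopf hc).comul ▷ tens V))
    (g := ∑ q ∈ antidiagonal n, op (shuf (strand hc) q.1 q.2 0) ≫ splitL q.1 q.2 l)
    (fun x hx y hy => ?_) hz).trans (sum_apply _ _ _)
  rw [sum_apply, comp_apply, split_mul hx hy, whiskerRight_tmul, comul_eq hc hx, sum_tmul]
  refine Finset.sum_congr rfl fun q hq => ?_
  rw [Finset.HasAntidiagonal.mem_antidiagonal] at hq
  subst hq
  rw [comp_apply, op_apply, Fam_mul_left hc (shuf_mem _ _) hx, splitL, comp_apply,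
    split_mul (shuf_mem_Homog hc _ _ _ hx) hy, whiskerRight_tmul]

lemma comul_split_right {n l : ℕ} {z : tens V} (hz : z ∈ Homog V (n + l)) :
    (tens V ◁ (tensHopf hc).comul) (split n l z) =
      ∑ q ∈ antidiagonal l, splitR n q.1 q.2 (shuf (strand hc) q.1 q.2 n • z) := by
  refine (eqOn_mul (f := split n l ≫ (tens V ◁ (tensHopf hc).comul))
    (g := ∑ q ∈ antidiagonal l, op (shuf (strand hc) q.1 q.2 n) ≫ splitR n q.1 q.2)
    (fun x hx y hy => ?_) hz).trans (sum_apply _ _ _)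
  rw [sum_apply, comp_apply, split_mul hx hy, whiskerLeft_tmul, comul_eq hc hy, tmul_sum]
  refine Finset.sum_congr rfl fun q hq => ?_
  rw [Finset.HasAntidiagonal.mem_antidiagonal] at hq
  subst hq
  have := Fam_mul_right hc (shuf_mem (c := strand hc) q.1 q.2) hx y 0
  rw [comp_apply, op_apply, ← add_zero n, this, add_zero, splitR, comp_apply,
    split_mul hx (shuf_mem_Homog hc _ _ _ hy), whiskerLeft_tmul]

lemma braid_tmul {n m : ℕ} {x y : tens V} (hx : x ∈ Homog V n) (hy : y ∈ Homog V m) :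
    tensBraid hc (tmul x y) = split m n (bb (strand hc) n m 0 • (x * y)) := by
  rw [← split_mul hx hy, braid_split]

lemma braid_one_left (x : tens V) : tensBraid hc (tmul 1 x) = tmul x 1 := by
  have : tmulL 1 (tens V) ≫ tensBraid hc = tmulR (tens V) (1 : tens V) :=
    tens_ext_Homog fun n x hx => by
      rw [comp_apply, tmulL_apply, braid_tmul hc one_mem_Homog hx, zero_bb, one_smul, one_mul,
        split_one hx, tmulR_apply]
  exact congrArg (fun F : tens V ⟶ tens V ⊗ tens V => F x) this

lemma braid_one_right (x : tens V) : tensBraid hc (tmul x 1) = tmul 1 x := by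
  have : tmulR (tens V) 1 ≫ tensBraid hc = tmulL (1 : tens V) (tens V) :=
    tens_ext_Homog fun n x hx => by
      rw [comp_apply, tmulR_apply, braid_tmul hc hx one_mem_Homog, bb_zero, one_smul, mul_one,
        one_split hx, tmulL_apply]
  exact congrArg (fun F : tens V ⟶ tens V ⊗ tens V => F x) this

/-- On a deconcatenation into three blocks both sides are words in block braidings, and they agree
because crossing a third block is natural for the braiding of the first two. -/
lemma hexagon_tensBraid (hb : IsPreBraiding c) : IsPreBraiding (tensBraid hc) := by
  have hs := isBraidSeq_strand hc hb
  refine splitL_ext fun n m l z hz => ?_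
  simp only [comp_apply, braid_splitL, splitL_assoc_apply, braid_splitR, splitR_assoc_apply]
  have h := bb_nat_left hs (bb_mem (c := strand hc) n m) l 0
  have h2 : bb (strand hc) (n + m) l 0 = bb (strand hc) m l 0 * bb (strand hc) n l m := by
    rw [add_comm, bb_add_left hs, zero_add]
  have h3 : bb (strand hc) (n + m) l 0 = bb (strand hc) n l 0 * bb (strand hc) m l n := by
    rw [bb_add_left hs, zero_add]
  rw [smul_smul, smul_smul, smul_smul, smul_smul, ← h2, h, h3, zero_add, mul_assoc]

/-- On deconcatenated elements each axiom is an identity of words: coassociativity is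
`shuf_coassoc`, the braiding of products is additivity of `bb` in a block, and the braiding of
coproducts is naturality of `bb` applied to `shuf`. -/
lemma isPreBraidedBialgebra_tensHopf (hb : IsPreBraiding c) :
    (tensHopf hc).IsPreBraidedBialgebra where
  one_mul := unit_tmul_ext fun x => by
    rw [comp_apply, whiskerRight_tmul, tensHopf_one, tensHopf_mul, one_mul, leftUnitor_tmul,
      unscal_scal, one_smul]
  mul_one := tmul_unit_ext fun x => by
    rw [comp_apply, whiskerLeft_tmul, tensHopf_one, tensHopf_mul, mul_one, rightUnitor_tmul,
      unscal_scal, one_smul]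
  mul_assoc := tmul_ext₃ fun x y z => by
    simp only [comp_apply, whiskerRight_tmul, tensHopf_mul, associator_hom_tmul, whiskerLeft_tmul,
      mul_assoc]
  counit_comul := tens_ext_Homog fun N z hz => by
    -- In every other term the left factor has positive degree and is killed by the counit.
    rw [comp_apply, comul_eq hc hz, map_sum, Finset.sum_eq_single (0, N)]
    · rw [shuf_zero_left, one_smul]
      exact counit_one_split hc hz
    · rintro ⟨i, j⟩ hp hne
      rw [Finset.HasAntidiagonal.mem_antidiagonal] at hp
      rcases i with _ | i
      · exact absurd (by rw [← hp, zero_add]) hne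
      · exact counit_split_left hc (hp.symm ▸ shuf_mem_Homog hc _ _ _ hz)
    · intro h
      exact absurd (Finset.HasAntidiagonal.mem_antidiagonal.mpr (zero_add N)) h
  comul_counit := tens_ext_Homog fun N z hz => by
    rw [comp_apply, comul_eq hc hz, map_sum, Finset.sum_eq_single (N, 0)]
    · rw [shuf_zero_right, one_smul]
      exact counit_split_one hc hz
    · rintro ⟨i, j⟩ hp hne
      rw [Finset.HasAntidiagonal.mem_antidiagonal] at hp
      rcases j with _ | j
      · exact absurd (by rw [← hp, add_zero]) hne
      · exact counit_split_right hc (hp.symm ▸ shuf_mem_Homog hc _ _ _ hz)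
    · intro h
      exact absurd (Finset.HasAntidiagonal.mem_antidiagonal.mpr (add_zero N)) h
  comul_assoc := tens_ext_Homog fun N z hz => by
    have hs := isBraidSeq_strand hc hb
    rw [comp_apply, comp_apply, comp_apply, comul_eq hc hz, map_sum, map_sum, map_sum]
    refine Eq.trans (Finset.sum_congr rfl fun p hp => ?_)
      ((sum_antidiagonal_assoc (fun i j l => splitR i j l
        ((shuf (strand hc) i j 0 * shuf (strand hc) (i + j) l 0) • z)) N).trans
      (Finset.sum_congr rfl fun p hp => ?_))
    · rw [Finset.HasAntidiagonal.mem_antidiagonal] at hp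
      rw [comul_split_left hc (hp.symm ▸ shuf_mem_Homog hc _ _ _ hz), map_sum]
      refine Finset.sum_congr rfl fun q hq => ?_
      rw [Finset.HasAntidiagonal.mem_antidiagonal] at hq
      rw [splitL_assoc_apply, smul_smul, hq]
    · rw [Finset.HasAntidiagonal.mem_antidiagonal] at hp
      rw [comul_split_right hc (hp.symm ▸ shuf_mem_Homog hc _ _ _ hz)]
      refine Finset.sum_congr rfl fun q hq => ?_
      rw [Finset.HasAntidiagonal.mem_antidiagonal] at hq
      rw [smul_smul, shuf_coassoc hs, hq, zero_add]
  hexagon := hexagon_tensBraid hc hb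
  one_braid := unit_tmul_ext fun x => by
    simp only [comp_apply, whiskerRight_tmul, tensHopf_one, leftUnitor_tmul, unscal_scal, one_smul,
      rightUnitor_inv_apply, whiskerLeft_tmul]
    exact braid_one_left hc x
  braid_one := tmul_unit_ext fun x => by
    simp only [comp_apply, whiskerLeft_tmul, tensHopf_one, rightUnitor_tmul, unscal_scal, one_smul,
      leftUnitor_inv_apply, whiskerRight_tmul]
    exact braid_one_right hc x
  mul_braid := splitL_ext fun n m l z hz => by
    change tensBraid hc ((tensMul V ▷ tens V) (splitL n m l z)) = (tens V ◁ tensMul V)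
      ((α_ (tens V) (tens V) (tens V)).hom ((tensBraid hc ▷ tens V)
        ((α_ (tens V) (tens V) (tens V)).inv ((tens V ◁ tensBraid hc)
        ((α_ (tens V) (tens V) (tens V)).hom (splitL n m l z))))))
    have h : l + n + m = n + m + l := by omega
    rw [splitL_assoc_apply, braid_splitR, splitR_assoc_apply, braid_splitL, splitL_assoc_apply,
      mul_splitL hz, braid_split, bb_add_left (isBraidSeq_strand hc hb), zero_add, mul_splitR
        (h ▸ bb_mem_Homog hc _ _ _ (bb_mem_Homog hc _ _ _ hz)), mul_smul]
  braid_mul := splitR_ext fun n m l z hz => by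
    change tensBraid hc ((tens V ◁ tensMul V) (splitR n m l z)) = (tensMul V ▷ tens V)
      ((α_ (tens V) (tens V) (tens V)).inv ((tens V ◁ tensBraid hc)
        ((α_ (tens V) (tens V) (tens V)).hom ((tensBraid hc ▷ tens V)
        ((α_ (tens V) (tens V) (tens V)).inv (splitR n m l z))))))
    have h : m + l + n = n + m + l := by omega
    rw [splitR_assoc_apply, braid_splitL, splitL_assoc_apply, braid_splitR, splitR_assoc_apply,
      mul_splitR hz, braid_split, bb_add_right, zero_add, mul_splitL
        (h ▸ bb_mem_Homog hc _ _ _ (bb_mem_Homog hc _ _ _ hz)), mul_smul]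
  braid_counit_left := split_ext fun n m z hz => by
    change (λ_ (tens V)).hom (((tensHopf hc).counit ▷ tens V) (tensBraid hc (split n m z))) =
      (ρ_ (tens V)).hom ((tens V ◁ (tensHopf hc).counit) (split n m z))
    rcases m with _ | m
    · rw [add_zero] at hz
      rw [braid_split, bb_zero, one_smul, counit_one_split hc hz, counit_split_one hc hz,
        leftUnitor_tmul, rightUnitor_tmul]
    · rw [braid_split, counit_split_left hc (by rw [add_comm]; exact bb_mem_Homog hc _ _ _ hz),
        counit_split_right hc hz, map_zero, map_zero]
  braid_counit_right := split_ext fun n m z hz => by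
    change (ρ_ (tens V)).hom ((tens V ◁ (tensHopf hc).counit) (tensBraid hc (split n m z))) =
      (λ_ (tens V)).hom (((tensHopf hc).counit ▷ tens V) (split n m z))
    rcases n with _ | n
    · rw [zero_add] at hz
      rw [braid_split, zero_bb, one_smul, counit_one_split hc hz, counit_split_one hc hz,
        leftUnitor_tmul, rightUnitor_tmul]
    · rw [braid_split, counit_split_right hc (by rw [add_comm]; exact bb_mem_Homog hc _ _ _ hz),
        counit_split_left hc hz, map_zero, map_zero]
  comul_braid := split_ext fun n l z hz => by
    have hs := isBraidSeq_strand hc hb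
    change (α_ (tens V) (tens V) (tens V)).hom ((tensBraid hc ▷ tens V)
      ((α_ (tens V) (tens V) (tens V)).inv ((tens V ◁ tensBraid hc)
      ((α_ (tens V) (tens V) (tens V)).hom (((tensHopf hc).comul ▷ tens V) (split n l z)))))) =
      (tens V ◁ (tensHopf hc).comul) (tensBraid hc (split n l z))
    rw [comul_split_left hc hz, braid_split, comul_split_right hc (by
      rw [add_comm]; exact bb_mem_Homog hc _ _ _ hz)]
    simp only [map_sum]
    refine Finset.sum_congr rfl fun q hq => ?_
    rw [Finset.HasAntidiagonal.mem_antidiagonal] at hq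
    subst hq
    have h := bb_nat_left hs (shuf_mem (c := strand hc) q.1 q.2) l 0
    rw [bb_add_left hs, zero_add, zero_add] at h
    rw [splitL_assoc_apply, braid_splitR, splitR_assoc_apply, braid_splitL, splitL_assoc_apply,
      smul_smul, smul_smul, h, bb_add_left hs, zero_add, mul_smul]
  braid_comul := split_ext fun n l z hz => by
    have hs := isBraidSeq_strand hc hb
    change (α_ (tens V) (tens V) (tens V)).inv ((tens V ◁ tensBraid hc)
      ((α_ (tens V) (tens V) (tens V)).hom ((tensBraid hc ▷ tens V)
      ((α_ (tens V) (tens V) (tens V)).inv ((tens V ◁ (tensHopf hc).comul) (split n l z)))))) =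
      ((tensHopf hc).comul ▷ tens V) (tensBraid hc (split n l z))
    rw [comul_split_right hc hz, braid_split, comul_split_left hc (by
      rw [add_comm]; exact bb_mem_Homog hc _ _ _ hz)]
    simp only [map_sum]
    refine Finset.sum_congr rfl fun q hq => ?_
    rw [Finset.HasAntidiagonal.mem_antidiagonal] at hq
    subst hq
    have h := bb_nat_right hs (shuf_mem (c := strand hc) q.1 q.2) n 0
    rw [bb_add_right, zero_add, zero_add] at h
    rw [splitR_assoc_apply, braid_splitL, splitL_assoc_apply, braid_splitR, splitR_assoc_apply,
      smul_smul, smul_smul, h, bb_add_right, zero_add, mul_smul]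
  mul_comul := tmul_ext fun x y => by
    rw [comp_apply, comp_apply, tensorHom_tmul]
    exact comul_mul hc hb x y
  one_comul := unit_ext <| by
    simp only [comp_apply, tensHopf_one, comul_one, leftUnitor_inv_apply, tensorHom_tmul]
  one_counit := unit_ext <| by
    rw [comp_apply, tensHopf_one, counit_one, id_apply]
  mul_counit := tens_ext₂ fun n x hx m y hy => by
    rw [comp_apply, comp_apply, tensHopf_mul, tensorHom_tmul, tmul_unit_eq]
    rcases n with _ | n
    · obtain ⟨a, rfl⟩ := eq_smul_of_mem_Homog_zero hx
      rw [smul_mul_assoc, one_mul, map_smul, map_smul, counit_one]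
      exact congrArg (· • _) (mul_one a).symm
    · rw [counit_of_mem hc hx, counit_of_mem hc (n := n + m) (by
        rw [show n + m + 1 = n + 1 + m by omega]; exact mul_mem_Homog hx hy)]
      exact (zero_smul k _).symm

end bialgebra

/-! ### The grading and the antipode -/

section grading

variable {k : Type u} [NormedField k] [IsUltrametricDist k] [CompleteSpace k] {V : NABan k}

variable (k) in
/-- The element `tⁿ` of `k{t}`. -/
def tn (n : ℕ) : kt k := tpower k n (scal 1)

lemma ktMul_tn (n m : ℕ) : ktMul k (tmul (tn k n) (tn k m)) = tn k (n + m) := by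
  refine (desc₂_incl (E := fun _ => 𝟙_ (NABan k)) (F := fun _ => 𝟙_ (NABan k))
    (fun n m => (λ_ (𝟙_ (NABan k))).hom ≫ tpower k (n + m))
    (fun _ _ => isContr_leftUnitor.comp (isContr_tpower _)) n m (scal (1 : k))
    (scal (1 : k))).trans ?_
  rw [comp_apply, leftUnitor_tmul, unscal_scal, one_smul]
  rfl

lemma ktComul_tn (n : ℕ) : ktComul k (tn k n) = tmul (tn k n) (tn k n) :=
  (desc_incl (E := fun _ => 𝟙_ (NABan k))
    (fun n => (λ_ (𝟙_ (NABan k))).inv ≫ (tpower k n ⊗ₘ tpower k n)) _ n (scal (1 : k))).trans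
    (tensorHom_tmul _ _ _ _)

lemma ktCounit_tn (n : ℕ) : ktCounit k (tn k n) = scal 1 :=
  desc_incl (E := fun _ => 𝟙_ (NABan k)) (fun _ => 𝟙 _) (fun _ => isContr_id) n (scal (1 : k))

lemma tensorμ_tmul {A B C D : NABan k} (a : A) (b : B) (c : C) (d : D) :
    tensorμ A B C D (tmul (tmul a b) (tmul c d)) = tmul (tmul a c) (tmul b d) := by
  simp only [tensorμ, comp_apply, associator_hom_tmul, whiskerLeft_tmul, associator_inv_tmul,
    whiskerRight_tmul, braiding_tmul]

open BraidWord

variable {c : V ⊗ V ⟶ V ⊗ V} (hc : IsContr c)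

lemma coact_of_mem {n : ℕ} {x : tens V} (hx : x ∈ Homog V n) :
    (tensHopf hc).coact x = tmul (tn k n) x := by
  obtain ⟨x, rfl⟩ := hx
  exact (desc_incl (fun n => (λ_ (tpow V n)).inv ≫ (tpower k n ⊗ₘ tensIncl V n))
    (fun n => isContr_leftUnitor_inv.comp ((isContr_tpower n).tensorHom (isContr_incl n)))
    n x).trans
    (tensorHom_tmul _ _ _ _)

lemma coact₂_tmul {n m : ℕ} {x y : tens V} (hx : x ∈ Homog V n) (hy : y ∈ Homog V m) :
    (tensHopf hc).coact₂ (tmul x y) = tmul (tmul (tn k n) (tn k m)) (tmul x y) := by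
  rw [HopfData.coact₂, comp_apply, tensorHom_tmul, coact_of_mem hc hx, coact_of_mem hc hy,
    tensorμ_tmul]

lemma coact₂_split {n m : ℕ} {z : tens V} (hz : z ∈ Homog V (n + m)) :
    (tensHopf hc).coact₂ (split n m z) = tmul (tmul (tn k n) (tn k m)) (split n m z) :=
  eqOn_mul (f := split n m ≫ (tensHopf hc).coact₂)
    (g := split n m ≫ tmulL (tmul (tn k n) (tn k m)) _) (fun x hx y hy => by
      rw [comp_apply, comp_apply, split_mul hx hy, coact₂_tmul hc hx hy, tmulL_apply]) hz

lemma isGraded_tensHopf : (tensHopf hc).IsGraded where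
  counit_coact := tens_ext_Homog fun n x hx => by
    rw [comp_apply, coact_of_mem hc hx, whiskerRight_tmul, ktCounit_tn, leftUnitor_inv_apply]
  coassoc := tens_ext_Homog fun n x hx => by
    simp only [comp_apply]
    rw [coact_of_mem hc hx, whiskerRight_tmul, ktComul_tn, associator_hom_tmul, whiskerLeft_tmul,
      coact_of_mem hc hx]
  one := unit_ext <| by
    rw [comp_apply, tensHopf_one, coact_of_mem hc one_mem_Homog, comp_apply, leftUnitor_inv_apply,
      tensorHom_tmul]
    rfl
  mul := tens_ext₂ fun n x hx m y hy => by
    rw [comp_apply, comp_apply, coact₂_tmul hc hx hy, tensorHom_tmul, ktMul_tn, tensHopf_mul,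
      coact_of_mem hc (mul_mem_Homog hx hy)]
  counit := tens_ext_Homog fun n x hx => by
    simp only [comp_apply]
    rw [coact_of_mem hc hx, whiskerLeft_tmul, leftUnitor_inv_apply, whiskerRight_tmul]
    rcases n with _ | n
    · rfl
    · rw [counit_of_mem hc hx, tmul_zero, tmul_zero]
  comul := tens_ext_Homog fun N x hx => by
    simp only [comp_apply]
    rw [coact_of_mem hc hx, whiskerLeft_tmul, comul_eq hc hx, map_sum, map_sum, tmul_sum]
    refine Finset.sum_congr rfl fun p hp => ?_
    rw [Finset.HasAntidiagonal.mem_antidiagonal] at hp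
    rw [coact₂_split hc (hp.symm ▸ shuf_mem_Homog hc _ _ _ hx), whiskerRight_tmul, ktMul_tn, hp]
  braid := split_ext fun n m z hz => by
    rw [comp_apply, comp_apply, coact₂_split hc hz, tensorHom_tmul, braiding_tmul]
    change (tensHopf hc).coact₂ (tensBraid hc (split n m z)) = tmul _ (tensBraid hc (split n m z))
    rw [braid_split, coact₂_split hc (by rw [add_comm]; exact bb_mem_Homog hc _ _ _ hz)]

/-- The antipode of the tensor algebra. -/
def tensAntipode : tens V ⟶ tens V :=
  desc (fun n => tensIncl V n ≫ op (anti (strand hc) n 0))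
    fun n => (isContr_incl n).comp (Fam_isContr hc (anti_mem n) 0)

lemma antipode_of_mem {n : ℕ} {x : tens V} (hx : x ∈ Homog V n) :
    tensAntipode hc x = anti (strand hc) n 0 • x := by
  obtain ⟨x, rfl⟩ := hx
  exact desc_incl (fun n => tensIncl V n ≫ op (anti (strand hc) n 0)) _ n x

lemma anti_mem_Homog (n o : ℕ) {N : ℕ} {x : tens V} (hx : x ∈ Homog V N) :
    anti (strand hc) n o • x ∈ Homog V N := Fam_mem hc (anti_mem n) o hx

lemma antipode_split_left {n m : ℕ} {z : tens V} (hz : z ∈ Homog V (n + m)) :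
    (tensAntipode hc ▷ tens V) (split n m z) = split n m (anti (strand hc) n 0 • z) :=
  eqOn_mul (f := split n m ≫ (tensAntipode hc ▷ tens V))
    (g := op (anti (strand hc) n 0) ≫ split n m) (fun x hx y hy => by
      rw [comp_apply, comp_apply, split_mul hx hy, whiskerRight_tmul, antipode_of_mem hc hx,
        op_apply, Fam_mul_left hc (anti_mem n) hx, split_mul (anti_mem_Homog hc _ _ hx) hy]) hz

lemma antipode_split_right {n m : ℕ} {z : tens V} (hz : z ∈ Homog V (n + m)) :
    (tens V ◁ tensAntipode hc) (split n m z) = split n m (anti (strand hc) m n • z) :=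
  eqOn_mul (f := split n m ≫ (tens V ◁ tensAntipode hc))
    (g := op (anti (strand hc) m n) ≫ split n m) (fun x hx y hy => by
      have := Fam_mul_right hc (anti_mem (c := strand hc) m) hx y 0
      rw [comp_apply, comp_apply, split_mul hx hy, whiskerLeft_tmul, antipode_of_mem hc hy,
        op_apply, ← add_zero n, this, add_zero, split_mul hx (anti_mem_Homog hc _ _ hy)]) hz

/-- Multiplying a deconcatenation back gives the element itself, so the convolution is the action of
a sum of words `anti * shuf`. That sum vanishes in positive degree, and in degree zero everything is
scalar. -/
lemma isAntipode_tensAntipode (hb : IsPreBraiding c) :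
    (tensHopf hc).IsAntipode (tensAntipode hc) := by
  have hs := isBraidSeq_strand hc hb
  have h0 : ∀ z ∈ Homog V 0, z = (tensHopf hc).one ((tensHopf hc).counit z) := fun z hz => by
    obtain ⟨a, rfl⟩ := eq_smul_of_mem_Homog_zero hz
    rw [map_smul, map_smul, counit_one, tensHopf_one]
  have h1 : ∀ n, ∀ z ∈ Homog V (n + 1), 0 = (tensHopf hc).one ((tensHopf hc).counit z) :=
    fun n z hz => by rw [counit_of_mem hc hz, map_zero]
  constructor
  · refine tens_ext_Homog fun N z hz => ?_
    have : ∀ p ∈ antidiagonal N, (tensHopf hc).mul ((tensAntipode hc ▷ tens V)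
        (split p.1 p.2 (shuf (strand hc) p.1 p.2 0 • z))) =
        (anti (strand hc) p.1 0 * shuf (strand hc) p.1 p.2 0) • z := fun p hp => by
      rw [Finset.HasAntidiagonal.mem_antidiagonal] at hp
      have hz' := shuf_mem_Homog hc p.1 p.2 0 hz
      rw [antipode_split_left hc (hp.symm ▸ hz'), mul_smul]
      exact mul_split (hp.symm ▸ anti_mem_Homog hc _ _ hz')
    rw [comp_apply, comp_apply, comul_eq hc hz, map_sum, map_sum, Finset.sum_congr rfl this,
      ← Finset.sum_smul, comp_apply]
    rcases N with _ | N
    · rw [Finset.Nat.antidiagonal_zero, Finset.sum_singleton, ← h0 z hz]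
      exact one_smul _ _
    · rw [sum_anti_left hs, zero_smul]
      exact h1 N z hz
  · refine tens_ext_Homog fun N z hz => ?_
    have : ∀ p ∈ antidiagonal N, (tensHopf hc).mul ((tens V ◁ tensAntipode hc)
        (split p.1 p.2 (shuf (strand hc) p.1 p.2 0 • z))) =
        (anti (strand hc) p.2 (0 + p.1) * shuf (strand hc) p.1 p.2 0) • z := fun p hp => by
      rw [Finset.HasAntidiagonal.mem_antidiagonal] at hp
      have hz' := shuf_mem_Homog hc p.1 p.2 0 hz
      rw [antipode_split_right hc (hp.symm ▸ hz'), mul_smul, zero_add]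
      exact mul_split (hp.symm ▸ anti_mem_Homog hc _ _ hz')
    rw [comp_apply, comp_apply, comul_eq hc hz, map_sum, map_sum, Finset.sum_congr rfl this,
      ← Finset.sum_smul, comp_apply]
    rcases N with _ | N
    · rw [Finset.Nat.antidiagonal_zero, Finset.sum_singleton, ← h0 z hz]
      exact one_smul _ _
    · rw [sum_anti_right, zero_smul]
      exact h1 N z hz

lemma antipode_coact : tensAntipode hc ≫ (tensHopf hc).coact =
    (tensHopf hc).coact ≫ (kt k ◁ tensAntipode hc) := tens_ext_Homog fun n x hx => by
  have := anti_mem_Homog hc n 0 hx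
  rw [← antipode_of_mem hc hx] at this
  rw [comp_apply, comp_apply, coact_of_mem hc hx, whiskerLeft_tmul, coact_of_mem hc this]

end grading

end NABan

namespace NABan

/-! ### The multiplicative pairing of tensor algebras -/

section form

variable {k : Type u} [NormedField k] [IsUltrametricDist k] [CompleteSpace k]
  {A B V W X Y Z : NABan k}

lemma pair₂_tmul (p : A ⊗ B ⟶ 𝟙_ (NABan k)) (a a' : A) (b b' : B) :
    pair₂ p (tmul (tmul a a') (tmul b b')) = unscal (p (tmul a b)) • p (tmul a' b') := by
  rw [pair₂, comp_apply, comp_apply, tensorμ_tmul, tensorHom_tmul, tmul_unit_eq]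

lemma isContr_tensorμ (A B C D : NABan k) : IsContr (tensorμ A B C D) :=
  isContr_assoc.comp (isContr_assoc_inv.whiskerLeft.comp
    (isContr_braiding.whiskerRight.whiskerLeft.comp
      (isContr_assoc.whiskerLeft.comp isContr_assoc_inv)))

/-- The pairing of `V^{⊗ n}` with `W^{⊗ m}` induced by `ψ`. -/
def powForm (ψ : V ⊗ W ⟶ 𝟙_ (NABan k)) : ∀ n m, tpow V n ⊗ tpow W m ⟶ 𝟙_ (NABan k)
  | 0, 0 => (λ_ (𝟙_ (NABan k))).hom
  | n + 1, m + 1 => tensorμ (tpow V n) V (tpow W m) W ≫ (powForm ψ n m ⊗ₘ ψ) ≫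
      (λ_ (𝟙_ (NABan k))).hom
  | 0, _ + 1 => 0
  | _ + 1, 0 => 0

variable {ψ : V ⊗ W ⟶ 𝟙_ (NABan k)}

lemma powForm_snoc (n m : ℕ) (x : tpow V n) (v : V) (y : tpow W m) (w : W) :
    powForm ψ (n + 1) (m + 1) (tmul (snoc x v) (snoc y w)) =
      unscal (powForm ψ n m (tmul x y)) • ψ (tmul v w) := by
  have := tensorμ_tmul x v y w
  change (λ_ (𝟙_ (NABan k))).hom ((powForm ψ n m ⊗ₘ ψ)
    (tensorμ (tpow V n) V (tpow W m) W (tmul (tmul x v) (tmul y w)))) = _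
  rw [this, tensorHom_tmul, tmul_unit_eq]

lemma isContr_powForm (hψ : IsContr ψ) : ∀ n m, IsContr (powForm ψ n m)
  | 0, 0 => isContr_leftUnitor
  | n + 1, m + 1 => (isContr_tensorμ _ _ _ _).comp
      (((isContr_powForm hψ n m).tensorHom hψ).comp isContr_leftUnitor)
  | 0, _ + 1 => isContr_zero
  | _ + 1, 0 => isContr_zero

lemma powForm_of_ne : ∀ {n m : ℕ}, n ≠ m → powForm ψ n m = 0
  | 0, 0, h => absurd rfl h
  | 0, _ + 1, _ => rfl
  | _ + 1, 0, _ => rfl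
  | n + 1, m + 1, h => by
    rw [powForm, powForm_of_ne (by omega : n ≠ m)]
    refine tmul_ext₃ fun x v t => ?_
    have : tmulL (tmul x v) (tpow W (m + 1)) ≫ tensorμ (tpow V n) V (tpow W m) W ≫
        ((0 : tpow V n ⊗ tpow W m ⟶ 𝟙_ (NABan k)) ⊗ₘ ψ) ≫ (λ_ (𝟙_ (NABan k))).hom = 0 :=
      tmul_ext fun y w => by
        change (λ_ (𝟙_ (NABan k))).hom (((0 : tpow V n ⊗ tpow W m ⟶ 𝟙_ (NABan k)) ⊗ₘ ψ)
          (tensorμ (tpow V n) V (tpow W m) W (tmul (tmul x v) (tmul y w)))) = 0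
        rw [tensorμ_tmul, tensorHom_tmul, zero_apply, zero_tmul, map_zero]
    exact congrArg (fun F : tpow W (m + 1) ⟶ 𝟙_ (NABan k) => F t) this

/-- The pairing of tensor algebras with `⟨x v, y w⟩ = ⟨x, y⟩ ψ(v, w)`. -/
def form (hψ : IsContr ψ) : tens V ⊗ tens W ⟶ 𝟙_ (NABan k) :=
  desc₂ (powForm ψ) (isContr_powForm hψ)

variable (hψ : IsContr ψ)

/-- The values of `form` in the base field. -/
def formVal (x : tens V) (y : tens W) : k := unscal (form hψ (tmul x y))

lemma formVal_eq_iff {x x' : tens V} {y y' : tens W} :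
    formVal hψ x y = formVal hψ x' y' ↔ form hψ (tmul x y) = form hψ (tmul x' y') := Iff.rfl

lemma form_incl (n m : ℕ) (x : tpow V n) (y : tpow W m) :
    form hψ (tmul (tensIncl V n x) (tensIncl W m y)) = powForm ψ n m (tmul x y) :=
  desc₂_incl (powForm ψ) (isContr_powForm hψ) n m x y

lemma formVal_of_ne {n m : ℕ} (h : n ≠ m) {x : tens V} (hx : x ∈ Homog V n) {y : tens W}
    (hy : y ∈ Homog W m) : formVal hψ x y = 0 := by
  obtain ⟨x, rfl⟩ := hx
  obtain ⟨y, rfl⟩ := hy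
  rw [formVal, form_incl, powForm_of_ne h]
  rfl

lemma formVal_one : formVal hψ 1 1 = 1 := by
  have : form hψ (tmul (1 : tens V) (1 : tens W)) =
      (λ_ (𝟙_ (NABan k))).hom (tmul (scal 1) (scal 1)) := form_incl hψ 0 0 (scal 1) (scal 1)
  rw [formVal, this, leftUnitor_tmul, unscal_scal, one_smul]
  rfl

lemma formVal_mul_gen {n m : ℕ} {x : tens V} (hx : x ∈ Homog V n) (v : V) {y : tens W}
    (hy : y ∈ Homog W m) (w : W) : formVal hψ (x * gen V v) (y * gen W w) =
      formVal hψ x y * unscal (ψ (tmul v w)) := by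
  obtain ⟨x, rfl⟩ := hx
  obtain ⟨y, rfl⟩ := hy
  rw [formVal, ← tensIncl_snoc, ← tensIncl_snoc, form_incl, powForm_snoc, ← form_incl hψ]
  rfl

/-- The map `x ↦ ⟨x, y⟩`. -/
def formR (y : tens W) : tens V ⟶ 𝟙_ (NABan k) := tmulR (tens V) y ≫ form hψ
/-- The map `y ↦ ⟨x, y⟩`. -/
def formL (x : tens V) : tens W ⟶ 𝟙_ (NABan k) := tmulL x (tens W) ≫ form hψ

lemma formR_apply (x : tens V) (y : tens W) : formR hψ y x = scal (formVal hψ x y) := rfl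
lemma formL_apply (x : tens V) (y : tens W) : formL hψ x y = scal (formVal hψ x y) := rfl

lemma formVal_add_left (x x' : tens V) (y : tens W) :
    formVal hψ (x + x') y = formVal hψ x y + formVal hψ x' y := map_add (Hom.lin (formR hψ y)) x x'
lemma formVal_add_right (x : tens V) (y y' : tens W) :
    formVal hψ x (y + y') = formVal hψ x y + formVal hψ x y' := map_add (Hom.lin (formL hψ x)) y y'
lemma formVal_neg_left (x : tens V) (y : tens W) :
    formVal hψ (-x) y = -formVal hψ x y := map_neg (Hom.lin (formR hψ y)) x
lemma formVal_neg_right (x : tens V) (y : tens W) :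
    formVal hψ x (-y) = -formVal hψ x y := map_neg (Hom.lin (formL hψ x)) y
lemma formVal_smul_left (a : k) (x : tens V) (y : tens W) :
    formVal hψ (a • x) y = a * formVal hψ x y := map_smul (Hom.lin (formR hψ y)) a x
lemma formVal_smul_right (a : k) (x : tens V) (y : tens W) :
    formVal hψ x (a • y) = a * formVal hψ x y := map_smul (Hom.lin (formL hψ x)) a y

/-- The factors are paired in the order in which they stand, without reversal, which matches the
convention of `pair₂`. -/
lemma formVal_mul {n m : ℕ} {x : tens V} (hx : x ∈ Homog V n) {y : tens V} (hy : y ∈ Homog V m)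
    {a : tens W} (ha : a ∈ Homog W n) {b : tens W} (hb : b ∈ Homog W m) :
    formVal hψ (x * y) (a * b) = formVal hψ x a * formVal hψ y b := by
  induction m generalizing y b with
  | zero =>
    obtain ⟨s, rfl⟩ := eq_smul_of_mem_Homog_zero hy
    obtain ⟨t, rfl⟩ := eq_smul_of_mem_Homog_zero hb
    rw [mul_smul_comm, mul_smul_comm, mul_one, mul_one]
    simp only [formVal_smul_left, formVal_smul_right, formVal_one]
    ring
  | succ m ih =>
    refine eqOn_gen (f := mulL x ≫ formR hψ (a * b))
      (g := formR hψ b ≫ scaleHom (formVal hψ x a) _) (fun y hy v => ?_) hy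
    refine eqOn_gen (f := mulL a ≫ formL hψ (x * (y * gen V v)))
      (g := formL hψ (y * gen V v) ≫ scaleHom (formVal hψ x a) _) (fun b hb w => ?_) hb
    change formVal hψ (x * (y * gen V v)) (a * (b * gen W w)) =
      formVal hψ x a * formVal hψ (y * gen V v) (b * gen W w)
    rw [← mul_assoc, ← mul_assoc, formVal_mul_gen hψ (mul_mem_Homog hx hy) v
      (mul_mem_Homog ha hb) w, formVal_mul_gen hψ hy v hb w, ih hy hb, mul_assoc]

lemma form_ext {f g : tens V ⊗ tens W ⟶ Z}
    (h : ∀ n, ∀ x ∈ Homog V n, ∀ m, ∀ y ∈ Homog W m, f (tmul x y) = g (tmul x y))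
    (x : tens V) (y : tens W) : f (tmul x y) = g (tmul x y) := by rw [tens_ext₂ h]

end form

section adjoint

variable {k : Type u} [NormedField k] [IsUltrametricDist k] [CompleteSpace k] {V W : NABan k}
  {c : V ⊗ V ⟶ V ⊗ V} {d : W ⊗ W ⟶ W ⊗ W} {ψ : V ⊗ W ⟶ 𝟙_ (NABan k)} (hψ : IsContr ψ)

/-- `c` and `d` are adjoint for `ψ`. -/
def IsAdjoint (c : V ⊗ V ⟶ V ⊗ V) (d : W ⊗ W ⟶ W ⊗ W) (ψ : V ⊗ W ⟶ 𝟙_ (NABan k)) : Prop :=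
  ∀ t s, pair₂ ψ (tmul (c t) s) = pair₂ ψ (tmul t (d s))

lemma form_genMul (t : (V ⊗ V : NABan k)) (s : (W ⊗ W : NABan k)) :
    form hψ (tmul (genMul V t) (genMul W s)) = pair₂ ψ (tmul t s) := by
  have h : (genMul V ⊗ₘ genMul W) ≫ form hψ = pair₂ ψ := by
    refine tmul_ext₃ fun v v' s => ?_
    have : tmulL (tmul v v') (W ⊗ W) ≫ (genMul V ⊗ₘ genMul W) ≫ form hψ =
        tmulL (tmul v v') (W ⊗ W) ≫ pair₂ ψ := tmul_ext fun w w' => by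
      rw [comp_apply, comp_apply, comp_apply, tmulL_apply, tensorHom_tmul, genMul_tmul,
        genMul_tmul, pair₂, comp_apply, comp_apply, tensorμ_tmul, tensorHom_tmul, tmul_unit_eq]
      refine (formVal_eq_iff hψ (x' := gen V v * gen V v') (y' := gen W w * gen W w')).mp
        rfl |>.trans ?_
      have h1 := formVal_mul_gen hψ (gen_mem_Homog v) v' (gen_mem_Homog w) w'
      have h2 := formVal_mul_gen hψ one_mem_Homog v one_mem_Homog w
      rw [one_mul, one_mul, formVal_one, one_mul] at h2
      rw [h2] at h1
      exact h1
    exact congrArg (fun F : W ⊗ W ⟶ 𝟙_ (NABan k) => F s) this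
  rw [← h, comp_apply, tensorHom_tmul]

open BraidWord

/-- Operators on tensor algebras that are adjoint for the form. -/
def Adj (u : End (tens V)) (u' : End (tens W)) : Prop :=
  ∀ x y, formVal hψ (u • x) y = formVal hψ x (u' • y)

variable (hc : IsContr c) (hd : IsContr d)

lemma strand_zero_gen (v w : V) :
    strand hc 0 • (gen V v * gen V w) = genMul V (c (tmul v w)) := by
  have := strand_mul_genMul hc one_mem_Homog (tmul v w)
  rwa [one_mul, one_mul, genMul_tmul] at this

lemma strand_mul_mul {i n : ℕ} {x y : tens V} (hx : x ∈ Homog V i) (hy : y ∈ Homog V (n + 2))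
    (z : tens V) : strand hc i • (x * y * z) = x * (strand hc 0 • y) * z := by
  have := strand_mul_right hc 0 hx y
  rw [add_zero] at this
  rw [strand_mul_left hc (n := i + (n + 2)) (by omega) (mul_mem_Homog hx hy), this]

variable {hψ hc hd}

lemma adj_strand_two (h : IsAdjoint c d ψ) {x : tens V} (hx : x ∈ Homog V 2) {y : tens W}
    (hy : y ∈ Homog W 2) : formVal hψ (strand hc 0 • x) y = formVal hψ x (strand hd 0 • y) := by
  refine eqOn_gen (n := 1) (f := op (strand hc 0) ≫ formR hψ y)
    (g := formR hψ (strand hd 0 • y)) (fun x hx v' => ?_) hx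
  refine eqOn_gen (n := 1) (f := formL hψ (strand hc 0 • (x * gen V v')))
    (g := op (strand hd 0) ≫ formL hψ (x * gen V v')) (fun y hy w' => ?_) hy
  obtain ⟨v, rfl⟩ := exists_gen_of_mem_Homog_one hx
  obtain ⟨w, rfl⟩ := exists_gen_of_mem_Homog_one hy
  change form hψ (tmul (strand hc 0 • (gen V v * gen V v')) (gen W w * gen W w')) =
    form hψ (tmul (gen V v * gen V v') (strand hd 0 • (gen W w * gen W w')))
  rw [strand_zero_gen, strand_zero_gen, ← genMul_tmul, ← genMul_tmul, form_genMul, form_genMul, h]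

/-- A crossing touches two neighbouring tensor factors. Cutting both arguments into pieces of
degrees `i`, `2` and `l` makes the form a product of three values, of which only the middle one
changes; there the claim is the adjointness of `c` and `d`. -/
lemma adj_strand (h : IsAdjoint c d ψ) (i : ℕ) : Adj hψ (strand hc i) (strand hd i) := by
  suffices H : ∀ n, ∀ x ∈ Homog V n, ∀ m, ∀ y ∈ Homog W m,
      formVal hψ (strand hc i • x) y = formVal hψ x (strand hd i • y) by
    intro x y
    have := form_ext (f := (op (strand hc i) ▷ tens W) ≫ form hψ)
      (g := (tens V ◁ op (strand hd i)) ≫ form hψ) (fun n x hx m y hy => by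
        rw [comp_apply, comp_apply, whiskerRight_tmul, whiskerLeft_tmul]
        exact H n x hx m y hy) x y
    rwa [comp_apply, comp_apply, whiskerRight_tmul, whiskerLeft_tmul] at this
  intro n x hx m y hy
  by_cases hnm : n = m
  swap
  · rw [formVal_of_ne hψ hnm (strand_mem hc hx) hy, formVal_of_ne hψ hnm hx (strand_mem hd hy)]
  subst hnm
  by_cases hn : n < i + 2
  · rw [strand_of_lt hc hn hx, strand_of_lt hd hn hy]
    exact (map_zero (Hom.lin (formR hψ y))).trans (map_zero (Hom.lin (formL hψ x))).symm
  obtain ⟨l, rfl⟩ : ∃ l, n = i + 2 + l := ⟨n - (i + 2), by omega⟩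
  refine eqOn_mul (f := op (strand hc i) ≫ formR hψ y) (g := formR hψ (strand hd i • y))
    (fun x hx x₃ hx₃ => ?_) hx
  refine eqOn_mul (f := mulR x₃ ≫ op (strand hc i) ≫ formR hψ y)
    (g := mulR x₃ ≫ formR hψ (strand hd i • y)) (fun x₁ hx₁ x₂ hx₂ => ?_) hx
  refine eqOn_mul (f := formL hψ (strand hc i • (x₁ * x₂ * x₃)))
    (g := op (strand hd i) ≫ formL hψ (x₁ * x₂ * x₃)) (fun y hy y₃ hy₃ => ?_) hy
  refine eqOn_mul (f := mulR y₃ ≫ formL hψ (strand hc i • (x₁ * x₂ * x₃)))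
    (g := mulR y₃ ≫ op (strand hd i) ≫ formL hψ (x₁ * x₂ * x₃)) (fun y₁ hy₁ y₂ hy₂ => ?_) hy
  change formVal hψ (strand hc i • (x₁ * x₂ * x₃)) (y₁ * y₂ * y₃) =
    formVal hψ (x₁ * x₂ * x₃) (strand hd i • (y₁ * y₂ * y₃))
  rw [strand_mul_mul hc (n := 0) hx₁ hx₂, strand_mul_mul hd (n := 0) hy₁ hy₂,
    formVal_mul hψ (mul_mem_Homog hx₁ (strand_mem hc hx₂)) hx₃ (mul_mem_Homog hy₁ hy₂) hy₃,
    formVal_mul hψ hx₁ (strand_mem hc hx₂) hy₁ hy₂,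
    formVal_mul hψ (mul_mem_Homog hx₁ hx₂) hx₃ (mul_mem_Homog hy₁ (strand_mem hd hy₂)) hy₃,
    formVal_mul hψ hx₁ hx₂ hy₁ (strand_mem hd hy₂), adj_strand_two h hx₂ hy₂]

lemma adj_one : Adj hψ 1 1 := fun _ _ => rfl

lemma Adj.add {u v : End (tens V)} {u' v' : End (tens W)} (hu : Adj hψ u u') (hv : Adj hψ v v') :
    Adj hψ (u + v) (u' + v') := fun x y => by
  rw [add_smul, add_smul, formVal_add_left, formVal_add_right, hu, hv]

lemma Adj.neg {u : End (tens V)} {u' : End (tens W)} (hu : Adj hψ u u') :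
    Adj hψ (-u) (-u') := fun x y => by
  rw [neg_smul, neg_smul, formVal_neg_left, formVal_neg_right, hu]

lemma Adj.mul {u v : End (tens V)} {u' v' : End (tens W)} (hu : Adj hψ u u') (hv : Adj hψ v v') :
    Adj hψ (u * v) (v' * u') := fun x y => by
  rw [mul_smul, mul_smul, hu, hv]

lemma adj_sym (h : IsAdjoint c d ψ) (hb : IsPreBraiding d) (n o : ℕ) :
    Adj hψ (sym (strand hc) n o) (sym (strand hd) n o) :=
  transpose_sym adj_one (adj_strand h) (fun _ _ _ _ => Adj.add) (fun _ _ _ _ => Adj.mul)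
    (isBraidSeq_strand hd hb) n o

lemma adj_anti (h : IsAdjoint c d ψ) (hb : IsPreBraiding d) (n o : ℕ) :
    Adj hψ (anti (strand hc) n o) (anti (strand hd) n o) :=
  transpose_anti adj_one (adj_strand h) (fun _ _ => Adj.neg) (fun _ _ _ _ => Adj.mul)
    (isBraidSeq_strand hd hb) n o

end adjoint

/-! ### The symmetrizer and the Hopf pairing -/

section pairing

variable {k : Type u} [NormedField k] [IsUltrametricDist k] [CompleteSpace k] {V W : NABan k}
  {c : V ⊗ V ⟶ V ⊗ V} {d : W ⊗ W ⟶ W ⊗ W} {ψ : V ⊗ W ⟶ 𝟙_ (NABan k)}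

open BraidWord

/-- The braided symmetrizer of the tensor algebra. -/
def symz (hc : IsContr c) : tens V ⟶ tens V :=
  desc (fun n => tensIncl V n ≫ op (sym (strand hc) n 0))
    fun n => (isContr_incl n).comp (Fam_isContr hc (sym_mem n) 0)

variable (hc : IsContr c) (hd : IsContr d) (hψ : IsContr ψ)

lemma symz_of_mem {n : ℕ} {x : tens V} (hx : x ∈ Homog V n) :
    symz hc x = sym (strand hc) n 0 • x := by
  obtain ⟨x, rfl⟩ := hx
  exact desc_incl (fun n => tensIncl V n ≫ op (sym (strand hc) n 0)) _ n x

lemma symz_mem {n : ℕ} {x : tens V} (hx : x ∈ Homog V n) : symz hc x ∈ Homog V n := by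
  rw [symz_of_mem hc hx]
  exact Fam_mem hc (sym_mem n) 0 hx

lemma symz_one : symz hc 1 = 1 := symz_of_mem hc one_mem_Homog

lemma symz_gen (v : V) : symz hc (gen V v) = gen V v := by
  rw [symz_of_mem hc (gen_mem_Homog v), sym, sym, shuf_zero_left, one_mul]
  exact one_smul _ _

/-- The symmetrizer of a product in terms of the inverse shuffles. -/
lemma symz_eq_mul (hb : IsPreBraiding c) {n m : ℕ} {z : tens V} (hz : z ∈ Homog V (n + m)) :
    symz hc z = tensMul V ((symz hc ⊗ₘ symz hc) (split n m (shuf (strand hc) n m 0 • z))) := by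
  have key : ∀ z ∈ Homog V (n + m), tensMul V ((symz hc ⊗ₘ symz hc) (split n m z)) =
      (sym (strand hc) n 0 * sym (strand hc) m n) • z := fun z hz => by
    refine eqOn_mul (f := split n m ≫ (symz hc ⊗ₘ symz hc) ≫ tensMul V)
      (g := op (sym (strand hc) n 0 * sym (strand hc) m n)) (fun x hx y hy => ?_) hz
    have h := Fam_mul_right hc (sym_mem (c := strand hc) m) hx y 0
    rw [add_zero] at h
    rw [comp_apply, comp_apply, split_mul hx hy, tensorHom_tmul, op_apply, mul_smul, h,
      Fam_mul_left hc (sym_mem n) hx, symz_of_mem hc hx, symz_of_mem hc hy]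
    rfl
  rw [key _ (shuf_mem_Homog hc _ _ _ hz), symz_of_mem hc hz, sym_add (isBraidSeq_strand hc hb),
    mul_smul, zero_add]

variable {hc hd} in
lemma formVal_symz (h : IsAdjoint c d ψ) (hb : IsPreBraiding d) (x : tens V) (y : tens W) :
    formVal hψ (symz hc x) y = formVal hψ x (symz hd y) := by
  have := form_ext (f := (symz hc ▷ tens W) ≫ form hψ)
    (g := (tens V ◁ symz hd) ≫ form hψ) (fun n x hx m y hy => by
      rw [comp_apply, comp_apply, whiskerRight_tmul, whiskerLeft_tmul, symz_of_mem hc hx,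
        symz_of_mem hd hy]
      by_cases hnm : n = m
      · subst hnm
        exact adj_sym (hψ := hψ) h hb n 0 x y
      · exact (formVal_of_ne hψ hnm (Fam_mem hc (sym_mem n) 0 hx) hy).trans
          (formVal_of_ne hψ hnm hx (Fam_mem hd (sym_mem m) 0 hy)).symm) x y
  rwa [comp_apply, comp_apply, whiskerRight_tmul, whiskerLeft_tmul] at this

/-- The Hopf pairing of tensor algebras. -/
def hopfForm : tens V ⊗ tens W ⟶ 𝟙_ (NABan k) := (tens V ◁ symz hd) ≫ form hψ

lemma hopfForm_tmul (x : tens V) (y : tens W) :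
    hopfForm hd hψ (tmul x y) = scal (formVal hψ x (symz hd y)) := by
  rw [hopfForm, comp_apply, whiskerLeft_tmul]
  rfl

end pairing

end NABan

namespace NABan

/-! ### The Hopf pairing is the unique dual pairing extending the form -/

section dualPairing

variable {k : Type u} [NormedField k] [IsUltrametricDist k] [CompleteSpace k] {V W Z : NABan k}
  {c : V ⊗ V ⟶ V ⊗ V} {d : W ⊗ W ⟶ W ⊗ W} {ψ : V ⊗ W ⟶ 𝟙_ (NABan k)}

open BraidWord

variable {hc : IsContr c} {hd : IsContr d} {hψ : IsContr ψ}

lemma hopfForm_tmul' (h : IsAdjoint c d ψ) (hb : IsPreBraiding d) (x : tens V) (y : tens W) :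
    hopfForm hd hψ (tmul x y) = scal (formVal hψ (symz hc x) y) := by
  rw [hopfForm_tmul, formVal_symz hψ h hb]

lemma pair₂_split_right {n m : ℕ} {x y : tens V} (hx : x ∈ Homog V n) (hy : y ∈ Homog V m)
    {z : tens W} (hz : z ∈ Homog W (n + m)) :
    pair₂ (hopfForm hd hψ) (tmul (tmul x y) (split n m z)) =
      scal (formVal hψ (x * y) (tensMul W ((symz hd ⊗ₘ symz hd) (split n m z)))) := by
  refine eqOn_mul (f := split n m ≫ tmulL (tmul x y) _ ≫ pair₂ (hopfForm hd hψ))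
    (g := split n m ≫ (symz hd ⊗ₘ symz hd) ≫ tensMul W ≫ formL hψ (x * y)) (fun a ha b hb => ?_) hz
  simp only [comp_apply]
  rw [split_mul ha hb, tmulL_apply, pair₂_tmul, hopfForm_tmul, hopfForm_tmul, tensorHom_tmul,
    tensMul_eq, formL_apply, formVal_mul hψ hx hy (symz_mem hd ha) (symz_mem hd hb)]
  rfl

lemma pair₂_split_right_of_ne {n m i j : ℕ} (h : (i, j) ≠ (n, m)) {x y : tens V}
    (hx : x ∈ Homog V n) (hy : y ∈ Homog V m) {z : tens W} (hz : z ∈ Homog W (i + j)) :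
    pair₂ (hopfForm hd hψ) (tmul (tmul x y) (split i j z)) = 0 := by
  refine eqOn_mul (f := split i j ≫ tmulL (tmul x y) _ ≫ pair₂ (hopfForm hd hψ)) (g := 0)
    (fun a ha b hb => ?_) hz
  simp only [comp_apply]
  rw [split_mul ha hb, tmulL_apply, pair₂_tmul, hopfForm_tmul, hopfForm_tmul]
  by_cases hi : n = i
  · rw [formVal_of_ne hψ (by rintro rfl; exact h (by rw [hi])) hy (symz_mem hd hb)]
    exact mul_zero (M₀ := k) _
  · rw [formVal_of_ne hψ hi hx (symz_mem hd ha)]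
    exact zero_mul (M₀ := k) _

lemma pair₂_split_left (h : IsAdjoint c d ψ) (hbd : IsPreBraiding d) {n m : ℕ} {x y : tens W}
    (hx : x ∈ Homog W n) (hy : y ∈ Homog W m) {z : tens V} (hz : z ∈ Homog V (n + m)) :
    pair₂ (hopfForm hd hψ) (tmul (split n m z) (tmul x y)) =
      scal (formVal hψ (tensMul V ((symz hc ⊗ₘ symz hc) (split n m z))) (x * y)) := by
  refine eqOn_mul (f := split n m ≫ tmulR _ (tmul x y) ≫ pair₂ (hopfForm hd hψ))
    (g := split n m ≫ (symz hc ⊗ₘ symz hc) ≫ tensMul V ≫ formR hψ (x * y)) (fun a ha b hb => ?_) hz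
  simp only [comp_apply]
  rw [split_mul ha hb, tmulR_apply, pair₂_tmul, hopfForm_tmul' (hc := hc) h hbd,
    hopfForm_tmul' (hc := hc) h hbd, tensorHom_tmul,
    tensMul_eq, formR_apply, formVal_mul hψ (symz_mem hc ha) (symz_mem hc hb) hx hy]
  rfl

lemma pair₂_split_left_of_ne {n m i j : ℕ} (h : (i, j) ≠ (n, m)) {x y : tens W}
    (hx : x ∈ Homog W n) (hy : y ∈ Homog W m) {z : tens V} (hz : z ∈ Homog V (i + j)) :
    pair₂ (hopfForm hd hψ) (tmul (split i j z) (tmul x y)) = 0 := by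
  refine eqOn_mul (f := split i j ≫ tmulR _ (tmul x y) ≫ pair₂ (hopfForm hd hψ)) (g := 0)
    (fun a ha b hb => ?_) hz
  simp only [comp_apply]
  rw [split_mul ha hb, tmulR_apply, pair₂_tmul, hopfForm_tmul, hopfForm_tmul]
  by_cases hi : i = n
  · rw [formVal_of_ne hψ (by rintro rfl; exact h (by rw [hi])) hb (symz_mem hd hy)]
    exact mul_zero (M₀ := k) _
  · rw [formVal_of_ne hψ hi ha (symz_mem hd hx)]
    exact zero_mul (M₀ := k) _

/-- The Hopf pairing is a dual pairing. -/
lemma isDualPairing_hopfForm (h : IsAdjoint c d ψ) (hbc : IsPreBraiding c) (hbd : IsPreBraiding d) :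
    IsDualPairing (tensHopf hc) (tensHopf hd) (hopfForm hd hψ) where
  mul_left := by
    refine tmul_ext fun X y => ?_
    have h1 : ∀ N, ∀ y ∈ Homog W N, tmulR (tens V ⊗ tens V) y ≫ ((tensHopf hc).mul ▷ tens W) ≫
        hopfForm hd hψ = tmulR (tens V ⊗ tens V) y ≫ ((tens V ⊗ tens V) ◁ (tensHopf hd).comul) ≫
        pair₂ (hopfForm hd hψ) := fun N y hy => tens_ext₂ fun n x hx m x' hx' => by
      simp only [comp_apply, tmulR_apply, whiskerRight_tmul, whiskerLeft_tmul, tensHopf_mul]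
      rw [hopfForm_tmul, comul_eq hd hy, ← tmulL_apply, map_sum, map_sum]
      by_cases hN : N = n + m
      · subst hN
        rw [Finset.sum_eq_single (n, m), tmulL_apply,
          pair₂_split_right hx hx' (shuf_mem_Homog hd _ _ _ hy), symz_eq_mul hd hbd hy]
        · rintro ⟨i, j⟩ hp hne
          rw [Finset.HasAntidiagonal.mem_antidiagonal] at hp
          exact pair₂_split_right_of_ne hne hx hx' (hp.symm ▸ shuf_mem_Homog hd _ _ _ hy)
        · intro hp
          exact (hp (by rw [Finset.HasAntidiagonal.mem_antidiagonal])).elim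
      · rw [formVal_of_ne hψ (Ne.symm hN) (mul_mem_Homog hx hx') (symz_mem hd hy)]
        refine (Finset.sum_eq_zero ?_).symm
        rintro ⟨i, j⟩ hp
        rw [Finset.HasAntidiagonal.mem_antidiagonal] at hp
        refine pair₂_split_right_of_ne ?_ hx hx' (hp.symm ▸ shuf_mem_Homog hd _ _ _ hy)
        rintro ⟨rfl, rfl⟩
        exact hN hp.symm
    have h2 : tmulL X (tens W) ≫ ((tensHopf hc).mul ▷ tens W) ≫ hopfForm hd hψ =
        tmulL X (tens W) ≫ ((tens V ⊗ tens V) ◁ (tensHopf hd).comul) ≫ pair₂ (hopfForm hd hψ) :=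
      tens_ext_Homog fun N y hy =>
        congrArg (fun F : tens V ⊗ tens V ⟶ 𝟙_ (NABan k) => F X) (h1 N y hy)
    exact congrArg (fun F : tens W ⟶ 𝟙_ (NABan k) => F y) h2
  mul_right := by
    refine tmul_ext fun x Y => ?_
    have h1 : ∀ N, ∀ x ∈ Homog V N, tmulL x (tens W ⊗ tens W) ≫ (tens V ◁ (tensHopf hd).mul) ≫
        hopfForm hd hψ = tmulL x (tens W ⊗ tens W) ≫ ((tensHopf hc).comul ▷ (tens W ⊗ tens W)) ≫
        pair₂ (hopfForm hd hψ) := fun N x hx => tens_ext₂ fun n y hy m y' hy' => by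
      simp only [comp_apply, tmulL_apply, whiskerRight_tmul, whiskerLeft_tmul, tensHopf_mul]
      -- For multiplication in the second argument the symmetrizer is first moved to the first
      -- argument, where the same factorisation applies.
      rw [hopfForm_tmul' (hc := hc) h hbd, comul_eq hc hx, ← tmulR_apply, map_sum, map_sum]
      by_cases hN : N = n + m
      · subst hN
        rw [Finset.sum_eq_single (n, m), tmulR_apply,
          pair₂_split_left h hbd hy hy' (shuf_mem_Homog hc _ _ _ hx), symz_eq_mul hc hbc hx]
        · rintro ⟨i, j⟩ hp hne
          rw [Finset.HasAntidiagonal.mem_antidiagonal] at hp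
          exact pair₂_split_left_of_ne hne hy hy' (hp.symm ▸ shuf_mem_Homog hc _ _ _ hx)
        · intro hp
          exact (hp (by rw [Finset.HasAntidiagonal.mem_antidiagonal])).elim
      · rw [formVal_of_ne hψ hN (symz_mem hc hx) (mul_mem_Homog hy hy')]
        refine (Finset.sum_eq_zero ?_).symm
        rintro ⟨i, j⟩ hp
        rw [Finset.HasAntidiagonal.mem_antidiagonal] at hp
        refine pair₂_split_left_of_ne ?_ hy hy' (hp.symm ▸ shuf_mem_Homog hc _ _ _ hx)
        rintro ⟨rfl, rfl⟩
        exact hN hp.symm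
    have h2 : tmulR (tens V) Y ≫ (tens V ◁ (tensHopf hd).mul) ≫ hopfForm hd hψ =
        tmulR (tens V) Y ≫ ((tensHopf hc).comul ▷ (tens W ⊗ tens W)) ≫ pair₂ (hopfForm hd hψ) :=
      tens_ext_Homog fun N x hx =>
        congrArg (fun F : tens W ⊗ tens W ⟶ 𝟙_ (NABan k) => F Y) (h1 N x hx)
    exact congrArg (fun F : tens V ⟶ 𝟙_ (NABan k) => F x) h2
  one_right := tens_ext_Homog fun n x hx => by
    simp only [comp_apply, rightUnitor_inv_apply, whiskerLeft_tmul, tensHopf_one]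
    rw [hopfForm_tmul, symz_one]
    rcases n with _ | n
    · obtain ⟨a, rfl⟩ := eq_smul_of_mem_Homog_zero hx
      rw [formVal_smul_left, formVal_one, map_smul, counit_one]
      rfl
    · rw [formVal_of_ne hψ (by omega) hx one_mem_Homog, counit_of_mem hc hx]
      rfl
  one_left := tens_ext_Homog fun n y hy => by
    simp only [comp_apply, leftUnitor_inv_apply, whiskerRight_tmul, tensHopf_one]
    rw [hopfForm_tmul]
    rcases n with _ | n
    · obtain ⟨a, rfl⟩ := eq_smul_of_mem_Homog_zero hy
      rw [map_smul, symz_one, formVal_smul_right, formVal_one, map_smul, counit_one]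
      rfl
    · rw [formVal_of_ne hψ (by omega) one_mem_Homog (symz_mem hd hy), counit_of_mem hd hy]
      rfl
  antipode := by
    refine ⟨tensAntipode hc, tensAntipode hd, isAntipode_tensAntipode hc hbc,
      isAntipode_tensAntipode hd hbd, tens_ext₂ fun n x hx m y hy => ?_⟩
    rw [comp_apply, comp_apply, whiskerRight_tmul, whiskerLeft_tmul, hopfForm_tmul, hopfForm_tmul,
      antipode_of_mem hc hx, antipode_of_mem hd hy]
    congr 1
    by_cases hnm : n = m
    · subst hnm
      -- The operator of the antipode is its own transpose for `form`, and it commutes with the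
      -- symmetrizer that separates `form` from the Hopf pairing.
      rw [adj_anti (hψ := hψ) (hd := hd) h hbd, symz_of_mem hd hy,
        symz_of_mem hd (anti_mem_Homog hd n 0 hy),
        smul_smul, smul_smul, anti_sym (isBraidSeq_strand hd hbd)]
    · rw [formVal_of_ne hψ hnm (anti_mem_Homog hc n 0 hx) (symz_mem hd hy),
        formVal_of_ne hψ hnm hx (symz_mem hd (anti_mem_Homog hd m 0 hy))]

lemma hopfForm_gen (v : V) (w : W) : hopfForm hd hψ (tmul (gen V v) (gen W w)) = ψ (tmul v w) := by
  have h2 := formVal_mul_gen hψ one_mem_Homog v one_mem_Homog w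
  rw [one_mul, one_mul, formVal_one, one_mul] at h2
  rw [hopfForm_tmul, symz_gen, h2]
  rfl

lemma comul_gen (hc : IsContr c) (v : V) :
    (tensHopf hc).comul (gen V v) = tmul 1 (gen V v) + tmul (gen V v) 1 := by
  have := comul_eq hc (gen_mem_Homog v)
  rw [Finset.Nat.sum_antidiagonal_succ, Finset.Nat.antidiagonal_zero, Finset.sum_singleton] at this
  simp only [zero_add, shuf_zero_left, shuf_zero_right, one_smul] at this
  rwa [one_split (gen_mem_Homog v), split_one (gen_mem_Homog v)] at this

/-- A dual pairing of tensor algebras is determined by its restriction to the generators. -/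
lemma IsDualPairing.unique {p p' : tens V ⊗ tens W ⟶ 𝟙_ (NABan k)}
    (hp : IsDualPairing (tensHopf hc) (tensHopf hd) p)
    (hp' : IsDualPairing (tensHopf hc) (tensHopf hd) p')
    (h : ∀ v w, p (tmul (gen V v) (gen W w)) = p' (tmul (gen V v) (gen W w))) : p = p' := by
  have one_r : ∀ q : tens V ⊗ tens W ⟶ 𝟙_ (NABan k),
      IsDualPairing (tensHopf hc) (tensHopf hd) q →
      ∀ x, q (tmul x 1) = (tensHopf hc).counit x := fun q hq x => by
    have := congrArg (fun F : tens V ⟶ 𝟙_ (NABan k) => F x) hq.one_right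
    simpa only [comp_apply, rightUnitor_inv_apply, whiskerLeft_tmul, tensHopf_one] using this
  have one_l : ∀ q : tens V ⊗ tens W ⟶ 𝟙_ (NABan k),
      IsDualPairing (tensHopf hc) (tensHopf hd) q →
      ∀ y, q (tmul 1 y) = (tensHopf hd).counit y := fun q hq y => by
    have := congrArg (fun F : tens W ⟶ 𝟙_ (NABan k) => F y) hq.one_left
    simpa only [comp_apply, leftUnitor_inv_apply, whiskerRight_tmul, tensHopf_one] using this
  have mul_l : ∀ q : tens V ⊗ tens W ⟶ 𝟙_ (NABan k),
      IsDualPairing (tensHopf hc) (tensHopf hd) q → ∀ x x' y, q (tmul (x * x') y) =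
        pair₂ q (tmul (tmul x x') ((tensHopf hd).comul y)) := fun q hq x x' y => by
    have := congrArg (fun F : (tens V ⊗ tens V) ⊗ tens W ⟶ 𝟙_ (NABan k) =>
      F (tmul (tmul x x') y)) hq.mul_left
    simpa only [comp_apply, whiskerLeft_tmul, whiskerRight_tmul, tensHopf_mul] using this
  have mul_r : ∀ q : tens V ⊗ tens W ⟶ 𝟙_ (NABan k),
      IsDualPairing (tensHopf hc) (tensHopf hd) q → ∀ x y y', q (tmul x (y * y')) =
        pair₂ q (tmul ((tensHopf hc).comul x) (tmul y y')) := fun q hq x y y' => by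
    have := congrArg (fun F : tens V ⊗ (tens W ⊗ tens W) ⟶ 𝟙_ (NABan k) =>
      F (tmul x (tmul y y'))) hq.mul_right
    simpa only [comp_apply, whiskerLeft_tmul, whiskerRight_tmul, tensHopf_mul] using this
  -- Since a generator is primitive, pairing it with `y w` reduces to the counit, to the pairing
  -- with `y` and to the value on generators. For general first arguments a generator is then split
  -- off on the right.
  have h_gen : ∀ v, ∀ n, ∀ y ∈ Homog W n, p (tmul (gen V v) y) = p' (tmul (gen V v) y) := by
    intro v n
    induction n with
    | zero =>
      intro y hy
      obtain ⟨a, rfl⟩ := eq_smul_of_mem_Homog_zero hy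
      rw [tmul_smul, map_smul, map_smul, one_r p hp, one_r p' hp']
    | succ n ih =>
      intro y hy
      refine eqOn_gen (f := tmulL (gen V v) (tens W) ≫ p) (g := tmulL (gen V v) (tens W) ≫ p')
        (fun y hy w => ?_) hy
      rw [comp_apply, comp_apply, tmulL_apply, mul_r p hp, mul_r p' hp', comul_gen hc, add_tmul,
        map_add, map_add, pair₂_tmul, pair₂_tmul, pair₂_tmul, pair₂_tmul, one_l p hp, one_l p' hp',
        one_l p hp, one_l p' hp', ih y hy, h]
  refine tens_ext₂ fun n x hx m y _ => ?_
  induction n generalizing x m y with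
  | zero =>
    obtain ⟨a, rfl⟩ := eq_smul_of_mem_Homog_zero hx
    rw [smul_tmul, map_smul, map_smul, one_l p hp, one_l p' hp']
  | succ n ih =>
    refine eqOn_gen (f := tmulR (tens V) y ≫ p) (g := tmulR (tens V) y ≫ p') (fun x hx v => ?_) hx
    have : tmulL (tmul x (gen V v)) _ ≫ pair₂ p = tmulL (tmul x (gen V v)) _ ≫ pair₂ p' :=
      tens_ext₂ fun i a ha j b hb => by
        rw [comp_apply, comp_apply, tmulL_apply, pair₂_tmul, pair₂_tmul, ih x hx i a ha,
          h_gen v j b hb]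
    rw [comp_apply, comp_apply, tmulR_apply, mul_l p hp, mul_l p' hp']
    exact congrArg (fun F : tens W ⊗ tens W ⟶ 𝟙_ (NABan k) => F ((tensHopf hd).comul y)) this

end dualPairing

end NABan

namespace NABan

/-! ### Almost orthogonal sequences and extension of functionals with small loss -/

section approximation

variable {k : Type*} [NormedField k] {A : Type*} [NormedAddCommGroup A] [NormedSpace k A]

/-- Almost best approximations exist in closed subspaces. -/
lemma exists_almost_best {S : Submodule k A} (hS : IsClosed (S : Set A)) (u : A) {s : ℝ}
    (hs : 0 < s) (hs1 : s < 1) : ∃ p ∈ S, ∀ v ∈ S, s * ‖u - p‖ ≤ ‖u - v‖ := by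
  by_cases hu : u ∈ S
  · exact ⟨u, hu, fun v _ => by simp⟩
  have hne : (S : Set A).Nonempty := ⟨0, S.zero_mem⟩
  have hpos : 0 < Metric.infDist u S := (hS.notMem_iff_infDist_pos hne).mp hu
  have hlt : Metric.infDist u S < Metric.infDist u S / s := by
    rw [lt_div_iff₀ hs]
    nlinarith
  obtain ⟨p, hp, hup⟩ := (Metric.infDist_lt_iff hne).mp hlt
  refine ⟨p, hp, fun v hv => ?_⟩
  rw [dist_eq_norm, lt_div_iff₀ hs, mul_comm] at hup
  exact hup.le.trans ((Metric.infDist_le_dist_of_mem hv).trans_eq (dist_eq_norm _ _))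

lemma almost_best_smul {S : Submodule k A} {u p : A} {s : ℝ} (hp : p ∈ S)
    (h : ∀ v ∈ S, s * ‖u - p‖ ≤ ‖u - v‖) (a : k) {v : A} (hv : v ∈ S) :
    s * ‖a • (u - p)‖ ≤ ‖a • (u - p) + v‖ := by
  rcases eq_or_ne a 0 with rfl | ha
  · simp
  have h1 : a • (u - p) + v = a • (u - (p - a⁻¹ • v)) := by
    rw [← sub_add, smul_add, smul_inv_smul₀ ha]
  rw [h1, norm_smul, norm_smul, mul_left_comm]
  exact mul_le_mul_of_nonneg_left (h _ (S.sub_mem hp (S.smul_mem _ hv))) (norm_nonneg a)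

variable [IsUltrametricDist A]

/-- If `v` is longer than the sum, the ultrametric inequality bounds `‖v‖` by the norm of the
multiple of `u - p`, which the sum already controls because `u - p` is almost orthogonal to `S`. -/
lemma norm_le_of_almost_best {S : Submodule k A} {u p : A} {s : ℝ} (hs : 0 < s) (hs1 : s < 1)
    (hp : p ∈ S) (h : ∀ v ∈ S, s * ‖u - p‖ ≤ ‖u - v‖) (a : k) {v : A} (hv : v ∈ S) :
    s * ‖v‖ ≤ ‖a • (u - p) + v‖ := by
  have h1 : ‖v‖ ≤ max ‖a • (u - p) + v‖ ‖a • (u - p)‖ := by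
    have := IsUltrametricDist.norm_add_le_max (a • (u - p) + v) (-(a • (u - p)))
    rwa [norm_neg, add_neg_cancel_comm] at this
  rcases le_max_iff.mp h1 with h2 | h2
  · nlinarith [norm_nonneg v]
  · exact (mul_le_mul_of_nonneg_left h2 hs.le).trans (almost_best_smul hp h a hv)

/-- With `p` an almost best approximation of `u`, the map `(v, a) ↦ v + a (u - p)` on `S × k` is
bounded below, so its range is complete. Any ratio below `1` would serve. -/
lemma isClosed_sup_span_singleton [CompleteSpace k] [CompleteSpace A] {S : Submodule k A}
    (hS : IsClosed (S : Set A)) (u : A) :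
    IsClosed ((S ⊔ Submodule.span k {u} : Submodule k A) : Set A) := by
  by_cases hu : u ∈ S
  · rwa [sup_eq_left.mpr ((Submodule.span_singleton_le_iff_mem u S).mpr hu)]
  obtain ⟨p, hp, h⟩ := exists_almost_best hS u (s := 2⁻¹) (by norm_num) (by norm_num)
  have hne : u - p ≠ 0 := fun h0 => hu (sub_eq_zero.mp h0 ▸ hp)
  have hpos : 0 < ‖u - p‖ := norm_pos_iff.mpr hne
  let F : S × k →ₗ[k] A := LinearMap.coprod S.subtype (LinearMap.toSpanSingleton k A (u - p))
  have hF : ∀ x, F x = x.2 • (u - p) + x.1 := fun x => by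
    simp [F, add_comm]
  have hr : Set.range F = ((S ⊔ Submodule.span k {u} : Submodule k A) : Set A) := by
    ext w
    constructor
    · rintro ⟨x, rfl⟩
      rw [hF]
      refine Submodule.add_mem _ (Submodule.smul_mem _ _ (Submodule.sub_mem _ ?_ ?_)) ?_
      · exact Submodule.mem_sup_right (Submodule.mem_span_singleton_self u)
      · exact Submodule.mem_sup_left hp
      · exact Submodule.mem_sup_left x.1.2
    · intro hw
      obtain ⟨v, hv, w', hw', rfl⟩ := Submodule.mem_sup.mp hw
      obtain ⟨a, rfl⟩ := Submodule.mem_span_singleton.mp hw'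
      refine ⟨(⟨v + a • p, S.add_mem hv (S.smul_mem a hp)⟩, a), ?_⟩
      rw [hF, smul_sub]
      change a • u - a • p + (v + a • p) = _
      abel
  have : CompleteSpace S := hS.completeSpace_coe
  have hb : ∀ x, ‖x‖ ≤ (2 * max 1 ‖u - p‖⁻¹) * ‖F x‖ := fun x => by
    rw [hF, Prod.norm_def]
    have h1 := norm_le_of_almost_best (by norm_num) (by norm_num) hp h x.2 x.1.2
    have h2 := almost_best_smul hp h x.2 x.1.2
    rw [norm_smul] at h2
    set M := ‖x.2 • (u - p) + x.1‖
    have hM : 0 ≤ M := norm_nonneg _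
    refine max_le ?_ ?_
    · change ‖(x.1 : A)‖ ≤ _
      nlinarith [le_max_left (1 : ℝ) ‖u - p‖⁻¹]
    · have : ‖x.2‖ ≤ 2 * ‖u - p‖⁻¹ * M := by
        rw [mul_right_comm, ← div_eq_mul_inv, le_div_iff₀ hpos]
        linarith
      refine this.trans ?_
      gcongr
      exact le_max_right _ _
  have hanti : AntilipschitzWith ⟨2 * max 1 ‖u - p‖⁻¹, by positivity⟩ F :=
    AddMonoidHomClass.antilipschitz_of_bound F hb
  have hcont : UniformContinuous F := by
    have : Continuous F := by
      have : (F : S × k → A) = fun x => x.2 • (u - p) + x.1 := funext hF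
      rw [this]
      fun_prop
    exact uniformContinuous_addMonoidHom_of_continuous (f := F.toAddMonoidHom) this
  rw [← hr]
  exact hanti.isClosed_range hcont

/-- One step of the extension of an almost bounded functional. -/
lemma exists_functional_step {S : Submodule k A} (hS : IsClosed (S : Set A)) {χ : A →ₗ[k] k}
    {K K' : ℝ} (hK : 0 < K) (hKK : K < K') (h : ∀ a ∈ S, ‖χ a‖ ≤ K * ‖a‖) (u : A) :
    ∃ χ' : A →ₗ[k] k, (∀ a ∈ S, χ' a = χ a) ∧
      ∀ a ∈ S ⊔ Submodule.span k {u}, ‖χ' a‖ ≤ K' * ‖a‖ := by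
  have hK' : 0 < K' := hK.trans hKK
  by_cases hu : u ∈ S
  · refine ⟨χ, fun _ _ => rfl, fun a ha => ?_⟩
    rw [sup_eq_left.mpr ((Submodule.span_singleton_le_iff_mem u S).mpr hu)] at ha
    exact (h a ha).trans (by gcongr)
  -- The ratio is exactly the loss that the new bound permits: replacing `u` by `p` in `v + b u`
  -- enlarges the norm by at most the factor `K' / K`.
  obtain ⟨p, hp, hbest⟩ := exists_almost_best hS u (s := K / K') (by positivity)
    (by rw [div_lt_one hK']; exact hKK)
  obtain ⟨f, hf0, hfS⟩ := Submodule.exists_le_ker_of_notMem hu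
  have hfS' : ∀ a ∈ S, f a = 0 := fun a ha => hfS ha
  -- As `f` vanishes on `S`, this correction leaves `χ` unchanged on `S` and gives `u` the value `χ
  -- p`.
  refine ⟨χ - (χ (u - p) * (f u)⁻¹) • f, fun a ha => by simp [hfS' a ha], fun a ha => ?_⟩
  obtain ⟨v, hv, w', hw', rfl⟩ := Submodule.mem_sup.mp ha
  obtain ⟨b, rfl⟩ := Submodule.mem_span_singleton.mp hw'
  have h1 : (χ - (χ (u - p) * (f u)⁻¹) • f) (v + b • u) = χ (v + b • p) := by
    simp only [LinearMap.sub_apply, LinearMap.smul_apply, map_add, map_smul, hfS' v hv, smul_eq_mul,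
      map_sub]
    field_simp
    ring
  have h2 : v + b • u = b • (u - p) + (v + b • p) := by rw [smul_sub]; abel
  have hmem : v + b • p ∈ S := S.add_mem hv (S.smul_mem b hp)
  have h3 := norm_le_of_almost_best (by positivity) (by rw [div_lt_one hK']; exact hKK) hp hbest b
    hmem
  rw [h1, h2]
  refine (h _ hmem).trans ?_
  rw [div_mul_eq_mul_div, div_le_iff₀ hK'] at h3
  linarith

/-- Without spherical completeness a functional need not extend with the same bound. Finitely many
vectors suffice for what follows, and each of them costs an intermediate constant between the
current bound and `K'`. -/
lemma exists_functional [CompleteSpace k] [CompleteSpace A] {S : Submodule k A}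
    (hS : IsClosed (S : Set A)) {χ : A →ₗ[k] k} {K K' : ℝ} (hK : 0 < K) (hKK : K < K')
    (h : ∀ a ∈ S, ‖χ a‖ ≤ K * ‖a‖) (T : Finset A) :
    ∃ χ' : A →ₗ[k] k, (∀ a ∈ S, χ' a = χ a) ∧ ∀ a ∈ T, ‖χ' a‖ ≤ K' * ‖a‖ := by
  classical
  suffices H : ∃ χ' : A →ₗ[k] k, (∀ a ∈ S, χ' a = χ a) ∧ ∃ S' : Submodule k A,
      IsClosed (S' : Set A) ∧ S ≤ S' ∧ (T : Set A) ⊆ S' ∧ ∃ K'' : ℝ, 0 < K'' ∧ K'' < K' ∧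
        ∀ a ∈ S', ‖χ' a‖ ≤ K'' * ‖a‖ by
    obtain ⟨χ', h1, S', -, -, hT, K'', -, hK'', h2⟩ := H
    exact ⟨χ', h1, fun a ha => (h2 a (hT ha)).trans (by gcongr)⟩
  induction T using Finset.induction_on with
  | empty => exact ⟨χ, fun _ _ => rfl, S, hS, le_rfl, by simp, K, hK, hKK, h⟩
  | insert u T _ ih =>
    obtain ⟨χ₁, h1, S₁, hS₁, hle, hT, K₁, hK₁, hK₁', h2⟩ := ih
    obtain ⟨K₂, hK₂, hK₂'⟩ := exists_between hK₁'
    obtain ⟨χ₂, h3, h4⟩ := exists_functional_step hS₁ hK₁ hK₂ h2 u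
    refine ⟨χ₂, fun a ha => (h3 a (hle ha)).trans (h1 a ha), _, isClosed_sup_span_singleton hS₁ u,
      hle.trans le_sup_left, ?_, K₂, hK₁.trans hK₂, hK₂', h4⟩
    rw [Finset.coe_insert, Set.insert_subset_iff]
    exact ⟨Submodule.mem_sup_right (Submodule.mem_span_singleton_self u),
      hT.trans fun _ hx => Submodule.mem_sup_left hx⟩

variable (k) in
/-- Sequences that are `1/2`-orthogonal, zero vectors being allowed. -/
def IsOrtho (e : ℕ → A) : Prop :=
  ∀ (n : ℕ) (a : ℕ → k), ∀ i < n, ‖a i • e i‖ ≤ 2 * ‖∑ j ∈ Finset.range n, a j • e j‖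

/-- Every sequence lies in the span of an orthogonal one. -/
lemma exists_isOrtho [CompleteSpace k] [CompleteSpace A] (u : ℕ → A) :
    ∃ e : ℕ → A, IsOrtho k e ∧ (∀ n, u n ∈ Submodule.span k (Set.range e)) ∧
      ∀ n, IsClosed (Submodule.span k (e '' Set.Iio n) : Set A) := by
  let S : ℕ → Submodule k A := fun n => Submodule.span k (u '' Set.Iio n)
  have S_succ : ∀ n, S (n + 1) = S n ⊔ Submodule.span k {u n} := fun n => by
    change Submodule.span k (u '' Set.Iio (n + 1)) = _
    rw [← Submodule.span_union, ← Set.image_singleton, ← Set.image_union]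
    congr 2
    ext i
    simp only [Set.mem_Iio, Set.mem_union, Set.mem_singleton_iff]
    omega
  have hS : ∀ n, IsClosed (S n : Set A) := fun n => by
    induction n with
    | zero =>
      have : S 0 = ⊥ := by simp [S]
      rw [this]
      exact isClosed_singleton
    | succ n ih => rw [S_succ]; exact isClosed_sup_span_singleton ih _
  -- The sequence decreases strictly from `1` towards `1/2`. The `n`-th vector is approximated with
  -- ratio `t (n + 1) / t n < 1`, so the accumulated constants telescope to `t n` and stay above
  -- `1/2`.
  let t : ℕ → ℝ := fun n => 2⁻¹ + 2⁻¹ ^ (n + 1)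
  have ht : ∀ n, 2⁻¹ < t n := fun n => lt_add_of_pos_right _ (by positivity)
  have ht0 : ∀ n, 0 < t n := fun n => lt_trans (by norm_num) (ht n)
  have htlt : ∀ n, t (n + 1) < t n := fun n =>
    (add_lt_add_iff_left _).mpr (pow_lt_pow_right_of_lt_one₀ (by norm_num) (by norm_num) (by omega))
  have ht1 : ∀ n, t n ≤ 1 := fun n => by
    have : (2⁻¹ : ℝ) ^ (n + 1) ≤ 2⁻¹ := pow_le_of_le_one (by norm_num) (by norm_num) (by omega)
    simp only [t]
    linarith
  choose p hp hbest using fun n => exists_almost_best (hS n) (u n) (s := t (n + 1) / t n)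
    (div_pos (ht0 _) (ht0 _)) ((div_lt_one (ht0 n)).mpr (htlt n))
  let e : ℕ → A := fun n => u n - p n
  have Sle : ∀ n, S n ≤ S (n + 1) := fun n => by rw [S_succ]; exact le_sup_left
  have hu : ∀ n, u n ∈ S (n + 1) := fun n => by
    rw [S_succ]
    exact Submodule.mem_sup_right (Submodule.mem_span_singleton_self _)
  have he : ∀ n, e n ∈ S (n + 1) := fun n => Submodule.sub_mem _ (hu n) (Sle n (hp n))
  have Smono : Monotone S := monotone_nat_of_le_succ Sle
  have hspan : ∀ n, S n = Submodule.span k (e '' Set.Iio n) := fun n => by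
    refine le_antisymm ?_ ?_
    · induction n with
      | zero => simp [S]
      | succ n ih =>
        have hle : Submodule.span k (e '' Set.Iio n) ≤ Submodule.span k (e '' Set.Iio (n + 1)) :=
          Submodule.span_mono (Set.image_mono fun i (hi : i < n) =>
            (show i < n + 1 by omega))
        rw [S_succ]
        refine sup_le (ih.trans hle) ?_
        rw [Submodule.span_singleton_le_iff_mem]
        have : u n = e n + p n := (sub_add_cancel _ _).symm
        rw [this]
        exact Submodule.add_mem _ (Submodule.subset_span ⟨n, Nat.lt_succ_self n, rfl⟩)
          (hle (ih (hp n)))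
    · rw [Submodule.span_le]
      rintro _ ⟨i, hi, rfl⟩
      exact Smono (show i + 1 ≤ n from hi) (he i)
  have key : ∀ (n : ℕ) (a : ℕ → k), ∀ i < n,
      t n * ‖a i • e i‖ ≤ ‖∑ j ∈ Finset.range n, a j • e j‖ := by
    intro n a
    induction n with
    | zero => intro i hi; omega
    | succ n ih =>
      intro i hi
      have hmem : ∑ j ∈ Finset.range n, a j • e j ∈ S n := Submodule.sum_mem _ fun j hj =>
        Submodule.smul_mem _ _ (Smono (Finset.mem_range.mp hj) (he j))
      rw [Finset.sum_range_succ, add_comm (Finset.sum _ _)]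
      have hs0 : 0 < t (n + 1) / t n := div_pos (ht0 _) (ht0 _)
      have h1 := almost_best_smul (hp n) (hbest n) (a n) hmem
      have h2 := norm_le_of_almost_best hs0 ((div_lt_one (ht0 n)).mpr (htlt n)) (hp n) (hbest n)
        (a n) hmem
      rcases Nat.lt_succ_iff_lt_or_eq.mp hi with hi | rfl
      · refine le_trans ?_ h2
        calc t (n + 1) * ‖a i • e i‖ = t (n + 1) / t n * (t n * ‖a i • e i‖) := by
              field_simp [(ht0 n).ne']
          _ ≤ _ := mul_le_mul_of_nonneg_left (ih i hi) hs0.le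
      · refine le_trans (mul_le_mul_of_nonneg_right ?_ (norm_nonneg _)) h1
        rw [le_div_iff₀ (ht0 _)]
        nlinarith [ht0 (i + 1), ht1 i]
  refine ⟨e, fun n a i hi => ?_, fun n => ?_, fun n => hspan n ▸ hS n⟩
  · have := key n a i hi
    nlinarith [ht n, norm_nonneg (a i • e i)]
  · exact Submodule.span_mono (Set.image_subset_range _ _) (hspan (n + 1) ▸ hu n)

end approximation

/-! ### Orthogonal expansions in completed tensor products -/

section flat

variable {k : Type u} [NormedField k] {A B X Y Z : NABan k}

/-- Slicing by a functional which is bounded on a suitable finite set is bounded. -/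
lemma exists_finset_slice_le {C : ℝ} {z : AlgTensor A Y} (hz : z ∈ AlgTensor.ball A Y C) :
    ∃ T : Finset A, ∀ (χ : A →ₗ[k] k) (K : ℝ), 0 ≤ C → 0 ≤ K → (∀ a ∈ T, ‖χ a‖ ≤ K * ‖a‖) →
      ‖AlgTensor.liftLin (LinearMap.lsmul k Y ∘ₗ χ) z‖ ≤ K * C := by
  classical
  induction hz using AddSubgroup.closure_induction with
  | mem z hz =>
    obtain ⟨a, y, hay, rfl⟩ := hz
    refine ⟨{a}, fun χ K _ hK h => ?_⟩
    rw [AlgTensor.liftLin_tmul]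
    change ‖χ a • y‖ ≤ _
    rw [norm_smul]
    calc ‖χ a‖ * ‖y‖ ≤ K * ‖a‖ * ‖y‖ := by gcongr; exact h a (Finset.mem_singleton_self a)
      _ ≤ K * C := by rw [mul_assoc]; gcongr
  | zero => exact ⟨∅, fun χ K hC hK _ => by rw [map_zero, norm_zero]; positivity⟩
  | add z w _ _ hz hw =>
    obtain ⟨T, hT⟩ := hz
    obtain ⟨T', hT'⟩ := hw
    refine ⟨T ∪ T', fun χ K hC hK h => ?_⟩
    rw [map_add]
    exact (IsUltrametricDist.norm_add_le_max _ _).trans (max_le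
      (hT χ K hC hK fun a ha => h a (Finset.mem_union_left _ ha))
      (hT' χ K hC hK fun a ha => h a (Finset.mem_union_right _ ha)))
  | neg z _ hz =>
    obtain ⟨T, hT⟩ := hz
    exact ⟨T, fun χ K hC hK h => by rw [map_neg, norm_neg]; exact hT χ K hC hK h⟩

variable [IsUltrametricDist k] [CompleteSpace k]

/-- Tensoring keeps orthogonality. -/
lemma norm_le_of_isOrtho {e : ℕ → A} (he : IsOrtho k e)
    (hcl : ∀ n, IsClosed (Submodule.span k (e '' Set.Iio n) : Set A)) (y : ℕ → Y) {n i : ℕ}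
    (hi : i < n) :
    ‖e i‖ * ‖y i‖ ≤ 2 * ‖∑ j ∈ Finset.range n, tmul (e j) (y j)‖ := by
  classical
  by_cases hei : e i = 0
  · rw [hei, norm_zero, zero_mul]; positivity
  have hei' : 0 < ‖e i‖ := norm_pos_iff.mpr hei
  let z : AlgTensor A Y := ∑ j ∈ Finset.range n, AlgTensor.tmul (e j) (y j)
  have hz : ‖∑ j ∈ Finset.range n, tmul (e j) (y j)‖ = ‖z‖ := by
    have h1 : ∑ j ∈ Finset.range n, tmul (e j) (y j) =
        UniformSpace.Completion.toComplL (𝕜 := k) (E := AlgTensor A Y) z := by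
      rw [map_sum]; rfl
    rw [h1]
    exact UniformSpace.Completion.norm_coe z
  rw [hz]
  let S := Submodule.span k (e '' Set.Iio n)
  have hind : ∀ a : ℕ → k, ∑ j ∈ Finset.range n, a j • e j = 0 → a i = 0 := fun a ha => by
    have := he n a i hi
    rw [ha, norm_zero, mul_zero, norm_le_zero_iff, smul_eq_zero, or_iff_left hei] at this
    exact this
  have hnot : e i ∉ Submodule.span k (e '' (Set.Iio n \ {i})) := fun hmem => by
    rw [Finsupp.mem_span_image_iff_linearCombination] at hmem
    obtain ⟨l, hl, hle⟩ := hmem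
    have hsupp : l.support ⊆ Finset.range n := fun j hj =>
      Finset.mem_range.mpr ((Finsupp.mem_supported k l).mp hl hj).1
    have hli : l i = 0 := by
      by_contra h
      exact ((Finsupp.mem_supported k l).mp hl (Finsupp.mem_support_iff.mpr h)).2 rfl
    rw [Finsupp.linearCombination_apply, Finsupp.sum_of_support_subset _ hsupp _ (by simp)] at hle
    have h0 := hind (fun j => l j - if j = i then 1 else 0) (by
      simp only [sub_smul, Finset.sum_sub_distrib, hle, ite_smul, one_smul, zero_smul,
        Finset.sum_ite_eq', Finset.mem_range, hi, if_true, sub_self])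
    simp [hli] at h0
  obtain ⟨f, hf0, hfS⟩ := Submodule.exists_le_ker_of_notMem hnot
  -- The coordinate functional of `e i`; orthogonality bounds it by `2 / ‖e i‖` on the span of the
  -- first `n` vectors. Slicing `z` with an extension of it returns `y i`.
  let χ : A →ₗ[k] k := (f (e i))⁻¹ • f
  have hχi : χ (e i) = 1 := inv_mul_cancel₀ hf0
  have hχj : ∀ j < n, j ≠ i → χ (e j) = 0 := fun j hj hji => by
    have : f (e j) = 0 := hfS (Submodule.subset_span ⟨j, ⟨hj, hji⟩, rfl⟩)
    simp [χ, this]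
  have hχ : ∀ a : ℕ → k, χ (∑ j ∈ Finset.range n, a j • e j) = a i := fun a => by
    rw [map_sum, Finset.sum_eq_single i]
    · rw [map_smul, hχi, smul_eq_mul, mul_one]
    · intro j hj hji
      rw [map_smul, hχj j (Finset.mem_range.mp hj) hji, smul_zero]
    · intro h
      exact absurd (Finset.mem_range.mpr hi) h
  have hbd : ∀ a ∈ S, ‖χ a‖ ≤ (2 / ‖e i‖) * ‖a‖ := fun a ha => by
    obtain ⟨l, hl, rfl⟩ := (Finsupp.mem_span_image_iff_linearCombination k).mp ha
    have hsupp : l.support ⊆ Finset.range n := fun j hj =>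
      Finset.mem_range.mpr ((Finsupp.mem_supported k l).mp hl hj)
    rw [Finsupp.linearCombination_apply, Finsupp.sum_of_support_subset _ hsupp _ (by simp), hχ,
      div_mul_eq_mul_div, le_div_iff₀ hei', ← norm_smul]
    exact he n l i hi
  refine le_of_forall_pos_le_add fun ε hε => ?_
  have hlt : ‖z‖ < ‖z‖ + ε / 4 := lt_add_of_pos_right _ (by positivity)
  have hC : 0 < ‖z‖ + ε / 4 := (AlgTensor.norm_nonneg' z).trans_lt hlt
  obtain ⟨T, hT⟩ := exists_finset_slice_le (AlgTensor.mem_ball_of_norm_lt hlt)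
  -- The constant is chosen so that the final estimate reads `2 * ‖z‖ + ε`. It exceeds `2 / ‖e i‖`
  -- because `ε > 2 * (ε / 4)`, and this leaves room for extending `χ` to the finite set `T`.
  obtain ⟨K, hK, hK'⟩ : ∃ K, 2 / ‖e i‖ < K ∧ K * ‖e i‖ * (‖z‖ + ε / 4) ≤ 2 * ‖z‖ + ε := by
    refine ⟨(2 * ‖z‖ + ε) / (‖e i‖ * (‖z‖ + ε / 4)), ?_, le_of_eq (by field_simp)⟩
    rw [div_lt_div_iff₀ hei' (by positivity)]
    nlinarith
  have hK0 : 0 < 2 / ‖e i‖ := by positivity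
  obtain ⟨χ', h1, h2⟩ := exists_functional (hcl n) hK0 hK hbd T
  have h3 := hT χ' K hC.le (hK0.trans hK).le h2
  have h4 : AlgTensor.liftLin (LinearMap.lsmul k Y ∘ₗ χ') z = y i := by
    rw [map_sum, Finset.sum_eq_single i]
    · rw [AlgTensor.liftLin_tmul]
      change χ' (e i) • y i = _
      rw [h1 _ (Submodule.subset_span ⟨i, hi, rfl⟩), hχi, one_smul]
    · intro j hj hji
      rw [AlgTensor.liftLin_tmul]
      change χ' (e j) • y j = _
      rw [h1 _ (Submodule.subset_span ⟨j, Finset.mem_range.mp hj, rfl⟩),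
        hχj j (Finset.mem_range.mp hj) hji, zero_smul]
    · intro h
      exact absurd (Finset.mem_range.mpr hi) h
  rw [h4] at h3
  calc ‖e i‖ * ‖y i‖ ≤ ‖e i‖ * (K * (‖z‖ + ε / 4)) := by gcongr
    _ ≤ _ := by linarith

lemma norm_le_of_isOrtho_of_hasSum {e : ℕ → A} (he : IsOrtho k e)
    (hcl : ∀ n, IsClosed (Submodule.span k (e '' Set.Iio n) : Set A)) {y : ℕ → Y}
    {z : (A ⊗ Y : NABan k)} (hz : HasSum (fun i => tmul (e i) (y i)) z) (i : ℕ) :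
    ‖e i‖ * ‖y i‖ ≤ 2 * ‖z‖ := by
  have h1 : Tendsto (fun n => 2 * ‖∑ j ∈ Finset.range n, tmul (e j) (y j)‖) atTop
      (𝓝 (2 * ‖z‖)) := (hz.tendsto_sum_nat.norm).const_mul 2
  refine ge_of_tendsto h1 ?_
  filter_upwards [eventually_gt_atTop i] with n hn
  exact norm_le_of_isOrtho he hcl y hn

/-- A finite sum involves finitely many vectors of `A`, and a limit of a sequence involves only
countably many. The property is therefore closed, and it holds on the dense set of finite sums. -/
lemma exists_countable_type (z : (A ⊗ X : NABan k)) : ∃ u : ℕ → A,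
    z ∈ (Submodule.span k
      {w : (A ⊗ X : NABan k) | ∃ i x, w = tmul (u i) x}).topologicalClosure := by
  let D : Set A → Submodule k (A ⊗ X : NABan k) := fun T =>
    Submodule.span k {w | ∃ a ∈ T, ∃ x, w = tmul a x}
  have Dmono : ∀ {T T' : Set A}, T ⊆ T' → D T ≤ D T' := fun h =>
    Submodule.span_mono fun w ⟨a, ha, x, hw⟩ => ⟨a, h ha, x, hw⟩
  suffices H : ∃ T : Set A, T.Countable ∧ z ∈ (D T).topologicalClosure by
    obtain ⟨T, hT, hz⟩ := H
    obtain ⟨u, hu⟩ := (hT.insert 0).exists_eq_range (Set.insert_nonempty _ _)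
    refine ⟨u, closure_mono (Submodule.span_mono ?_) hz⟩
    rintro w ⟨a, ha, x, rfl⟩
    obtain ⟨i, rfl⟩ : a ∈ Set.range u := hu ▸ Set.mem_insert_of_mem _ ha
    exact ⟨i, x, rfl⟩
  induction z using tmul_induction with
  | hp =>
    refine IsSeqClosed.isClosed fun w z hw hz => ?_
    choose T hT hwT using hw
    refine ⟨⋃ n, T n, Set.countable_iUnion hT, ?_⟩
    exact (D _).isClosed_topologicalClosure.mem_of_tendsto hz (Eventually.of_forall fun n =>
      Submodule.topologicalClosure_mono (Dmono (Set.subset_iUnion T n)) (hwT n))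
  | h0 => exact ⟨∅, Set.countable_empty, Submodule.zero_mem _⟩
  | ht a x => exact ⟨{a}, Set.countable_singleton a,
      (D _).le_topologicalClosure (Submodule.subset_span ⟨a, rfl, x, rfl⟩)⟩
  | ha z w hz hw =>
    obtain ⟨T, hT, hz⟩ := hz
    obtain ⟨T', hT', hw⟩ := hw
    exact ⟨T ∪ T', hT.union hT', Submodule.add_mem _
      (Submodule.topologicalClosure_mono (Dmono Set.subset_union_left) hz)
      (Submodule.topologicalClosure_mono (Dmono Set.subset_union_right) hw)⟩

/-- Elements of a completed tensor product are orthogonal series of elementary tensors. -/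
lemma exists_ortho_expansion (z : (A ⊗ X : NABan k)) : ∃ e : ℕ → A, IsOrtho k e ∧
    (∀ n, IsClosed (Submodule.span k (e '' Set.Iio n) : Set A)) ∧
    ∃ x : ℕ → X, HasSum (fun i => tmul (e i) (x i)) z := by
  classical
  obtain ⟨u, hu⟩ := exists_countable_type z
  obtain ⟨e, he, hue, hcl⟩ := exists_isOrtho (k := k) u
  refine ⟨e, he, hcl, ?_⟩
  -- With these weights every map `x ↦ e i ⊗ x` is a contraction, and the maps assemble on the
  -- contracting coproduct. The weight at a zero vector is arbitrary, but has to be positive.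
  let ρ : ℕ → ℝ := fun i => if e i = 0 then 1 else ‖e i‖
  have hρ : ∀ i, 0 < ρ i := fun i => by
    simp only [ρ]
    split_ifs with h
    · exact one_pos
    · exact norm_pos_iff.mpr h
  let E : ℕ → NABan k := fun i => rescale (ρ i) (hρ i) X
  let φ : ∀ i, E i ⟶ A ⊗ X := fun i => ofRescale (ρ i) X (hρ i) ≫ tmulL (e i) X
  have hφ : ∀ i, IsContr (φ i) := fun i x => by
    change ‖tmul (e i) (ofRescale (ρ i) X (hρ i) x)‖ ≤ _
    refine (norm_tmul_le _ _).trans ?_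
    rw [norm_ofRescale, ← mul_assoc]
    refine mul_le_of_le_one_left (norm_nonneg x) ?_
    rw [← div_eq_mul_inv, div_le_one (hρ i)]
    simp only [ρ]
    split_ifs with h
    · rw [h, norm_zero]; exact zero_le_one
    · exact le_rfl
  let Φ : coprod E ⟶ A ⊗ X := desc φ hφ
  have hΦ : ∀ w, HasSum (fun i => tmul (e i) (ofRescale (ρ i) X (hρ i) (comp w i))) (Φ w) :=
    fun w => by
      rw [desc_apply]
      exact (summable_desc φ hφ w).hasSum
  -- Components at zero vectors of the sequence are discarded, since `Φ` loses them. On the rest,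
  -- orthogonality bounds `Φ` below, so its range is closed; it contains all `u i ⊗ x`, hence also
  -- `z`.
  let S : Submodule k (coprod E) :=
    ⨅ i : {i // e i = 0}, LinearMap.ker (Hom.lin (compHom E i))
  have hS : ∀ {w}, w ∈ S ↔ ∀ i, e i = 0 → comp w i = 0 := fun {w} => by
    simp only [S, Submodule.mem_iInf, Subtype.forall, LinearMap.mem_ker]
    rfl
  have hSc : IsClosed (S : Set (coprod E)) := by
    simp only [S, Submodule.coe_iInf]
    exact isClosed_iInter fun i => isClosed_eq (continuous (compHom E i)) continuous_const
  have hanti : ∀ w ∈ S, ‖w‖ ≤ 2 * ‖Φ w‖ := fun w hw =>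
    norm_coprod_le (by positivity) fun i => by
      by_cases h : e i = 0
      · rw [hS.mp hw i h, norm_zero]; positivity
      · have h1 := norm_le_of_isOrtho_of_hasSum he hcl (hΦ w) i
        rw [norm_ofRescale, ← mul_assoc] at h1
        have h2 : ‖e i‖ * (ρ i)⁻¹ = 1 := by
          simp only [ρ, if_neg h]
          exact mul_inv_cancel₀ (norm_ne_zero_iff.mpr h)
        rwa [h2, one_mul] at h1
  have : CompleteSpace S := hSc.completeSpace_coe
  let F : S →ₗ[k] (A ⊗ X : NABan k) := Hom.lin Φ ∘ₗ S.subtype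
  have hF : IsClosed (Set.range F) := by
    have h1 : AntilipschitzWith 2 F := AddMonoidHomClass.antilipschitz_of_bound F fun w =>
      hanti w w.2
    refine h1.isClosed_range (uniformContinuous_addMonoidHom_of_continuous
      (f := F.toAddMonoidHom) ?_)
    exact (continuous Φ).comp continuous_subtype_val
  have hrange : z ∈ LinearMap.range F := by
    refine closure_minimal ?_ hF hu
    change Submodule.span k {w | ∃ i x, w = tmul (u i) x} ≤ LinearMap.range F
    rw [Submodule.span_le]
    rintro w ⟨i, x, rfl⟩
    have h1 : Submodule.span k (Set.range e) ≤ (LinearMap.range F).comap (Hom.lin (tmulR A x)) := by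
      rw [Submodule.span_le]
      rintro _ ⟨j, rfl⟩
      rw [SetLike.mem_coe, Submodule.mem_comap]
      change tmul (e j) x ∈ _
      by_cases hj : e j = 0
      · rw [hj, show tmul (0 : A) x = 0 from map_zero (Hom.lin (tmulR A x))]
        exact Submodule.zero_mem _
      · refine ⟨⟨incl E j (toRescale (ρ j) X (hρ j) x), hS.mpr fun i hi => ?_⟩, ?_⟩
        · exact comp_incl_ne _ fun h => hj (h ▸ hi)
        · change Φ (incl E j _) = _
          rw [desc_incl]
          rfl
    exact h1 (hue i)
  obtain ⟨w, rfl⟩ := hrange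
  exact ⟨_, hΦ w⟩

end flat

end NABan

namespace NABan

/-! ### Kernels and the flatness of Banach spaces -/

section kernels

variable {k : Type u} [NormedField k] {A B X Y Z K : NABan k}

lemma isContr_sum {X Y : NABan k} {ι : Type*} (s : Finset ι) (f : ι → (X ⟶ Y))
    (hf : ∀ i ∈ s, IsContr (f i)) : IsContr (∑ i ∈ s, f i) :=
  Finset.sum_induction f IsContr (fun _ _ h h' => h.add h') isContr_zero hf

instance : Limits.HasZeroObject (NABan k) := by
  let O : NABan k :=
    { carrier := PUnit
      ultra := ⟨fun x y z => le_max_of_le_left (dist_self x).le⟩ }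
  exact ⟨O, (Limits.IsZero.iff_id_eq_zero O).mpr (hom_ext fun x => (rfl : PUnit.unit = PUnit.unit))⟩

/-- The product of two Banach spaces, with the supremum norm. -/
def prodObj (X Y : NABan k) : NABan k where
  carrier := X × Y
  ultra := ⟨fun x y z => by
    simp only [Prod.dist_eq]
    refine max_le ((dist_triangle_max x.1 y.1 z.1).trans ?_)
      ((dist_triangle_max x.2 y.2 z.2).trans ?_)
    · exact max_le_max (le_max_left _ _) (le_max_left _ _)
    · exact max_le_max (le_max_right _ _) (le_max_right _ _)⟩

instance : Limits.HasBinaryBiproducts (NABan k) := ⟨fun X Y => by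
  let b : Limits.BinaryBicone X Y :=
    { pt := prodObj X Y
      fst := mk' (X := prodObj X Y) (show X × Y →ₗ[k] X from LinearMap.fst k X Y) 1
        fun (x : X × Y) => (norm_fst_le x).trans_eq (one_mul ‖x‖).symm
      snd := mk' (X := prodObj X Y) (show X × Y →ₗ[k] Y from LinearMap.snd k X Y) 1
        fun (x : X × Y) => (norm_snd_le x).trans_eq (one_mul ‖x‖).symm
      inl := mk' (Y := prodObj X Y) (show X →ₗ[k] X × Y from LinearMap.inl k X Y) 1 fun x =>
        show ‖((x, 0) : X × Y)‖ ≤ 1 * ‖x‖ by simp [Prod.norm_def]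
      inr := mk' (Y := prodObj X Y) (show Y →ₗ[k] X × Y from LinearMap.inr k X Y) 1 fun x =>
        show ‖((0, x) : X × Y)‖ ≤ 1 * ‖x‖ by simp [Prod.norm_def]
      inl_fst := rfl
      inl_snd := rfl
      inr_fst := rfl
      inr_snd := rfl }
  refine Limits.hasBinaryBiproduct_of_total b (hom_ext fun (x : X × Y) => ?_)
  change ((x.1, 0) : X × Y) + (0, x.2) = x
  simp⟩

instance : Limits.HasFiniteProducts (NABan k) :=
  have : Limits.HasTerminal (NABan k) := Limits.HasZeroObject.hasTerminal
  hasFiniteProducts_of_has_binary_and_terminal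

/-- Closed embeddings onto the kernel of `f` are kernels of `f`. -/
def isLimitKernelFork {i : K ⟶ X} {f : X ⟶ Y} (w : i ≫ f = 0) {C : ℝ}
    (hb : ∀ z, ‖z‖ ≤ C * ‖i z‖) (hr : ∀ x, f x = 0 → ∃ z, i z = x) :
    Limits.IsLimit (Limits.KernelFork.ofι i w) := by
  have inj : Function.Injective i := (injective_iff_map_eq_zero (Hom.lin i)).mpr fun z hz => by
    have := hb z
    rwa [show i z = 0 from hz, norm_zero, mul_zero, norm_le_zero_iff] at this
  have hmem : ∀ {W : NABan k} (s : W ⟶ X), s ≫ f = 0 → ∀ x, ∃ z, i z = s x := fun s hs x =>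
    hr _ (congrArg (fun F => Hom.lin F x) hs)
  have hlift : ∀ {W : NABan k} (s : W ⟶ X), s ≫ f = 0 → ∃ l : W ⟶ K, l ≫ i = s := fun {W} s hs => by
    choose L hL using hmem s hs
    refine ⟨Hom.mk
      { toFun := L
        map_add' := fun x y => inj (by rw [map_add, hL, hL, hL, map_add])
        map_smul' := fun a x => inj (by rw [map_smul, hL, hL, map_smul]; rfl) } ?_,
      hom_ext fun x => hL x⟩
    obtain ⟨D, hD⟩ := Hom.bound s
    refine ⟨|C| * D, fun x => ?_⟩
    have h1 := hb (L x)
    rw [hL] at h1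
    refine h1.trans ?_
    rw [mul_assoc]
    exact mul_le_mul (le_abs_self C) (hD x) (norm_nonneg _) (abs_nonneg C)
  refine Limits.KernelFork.IsLimit.ofι i w (fun s hs => (hlift s hs).choose)
    (fun s hs => (hlift s hs).choose_spec) fun s hs m hm => hom_ext fun x => inj ?_
  exact congrArg (fun F => Hom.lin F x) (hm.trans (hlift s hs).choose_spec.symm)

lemma eqIncl_comp_zero (f : X ⟶ Y) : eqIncl f 0 ≫ f = 0 := hom_ext fun x => x.2

/-- The standard kernel. -/
def isLimitEqIncl (f : X ⟶ Y) : Limits.IsLimit (Limits.KernelFork.ofι (eqIncl f 0)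
    (eqIncl_comp_zero f)) :=
  isLimitKernelFork (eqIncl_comp_zero f) (C := 1) (fun z => (one_mul ‖z‖).ge)
    fun x hx => ⟨⟨x, hx⟩, rfl⟩

instance : Limits.HasEqualizers (NABan k) :=
  have : Limits.HasKernels (NABan k) := ⟨fun f => ⟨⟨_, isLimitEqIncl f⟩⟩⟩
  Preadditive.hasEqualizers_of_hasKernels

variable [IsUltrametricDist k] [CompleteSpace k]

lemma hasSum_whiskerLeft {e : ℕ → A} {x : ℕ → X} {z : (A ⊗ X : NABan k)} (g : X ⟶ Y)
    (hs : HasSum (fun i => tmul (e i) (x i)) z) :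
    HasSum (fun i => tmul (e i) (g (x i))) ((A ◁ g) z) := by
  simpa only [Function.comp_def, whiskerLeft_tmul] using
    hs.map (Hom.lin (A ◁ g)) (continuous (A ◁ g))

/-- Tensoring preserves jointly injective families. -/
lemma eq_zero_of_whiskerLeft {ι : Type*} {Z : ι → NABan k} (g : ∀ j, X ⟶ Z j)
    (hg : ∀ x, (∀ j, g j x = 0) → x = 0) (z : (A ⊗ X : NABan k))
    (hz : ∀ j, (A ◁ g j) z = 0) : z = 0 := by
  -- Applying `g j` to the coefficients gives another orthogonal expansion, whose sum is zero. Each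
  -- `g j (x i)` with `e i ≠ 0` therefore vanishes, and joint injectivity kills `x i` itself.
  obtain ⟨e, he, hcl, x, hs⟩ := exists_ortho_expansion z
  have h0 : ∀ i, tmul (e i) (x i) = 0 := fun i => by
    by_cases hei : e i = 0
    · rw [hei]
      exact map_zero (Hom.lin (tmulR A (x i)))
    · rw [hg (x i) fun j => ?_]
      · exact map_zero (Hom.lin (tmulL (e i) X))
      · have h1 : HasSum (fun i => tmul (e i) (g j (x i))) 0 := by
          rw [← hz j]
          exact hasSum_whiskerLeft (g j) hs
        have h2 := norm_le_of_isOrtho_of_hasSum he hcl h1 i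
        rw [norm_zero, mul_zero] at h2
        have h3 : ‖g j (x i)‖ ≤ 0 := by
          have : 0 < ‖e i‖ := norm_pos_iff.mpr hei
          nlinarith [norm_nonneg (g j (x i))]
        exact norm_le_zero_iff.mp h3
  simp only [h0] at hs
  exact hs.unique hasSum_zero

lemma whiskerLeft_injective {g : X ⟶ Y} (hg : ∀ x, g x = 0 → x = 0) (z : (A ⊗ X : NABan k))
    (hz : (A ◁ g) z = 0) : z = 0 :=
  eq_zero_of_whiskerLeft (fun _ : Unit => g) (fun x hx => hg x (hx ())) z fun _ => hz

lemma whiskerRight_injective {g : X ⟶ Y} (hg : ∀ x, g x = 0 → x = 0) (z : (X ⊗ A : NABan k))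
    (hz : (g ▷ A) z = 0) : z = 0 := by
  have h1 : (β_ X A).hom ≫ (A ◁ g) = (g ▷ A) ≫ (β_ Y A).hom :=
    (BraidedCategory.braiding_naturality_left g A).symm
  have h2 : (β_ X A).hom z = 0 := whiskerLeft_injective hg _ (by
    have := congrArg (fun F => Hom.lin F z) h1
    simp only [lin_comp] at this
    rw [this, hz, map_zero])
  have h3 := congrArg (fun F => Hom.lin F z) (β_ X A).hom_inv_id
  simp only [lin_comp, lin_id] at h3
  rw [← h3, h2, map_zero]

/-- Injectivity alone suffices. This matters for the map from the quotient to the tensor algebra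
induced by the symmetrizer, for which no lower bound on norms is at hand. -/
lemma tensorHom_injective {f : X ⟶ Y} {g : A ⟶ B} (hf : ∀ x, f x = 0 → x = 0)
    (hg : ∀ x, g x = 0 → x = 0) (z : (X ⊗ A : NABan k)) (hz : (f ⊗ₘ g) z = 0) : z = 0 := by
  rw [MonoidalCategory.tensorHom_def] at hz
  exact whiskerRight_injective hf z (whiskerLeft_injective hg _ hz)

/-- Tensoring an isometric embedding bounds norms from below. -/
lemma norm_le_whiskerLeft {i : K ⟶ X} (hi : ∀ x, ‖x‖ ≤ ‖i x‖) (z : (A ⊗ K : NABan k)) :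
    ‖z‖ ≤ 2 * ‖(A ◁ i) z‖ := by
  obtain ⟨e, he, hcl, x, hs⟩ := exists_ortho_expansion z
  have h1 : HasSum (fun j => tmul (e j) (i (x j))) ((A ◁ i) z) := hasSum_whiskerLeft i hs
  have h2 : ∀ j, ‖tmul (e j) (x j)‖ ≤ 2 * ‖(A ◁ i) z‖ := fun j =>
    (norm_tmul_le _ _).trans ((mul_le_mul_of_nonneg_left (hi _) (norm_nonneg _)).trans
      (norm_le_of_isOrtho_of_hasSum he hcl h1 j))
  refine le_of_tendsto hs.tendsto_sum_nat.norm (Eventually.of_forall fun n => ?_)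
  exact IsUltrametricDist.norm_sum_le_of_forall_le_of_nonneg (by positivity) fun j _ => h2 j

/-- Tensoring is exact in the middle. -/
lemma mem_range_whiskerLeft {i : K ⟶ X} (hi : ∀ x, ‖x‖ ≤ ‖i x‖) {f : X ⟶ Y}
    (hr : ∀ x, f x = 0 → ∃ z, i z = x) {z : (A ⊗ X : NABan k)} (hz : (A ◁ f) z = 0) :
    ∃ w, (A ◁ i) w = z := by
  have hcl : IsClosed (Set.range (A ◁ i)) := by
    -- The range is closed by the bound from below, so it is enough to place each term of the
    -- expansion of `z` in it.
    have h1 : AntilipschitzWith 2 (Hom.lin (A ◁ i)) :=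
      AddMonoidHomClass.antilipschitz_of_bound _ fun w => norm_le_whiskerLeft hi w
    exact h1.isClosed_range (uniformContinuous_addMonoidHom_of_continuous
      (f := (Hom.lin (A ◁ i)).toAddMonoidHom) (continuous (A ◁ i)))
  obtain ⟨e, he, hcl', x, hs⟩ := exists_ortho_expansion z
  have h1 : HasSum (fun j => tmul (e j) (f (x j))) 0 := by
    rw [← hz]
    exact hasSum_whiskerLeft f hs
  have h2 : ∀ j, ∃ w, (A ◁ i) w = tmul (e j) (x j) := fun j => by
    by_cases hej : e j = 0
    · refine ⟨0, (map_zero _).trans ?_⟩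
      rw [hej]
      exact (map_zero (Hom.lin (tmulR A (x j)))).symm
    · have h2 := norm_le_of_isOrtho_of_hasSum he hcl' h1 j
      rw [norm_zero, mul_zero] at h2
      have h3 : ‖f (x j)‖ ≤ 0 := by
        have : 0 < ‖e j‖ := norm_pos_iff.mpr hej
        nlinarith [norm_nonneg (f (x j))]
      obtain ⟨w, hw⟩ := hr _ (norm_le_zero_iff.mp h3)
      exact ⟨tmul (e j) w, by rw [whiskerLeft_tmul, hw]⟩
  refine hcl.mem_of_tendsto hs.tendsto_sum_nat (Eventually.of_forall fun n => ?_)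
  choose w hw using h2
  exact ⟨∑ j ∈ Finset.range n, w j, by rw [map_sum]; exact Finset.sum_congr rfl fun j _ => hw j⟩

/-- Every Banach space is flat. -/
lemma isFlat (A : NABan k) : IsFlat A := by
  have : ∀ {X Y : NABan k} (f : X ⟶ Y),
      Limits.PreservesLimit (Limits.parallelPair f 0) (tensorLeft A) := fun {X Y} f => by
    refine Limits.preservesLimit_of_preserves_limit_cone (isLimitEqIncl f)
      ((Limits.KernelFork.isLimitMapConeEquiv _ _).symm ?_)
    have w : (A ◁ eqIncl f 0) ≫ (A ◁ f) = 0 := by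
      rw [← whiskerLeft_comp, eqIncl_comp_zero, MonoidalPreadditive.whiskerLeft_zero]
    exact isLimitKernelFork w (C := 2) (norm_le_whiskerLeft fun x => le_rfl)
      fun z hz => mem_range_whiskerLeft (i := eqIncl f 0) (f := f) (fun x => le_rfl)
        (fun x hx => ⟨(⟨x, hx⟩ : eqSub f 0), rfl⟩) hz
  exact Functor.preservesFiniteLimits_of_preservesKernels (tensorLeft A)

end kernels

end NABan

namespace NABan

/-! ### Descent of axioms along maps with dense range -/

section squares

variable {k : Type u} [NormedField k] {X X' Y Y' Z Z' W W' : NABan k}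

/-- Morphisms with dense range. -/
class IsDense (f : X ⟶ Y) : Prop where
  dense : DenseRange f

instance : IsDense (𝟙 X) := ⟨Function.surjective_id.denseRange⟩

lemma IsDense.cancel (p : X ⟶ Y) [IsDense p] {f g : Y ⟶ Z} (h : p ≫ f = p ≫ g) : f = g :=
  eq_of_dense (S := Set.range p) IsDense.dense (by
    rintro _ ⟨x, rfl⟩
    exact congrArg (fun F : X ⟶ Z => F x) h)

/-- Commutative squares with horizontal maps `f`, `f'` and vertical maps `p`, `q`. -/
def IsSq (f : X ⟶ Y) (f' : X' ⟶ Y') (p : X ⟶ X') (q : Y ⟶ Y') : Prop := f ≫ q = p ≫ f'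

lemma IsSq.paste {X'' Y'' : NABan k} {f : X ⟶ Y} {f' : X' ⟶ Y'} {f'' : X'' ⟶ Y''} {p : X ⟶ X'}
    {q : Y ⟶ Y'} {p' : X' ⟶ X''} {q' : Y' ⟶ Y''} (h : IsSq f f' p q) (h' : IsSq f' f'' p' q') :
    IsSq f f'' (p ≫ p') (q ≫ q') := by
  unfold IsSq at *
  rw [← Category.assoc, h, Category.assoc, h', Category.assoc]

lemma IsSq.comp {f : X ⟶ Y} {g : Y ⟶ Z} {f' : X' ⟶ Y'} {g' : Y' ⟶ Z'} {p : X ⟶ X'} {q : Y ⟶ Y'}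
    {r : Z ⟶ Z'} (h : IsSq f f' p q) (h' : IsSq g g' q r) : IsSq (f ≫ g) (f' ≫ g') p r := by
  unfold IsSq at *
  rw [Category.assoc, h', ← Category.assoc, h, Category.assoc]

/-- Equations between horizontal maps descend along dense vertical maps. -/
lemma IsSq.descend {f g : X ⟶ Y} {f' g' : X' ⟶ Y'} {p : X ⟶ X'} {q : Y ⟶ Y'} (h : f = g)
    (hf : IsSq f f' p q) (hg : IsSq g g' p q) [IsDense p] : f' = g' :=
  IsDense.cancel p (by rw [← show f ≫ q = p ≫ f' from hf, ← show g ≫ q = p ≫ g' from hg, h])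

lemma isSq_id (p : X ⟶ X') : IsSq (𝟙 X) (𝟙 X') p p := by
  rw [IsSq, Category.id_comp, Category.comp_id]

variable [IsUltrametricDist k] [CompleteSpace k]

instance (f : X ⟶ Y) (g : X' ⟶ Y') [IsDense f] [IsDense g] : IsDense (f ⊗ₘ g) := ⟨fun z => by
  induction z using tmul_induction with
  | hp => exact isClosed_closure
  | h0 => exact subset_closure ⟨0, map_zero _⟩
  | ht y y' =>
    refine map_mem_closure₂ continuous_tmul (IsDense.dense (f := f) y)
      (IsDense.dense (f := g) y') ?_
    rintro _ ⟨x, rfl⟩ _ ⟨x', rfl⟩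
    exact ⟨tmul x x', tensorHom_tmul _ _ _ _⟩
  | ha a b ha hb =>
    exact (LinearMap.range (Hom.lin (f ⊗ₘ g))).topologicalClosure.add_mem ha hb⟩

lemma IsSq.tensor {f : X ⟶ Y} {f' : X' ⟶ Y'} {p : X ⟶ X'} {q : Y ⟶ Y'} (h : IsSq f f' p q)
    {g : Z ⟶ W} {g' : Z' ⟶ W'} {r : Z ⟶ Z'} {s : W ⟶ W'} (h' : IsSq g g' r s) :
    IsSq (f ⊗ₘ g) (f' ⊗ₘ g') (p ⊗ₘ r) (q ⊗ₘ s) := by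
  unfold IsSq at *
  rw [tensorHom_comp_tensorHom, tensorHom_comp_tensorHom, h, h']

lemma IsSq.right {f : X ⟶ Y} {f' : X' ⟶ Y'} {p : X ⟶ X'} {q : Y ⟶ Y'} (h : IsSq f f' p q)
    (r : Z ⟶ Z') : IsSq (f ▷ Z) (f' ▷ Z') (p ⊗ₘ r) (q ⊗ₘ r) := by
  rw [← tensorHom_id, ← tensorHom_id]
  exact h.tensor (isSq_id r)

lemma IsSq.left {f : X ⟶ Y} {f' : X' ⟶ Y'} {p : X ⟶ X'} {q : Y ⟶ Y'} (h : IsSq f f' p q)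
    (r : Z ⟶ Z') : IsSq (Z ◁ f) (Z' ◁ f') (r ⊗ₘ p) (r ⊗ₘ q) := by
  rw [← id_tensorHom, ← id_tensorHom]
  exact (isSq_id r).tensor h

variable (p : X ⟶ X') (q : Y ⟶ Y') (r : Z ⟶ Z') (s : W ⟶ W')

lemma isSq_assoc : IsSq (α_ X Y Z).hom (α_ X' Y' Z').hom ((p ⊗ₘ q) ⊗ₘ r) (p ⊗ₘ (q ⊗ₘ r)) :=
  (associator_naturality p q r).symm
lemma isSq_assoc_inv : IsSq (α_ X Y Z).inv (α_ X' Y' Z').inv (p ⊗ₘ (q ⊗ₘ r)) ((p ⊗ₘ q) ⊗ₘ r) :=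
  (associator_inv_naturality p q r).symm
lemma isSq_leftUnitor : IsSq (λ_ X).hom (λ_ X').hom (𝟙 (𝟙_ (NABan k)) ⊗ₘ p) p := by
  rw [IsSq, id_tensorHom, leftUnitor_naturality]
lemma isSq_leftUnitor_inv : IsSq (λ_ X).inv (λ_ X').inv p (𝟙 (𝟙_ (NABan k)) ⊗ₘ p) := by
  rw [IsSq, id_tensorHom, leftUnitor_inv_naturality]
lemma isSq_rightUnitor : IsSq (ρ_ X).hom (ρ_ X').hom (p ⊗ₘ 𝟙 (𝟙_ (NABan k))) p := by
  rw [IsSq, tensorHom_id, rightUnitor_naturality]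
lemma isSq_rightUnitor_inv : IsSq (ρ_ X).inv (ρ_ X').inv p (p ⊗ₘ 𝟙 (𝟙_ (NABan k))) := by
  rw [IsSq, tensorHom_id, rightUnitor_inv_naturality]
lemma isSq_tensorμ : IsSq (tensorμ X Y Z W) (tensorμ X' Y' Z' W') ((p ⊗ₘ q) ⊗ₘ (r ⊗ₘ s))
    ((p ⊗ₘ r) ⊗ₘ (q ⊗ₘ s)) := (tensorμ_natural p q r s).symm

lemma IsPreBraiding.descend {V W : NABan k} {c : V ⊗ V ⟶ V ⊗ V} {d : W ⊗ W ⟶ W ⊗ W} {p : V ⟶ W}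
    [IsDense p] (h : IsSq c d (p ⊗ₘ p) (p ⊗ₘ p)) (hc : IsPreBraiding c) : IsPreBraiding d := by
  have a := isSq_assoc p p p
  have a' := isSq_assoc_inv p p p
  exact IsSq.descend hc ((h.right p).comp (a.comp ((h.left p).comp (a'.comp ((h.right p).comp a)))))
    (a.comp ((h.left p).comp (a'.comp ((h.right p).comp (a.comp (h.left p))))))

namespace HopfData

variable {A B : NABan k} {D : HopfData A} {D' : HopfData B} {f : A ⟶ B}

lemma IsHom.sq_one (h : IsHom D D' f) : IsSq D.one D'.one (𝟙 _) f :=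
  h.one.trans (Category.id_comp _).symm
lemma IsHom.sq_mul (h : IsHom D D' f) : IsSq D.mul D'.mul (f ⊗ₘ f) f := h.mul.symm
lemma IsHom.sq_counit (h : IsHom D D' f) : IsSq D.counit D'.counit f (𝟙 _) :=
  (Category.comp_id _).trans h.counit.symm
lemma IsHom.sq_comul (h : IsHom D D' f) : IsSq D.comul D'.comul f (f ⊗ₘ f) := h.comul.symm
lemma IsHom.sq_braid (h : IsHom D D' f) : IsSq D.braid D'.braid (f ⊗ₘ f) (f ⊗ₘ f) := h.braid.symm
lemma IsHom.sq_coact (h : IsHom D D' f) : IsSq D.coact D'.coact f (𝟙 (kt k) ⊗ₘ f) := by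
  rw [id_tensorHom]
  exact h.coact.symm

/-- The bialgebra axioms descend along morphisms with dense range. -/
lemma IsHom.isPreBraidedBialgebra (h : IsHom D D' f) [IsDense f] (hD : D.IsPreBraidedBialgebra) :
    D'.IsPreBraidedBialgebra := by
  have a := isSq_assoc f f f
  have a' := isSq_assoc_inv f f f
  have one := h.sq_one
  have mul := h.sq_mul
  have counit := h.sq_counit
  have comul := h.sq_comul
  have braid := h.sq_braid
  have l := isSq_leftUnitor f
  have l' := isSq_leftUnitor_inv f
  have r := isSq_rightUnitor f
  have r' := isSq_rightUnitor_inv f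
  have mid : IsSq (midBraid D.braid) (midBraid D'.braid) ((f ⊗ₘ f) ⊗ₘ (f ⊗ₘ f))
      ((f ⊗ₘ f) ⊗ₘ (f ⊗ₘ f)) :=
    (isSq_assoc f f (f ⊗ₘ f)).comp ((a'.left f).comp (((braid.right f).left f).comp
      ((a.left f).comp (isSq_assoc_inv f f (f ⊗ₘ f)))))
  -- Every axiom equates two composites of arrows, each of which sits in a commutative square over
  -- tensor powers of `f` and identities. The outer squares have a dense left side, so the equation
  -- descends.
  exact
    { one_mul := IsSq.descend hD.one_mul ((one.right f).comp mul) l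
      mul_one := IsSq.descend hD.mul_one ((one.left f).comp mul) r
      mul_assoc := IsSq.descend hD.mul_assoc ((mul.right f).comp mul)
        (a.comp ((mul.left f).comp mul))
      counit_comul := IsSq.descend hD.counit_comul (comul.comp (counit.right f)) l'
      comul_counit := IsSq.descend hD.comul_counit (comul.comp (counit.left f)) r'
      comul_assoc := IsSq.descend hD.comul_assoc (comul.comp ((comul.right f).comp a))
        (comul.comp (comul.left f))
      hexagon := hD.hexagon.descend braid
      one_braid := IsSq.descend hD.one_braid ((one.right f).comp braid)
        (l.comp (r'.comp (one.left f)))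
      braid_one := IsSq.descend hD.braid_one ((one.left f).comp braid)
        (r.comp (l'.comp (one.right f)))
      mul_braid := IsSq.descend hD.mul_braid ((mul.right f).comp braid)
        (a.comp ((braid.left f).comp (a'.comp ((braid.right f).comp (a.comp (mul.left f))))))
      braid_mul := IsSq.descend hD.braid_mul ((mul.left f).comp braid)
        (a'.comp ((braid.right f).comp (a.comp ((braid.left f).comp (a'.comp (mul.right f))))))
      braid_counit_left := IsSq.descend hD.braid_counit_left
        (braid.comp ((counit.right f).comp l)) ((counit.left f).comp r)
      braid_counit_right := IsSq.descend hD.braid_counit_right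
        (braid.comp ((counit.left f).comp r)) ((counit.right f).comp l)
      comul_braid := IsSq.descend hD.comul_braid ((comul.right f).comp (a.comp ((braid.left f).comp
        (a'.comp ((braid.right f).comp a))))) (braid.comp (comul.left f))
      braid_comul := IsSq.descend hD.braid_comul ((comul.left f).comp (a'.comp ((braid.right f).comp
        (a.comp ((braid.left f).comp a'))))) (braid.comp (comul.right f))
      mul_comul := IsSq.descend hD.mul_comul (mul.comp comul)
        ((comul.tensor comul).comp (mid.comp (mul.tensor mul)))
      one_comul := IsSq.descend hD.one_comul (one.comp comul)
        ((isSq_leftUnitor_inv (𝟙 (𝟙_ (NABan k)))).comp (one.tensor one))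
      one_counit := IsSq.descend hD.one_counit (one.comp counit) (isSq_id _)
      mul_counit := IsSq.descend hD.mul_counit (mul.comp counit)
        ((counit.tensor counit).comp (isSq_leftUnitor (𝟙 (𝟙_ (NABan k))))) }

/-- The axioms of a graded structure descend along morphisms with dense range. -/
lemma IsHom.isGraded (h : IsHom D D' f) [IsDense f] (hD : D.IsGraded) : D'.IsGraded := by
  have t := isSq_id (𝟙 (kt k))
  have tm : IsSq (ktMul k) (ktMul k) (𝟙 _ ⊗ₘ 𝟙 _) (𝟙 _) := by
    rw [IsSq, id_tensorHom_id, Category.id_comp, Category.comp_id]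
  have td : IsSq (ktComul k) (ktComul k) (𝟙 _) (𝟙 _ ⊗ₘ 𝟙 _) := by
    rw [IsSq, id_tensorHom_id, Category.id_comp, Category.comp_id]
  have te : IsSq (ktCounit k) (ktCounit k) (𝟙 _) (𝟙 _) := by
    rw [IsSq, Category.id_comp, Category.comp_id]
  have tp : IsSq (tpower k 0) (tpower k 0) (𝟙 _) (𝟙 _) := by
    rw [IsSq, Category.id_comp, Category.comp_id]
  have tb : IsSq (β_ (kt k) (kt k)).hom (β_ (kt k) (kt k)).hom (𝟙 _ ⊗ₘ 𝟙 _) (𝟙 _ ⊗ₘ 𝟙 _) := by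
    rw [IsSq, id_tensorHom_id, Category.id_comp, Category.comp_id]
  have one := h.sq_one
  have mul := h.sq_mul
  have counit := h.sq_counit
  have comul := h.sq_comul
  have braid := h.sq_braid
  have co := h.sq_coact
  have co₂ : IsSq D.coact₂ D'.coact₂ (f ⊗ₘ f) ((𝟙 (kt k) ⊗ₘ 𝟙 (kt k)) ⊗ₘ (f ⊗ₘ f)) :=
    (co.tensor co).comp (isSq_tensorμ _ _ _ _)
  have lu := isSq_leftUnitor_inv (𝟙 (𝟙_ (NABan k)))
  exact
    { counit_coact := IsSq.descend hD.counit_coact (co.comp (te.right f)) (isSq_leftUnitor_inv f)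
      coassoc := IsSq.descend hD.coassoc (co.comp ((td.right f).comp (isSq_assoc _ _ f)))
        (co.comp (co.left _))
      one := IsSq.descend hD.one (one.comp co) (lu.comp (tp.tensor one))
      mul := IsSq.descend hD.mul (mul.comp co) (co₂.comp (tm.tensor mul))
      counit := IsSq.descend hD.counit (co.comp (counit.left _))
        (counit.comp (lu.comp (tp.right _)))
      comul := IsSq.descend hD.comul (comul.comp (co₂.comp (tm.right _)))
        (co.comp (comul.left _))
      braid := IsSq.descend hD.braid (braid.comp co₂) (co₂.comp (tb.tensor braid)) }

lemma IsHom.isAntipode (h : IsHom D D' f) [IsDense f] {S : A ⟶ A} {S' : B ⟶ B}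
    (hS : D.IsAntipode S) (hSS : IsSq S S' f f) : D'.IsAntipode S' :=
  ⟨IsSq.descend hS.1 (h.sq_comul.comp ((hSS.right f).comp h.sq_mul)) (h.sq_counit.comp h.sq_one),
    IsSq.descend hS.2 (h.sq_comul.comp ((hSS.left f).comp h.sq_mul)) (h.sq_counit.comp h.sq_one)⟩

lemma IsHom.isGradedHopf (h : IsHom D D' f) [IsDense f] (hb : D.IsPreBraidedBialgebra)
    (hg : D.IsGraded) {S : A ⟶ A} {S' : B ⟶ B} (hS : D.IsAntipode S)
    (hS' : S ≫ D.coact = D.coact ≫ (kt k ◁ S)) (hSS : IsSq S S' f f) : D'.IsGradedHopf where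
  bialgebra := h.isPreBraidedBialgebra hb
  graded := h.isGraded hg
  antipode := ⟨S', h.isAntipode hS hSS, IsSq.descend hS' (hSS.comp h.sq_coact)
    (h.sq_coact.comp (hSS.left _))⟩

/-- Structure maps with which a morphism with dense range is compatible are unique. -/
lemma IsHom.unique {D'' : HopfData B} (h : IsHom D D' f) (h' : IsHom D D'' f) [IsDense f] :
    D' = D'' :=
  HopfData.ext (IsSq.descend rfl h.sq_one h'.sq_one) (IsSq.descend rfl h.sq_mul h'.sq_mul)
    (IsSq.descend rfl h.sq_counit h'.sq_counit) (IsSq.descend rfl h.sq_comul h'.sq_comul)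
    (IsSq.descend rfl h.sq_braid h'.sq_braid) (IsSq.descend rfl h.sq_coact h'.sq_coact)

end HopfData

end squares

/-! ### Quotients by closed subspaces -/

section quotients

variable {k : Type u} [NormedField k] {A B X Y Z : NABan k} {I : Submodule k X}
  {hI : IsClosed (I : Set X)}

lemma proj_surjective : Function.Surjective (proj I hI) := I.mkQ_surjective

instance : IsDense (proj I hI) := ⟨proj_surjective.denseRange⟩

lemma proj_eq_zero {x : X} : proj I hI x = 0 ↔ x ∈ I := Submodule.Quotient.mk_eq_zero I

lemma exists_norm_proj_lt (y : quot I hI) {ε : ℝ} (hε : 0 < ε) :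
    ∃ x : X, proj I hI x = y ∧ ‖x‖ < ‖y‖ + ε :=
  have := hI
  Submodule.Quotient.norm_mk_lt (S := I) y hε

lemma exists_quotLift (f : X ⟶ Z) (hf : ∀ x ∈ I, f x = 0) :
    ∃ g : quot I hI ⟶ Z, proj I hI ≫ g = f := by
  refine ⟨Hom.mk (I.liftQ (Hom.lin f) hf) ⟨opNorm f, fun y => ?_⟩, hom_ext fun x => rfl⟩
  refine le_of_forall_pos_le_add fun ε hε => ?_
  have hK := opNorm_nonneg f
  obtain ⟨x, rfl, hx⟩ := exists_norm_proj_lt y (ε := ε / (opNorm f + 1)) (by positivity)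
  change ‖f x‖ ≤ _
  refine (le_opNorm f x).trans ((mul_le_mul_of_nonneg_left hx.le hK).trans ?_)
  rw [mul_add]
  gcongr
  rw [← mul_div_assoc, div_le_iff₀ (by positivity)]
  nlinarith

lemma norm_le_of_proj {f : X ⟶ Z} (hf : IsContr f) {g : quot I hI ⟶ Z} (h : proj I hI ≫ g = f) :
    IsContr g := fun y => by
  refine le_of_forall_pos_le_add fun ε hε => ?_
  obtain ⟨x, rfl, hx⟩ := exists_norm_proj_lt y hε
  rw [show g (proj I hI x) = f x from congrArg (fun F : X ⟶ Z => F x) h]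
  exact (hf x).trans hx.le

variable [IsUltrametricDist k] [CompleteSpace k]

/-- Maps out of a tensor square vanishing on `I ⊗ X` and `X ⊗ I` descend to the quotient. -/
lemma exists_quotLift₂ (f : X ⊗ X ⟶ Z) (hf : ∀ x ∈ I, ∀ y, f (tmul x y) = 0)
    (hf' : ∀ x ∈ I, ∀ y, f (tmul y x) = 0) :
    ∃ g : quot I hI ⊗ quot I hI ⟶ Z, (proj I hI ⊗ₘ proj I hI) ≫ g = f := by
  let F : X →ₗ[k] X →ₗ[k] Z := tmkLin.compr₂ (Hom.lin f)
  have hF : ∀ x y, F x y = f (tmul x y) := fun _ _ => rfl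
  let G : (quot I hI : NABan k) →ₗ[k] (quot I hI : NABan k) →ₗ[k] Z :=
    I.liftQ (LinearMap.flip (I.liftQ F.flip fun y hy => LinearMap.ext fun x => hf' y hy x))
      fun x hx => LinearMap.ext fun y => by
        obtain ⟨y, rfl⟩ := proj_surjective y
        exact hf x hx y
  have hG : ∀ x y, G (proj I hI x) (proj I hI y) = f (tmul x y) := fun _ _ => rfl
  have hK := opNorm_nonneg f
  have hb : ∀ x y, ‖G x y‖ ≤ opNorm f * (‖x‖ * ‖y‖) := fun x y => by
    have h1 : ∀ ε > 0, ‖G x y‖ ≤ opNorm f * ((‖x‖ + ε) * (‖y‖ + ε)) := fun ε hε => by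
      obtain ⟨x, rfl, hx⟩ := exists_norm_proj_lt x hε
      obtain ⟨y, rfl, hy⟩ := exists_norm_proj_lt y hε
      rw [hG]
      refine (le_opNorm f _).trans (mul_le_mul_of_nonneg_left ((norm_tmul_le x y).trans ?_) hK)
      exact mul_le_mul hx.le hy.le (norm_nonneg _) (by positivity)
    have h2 : Tendsto (fun ε : ℝ => opNorm f * ((‖x‖ + ε) * (‖y‖ + ε))) (𝓝[>] 0)
        (𝓝 (opNorm f * ((‖x‖ + 0) * (‖y‖ + 0)))) :=
      (Continuous.tendsto (by fun_prop) 0).mono_left nhdsWithin_le_nhds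
    rw [add_zero, add_zero] at h2
    exact ge_of_tendsto h2 (eventually_nhdsWithin_of_forall h1)
  refine ⟨lift G (opNorm f) hK hb, tmul_ext fun x y => ?_⟩
  rw [comp_apply, tensorHom_tmul]
  exact (lift_tmk G (opNorm f) hK hb _ _).trans (hG x y)

/-- The projection of `X ⊗ X` modulo the closed sum kills `I ⊗ X` and `X ⊗ I`, hence factors through
the tensor square of the quotient. So whatever dies there lies in the closed sum. -/
lemma mem_closedSum_of_proj {z : (X ⊗ X : NABan k)} (hz : (proj I hI ⊗ₘ proj I hI) z = 0) :
    z ∈ HopfData.closedSum I := by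
  have hcl : IsClosed (HopfData.closedSum I : Set (X ⊗ X : NABan k)) :=
    Submodule.isClosed_topologicalClosure _
  have hmem : ∀ x ∈ I, ∀ y : X, tmul x y ∈ HopfData.closedSum I ∧ tmul y x ∈ HopfData.closedSum I :=
    fun x hx y => ⟨Submodule.le_topologicalClosure _ (Submodule.subset_span ⟨x, hx, y, Or.inl rfl⟩),
      Submodule.le_topologicalClosure _ (Submodule.subset_span ⟨x, hx, y, Or.inr rfl⟩)⟩
  obtain ⟨g, hg⟩ := exists_quotLift₂ (hI := hI) (proj (HopfData.closedSum I) hcl)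
    (fun x hx y => proj_eq_zero.mpr (hmem x hx y).1) fun x hx y => proj_eq_zero.mpr (hmem x hx y).2
  rw [← proj_eq_zero (hI := hcl), ← hg, comp_apply, hz, map_zero]

/-- The Hopf structure descends to the quotient by the kernel of a map `F` under compatibility
conditions. -/
lemma HopfData.exists_isHom_proj {D : HopfData X} {F : X ⟶ Y} (hIF : ∀ x, x ∈ I ↔ F x = 0)
    (hideal : D.IsIdeal I) (hcounit : ∀ x ∈ I, D.counit x = 0)
    (hcomul : ∀ x ∈ I, (F ⊗ₘ F) (D.comul x) = 0)
    (hbraid : ∀ x ∈ I, ∀ y, (F ⊗ₘ F) (D.braid (tmul x y)) = 0 ∧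
      (F ⊗ₘ F) (D.braid (tmul y x)) = 0)
    (hcoact : ∀ x ∈ I, (kt k ◁ F) (D.coact x) = 0) :
    (∃ D' : HopfData (quot I hI), IsHom D D' (proj I hI)) ∧ D.IsCoideal I := by
  -- Because `F` is the projection followed by an injection, and tensoring preserves injections,
  -- vanishing in the tensor products of the quotient can be tested after `F`.
  obtain ⟨F', hF'⟩ := exists_quotLift (hI := hI) F fun x hx => (hIF x).mp hx
  have hinj : ∀ y, F' y = 0 → y = 0 := fun y hy => by
    obtain ⟨x, rfl⟩ := proj_surjective y
    rw [proj_eq_zero, hIF, ← hF']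
    exact hy
  have hinj₂ : ∀ z, (F ⊗ₘ F) z = 0 → (proj I hI ⊗ₘ proj I hI) z = 0 := fun z hz =>
    tensorHom_injective hinj hinj _ (by
      rw [← hF', ← tensorHom_comp_tensorHom] at hz
      exact hz)
  have hinj₁ : ∀ z, (kt k ◁ F) z = 0 → (kt k ◁ proj I hI) z = 0 := fun z hz =>
    whiskerLeft_injective hinj _ (by
      rw [← hF', MonoidalCategory.whiskerLeft_comp] at hz
      exact hz)
  obtain ⟨mul, hmul⟩ := exists_quotLift₂ (hI := hI) (D.mul ≫ proj I hI)
    (fun x hx y => proj_eq_zero.mpr (hideal x hx y).1)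
    fun x hx y => proj_eq_zero.mpr (hideal x hx y).2
  obtain ⟨counit, hcounit'⟩ := exists_quotLift (hI := hI) D.counit hcounit
  obtain ⟨comul, hcomul'⟩ := exists_quotLift (hI := hI) (D.comul ≫ (proj I hI ⊗ₘ proj I hI))
    fun x hx => hinj₂ _ (hcomul x hx)
  obtain ⟨braid, hbraid'⟩ := exists_quotLift₂ (hI := hI) (D.braid ≫ (proj I hI ⊗ₘ proj I hI))
    (fun x hx y => hinj₂ _ (hbraid x hx y).1) fun x hx y => hinj₂ _ (hbraid x hx y).2
  obtain ⟨coact, hcoact'⟩ := exists_quotLift (hI := hI) (D.coact ≫ (kt k ◁ proj I hI))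
    fun x hx => hinj₁ _ (hcoact x hx)
  exact ⟨⟨⟨D.one ≫ proj I hI, mul, counit, comul, braid, coact⟩,
    ⟨rfl, hmul, hcounit', hcomul', hbraid', hcoact'⟩⟩,
    fun x hx => mem_closedSum_of_proj (hinj₂ _ (hcomul x hx)), hcounit⟩

end quotients

/-! ### The radical of a dual pairing -/

section radical

variable {k : Type u} [NormedField k] [IsUltrametricDist k] [CompleteSpace k] {A B : NABan k}
  {D : HopfData A} {D' : HopfData B} {p : A ⊗ B ⟶ 𝟙_ (NABan k)}

/-- The radical of a dual pairing is an ideal. -/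
lemma IsDualPairing.isIdeal_radical (h : IsDualPairing D D' p) : D.IsIdeal (radical p) := by
  have key : ∀ (x y : A) (b : B), p (tmul (D.mul (tmul x y)) b) =
      pair₂ p (tmul (tmul x y) (D'.comul b)) := fun x y b => by
    have := congrArg (fun F : (A ⊗ A) ⊗ B ⟶ 𝟙_ (NABan k) => F (tmul (tmul x y) b)) h.mul_left
    simpa only [comp_apply, whiskerLeft_tmul, whiskerRight_tmul] using this
  -- The coproduct of `b` is not a finite sum in general, so vanishing is established on elementary
  -- tensors `b ⊗ b'` and extended to the completed tensor product.
  have hz : ∀ x y : A, (∀ b b', pair₂ p (tmul (tmul x y) (tmul b b')) = 0) →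
      D.mul (tmul x y) ∈ radical p := fun x y hxy b => by
    rw [key]
    have : tmulL (tmul x y) (B ⊗ B) ≫ pair₂ p = 0 := tmul_ext fun b b' => hxy b b'
    exact congrArg (fun F : B ⊗ B ⟶ 𝟙_ (NABan k) => F (D'.comul b)) this
  refine fun x hx y => ⟨hz _ _ fun b b' => ?_, hz _ _ fun b b' => ?_⟩
  · rw [pair₂_tmul, show p (tmul x b) = 0 from hx b]
    exact zero_mul (M₀ := k) _
  · rw [pair₂_tmul, show p (tmul x b') = 0 from hx b']
    exact mul_zero (M₀ := k) _

end radical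

end NABan

namespace NABan

/-! ### The radical as the kernel of the symmetrizer -/

section nondegenerate

variable {k : Type u} [NormedField k] [IsUltrametricDist k] [CompleteSpace k] {V W : NABan k}
  {c : V ⊗ V ⟶ V ⊗ V} {d : W ⊗ W ⟶ W ⊗ W} {ψ : V ⊗ W ⟶ 𝟙_ (NABan k)}

open BraidWord

/-- The pairing of tensor powers by a non-degenerate form is non-degenerate. -/
lemma powForm_nondegenerate (hn : ∀ v, (∀ w, ψ (tmul v w) = 0) → v = 0) (n : ℕ) (x : tpow V n)
    (hx : ∀ y, powForm ψ n n (tmul x y) = 0) : x = 0 := by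
  induction n with
  | zero =>
    have h1 : (λ_ (𝟙_ (NABan k))).hom (tmul (show (𝟙_ (NABan k) : NABan k) from x) (scal 1)) = 0 :=
      hx (scal 1)
    rw [leftUnitor_tmul] at h1
    have h2 := eq_smul_one (k := k) x
    rw [h1] at h2
    exact h2
  | succ n ih =>
    -- Non-degeneracy is not formal on a completed tensor product. The functionals `⟨·, w⟩` are
    -- jointly injective on `V`, and they remain so after tensoring with `tpow V n`; contraction of
    -- the last factor with `w` leaves an element of degree `n` for the induction.
    refine eq_zero_of_whiskerLeft (fun w => tmulR V w ≫ ψ) (fun v hv => hn v hv) x fun w => ?_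
    have h1 : ∀ y, powForm ψ n n (tmul ((ρ_ (tpow V n)).hom ((tpow V n ◁ (tmulR V w ≫ ψ)) x)) y) =
        powForm ψ (n + 1) (n + 1) (tmul x (snoc y w)) := fun y => by
      have : (tpow V n ◁ (tmulR V w ≫ ψ)) ≫ (ρ_ (tpow V n)).hom ≫ tmulR (tpow V n) y ≫
          powForm ψ n n = tmulR (tpow V (n + 1)) (snoc y w) ≫ powForm ψ (n + 1) (n + 1) :=
        tmul_ext fun a v => by
          have h2 := powForm_snoc (ψ := ψ) n n a v y w
          refine Eq.trans ?_ h2.symm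
          simp only [comp_apply, whiskerLeft_tmul, tmulR_apply]
          rw [rightUnitor_tmul, smul_tmul, map_smul]
          exact mul_comm (G := k) _ _
      exact congrArg (fun F : tpow V (n + 1) ⟶ 𝟙_ (NABan k) => F x) this
    have h2 := ih _ fun y => (h1 y).trans (hx _)
    have h3 := isIsom_rightUnitor.norm_eq ((tpow V n ◁ (tmulR V w ≫ ψ)) x)
    rw [h2, norm_zero] at h3
    exact norm_eq_zero.mp h3.symm

variable {hc : IsContr c} {hd : IsContr d} {hψ : IsContr ψ}

/-- Elements of degree `n` pair only with the component of degree `n`, so the claim reduces to each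
tensor power. -/
lemma formVal_nondegenerate (hn : ∀ v, (∀ w, ψ (tmul v w) = 0) → v = 0) {x : tens V}
    (hx : ∀ y, formVal hψ x y = 0) : x = 0 :=
  coprod_ext_comp fun n => powForm_nondegenerate hn n _ fun y => by
    have h1 : formR hψ (tensIncl W n y) = tensProj n ≫ tmulR (tpow V n) y ≫ powForm ψ n n :=
      tens_ext fun m z => by
        rw [comp_apply, comp_apply]
        change form hψ (tmul (tensIncl V m z) (tensIncl W n y)) = _
        rw [form_incl]
        by_cases hmn : m = n
        · subst hmn
          rw [tensProj_self]
          rfl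
        · rw [tensProj_ne hmn, map_zero, map_zero, powForm_of_ne hmn]
          rfl
    exact (congrArg (fun F : tens V ⟶ 𝟙_ (NABan k) => F x) h1).symm.trans (hx _)

/-- The radical of the Hopf pairing is the kernel of the symmetrizer. -/
lemma mem_radical_hopfForm (h : IsAdjoint c d ψ) (hb : IsPreBraiding d)
    (hn : ∀ v, (∀ w, ψ (tmul v w) = 0) → v = 0) {x : tens V} :
    x ∈ radical (hopfForm hd hψ) ↔ symz hc x = 0 := by
  constructor
  · intro hx
    refine formVal_nondegenerate (hψ := hψ) hn fun y => ?_
    exact (hopfForm_tmul' (hc := hc) h hb x y).symm.trans (hx y)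
  · intro hx y
    rw [hopfForm_tmul' (hc := hc) h hb, hx]
    exact map_zero (Hom.lin (formR hψ y))

end nondegenerate

/-! ### The symmetrizer intertwines the structure maps -/

section symmetrizer

variable {k : Type u} [NormedField k] [IsUltrametricDist k] [CompleteSpace k] {V : NABan k}
  {c : V ⊗ V ⟶ V ⊗ V}

open BraidWord

variable (V) in
/-- The deconcatenation comultiplication. -/
def deconc : tens V ⟶ tens V ⊗ tens V :=
  desc (fun N => tensIncl V N ≫ ∑ p ∈ antidiagonal N, split p.1 p.2)
    fun N => (isContr_incl N).comp (isContr_sum _ _ fun p _ => isContr_split p.1 p.2)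

lemma deconc_of_mem {N : ℕ} {x : tens V} (hx : x ∈ Homog V N) :
    deconc V x = ∑ p ∈ antidiagonal N, split p.1 p.2 x := by
  obtain ⟨x, rfl⟩ := hx
  rw [← sum_apply]
  exact desc_incl (fun N => tensIncl V N ≫ ∑ p ∈ antidiagonal N, split p.1 p.2) _ N x

variable (hc : IsContr c)

lemma symz_mul_symz {n m : ℕ} {x y : tens V} (hx : x ∈ Homog V n) (hy : y ∈ Homog V m) :
    symz hc x * symz hc y = (sym (strand hc) n 0 * sym (strand hc) m n) • (x * y) := by
  have h := Fam_mul_right hc (sym_mem (c := strand hc) m) hx y 0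
  rw [add_zero] at h
  rw [mul_smul, h, Fam_mul_left hc (sym_mem n) hx, symz_of_mem hc hx, symz_of_mem hc hy]

lemma symz_split {n m : ℕ} {z : tens V} (hz : z ∈ Homog V (n + m)) :
    (symz hc ⊗ₘ symz hc) (split n m z) =
      split n m ((sym (strand hc) n 0 * sym (strand hc) m n) • z) :=
  eqOn_mul (f := split n m ≫ (symz hc ⊗ₘ symz hc))
    (g := op (sym (strand hc) n 0 * sym (strand hc) m n) ≫ split n m) (fun x hx y hy => by
      rw [comp_apply, comp_apply, split_mul hx hy, tensorHom_tmul, op_apply,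
        ← symz_mul_symz hc hx hy, split_mul (symz_mem hc hx) (symz_mem hc hy)]) hz

/-- This is the factorisation `sym_add` read bidegree by bidegree. It transfers questions about the
braided coproduct on the quotient to the much simpler deconcatenation. -/
lemma comul_symz (hb : IsPreBraiding c) (x : tens V) :
    (symz hc ⊗ₘ symz hc) ((tensHopf hc).comul x) = deconc V (symz hc x) := by
  have : (tensHopf hc).comul ≫ (symz hc ⊗ₘ symz hc) = symz hc ≫ deconc V :=
    tens_ext_Homog fun N x hx => by
      rw [comp_apply, comp_apply, comul_eq hc hx, deconc_of_mem (symz_mem hc hx), map_sum]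
      refine Finset.sum_congr rfl ?_
      rintro ⟨n, m⟩ hp
      rw [Finset.HasAntidiagonal.mem_antidiagonal] at hp
      change n + m = N at hp
      subst hp
      rw [symz_split hc (shuf_mem_Homog hc _ _ _ hx), symz_of_mem hc hx,
        sym_add (isBraidSeq_strand hc hb), mul_smul, mul_smul, mul_smul, zero_add]
  exact congrArg (fun F : tens V ⟶ tens V ⊗ tens V => F x) this

/-- The block braiding is natural in each block, so the symmetrizers of the two blocks slide through
it. They arrive in the opposite order, and commute because they act on disjoint strands. -/
lemma braid_symz (hb : IsPreBraiding c) :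
    tensBraid hc ≫ (symz hc ⊗ₘ symz hc) = (symz hc ⊗ₘ symz hc) ≫ tensBraid hc :=
  tens_ext₂ fun n x hx m y hy => by
    have hs := isBraidSeq_strand hc hb
    have hxy : bb (strand hc) n m 0 • (x * y) ∈ Homog V (m + n) := by
      rw [add_comm m n]
      exact bb_mem_Homog hc n m 0 (mul_mem_Homog hx hy)
    have h1 := bb_nat_left hs (sym_mem (c := strand hc) n) m 0
    have h2 := bb_nat_right hs (sym_mem (c := strand hc) m) n 0
    rw [zero_add] at h1 h2
    have h3 := hs.commute_Fam (o := 0) (o' := m) (by omega) (sym_mem (c := strand hc) m)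
      (sym_mem (c := strand hc) n)
    rw [comp_apply, comp_apply, tensorHom_tmul, braid_tmul hc hx hy,
      braid_tmul hc (symz_mem hc hx) (symz_mem hc hy), symz_split hc hxy, symz_mul_symz hc hx hy,
      smul_smul, smul_smul, ← mul_assoc, h1, mul_assoc _ (bb _ _ _ _), h2, ← mul_assoc, h3]

lemma antipode_symz (hb : IsPreBraiding c) :
    tensAntipode hc ≫ symz hc = symz hc ≫ tensAntipode hc :=
  tens_ext_Homog fun n x hx => by
    rw [comp_apply, comp_apply, antipode_of_mem hc hx, antipode_of_mem hc (symz_mem hc hx),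
      symz_of_mem hc hx, symz_of_mem hc (anti_mem_Homog hc n 0 hx), smul_smul, smul_smul,
      anti_sym (isBraidSeq_strand hc hb)]

lemma coact_symz :
    (tensHopf hc).coact ≫ (kt k ◁ symz hc) = symz hc ≫ (tensHopf hc).coact :=
  tens_ext_Homog fun n x hx => by
    rw [comp_apply, comp_apply, coact_of_mem hc hx, whiskerLeft_tmul,
      coact_of_mem hc (symz_mem hc hx)]

lemma counit_symz : symz hc ≫ (tensHopf hc).counit = (tensHopf hc).counit :=
  tens_ext_Homog fun n x hx => by
    rw [comp_apply]
    rcases n with _ | n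
    · obtain ⟨a, rfl⟩ := eq_smul_of_mem_Homog_zero hx
      rw [map_smul, symz_one]
    · rw [counit_of_mem hc hx, counit_of_mem hc (symz_mem hc hx)]

end symmetrizer

/-! ### Degrees and primitive elements -/

section degree

variable {k : Type u} [NormedField k] [IsUltrametricDist k] [CompleteSpace k] {V : NABan k}
  {c : V ⊗ V ⟶ V ⊗ V}

variable (V) in
/-- The projection to the component of degree `n`. -/
def degProj (n : ℕ) : tens V ⟶ tens V := tensProj n ≫ tensIncl V n

lemma isContr_degProj (n : ℕ) : IsContr (degProj V n) := (isContr_tensProj n).comp (isContr_incl n)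

lemma degProj_mem (n : ℕ) (x : tens V) : degProj V n x ∈ Homog V n := incl_mem_Homog n _

lemma degProj_of_mem {n : ℕ} {x : tens V} (hx : x ∈ Homog V n) : degProj V n x = x := by
  obtain ⟨x, rfl⟩ := hx
  rw [degProj, comp_apply, tensProj_self]

lemma degProj_of_ne {n m : ℕ} (h : m ≠ n) {x : tens V} (hx : x ∈ Homog V m) :
    degProj V n x = 0 := by
  obtain ⟨x, rfl⟩ := hx
  rw [degProj, comp_apply, tensProj_ne h, map_zero]

lemma ext_degProj {x y : tens V} (h : ∀ n, degProj V n x = degProj V n y) : x = y :=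
  coprod_ext_comp fun n => by
    have := congrArg (tensProj n) (h n)
    rwa [degProj, comp_apply, comp_apply, tensProj_self, tensProj_self] at this

lemma mem_Homog_of_degProj {n : ℕ} {x : tens V} (h : ∀ m ≠ n, degProj V m x = 0) :
    x ∈ Homog V n := by
  have : x = degProj V n x := ext_degProj fun m => by
    by_cases hm : m = n
    · subst hm
      rw [degProj_of_mem (degProj_mem m x)]
    · rw [h m hm, degProj_of_ne (Ne.symm hm) (degProj_mem n x)]
  rw [this]
  exact degProj_mem n x

/-- The coefficient of `tⁿ`. -/
def ktCoeff (n : ℕ) : kt k ⟶ 𝟙_ (NABan k) := compHom (fun _ => 𝟙_ (NABan k)) n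

variable (hc : IsContr c)

lemma coact_ktCoeff (n : ℕ) :
    (tensHopf hc).coact ≫ (ktCoeff n ▷ tens V) ≫ (λ_ (tens V)).hom = degProj V n :=
  tens_ext_Homog fun m x hx => by
    rw [comp_apply, comp_apply, coact_of_mem hc hx, whiskerRight_tmul, leftUnitor_tmul]
    by_cases hm : m = n
    · subst hm
      rw [degProj_of_mem hx, show ktCoeff m (tn k m) = scal 1 from comp_incl_self m _]
      exact one_smul k x
    · rw [degProj_of_ne hm hx, show ktCoeff n (tn k m) = 0 from comp_incl_ne _ (Ne.symm hm)]
      exact zero_smul k x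

/-- Homogeneous elements are characterised by the coaction. -/
lemma mem_Homog_of_coact {n : ℕ} {x : tens V} (hx : (tensHopf hc).coact x = tmul (tn k n) x) :
    x ∈ Homog V n := mem_Homog_of_degProj fun m hm => by
  rw [← coact_ktCoeff hc m, comp_apply, comp_apply, hx, whiskerRight_tmul, leftUnitor_tmul,
    show ktCoeff m (tn k n) = 0 from comp_incl_ne _ hm]
  exact zero_smul k x

/-- The bidegrees of a deconcatenation can be isolated, which allows an equation for `deconc V x` to
be read component by component for arbitrary, not necessarily homogeneous `x`. -/
lemma deconc_degProj (n m : ℕ) : deconc V ≫ (degProj V n ⊗ₘ degProj V m) = split n m :=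
  tens_ext_Homog fun N x hx => by
    rw [comp_apply, deconc_of_mem hx, map_sum]
    have h1 : ∀ i j, i + j = N → (degProj V n ⊗ₘ degProj V m) (split i j x) =
        if (i, j) = (n, m) then split n m x else 0 := fun i j hij => by
      subst hij
      split_ifs with h
      · obtain ⟨rfl, rfl⟩ := Prod.mk.inj h
        refine eqOn_mul (f := split i j ≫ (degProj V i ⊗ₘ degProj V j)) (g := split i j)
          (fun a ha b hb => ?_) hx
        rw [comp_apply, split_mul ha hb, tensorHom_tmul, degProj_of_mem ha, degProj_of_mem hb]
      · refine eqOn_mul (f := split i j ≫ (degProj V n ⊗ₘ degProj V m)) (g := 0)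
          (fun a ha b hb => ?_) hx
        rw [comp_apply, split_mul ha hb, tensorHom_tmul, zero_apply]
        by_cases hi : i = n
        · rw [degProj_of_ne (fun hj => h (by rw [hi, hj])) hb]
          exact map_zero (Hom.lin (tmulL _ _))
        · rw [degProj_of_ne hi ha]
          exact map_zero (Hom.lin (tmulR _ _))
    by_cases hN : N = n + m
    · rw [Finset.sum_eq_single (n, m)]
      · rw [h1 n m hN.symm, if_pos rfl]
      · rintro ⟨i, j⟩ hp hne
        rw [Finset.HasAntidiagonal.mem_antidiagonal] at hp
        exact (h1 i j hp).trans (if_neg hne)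
      · intro hp
        exact (hp (by rw [Finset.HasAntidiagonal.mem_antidiagonal, hN])).elim
    · rw [split_of_ne hN hx]
      refine Finset.sum_eq_zero ?_
      rintro ⟨i, j⟩ hp
      rw [Finset.HasAntidiagonal.mem_antidiagonal] at hp
      refine (h1 i j hp).trans (if_neg ?_)
      rintro ⟨rfl, rfl⟩
      exact hN hp.symm

lemma mul_split_degProj (n m : ℕ) : split n m ≫ tensMul V = degProj V (n + m) :=
  tens_ext_Homog fun N x hx => by
    rw [comp_apply]
    by_cases hN : N = n + m
    · subst hN
      rw [mul_split hx, degProj_of_mem hx]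
    · rw [split_of_ne hN hx, degProj_of_ne hN hx, map_zero]

/-- The primitive elements for deconcatenation have degree one. -/
lemma mem_Homog_of_deconc {x : tens V} (hx : deconc V x = tmul 1 x + tmul x 1) :
    x ∈ Homog V 1 := mem_Homog_of_degProj fun N hN => by
  -- Concatenating the component of bidegree `(n, m)` gives back the component of degree `n + m`.
  -- Since `1` has degree zero, a degree of the form `n + m` with both positive is excluded; degree
  -- zero is excluded because there the component is twice itself.
  have key : ∀ n m, degProj V (n + m) x =
      degProj V n 1 * degProj V m x + degProj V n x * degProj V m 1 := fun n m => by
    rw [← mul_split_degProj, comp_apply, ← deconc_degProj, comp_apply, hx, map_add, map_add,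
      tensorHom_tmul, tensorHom_tmul, tensMul_eq, tensMul_eq]
  have hone : degProj V 0 (1 : tens V) = 1 := degProj_of_mem one_mem_Homog
  have hone' : ∀ n ≠ 0, degProj V n (1 : tens V) = 0 := fun n hn =>
    degProj_of_ne (Ne.symm hn) one_mem_Homog
  rcases N with _ | _ | N
  · have := key 0 0
    rw [hone, one_mul, mul_one] at this
    exact left_eq_add.mp this
  · exact (hN rfl).elim
  · have := key 1 (N + 1)
    rw [hone' 1 one_ne_zero, hone' (N + 1) (by omega), zero_mul, mul_zero, add_zero] at this
    rwa [add_comm 1] at this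

lemma symz_degProj (n : ℕ) : degProj V n ≫ symz hc = symz hc ≫ degProj V n :=
  tens_ext_Homog fun m x hx => by
    rw [comp_apply, comp_apply]
    by_cases hm : m = n
    · subst hm
      rw [degProj_of_mem hx, degProj_of_mem (symz_mem hc hx)]
    · rw [degProj_of_ne hm hx, degProj_of_ne hm (symz_mem hc hx), map_zero]

end degree

end NABan

namespace NABan

/-! ### Invertibility of the braiding -/

section inverse

variable {k : Type u} [NormedField k] [IsUltrametricDist k] [CompleteSpace k] {V Z : NABan k}
  {E F : ℕ → NABan k} {c : V ⊗ V ⟶ V ⊗ V}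

lemma incl_comp_desc₂ (f : ∀ n m, E n ⊗ F m ⟶ Z) (hf : ∀ n m, IsContr (f n m)) (n m : ℕ) :
    (incl E n ⊗ₘ incl F m) ≫ desc₂ f hf = f n m := tmul_ext fun x y => by
  rw [comp_apply, tensorHom_tmul, desc₂_incl]

/-- The inverses are needed as contractions, since only uniformly bounded families assemble to a map
on the completed tensor algebra; hence isometric isomorphisms instead of isomorphisms. -/
lemma isIsom_powBraid₁ (hc : IsIsom c) : ∀ n, IsIsom (powBraid₁ c n)
  | 0 => isIsom_leftUnitor.comp isIsom_rightUnitor_inv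
  | n + 1 => isIsom_assoc.comp (hc.whiskerLeft.comp (isIsom_assoc_inv.comp
      ((isIsom_powBraid₁ hc n).whiskerRight.comp isIsom_assoc)))

lemma isIsom_powBraid (hc : IsIsom c) (n : ℕ) : ∀ m, IsIsom (powBraid c n m)
  | 0 => isIsom_rightUnitor.comp isIsom_leftUnitor_inv
  | m + 1 => isIsom_assoc_inv.comp ((isIsom_powBraid hc n m).whiskerRight.comp
      (isIsom_assoc.comp ((isIsom_powBraid₁ hc n).whiskerLeft.comp isIsom_assoc_inv)))

/-- The braiding of the tensor algebra is invertible if `c` is an isometric isomorphism. -/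
lemma exists_tensBraid_inv (hc : IsContr c) (h : IsIsom c) :
    ∃ b, tensBraid hc ≫ b = 𝟙 _ ∧ b ≫ tensBraid hc = 𝟙 _ := by
  have hb : ∀ n m, IsContr ((isIsom_powBraid h m n).inv ≫ (tensIncl V m ⊗ₘ tensIncl V n)) :=
    fun n m => (isIsom_powBraid h m n).isContr_inv.comp
      ((isContr_incl m).tensorHom (isContr_incl n))
  have h1 : ∀ n m, (tensIncl V n ⊗ₘ tensIncl V m) ≫ tensBraid hc =
      powBraid c n m ≫ (tensIncl V m ⊗ₘ tensIncl V n) := fun n m => incl_comp_desc₂ _ _ n m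
  let b : tens V ⊗ tens V ⟶ tens V ⊗ tens V := desc₂ _ hb
  have h2 : ∀ n m, (tensIncl V n ⊗ₘ tensIncl V m) ≫ b =
      (isIsom_powBraid h m n).inv ≫ (tensIncl V m ⊗ₘ tensIncl V n) :=
    fun n m => incl_comp_desc₂ _ _ n m
  have ext : ∀ f : tens V ⊗ tens V ⟶ tens V ⊗ tens V,
      (∀ n m, (tensIncl V n ⊗ₘ tensIncl V m) ≫ f = (tensIncl V n ⊗ₘ tensIncl V m)) → f = 𝟙 _ :=
    fun f hf => tens_ext₂ fun n x hx m y hy => by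
      obtain ⟨x, rfl⟩ := hx
      obtain ⟨y, rfl⟩ := hy
      have := congrArg (fun F : tpow V n ⊗ tpow V m ⟶ _ => F (tmul x y)) (hf n m)
      rw [comp_apply, tensorHom_tmul] at this
      exact this
  refine ⟨b, ext _ fun n m => ?_, ext _ fun n m => ?_⟩
  · rw [← Category.assoc, h1, Category.assoc, h2, ← Category.assoc, IsIsom.hom_inv,
      Category.id_comp]
  · rw [← Category.assoc, h2, Category.assoc, h1, ← Category.assoc, IsIsom.inv_hom,
      Category.id_comp]

end inverse

section equaliser

variable {k : Type u} [NormedField k] {W X Y : NABan k} {f g : X ⟶ Y}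

/-- Morphisms that scale norms onto the subspace where `f` and `g` agree are isomorphisms with the
equaliser. -/
lemma exists_iso_eqObj (s : W ⟶ X) (hs : ∀ x, x ∈ eqSub f g ↔ ∃ w, s w = x) {r : ℝ} (hr : 0 < r)
    (hn : ∀ w, ‖s w‖ = r * ‖w‖) : ∃ e : W ≅ eqObj f g, e.hom ≫ eqIncl f g = s := by
  obtain ⟨C, hC⟩ := Hom.bound s
  let l : W ⟶ eqObj f g := mk' (X := W) (Y := eqObj f g)
    ((Hom.lin s).codRestrict (eqSub f g) fun w => (hs _).mpr ⟨w, rfl⟩) C hC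
  obtain ⟨e, he⟩ := exists_iso_of_norm l (fun y => by
    obtain ⟨w, hw⟩ := (hs y.1).mp y.2
    exact ⟨w, Subtype.ext hw⟩) hr hn
  exact ⟨e, he ▸ rfl⟩

end equaliser

/-! ### The Nichols algebra as a quotient of the tensor algebra -/

section nichols

variable {k : Type u} [NormedField k] [IsUltrametricDist k] [CompleteSpace k] {V : NABan k}
  {c : V ⊗ V ⟶ V ⊗ V} {hc : IsContr c} {I : Submodule k (tens V)}
  {hI : IsClosed (I : Set (tens V))}

/-- The symmetrizer becomes an injection on the quotient, and elements of the quotient are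
recognised by their image in the tensor algebra. -/
lemma exists_symz_lift (hIF : ∀ x, x ∈ I ↔ symz hc x = 0) : ∃ F : quot I hI ⟶ tens V,
    proj I hI ≫ F = symz hc ∧ ∀ y, F y = 0 → y = 0 := by
  obtain ⟨F, hF⟩ := exists_quotLift (hI := hI) (symz hc) fun x hx => (hIF x).mp hx
  refine ⟨F, hF, fun y hy => ?_⟩
  obtain ⟨x, rfl⟩ := proj_surjective y
  rw [proj_eq_zero, hIF, ← hF]
  exact hy

lemma proj_eq_of_symz (hIF : ∀ x, x ∈ I ↔ symz hc x = 0) {x y : tens V}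
    (h : symz hc x = symz hc y) : proj I hI x = proj I hI y := by
  rw [← sub_eq_zero, ← map_sub, proj_eq_zero, hIF, map_sub, h, sub_self]

/-- The quotient by the kernel of the symmetrizer inherits the structure maps. -/
lemma exists_isHom_nichols (hb : IsPreBraiding c) (hIF : ∀ x, x ∈ I ↔ symz hc x = 0)
    (hideal : (tensHopf hc).IsIdeal I) :
    (∃ D : HopfData (quot I hI), HopfData.IsHom (tensHopf hc) D (proj I hI)) ∧
      (tensHopf hc).IsCoideal I := by
  refine HopfData.exists_isHom_proj hIF hideal (fun x hx => ?_) (fun x hx => ?_)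
    (fun x hx y => ?_) fun x hx => ?_
  · rw [← counit_symz, comp_apply, (hIF x).mp hx, map_zero]
  · rw [comul_symz hc hb, (hIF x).mp hx, map_zero]
  · have h1 : ∀ z, (symz hc ⊗ₘ symz hc) ((tensHopf hc).braid z) =
        tensBraid hc ((symz hc ⊗ₘ symz hc) z) := fun z =>
      congrArg (fun F : tens V ⊗ tens V ⟶ tens V ⊗ tens V => F z) (braid_symz hc hb)
    rw [h1, h1, tensorHom_tmul, tensorHom_tmul, (hIF x).mp hx,
      show tmul (0 : tens V) (symz hc y) = 0 from map_zero (Hom.lin (tmulR _ _)),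
      show tmul (symz hc y) (0 : tens V) = 0 from map_zero (Hom.lin (tmulL _ _)), map_zero]
    exact ⟨rfl, rfl⟩
  · have h1 := congrArg (fun F : tens V ⟶ kt k ⊗ tens V => F x) (coact_symz hc)
    simp only [comp_apply] at h1
    rw [h1, (hIF x).mp hx, map_zero]

variable {D : HopfData (quot I hI)}

lemma isGradedHopf_nichols (hb : IsPreBraiding c) (hIF : ∀ x, x ∈ I ↔ symz hc x = 0)
    (h : HopfData.IsHom (tensHopf hc) D (proj I hI)) : D.IsGradedHopf := by
  obtain ⟨S, hS⟩ := exists_quotLift (hI := hI) (tensAntipode hc ≫ proj I hI) fun x hx => by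
    rw [comp_apply, proj_eq_zero, hIF, ← comp_apply, antipode_symz hc hb, comp_apply,
      (hIF x).mp hx, map_zero]
  exact h.isGradedHopf (isPreBraidedBialgebra_tensHopf hc hb) (isGraded_tensHopf hc)
    (isAntipode_tensAntipode hc hb) (antipode_coact hc) hS.symm

lemma mem_pieceSub_iff {A : NABan k} {D : HopfData A} {n : ℕ} {x : A} :
    x ∈ D.pieceSub n ↔ D.coact x = tmul (tn k n) x := by
  have : ((λ_ A).inv ≫ (tpower k n ▷ A)) x = tmul (tn k n) x := by
    rw [comp_apply, leftUnitor_inv_apply, whiskerRight_tmul]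
    rfl
  rw [← this]
  exact Iff.rfl

lemma mem_prim_iff {A : NABan k} {D : HopfData A} {x : A} :
    x ∈ D.prim ↔ D.comul x = tmul (D.one (scal 1)) x + tmul x (D.one (scal 1)) := by
  have : ((λ_ A).inv ≫ (D.one ▷ A) + (ρ_ A).inv ≫ (A ◁ D.one)) x =
      tmul (D.one (scal 1)) x + tmul x (D.one (scal 1)) := by
    rw [add_apply, comp_apply, comp_apply, leftUnitor_inv_apply, rightUnitor_inv_apply,
      whiskerRight_tmul, whiskerLeft_tmul]
  rw [← this]
  exact Iff.rfl

/-- The graded pieces of the quotient are the images of the graded pieces. -/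
lemma mem_pieceSub_nichols (hIF : ∀ x, x ∈ I ↔ symz hc x = 0)
    (h : HopfData.IsHom (tensHopf hc) D (proj I hI)) {n : ℕ} {y : quot I hI} :
    y ∈ D.pieceSub n ↔ ∃ x ∈ Homog V n, proj I hI x = y := by
  have hco : ∀ x, D.coact (proj I hI x) = (kt k ◁ proj I hI) ((tensHopf hc).coact x) := fun x =>
    congrArg (fun F : tens V ⟶ kt k ⊗ quot I hI => F x) h.coact
  rw [mem_pieceSub_iff]
  constructor
  · intro hy
    obtain ⟨F, hF, -⟩ := exists_symz_lift (hI := hI) hIF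
    obtain ⟨x, rfl⟩ := proj_surjective y
    have hFx : F (proj I hI x) = symz hc x := congrArg (fun F : tens V ⟶ tens V => F x) hF
    -- The symmetrizer commutes with the coaction, so `symz hc x` is homogeneous of degree `n`. Then
    -- `x` and its component of degree `n` have the same symmetrization, and so the same class.
    have h1 := congrArg (kt k ◁ F) hy
    rw [hco, ← comp_apply, ← MonoidalCategory.whiskerLeft_comp, hF, whiskerLeft_tmul, hFx,
      ← comp_apply, coact_symz, comp_apply] at h1
    refine ⟨degProj V n x, degProj_mem n x, proj_eq_of_symz hIF ?_⟩
    rw [← comp_apply, symz_degProj, comp_apply, degProj_of_mem (mem_Homog_of_coact hc h1)]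
  · rintro ⟨x, hx, rfl⟩
    rw [hco, coact_of_mem hc hx, whiskerLeft_tmul]

/-- The primitive elements of the quotient are the images of the generators. -/
lemma mem_prim_nichols (hb : IsPreBraiding c) (hIF : ∀ x, x ∈ I ↔ symz hc x = 0)
    (h : HopfData.IsHom (tensHopf hc) D (proj I hI)) {y : quot I hI} :
    y ∈ D.prim ↔ ∃ v, proj I hI (gen V v) = y := by
  have hco : ∀ x, D.comul (proj I hI x) =
      (proj I hI ⊗ₘ proj I hI) ((tensHopf hc).comul x) := fun x =>
    congrArg (fun F : tens V ⟶ quot I hI ⊗ quot I hI => F x) h.comul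
  have hone : D.one (scal 1) = proj I hI 1 :=
    (congrArg (fun F : 𝟙_ (NABan k) ⟶ quot I hI => F (scal 1)) h.one).symm
  rw [mem_prim_iff, hone]
  constructor
  · intro hy
    obtain ⟨F, hF, -⟩ := exists_symz_lift (hI := hI) hIF
    obtain ⟨x, rfl⟩ := proj_surjective y
    have hFx : ∀ x, F (proj I hI x) = symz hc x := fun x =>
      congrArg (fun F : tens V ⟶ tens V => F x) hF
    -- After `F ⊗ F` the equation says that `symz hc x` is primitive for deconcatenation, hence
    -- equal to a generator. The symmetrizer fixes generators, so `x` and that generator have the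
    -- same class.
    have h1 := congrArg (F ⊗ₘ F) hy
    rw [hco, ← comp_apply, tensorHom_comp_tensorHom, hF, comul_symz hc hb, map_add, tensorHom_tmul,
      tensorHom_tmul, hFx, hFx, symz_one] at h1
    obtain ⟨v, hv⟩ := exists_gen_of_mem_Homog_one (mem_Homog_of_deconc h1)
    refine ⟨v, proj_eq_of_symz hIF ?_⟩
    rw [hv, symz_gen]
  · rintro ⟨v, rfl⟩
    rw [hco, comul_gen, map_add, tensorHom_tmul, tensorHom_tmul]

/-- In a degree where the symmetrizer is the identity, the projection to that degree kills `I`. It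
induces a contraction on the quotient that inverts the class map on this degree, so no norm is lost.
-/
lemma norm_proj_of_mem (hIF : ∀ x, x ∈ I ↔ symz hc x = 0) {n : ℕ}
    (hn : ∀ x ∈ Homog V n, symz hc x = x) {x : tens V} (hx : x ∈ Homog V n) :
    ‖proj I hI x‖ = ‖x‖ := by
  obtain ⟨P, hP⟩ := exists_quotLift (hI := hI) (degProj V n) fun x hx => by
    rw [← hn _ (degProj_mem n x), ← comp_apply, symz_degProj, comp_apply, (hIF x).mp hx, map_zero]
  have hPx : P (proj I hI x) = x :=
    (congrArg (fun F : tens V ⟶ tens V => F x) hP).trans (degProj_of_mem hx)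
  refine le_antisymm ?_ ?_
  · exact Submodule.Quotient.norm_mk_le I x
  · conv_lhs => rw [← hPx]
    exact norm_le_of_proj (isContr_degProj n) hP _

lemma symz_of_mem_zero {x : tens V} (hx : x ∈ Homog V 0) : symz hc x = x := by
  obtain ⟨a, rfl⟩ := eq_smul_of_mem_Homog_zero hx
  rw [map_smul, symz_one]

lemma symz_of_mem_one {x : tens V} (hx : x ∈ Homog V 1) : symz hc x = x := by
  obtain ⟨v, rfl⟩ := exists_gen_of_mem_Homog_one hx
  exact symz_gen hc v

lemma norm_gen (v : V) : ‖gen V v‖ = ‖v‖ :=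
  (norm_incl 1 _).trans (isIsom_leftUnitor_inv.norm_eq v)

lemma norm_one_tens : ‖(1 : tens V)‖ = 1 :=
  (norm_incl (E := tpow V) 0 (scal (1 : k))).trans (norm_one (α := k))

lemma norm_proj_gen (hIF : ∀ x, x ∈ I ↔ symz hc x = 0) (v : V) :
    ‖proj I hI (gen V v)‖ = ‖v‖ :=
  (norm_proj_of_mem hIF (fun _ => symz_of_mem_one) (gen_mem_Homog v)).trans (norm_gen v)

lemma piece_zero_nichols (hIF : ∀ x, x ∈ I ↔ symz hc x = 0)
    (h : HopfData.IsHom (tensHopf hc) D (proj I hI)) : Nonempty (D.piece 0 ≅ 𝟙_ (NABan k)) := by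
  have hone : ∀ a : k, (tensOne V ≫ proj I hI) (scal a) = proj I hI (a • 1) := fun a => by
    rw [comp_apply, show scal a = a • scal (1 : k) from (by rw [scal_smul, mul_one]), map_smul,
      map_smul, map_smul]
    rfl
  obtain ⟨e, -⟩ := exists_iso_eqObj (tensOne V ≫ proj I hI)
    (fun y => (mem_pieceSub_nichols hIF h (n := 0)).trans ⟨fun ⟨x, hx, hxy⟩ => by
      obtain ⟨a, rfl⟩ := eq_smul_of_mem_Homog_zero hx
      exact ⟨scal a, (hone a).trans hxy⟩, fun ⟨a, ha⟩ =>
        ⟨unscal a • 1, Submodule.smul_mem _ _ one_mem_Homog, (hone (unscal a)).symm.trans ha⟩⟩)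
    one_pos fun a => by
      rw [one_mul]
      refine (congrArg norm (hone (unscal a))).trans ?_
      rw [norm_proj_of_mem hIF (fun _ => symz_of_mem_zero)
        (Submodule.smul_mem _ _ one_mem_Homog), norm_smul, norm_one_tens, mul_one]
      rfl
  exact ⟨e.symm⟩

/-- The degree one part of the quotient. -/
lemma piece_one_nichols (hIF : ∀ x, x ∈ I ↔ symz hc x = 0)
    (h : HopfData.IsHom (tensHopf hc) D (proj I hI)) {W : NABan k} (s : W ⟶ V)
    (hs : Function.Surjective s) {r : ℝ} (hr : 0 < r) (hsn : ∀ w, ‖s w‖ = r * ‖w‖) :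
    ∃ e : W ≅ D.piece 1, e.hom ≫ D.pieceIncl 1 = s ≫ gen V ≫ proj I hI :=
  exists_iso_eqObj (s ≫ gen V ≫ proj I hI)
    (fun y => (mem_pieceSub_nichols hIF h (n := 1)).trans ⟨fun ⟨x, hx, hxy⟩ => by
      obtain ⟨v, rfl⟩ := exists_gen_of_mem_Homog_one hx
      obtain ⟨w, rfl⟩ := hs v
      exact ⟨w, hxy⟩, fun ⟨w, hw⟩ => ⟨_, gen_mem_Homog (s w), hw⟩⟩)
    hr fun w => (norm_proj_gen hIF (s w)).trans (hsn w)

lemma gen_braid : (gen V ⊗ₘ gen V) ≫ tensBraid hc = c ≫ (gen V ⊗ₘ gen V) :=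
  tmul_ext fun v w => by
    have h1 : ∀ t, split 1 1 (genMul V t) = (gen V ⊗ₘ gen V) t := fun t => by
      have : genMul V ≫ split 1 1 = (gen V ⊗ₘ gen V) := tmul_ext fun v w => by
        rw [comp_apply, genMul_tmul, split_mul (gen_mem_Homog v) (gen_mem_Homog w), tensorHom_tmul]
      exact congrArg (fun F : V ⊗ V ⟶ tens V ⊗ tens V => F t) this
    have h2 := strand_mul_genMul hc (one_mem_Homog (V := V)) (tmul v w)
    rw [one_mul, one_mul, genMul_tmul] at h2
    rw [comp_apply, comp_apply, tensorHom_tmul, braid_tmul hc (gen_mem_Homog v) (gen_mem_Homog w),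
      BraidWord.bb_one_right, BraidWord.up_one, h2, h1]

/-- The quotient is generated in degree one. -/
lemma isGeneratedBy_nichols (hIF : ∀ x, x ∈ I ↔ symz hc x = 0)
    (h : HopfData.IsHom (tensHopf hc) D (proj I hI)) : D.IsGeneratedBy (D.pieceIncl 1) := by
  intro A' _ f j hone hmul hj
  -- The closure of the image is a closed subalgebra containing the degree one part. Once it is
  -- everything, `f` has dense range and is therefore an epimorphism.
  let R := (LinearMap.range (Hom.lin f)).topologicalClosure
  have hR : IsClosed (R : Set (quot I hI)) := Submodule.isClosed_topologicalClosure _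
  have hle : ∀ a, f a ∈ R := fun a => Submodule.le_topologicalClosure _ ⟨a, rfl⟩
  have hmulR : ∀ x ∈ R, ∀ y ∈ R, D.mul (tmul x y) ∈ R := fun x hx y hy => by
    refine map_mem_closure₂ (f := fun x y => D.mul (tmul x y))
      ((continuous D.mul).comp continuous_tmul) hx hy ?_
    rintro _ ⟨a, rfl⟩ _ ⟨b, rfl⟩
    refine ⟨(MonObj.mul : A' ⊗ A' ⟶ A') (tmul a b), ?_⟩
    have := congrArg (fun F : A' ⊗ A' ⟶ quot I hI => F (tmul a b)) hmul
    simpa only [comp_apply, tensorHom_tmul] using this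
  have hgen : ∀ v, proj I hI (gen V v) ∈ R := fun v => by
    have hv : proj I hI (gen V v) ∈ D.pieceSub 1 :=
      (mem_pieceSub_nichols hIF h).mpr ⟨_, gen_mem_Homog v, rfl⟩
    have : f (j (⟨_, hv⟩ : D.pieceSub 1)) = proj I hI (gen V v) :=
      congrArg (fun F : D.piece 1 ⟶ quot I hI => F (⟨_, hv⟩ : D.pieceSub 1)) hj
    rw [← this]
    exact hle _
  have hmul' : ∀ x y, proj I hI (x * y) = D.mul (tmul (proj I hI x) (proj I hI y)) := fun x y => by
    have := congrArg (fun F : tens V ⊗ tens V ⟶ quot I hI => F (tmul x y)) h.mul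
    simp only [comp_apply, tensorHom_tmul] at this
    exact this.symm
  have hone' : proj I hI 1 = f ((MonObj.one : 𝟙_ (NABan k) ⟶ A') (scal 1)) :=
    congrArg (fun F : 𝟙_ (NABan k) ⟶ quot I hI => F (scal 1)) (h.one.trans hone.symm)
  -- Membership in the closed subspace `R` is expressed as the vanishing of a morphism, so induction
  -- on homogeneous elements also covers infinite series.
  have key : proj I hI ≫ proj R hR = 0 := tens_ext_Homog fun n x hx => by
    induction n generalizing x with
    | zero =>
      obtain ⟨a, rfl⟩ := eq_smul_of_mem_Homog_zero hx
      refine proj_eq_zero.mpr ?_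
      rw [map_smul, hone']
      exact Submodule.smul_mem _ _ (hle _)
    | succ n ih =>
      refine eqOn_gen (fun x hx v => ?_) hx
      refine proj_eq_zero.mpr ?_
      rw [hmul']
      exact hmulR _ (proj_eq_zero.mp (ih x hx)) _ (hgen v)
  have : IsDense f := ⟨fun y => by
    obtain ⟨x, rfl⟩ := proj_surjective y
    exact proj_eq_zero.mp (congrArg (fun F : tens V ⟶ quot R hR => F x) key)⟩
  exact ⟨fun _ _ h => IsDense.cancel f h⟩

/-- The pre-braiding of the quotient is invertible if `c` is an isometric isomorphism. -/
lemma isIso_braid_nichols (hb : IsPreBraiding c) (hIF : ∀ x, x ∈ I ↔ symz hc x = 0)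
    (h : HopfData.IsHom (tensHopf hc) D (proj I hI)) (hiso : IsIsom c) : IsIso D.braid := by
  obtain ⟨b, hb1, hb2⟩ := exists_tensBraid_inv hc hiso
  obtain ⟨F, hF, hFinj⟩ := exists_symz_lift (hI := hI) hIF
  -- The inverse of the braiding inherits its commutation with the symmetrizer; hence it preserves
  -- the kernel of `symz ⊗ symz`, which dies in the tensor square of the quotient, and descends.
  have hcomm : b ≫ (symz hc ⊗ₘ symz hc) = (symz hc ⊗ₘ symz hc) ≫ b := by
    calc b ≫ (symz hc ⊗ₘ symz hc) = b ≫ ((symz hc ⊗ₘ symz hc) ≫ tensBraid hc) ≫ b := by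
          rw [Category.assoc, hb1, Category.comp_id]
      _ = (symz hc ⊗ₘ symz hc) ≫ b := by
          rw [← braid_symz hc hb, Category.assoc, ← Category.assoc, hb2, Category.id_comp]
  have hinj : ∀ z, (symz hc ⊗ₘ symz hc) z = 0 → (proj I hI ⊗ₘ proj I hI) z = 0 := fun z hz =>
    tensorHom_injective hFinj hFinj _ (by
      rw [← hF, ← tensorHom_comp_tensorHom] at hz
      exact hz)
  have hz : ∀ z, (symz hc ⊗ₘ symz hc) z = 0 → (proj I hI ⊗ₘ proj I hI) (b z) = 0 := fun z hz =>
    hinj _ (by rw [← comp_apply, hcomm, comp_apply, hz, map_zero])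
  obtain ⟨b', hb'⟩ := exists_quotLift₂ (hI := hI) (b ≫ (proj I hI ⊗ₘ proj I hI))
    (fun x hx y => hz _ (by
      rw [tensorHom_tmul, (hIF x).mp hx]
      exact map_zero (Hom.lin (tmulR _ _))))
    fun x hx y => hz _ (by
      rw [tensorHom_tmul, (hIF x).mp hx]
      exact map_zero (Hom.lin (tmulL _ _)))
  have sq : IsSq b b' (proj I hI ⊗ₘ proj I hI) (proj I hI ⊗ₘ proj I hI) := hb'.symm
  exact ⟨b', IsSq.descend hb1 (h.sq_braid.comp sq) (isSq_id _),
    IsSq.descend hb2 (sq.comp h.sq_braid) (isSq_id _)⟩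

end nichols

/-! ### Change of radius and extension of the form -/

section rescaling

variable {k : Type u} [NormedField k] {V : NABan k} {r s : ℝ} {hr : 0 < r} {hs : 0 < s}

lemma toRescale_ofRescale : toRescale r V hr ≫ ofRescale r V hr = 𝟙 V := rfl
lemma ofRescale_toRescale : ofRescale r V hr ≫ toRescale r V hr = 𝟙 (rescale r hr V) := rfl

lemma toRescale_surjective : Function.Surjective (toRescale r V hr) := fun x =>
  ⟨ofRescale r V hr x, rfl⟩

instance : IsDense (toRescale r V hr) := ⟨toRescale_surjective.denseRange⟩

variable [IsUltrametricDist k] [CompleteSpace k] {c : V ⊗ V ⟶ V ⊗ V}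

lemma isSq_toRescale (c : V ⊗ V ⟶ V ⊗ V) : IsSq c (rescaleBraid r hr c)
    (toRescale r V hr ⊗ₘ toRescale r V hr) (toRescale r V hr ⊗ₘ toRescale r V hr) := by
  rw [IsSq, rescaleBraid, ← Category.assoc, tensorHom_comp_tensorHom, toRescale_ofRescale,
    id_tensorHom_id, Category.id_comp]

lemma isSq_ofRescale (c : V ⊗ V ⟶ V ⊗ V) : IsSq (rescaleBraid r hr c) c
    (ofRescale r V hr ⊗ₘ ofRescale r V hr) (ofRescale r V hr ⊗ₘ ofRescale r V hr) := by
  rw [IsSq, rescaleBraid, Category.assoc, Category.assoc, tensorHom_comp_tensorHom,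
    toRescale_ofRescale, id_tensorHom_id, Category.comp_id]

lemma isPreBraiding_rescaleBraid (hc : IsPreBraiding c) : IsPreBraiding (rescaleBraid r hr c) :=
  hc.descend (isSq_toRescale c)

lemma rescaleBraid_comp (c d : V ⊗ V ⟶ V ⊗ V) :
    rescaleBraid r hr c ≫ rescaleBraid r hr d = rescaleBraid r hr (c ≫ d) := by
  simp only [rescaleBraid, Category.assoc]
  rw [← Category.assoc (toRescale r V hr ⊗ₘ toRescale r V hr), tensorHom_comp_tensorHom,
    toRescale_ofRescale, id_tensorHom_id, Category.id_comp]

lemma rescaleBraid_id : rescaleBraid r hr (𝟙 (V ⊗ V)) = 𝟙 _ := by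
  rw [rescaleBraid, Category.id_comp, tensorHom_comp_tensorHom, ofRescale_toRescale,
    id_tensorHom_id]

lemma isIsom_rescaleBraid (h : IsIsom c) : IsIsom (rescaleBraid r hr c) :=
  ⟨isContr_rescaleBraid r hr h.1, rescaleBraid r hr h.inv, isContr_rescaleBraid r hr h.isContr_inv,
    by rw [rescaleBraid_comp, h.hom_inv, rescaleBraid_id],
    by rw [rescaleBraid_comp, h.inv_hom, rescaleBraid_id]⟩

lemma isIsom_of_norm (h : ∀ z, ‖c z‖ = ‖z‖) (hc : Function.Surjective c) : IsIsom c := by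
  obtain ⟨e, rfl⟩ := exists_iso_of_norm c hc one_pos fun z => (h z).trans (one_mul _).symm
  refine IsIsom.of_iso e (fun z => (h z).le) fun z => ?_
  rw [← h (e.inv z), ← comp_apply, e.inv_hom_id, id_apply]

/-- The form on rescaled spaces. -/
def rescaleForm (hr : 0 < r) (hs : 0 < s) (φ : V ⊗ V ⟶ 𝟙_ (NABan k)) :
    rescale r hr V ⊗ rescale s hs V ⟶ 𝟙_ (NABan k) :=
  (ofRescale r V hr ⊗ₘ ofRescale s V hs) ≫ φ

variable {φ : V ⊗ V ⟶ 𝟙_ (NABan k)}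

lemma rescaleForm_tmul (v : rescale r hr V) (w : rescale s hs V) :
    rescaleForm hr hs φ (tmul v w) = φ (tmul (ofRescale r V hr v) (ofRescale s V hs w)) := by
  rw [rescaleForm, comp_apply, tensorHom_tmul]

/-- This is the role of the bound `C ≤ r s`: for a contracting form the pairings of the tensor
powers are contractions in every degree and assemble on the completed algebras. -/
lemma isContr_rescaleForm (h : opNorm φ ≤ r * s) : IsContr (rescaleForm hr hs φ) := fun z => by
  refine (bound_of_tmk (f := rescaleForm hr hs φ) 1 zero_le_one (fun x y => ?_) z).trans_eq
    (one_mul _)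
  change ‖rescaleForm hr hs φ (tmul x y)‖ ≤ _
  rw [rescaleForm_tmul, one_mul]
  refine (le_opNorm φ _).trans ?_
  calc opNorm φ * ‖tmul (ofRescale r V hr x) (ofRescale s V hs y)‖
      ≤ (r * s) * ((r⁻¹ * ‖x‖) * (s⁻¹ * ‖y‖)) := by
        refine mul_le_mul h ?_ (norm_nonneg _) (by positivity)
        refine (norm_tmul_le _ _).trans_eq ?_
        rw [norm_ofRescale, norm_ofRescale]
    _ = ‖x‖ * ‖y‖ := by field_simp

lemma isAdjoint_rescale (h : IsCompatible c φ) :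
    IsAdjoint (rescaleBraid r hr c) (rescaleBraid s hs c) (rescaleForm hr hs φ) := by
  have h1 : pair₂ (rescaleForm hr hs φ) = ((ofRescale r V hr ⊗ₘ ofRescale r V hr) ⊗ₘ
      (ofRescale s V hs ⊗ₘ ofRescale s V hs)) ≫ pair₂ φ := by
    rw [pair₂, pair₂, rescaleForm, ← tensorHom_comp_tensorHom, Category.assoc, ← Category.assoc,
      ← tensorμ_natural, Category.assoc]
  intro t t'
  have h2 := fun t : (rescale r hr V ⊗ rescale r hr V : NABan k) =>
    congrArg (fun F : rescale r hr V ⊗ rescale r hr V ⟶ V ⊗ V => F t) (isSq_ofRescale (hr := hr) c)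
  have h3 := fun t : (rescale s hs V ⊗ rescale s hs V : NABan k) =>
    congrArg (fun F : rescale s hs V ⊗ rescale s hs V ⟶ V ⊗ V => F t) (isSq_ofRescale (hr := hs) c)
  simp only [comp_apply] at h2 h3
  rw [h1, comp_apply, comp_apply, tensorHom_tmul, tensorHom_tmul, h2, h3]
  have h4 := congrArg (fun F : (V ⊗ V) ⊗ (V ⊗ V) ⟶ 𝟙_ (NABan k) =>
    F (tmul ((ofRescale r V hr ⊗ₘ ofRescale r V hr) t)
      ((ofRescale s V hs ⊗ₘ ofRescale s V hs) t'))) h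
  simpa only [comp_apply, whiskerRight_tmul, whiskerLeft_tmul] using h4

lemma rescaleForm_nondegenerate (h : IsNondegenerate φ) (v : rescale r hr V)
    (hv : ∀ w, rescaleForm hr hs φ (tmul v w) = 0) : v = 0 :=
  h.1 (ofRescale r V hr v) fun y => by
    have := hv (toRescale s V hs y)
    rwa [rescaleForm_tmul] at this

/-- The extension of a form to a dual pairing of tensor algebras, and its radical. -/
lemma exists_unique_extension (hc : IsPreBraiding c) (hc1 : IsContr c) (hφc : IsCompatible c φ)
    (hφn : IsNondegenerate φ) (hr : 0 < r) (hs : 0 < s) (h : opNorm φ ≤ r * s) :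
    ∃ p : tensR V r hr ⊗ tensR V s hs ⟶ 𝟙_ (NABan k), IsExtension hc1 φ r hr s hs p ∧
      (∀ p', IsExtension hc1 φ r hr s hs p' → p' = p) ∧
      LinearMap.ker (Hom.lin (symz (isContr_rescaleBraid r hr hc1))) = radical p := by
  have hψ := isContr_rescaleForm (hr := hr) (hs := hs) h
  have hadj := isAdjoint_rescale (hr := hr) (hs := hs) hφc
  have hbr := isPreBraiding_rescaleBraid (hr := hr) hc
  have hbs := isPreBraiding_rescaleBraid (hr := hs) hc
  have hext : IsExtension hc1 φ r hr s hs (hopfForm (isContr_rescaleBraid s hs hc1) hψ) := by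
    refine ⟨isDualPairing_hopfForm hadj hbr hbs, tmul_ext fun v w => ?_⟩
    refine Eq.trans ?_ ((hopfForm_gen (hd := isContr_rescaleBraid s hs hc1) (hψ := hψ)
      (toRescale r V hr v)
      (toRescale s V hs w)).trans
      (rescaleForm_tmul _ _))
    exact congrArg (hopfForm (isContr_rescaleBraid s hs hc1) hψ)
      (tensorHom_tmul (genR V r hr) (genR V s hs) v w)
  have hval : ∀ p, IsExtension hc1 φ r hr s hs p → ∀ v w, p (tmul (gen (rescale r hr V) v)
      (gen (rescale s hs V) w)) = φ (tmul (ofRescale r V hr v) (ofRescale s V hs w)) :=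
    fun p hp v w => by
      rw [← hp.2]
      exact congrArg p (tensorHom_tmul (genR V r hr) (genR V s hs) (ofRescale r V hr v)
        (ofRescale s V hs w)).symm
  refine ⟨_, hext, fun p' hp' => IsDualPairing.unique hp'.1 hext.1 fun v w => ?_, ?_⟩
  · exact (hval p' hp' v w).trans (hval _ hext v w).symm
  -- The description of the radical as the kernel of the symmetrizer of radius `r` does not involve
  -- `s`, so neither does the radical.
  · ext x
    exact (mem_radical_hopfForm hadj hbs (rescaleForm_nondegenerate hφn)).symm

end rescaling

end NABan

end

theorem proposition3p10 {k : Type u} [NormedField k] [IsUltrametricDist k] [CompleteSpace k]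
    (V : NABan k) (c : V ⊗ V ⟶ V ⊗ V) (hc : IsPreBraiding c) (hc1 : IsContr c)
    (φ : V ⊗ V ⟶ 𝟙_ (NABan k)) (hφc : IsCompatible c φ) (hφs : IsSymmForm φ)
    (hφn : IsNondegenerate φ) (r : ℝ) (hr : 0 < r) :
    ∃ (I : Submodule k (tensR V r hr)) (hI : IsClosed (I : Set (tensR V r hr))),
      (∀ (s : ℝ) (hs : 0 < s), opNorm φ ≤ r * s →
        ∃ p : tensR V r hr ⊗ tensR V s hs ⟶ 𝟙_ (NABan k),
          IsExtension hc1 φ r hr s hs p ∧ (∀ p', IsExtension hc1 φ r hr s hs p' → p' = p) ∧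
            I = radical p) ∧
      (tensRHopf hc1 r hr).IsIdeal I ∧
      (tensRHopf hc1 r hr).IsCoideal I ∧
      ∃ D : HopfData (quot I hI),
        HopfData.IsHom (tensRHopf hc1 r hr) D (proj I hI) ∧
        (∀ D', HopfData.IsHom (tensRHopf hc1 r hr) D' (proj I hI) → D' = D) ∧
        D.prim = LinearMap.range (Hom.lin (genR V r hr ≫ proj I hI)) ∧
        (∀ v : V, ‖(genR V r hr ≫ proj I hI) v‖ = r * ‖v‖) ∧
        D.IsAnalyticNichols V c ∧
        ((∀ z, ‖c z‖ = ‖z‖) → Function.Surjective c → IsIso D.braid) := by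
  have hcr := isContr_rescaleBraid r hr hc1
  have hbr := isPreBraiding_rescaleBraid (hr := hr) hc
  let I : Submodule k (tensR V r hr) := LinearMap.ker (Hom.lin (symz hcr))
  have hI : IsClosed (I : Set (tensR V r hr)) :=
    isClosed_eq (NABan.continuous (symz hcr)) continuous_const
  have hIF : ∀ x, x ∈ I ↔ symz hcr x = 0 := fun x => Iff.rfl
  have hideal : (tensRHopf hc1 r hr).IsIdeal I := by
    -- That the kernel of the symmetrizer is an ideal is read off from any one pairing with this
    -- radical; this radius satisfies `C ≤ r s`.
    have hs : 0 < (opNorm φ + 1) / r := div_pos (by linarith [opNorm_nonneg φ]) hr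
    obtain ⟨p, hp, -, hrad⟩ := exists_unique_extension hc hc1 hφc hφn hr hs
      (by rw [mul_div_cancel₀ _ hr.ne']; linarith)
    exact fun x hx y => (hp.1.isIdeal_radical x (hrad.le hx) y).imp (fun h => hrad.ge h)
      fun h => hrad.ge h
  obtain ⟨⟨D, h⟩, hcoideal⟩ := exists_isHom_nichols (hI := hI) hbr hIF hideal
  refine ⟨I, hI, fun s hs hrs => exists_unique_extension hc hc1 hφc hφn hr hs hrs, hideal, hcoideal,
    D, h, fun D' h' => h'.unique h, ?_, fun v => ?_, ?_, fun hn hsurj => ?_⟩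
  · ext y
    refine (mem_prim_nichols hbr hIF h).trans ⟨?_, ?_⟩
    · rintro ⟨v, rfl⟩
      exact ⟨ofRescale r V hr v, rfl⟩
    · rintro ⟨v, rfl⟩
      exact ⟨toRescale r V hr v, rfl⟩
  · exact (norm_proj_gen hIF _).trans (norm_toRescale r V hr v)
  · obtain ⟨e, he⟩ := piece_one_nichols hIF h (toRescale r V hr) toRescale_surjective hr
      (norm_toRescale r V hr)
    refine ⟨isGradedHopf_nichols hbr hIF h, isFlat _, piece_zero_nichols hIF h, ?_, ⟨e, ?_⟩,
      isGeneratedBy_nichols hIF h⟩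
    · ext y
      refine (mem_prim_nichols hbr hIF h).trans (Iff.trans ?_ (mem_pieceSub_nichols hIF h).symm)
      refine ⟨fun ⟨v, hv⟩ => ⟨_, gen_mem_Homog v, hv⟩, ?_⟩
      rintro ⟨x, hx, hxy⟩
      obtain ⟨v, rfl⟩ := exists_gen_of_mem_Homog_one hx
      exact ⟨v, hxy⟩
    · have hgen : IsSq (rescaleBraid r hr c) (tensBraid hcr) (gen (rescale r hr V) ⊗ₘ gen _)
        (gen _ ⊗ₘ gen _) := gen_braid.symm
      have hsq := ((isSq_toRescale c).paste hgen).paste h.sq_braid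
      simp only [tensorHom_comp_tensorHom, Category.assoc] at hsq
      rw [← he] at hsq
      exact hsq
  · exact isIso_braid_nichols hbr hIF h (isIsom_rescaleBraid (isIsom_of_norm hn hsurj))
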